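/- **Setting.** Let $T\in(0,\infty)$ and let $W$ be a standard Brownian motion on a filtered probability space $(\Omega,\mathcal F,(\mathcal F_t)_{t\ge0},\mathbb P)$. Let $\mu$ be a fractional Laurent polynomial, i.e. $\mu(x)=\sum_i a_i x^{s_i}$, $x>0$, a finite sum with real $a_i$ and pairwise distinct real exponents $s_i$, and let $\deg^-(\mu)$ be its smallest exponent with nonzero coefficient. Let $\sigma\neq0$, $X_0>0$ be constants, and let $X$ be a strong solution of $$dX_t=\mu(X_t)\,dt+\sigma\,dW_t,\quad t\ge 0,$$ started at $X_0$, with values in $(0,\infty)$. Call $f:(0,\infty)\to\mathbb R$ one-sided Lipschitz if there is $L>0$ with $(f(x)-f(y))(x-y)\le L|x-y|^2$ for all $x,y>0$. Let $c_{-1}>0$ and $\hat\mu(x):=\mu(x)-c_{-1}x^{-1}$. Assume: 1. $\mu$ and $\hat\mu$ are one-sided Lipschitz. 2. For some $p^*\in(2,\infty]$: $\sup_{t\in[0,T]}\mathbb E[|X_t|^{-q}]<\infty$ for all real $q$ with $0<q\le p^*$. 3. For every step size $h=T/M\in(0,1]$ ($M=1,2,\dots$) a map $\mathcal P_h:(0,\infty)\to(0,\infty)$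 is given, and there are constants $K>0$, $m_1,m_2\ge0$ independent of $h$ such that for all $x,y>0$ $$|\mathcal P_h(x)-\mathcal P_h(y)|\le|x-y|,\qquad |\mathcal P_h(x)-x|\le K h^2(1+x^{-m_1}+x^{m_2}),$$ $$|\hat\mu(\mathcal P_h(x))|\le \max\{K h^{-1/2},K x\},\qquad |\hat\mu(\mathcal P_h(x))-\hat\mu(\mathcal P_h(y))|\le K h^{-1/2}|x-y|.$$ For $h=T/M\in(0,1]$ and $t_n=nh$ let $Y_0=X_0$ and let $Y_1,\dots,Y_M>0$ be the positive numerical solution of $$Y_{n+1}=\mathcal P_h(Y_n)+c_{-1}hY_{n+1}^{-1}+\hat\mu(\mathcal P_h(Y_n))h+\sigma(W_{t_{n+1}}-W_{t_n}),\qquad 0\le n<M.$$ Set $$R_{n+1}=X_{t_n}-\mathcal P_h(X_{t_n})+\int_{t_n}^{t_{n+1}}\mu(X_s)\,ds-c_{-1}hX_{t_{n+1}}^{-1}-\hat\mu(\mathcal P_h(X_{t_n}))h,\qquad 0\le n<M,$$ and let $R_{n+1}=R^{(1)}_{n+1}+R^{(2)}_{n+1}$ be any decomposition with $R^{(2)}_{n+1}$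 integrable and $\mathbb E[R^{(2)}_{n+1}\mid\mathcal F_{t_n}]=0$. **Lemma 4.3.** For every finite $\bar p$ there is a constant $C>0$, independent of $h$, of the decomposition and of $p$, such that for all real $p$ with $p\le\bar p$ and $$1\le p\le -\frac{p^*}{2\deg^-(\mu)}\wedge\frac{p^*}{2m_1}$$ (with $p^*/0:=\infty$) and all step sizes $h=T/M\in(0,1]$, $$\mathbb E\Big[\sup_{n=0,\dots,M}|Y_n|^{-2p}\Big]\le \frac{C}{h^{2p-1}}\Big(\sup_{n=1,\dots,M}\mathbb E\big[|R^{(1)}_n|^{2p}\big]+\sup_{n=1,\dots,M}\mathbb E\big[|R^{(2)}_n|^{2p}\big]\Big)+C\,\mathbb E\Big[\sup_{t\in[0,T]}|X_t|^{-2p}\Big].$$ (Both sides are in $[0,\infty]$. If the upper bound on $p$ is finite, one may take $\bar p$ equal to it, so that $C$ serves all admissible $p$.) -/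

import Mathlib

open MeasureTheory ProbabilityTheory Set
open scoped NNReal ENNReal

noncomputable section

namespace PosScheme

/-- A fractional Laurent polynomial `∑ a_i x ^ (s_i)` with finitely many pairwise distinct real
exponents `s_i`: it is recorded by its finitely supported coefficient function
(exponent `s ↦` coefficient of `x ^ s`). -/
abbrev FLP : Type := ℝ →₀ ℝ

/-- The function `x ↦ ∑ a_i x ^ (s_i)`; only its values at `x > 0` matter. -/
def FLP.eval (q : FLP) (x : ℝ) : ℝ := q.sum fun s a => a * x ^ s

/-- The smallest exponent that occurs with a nonzero coefficient (`q.support` is finite, so for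
`q ≠ 0` the infimum is a minimum). -/
def FLP.degMinus (q : FLP) : ℝ := sInf (q.support : Set ℝ)

/-- The one-sided Lipschitz (monotonicity) condition on `(0, ∞)`. -/
def OneSidedLipschitz (f : ℝ → ℝ) : Prop :=
  ∃ L : ℝ, 0 < L ∧ ∀ x y : ℝ, 0 < x → 0 < y → (f x - f y) * (x - y) ≤ L * (x - y) ^ 2

/-- The part `μ̂(x) = μ(x) - c x⁻¹` of the drift that is treated explicitly. -/
def muHat (μ : ℝ → ℝ) (c : ℝ) (x : ℝ) : ℝ := μ x - c * x⁻¹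

/-- The admissible step sizes `h = T / M ∈ (0, 1]`, `M = 1, 2, …`. -/
def IsStepSize (T h : ℝ≥0) : Prop := ∃ M : ℕ, 0 < M ∧ h = T / M ∧ h ≤ 1

/-- `W` is a standard Brownian motion relative to the filtration `ℱ`. -/
structure IsBrownianOn {Ω : Type*} [mΩ : MeasurableSpace Ω] (Pr : Measure Ω)
    (ℱ : Filtration ℝ≥0 mΩ) (W : ℝ≥0 → Ω → ℝ) : Prop where
  brownian : IsBrownianReal W Pr
  adapted : ∀ t, Measurable[ℱ t] (W t)
  indep : ∀ s t, s ≤ t → Indep (MeasurableSpace.comap (W t - W s) inferInstance) (ℱ s) Pr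

/-- `X` is a strong solution, with values in `(0, ∞)`, of `dX = μ(X) dt + σ dW`, `X_0 = x₀`:
it is adapted and almost surely has continuous positive paths satisfying
`X_t = x₀ + ∫₀ᵗ μ(X_s) ds + σ (W_t - W_0)` for all `t ≥ 0`
(the noise is additive, so the stochastic integral is `σ (W_t - W_0)`). -/
structure IsPositiveSolution {Ω : Type*} [mΩ : MeasurableSpace Ω] (Pr : Measure Ω)
    (ℱ : Filtration ℝ≥0 mΩ) (W : ℝ≥0 → Ω → ℝ) (μ : ℝ → ℝ) (σ x₀ : ℝ)
    (X : ℝ≥0 → Ω → ℝ) : Prop where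
  adapted : ∀ t, Measurable[ℱ t] (X t)
  continuous : ∀ᵐ ω ∂Pr, Continuous fun t => X t ω
  pos : ∀ᵐ ω ∂Pr, ∀ t, 0 < X t ω
  eqn : ∀ᵐ ω ∂Pr, ∀ t : ℝ≥0,
    X t ω = x₀ + (∫ s in (0 : ℝ)..t, μ (X s.toNNReal ω)) + σ * (W t ω - W 0 ω)

/-- Bounded inverse moments of the exact solution:
`sup_{t ∈ [0,T]} E |X_t|^{-q} < ∞` for all (finite) `0 < q ≤ p*`, where `p* ∈ [0, ∞]`. -/
def InverseMomentsBounded {Ω : Type*} [MeasurableSpace Ω] (Pr : Measure Ω)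
    (X : ℝ≥0 → Ω → ℝ) (T : ℝ≥0) (pstar : ℝ≥0∞) : Prop :=
  ∀ q : ℝ, 0 < q → ENNReal.ofReal q ≤ pstar →
    (⨆ t ∈ Icc (0 : ℝ≥0) T, ∫⁻ ω, ENNReal.ofReal (|X t ω| ^ (-q)) ∂Pr) < ⊤

/-- The family `P h : (0, ∞) → (0, ∞)` of correction functions is contractive and consistent,
with exponent `m₁` and with constants that do not depend on the step size. -/
def IsCorrection (T : ℝ≥0) (P : ℝ≥0 → ℝ → ℝ) (m₁ : ℝ) : Prop :=
  0 ≤ m₁ ∧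
  (∀ h, IsStepSize T h → ∀ x, 0 < x → 0 < P h x) ∧
  (∀ h, IsStepSize T h → ∀ x y, 0 < x → 0 < y → |P h x - P h y| ≤ |x - y|) ∧
  ∃ C m₂ : ℝ, 0 < C ∧ 0 ≤ m₂ ∧ ∀ h, IsStepSize T h → ∀ x, 0 < x →
    |P h x - x| ≤ C * (h : ℝ) ^ 2 * (1 + |x| ^ (-m₁) + |x| ^ m₂)

/-- The growth and Lipschitz bounds on `μ̂ ∘ P h`, uniformly in the step size. -/
def CorrectedDriftBound (T : ℝ≥0) (P : ℝ≥0 → ℝ → ℝ) (μ : ℝ → ℝ) (c : ℝ) : Prop :=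
  ∃ C : ℝ, 0 < C ∧ ∀ h, IsStepSize T h →
    (∀ x, 0 < x → |muHat μ c (P h x)| ≤ max (C * (h : ℝ) ^ (-(1 / 2) : ℝ)) (C * |x|)) ∧
    (∀ x y, 0 < x → 0 < y →
      |muHat μ c (P h x) - muHat μ c (P h y)| ≤ C * (h : ℝ) ^ (-(1 / 2) : ℝ) * |x - y|)

/-- `Y_0, …, Y_M` is the positive numerical solution with step size `h` and starting value `x₀`:
`Y_{n+1} = P_h(Y_n) + c h Y_{n+1}⁻¹ + μ̂(P_h(Y_n)) h + σ (W_{(n+1)h} - W_{nh})`. -/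
def IsSchemeSolution {Ω : Type*} [MeasurableSpace Ω] (Pr : Measure Ω) (W : ℝ≥0 → Ω → ℝ)
    (μ : ℝ → ℝ) (σ x₀ c : ℝ) (P : ℝ≥0 → ℝ → ℝ) (h : ℝ≥0) (M : ℕ) (Y : ℕ → Ω → ℝ) : Prop :=
  ∀ᵐ ω ∂Pr, Y 0 ω = x₀ ∧ ∀ n < M, 0 < Y (n + 1) ω ∧
    Y (n + 1) ω = P h (Y n ω) + c * h * (Y (n + 1) ω)⁻¹ + muHat μ c (P h (Y n ω)) * h
      + σ * (W ((n + 1 : ℕ) * h) ω - W (n * h) ω)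

/-- The remainder `R_{n+1}` (local error of the exact solution in the scheme), with `t_n = n h`. -/
def remainder {Ω : Type*} (X : ℝ≥0 → Ω → ℝ) (μ : ℝ → ℝ) (c : ℝ) (P : ℝ≥0 → ℝ → ℝ)
    (h : ℝ≥0) (n : ℕ) (ω : Ω) : ℝ :=
  X (n * h) ω - P h (X (n * h) ω)
    + (∫ s in ((n * h : ℝ≥0) : ℝ)..(((n + 1 : ℕ) * h : ℝ≥0) : ℝ), μ (X s.toNNReal ω))
    - c * h * (X ((n + 1 : ℕ) * h) ω)⁻¹
    - muHat μ c (P h (X (n * h) ω)) * h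

/-- `R_n = R¹_n + R²_n` for `n = 1, …, M`, where `R²_{n+1}` is integrable with
`E[R²_{n+1} | ℱ_{t_n}] = 0`. -/
def IsRemainderSplit {Ω : Type*} [mΩ : MeasurableSpace Ω] (Pr : Measure Ω)
    (ℱ : Filtration ℝ≥0 mΩ) (X : ℝ≥0 → Ω → ℝ) (μ : ℝ → ℝ) (c : ℝ) (P : ℝ≥0 → ℝ → ℝ)
    (h : ℝ≥0) (M : ℕ) (R₁ R₂ : ℕ → Ω → ℝ) : Prop :=
  ∀ n < M,
    (∀ᵐ ω ∂Pr, remainder X μ c P h n ω = R₁ (n + 1) ω + R₂ (n + 1) ω) ∧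
    Integrable (R₂ (n + 1)) Pr ∧
    Pr[R₂ (n + 1) | ℱ (n * h)] =ᵐ[Pr] 0

end PosScheme

end

/-!
The terms with the remainders on the right-hand side are nonnegative and are not needed: the inverse
moments of the numerical solution are bounded by those of the exact one,
`E sup Y ^ (-2p) ≤ C E sup X ^ (-2p) + C` with `C` independent of `h` and `p`
(`SchemeBounds.exists_moment`), and the additive constant is absorbed because `X` starts at `x₀`
(`IsPositiveSolution.ofReal_le_lintegral`). How `Y` is compared with `X` depends on the exponents of
the explicit drift `μ - c / x`.

*Some exponent is at most `-1`.* Let `-d` be the lowest one. The corrected drift is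
`h ^ (-1/2)`-Lipschitz, so the correction has to move points of size about `h ^ (1 / (2 (d + 1)))`,
which forces its consistency exponent to satisfy `m₁ ≥ 4 d + 3`
(`SchemeBounds.four_mul_add_three_le`). Admissible `p` therefore come with inverse moments of `X` of
the high order `2 m₁ p`, and `X` is below `2 h ^ θ` somewhere on the grid only with small
probability, for a suitable `θ`. Otherwise a pathwise comparison gives `Y ≥ X / 2`
(`SchemeBounds.compare`, `SchemeBounds.exists_window`), up to an event of superpolynomially small
probability on which the noise is large (`IsBrownianOn.exists_exceptional_bound`). On the bad events
crude bounds of `Y` suffice (`SchemeBounds.exists_moment_of_singular`).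

*All exponents are larger than `-1`.* Near the origin `X` behaves like a Bessel process, and
`x ^ (-β)` with `β = 2 c / σ² - 1` is its scale function to leading order. Both sides are compared
through the probabilities of coming below a level `δ`
(`SchemeBounds.exists_moment_of_regular`).

* The probability that `X` comes below `δ` is at least of order `δ ^ b` for `b ≥ max β 1`
  (`IsPositiveSolution.exists_hitting_lower_bound`). A perturbation of `x ^ (-b)`, combined with a
  factor that makes it negative outside of a region which shrinks to the origin at the final time,
  is a subsolution of the backward equation (`exists_subsolution`). Dynkin's inequality is applied
  to Euler chains (`IsBrownianOn.le_hitting`), which converge to `X` pathwise away from the origin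
  (`SolPath.exists_forall_lt_euler`), so that no stochastic calculus is involved.
* If `β < 2`, it follows that `E sup X ^ (-2p) = ∞` (`IsPositiveSolution.lintegral_iSup_eq_top`).
* If `β ≥ 2`, the probability that `Y` comes below `δ` is at most of order `δ ^ β`, uniformly in `h`
  (`SchemeBounds.exists_tail`). With `ρ = y² + A h` the potential `ρ ^ (-β/2) + ρ ^ (-β/2 + 1/4)` is
  a supermartingale of the scheme up to errors of order `h`, for one step by an expansion of the
  implicit step (`exists_gaussian_step`, `SchemeBounds.exists_potential_step`), and the maximal
  inequality applies for `δ ≥ √h`. For `δ < √h` the potential is flat, and a union bound over the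
  steps is summed against the average decrease of the potential (`SchemeBounds.exists_small_step`).
* The layer cake formula turns the comparison of tails into one of moments, with a constant that
  does not depend on `p` (`lintegral_rpow_le_of_tail_le`).
-/

set_option linter.unusedSectionVars false

/-! ### Brownian increments, the Markov step and maximal inequalities -/

namespace PosScheme

section Brownian

variable {Ω : Type*} [mΩ : MeasurableSpace Ω] {Pr : Measure Ω} [IsProbabilityMeasure Pr]
  {ℱ : Filtration ℝ≥0 mΩ} {W : ℝ≥0 → Ω → ℝ}

lemma IsBrownianOn.measurable (hW : IsBrownianOn Pr ℱ W) (t : ℝ≥0) : Measurable (W t) :=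
  (hW.adapted t).mono (ℱ.le t) le_rfl

lemma IsBrownianOn.map_increment (hW : IsBrownianOn Pr ℱ W) {s t : ℝ≥0} (hst : s ≤ t) :
    Pr.map (fun ω => W t ω - W s ω)
      = (gaussianReal 0 1).map (fun z => Real.sqrt ((t - s : ℝ≥0) : ℝ) * z) := by
  have h := (hW.brownian.toIsPreBrownianReal.hasLaw_sub t s).map_eq
  rw [gaussianReal_map_const_mul]
  have e : (W t - W s) = fun ω => W t ω - W s ω := rfl
  rw [e] at h
  rw [h]
  congr 1
  · simp
  · ext
    simp only [coe_nndist, NNReal.coe_mk, mul_one]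
    rw [Real.sq_sqrt (by positivity), NNReal.coe_sub hst]
    change |(t : ℝ) - s| = _
    rw [abs_of_nonneg (sub_nonneg.2 (by exact_mod_cast hst))]

/-- The Markov step in terms of measures: on an event known at time `s`, an `ℱ_s`-measurable
variable and the later increment `W_t - W_s` have a product law. -/
lemma IsBrownianOn.map_prod (hW : IsBrownianOn Pr ℱ W) {s t : ℝ≥0} (hst : s ≤ t)
    {S : Set Ω} (hS : MeasurableSet[ℱ s] S) {U : Ω → ℝ} (hU : Measurable[ℱ s] U) :
    (Pr.restrict S).map (fun ω => (U ω, W t ω - W s ω))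
      = ((Pr.restrict S).map U).prod
        ((gaussianReal 0 1).map (fun z => Real.sqrt ((t - s : ℝ≥0) : ℝ) * z)) := by
  have hU' : Measurable U := hU.mono (ℱ.le s) le_rfl
  have hI : Measurable (fun ω => W t ω - W s ω) := (hW.measurable t).sub (hW.measurable s)
  have : IsProbabilityMeasure
      ((gaussianReal 0 1).map (fun z => Real.sqrt ((t - s : ℝ≥0) : ℝ) * z)) :=
    Measure.isProbabilityMeasure_map (by fun_prop)
  symm
  refine Measure.prod_eq fun A B hA hB => ?_
  rw [Measure.map_apply (hU'.prodMk hI) (hA.prod hB), Measure.map_apply hU' hA,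
    Measure.restrict_apply ((hU'.prodMk hI) (hA.prod hB)), Measure.restrict_apply (hU' hA),
    ← hW.map_increment hst, Measure.map_apply hI hB]
  have hind := (Indep_iff _ _ _).1 (hW.indep s t hst)
    ((fun ω => W t ω - W s ω) ⁻¹' B) (U ⁻¹' A ∩ S) ⟨B, hB, rfl⟩ ((hU hA).inter hS)
  rw [mul_comm, ← hind]
  congr 1
  ext ω
  simp only [mem_inter_iff, mem_preimage, mem_prod]
  tauto

/-- The Markov step for nonnegative functions. -/
lemma IsBrownianOn.lintegral_step (hW : IsBrownianOn Pr ℱ W) {s t : ℝ≥0} (hst : s ≤ t)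
    {S : Set Ω} (hS : MeasurableSet[ℱ s] S) {U : Ω → ℝ} (hU : Measurable[ℱ s] U)
    {G : ℝ → ℝ → ℝ≥0∞} (hG : Measurable (Function.uncurry G)) :
    ∫⁻ ω in S, G (U ω) (W t ω - W s ω) ∂Pr
      = ∫⁻ ω in S, ∫⁻ z, G (U ω) (Real.sqrt ((t - s : ℝ≥0) : ℝ) * z) ∂gaussianReal 0 1 ∂Pr := by
  have hU' : Measurable U := hU.mono (ℱ.le s) le_rfl
  have hI : Measurable (fun ω => W t ω - W s ω) := (hW.measurable t).sub (hW.measurable s)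
  have : IsProbabilityMeasure
      ((gaussianReal 0 1).map (fun z => Real.sqrt ((t - s : ℝ≥0) : ℝ) * z)) :=
    Measure.isProbabilityMeasure_map (by fun_prop)
  have h1 := lintegral_map (μ := Pr.restrict S) hG (hU'.prodMk hI)
  simp only [Function.uncurry_apply_pair] at h1
  rw [← h1, hW.map_prod hst hS hU, lintegral_prod _ hG.aemeasurable, lintegral_map _ hU']
  · refine lintegral_congr fun ω => ?_
    rw [lintegral_map (by fun_prop) (by fun_prop)]
    rfl
  · exact hG.lintegral_prod_right'

/-- The Markov step for bounded functions. -/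
lemma IsBrownianOn.integral_step (hW : IsBrownianOn Pr ℱ W) {s t : ℝ≥0} (hst : s ≤ t)
    {S : Set Ω} (hS : MeasurableSet[ℱ s] S) {U : Ω → ℝ} (hU : Measurable[ℱ s] U)
    {G : ℝ → ℝ → ℝ} (hG : Measurable (Function.uncurry G)) {B : ℝ} (hB : ∀ x z, |G x z| ≤ B) :
    ∫ ω in S, G (U ω) (W t ω - W s ω) ∂Pr
      = ∫ ω in S, ∫ z, G (U ω) (Real.sqrt ((t - s : ℝ≥0) : ℝ) * z) ∂gaussianReal 0 1 ∂Pr := by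
  have hU' : Measurable U := hU.mono (ℱ.le s) le_rfl
  have hI : Measurable (fun ω => W t ω - W s ω) := (hW.measurable t).sub (hW.measurable s)
  have : IsProbabilityMeasure
      ((gaussianReal 0 1).map (fun z => Real.sqrt ((t - s : ℝ≥0) : ℝ) * z)) :=
    Measure.isProbabilityMeasure_map (by fun_prop)
  have h1 := integral_map (μ := Pr.restrict S) (hU'.prodMk hI).aemeasurable
    (f := Function.uncurry G) hG.aestronglyMeasurable
  simp only [Function.uncurry_apply_pair] at h1
  have : IsFiniteMeasure ((Pr.restrict S).map U) := Measure.isFiniteMeasure_map _ _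
  rw [← h1, hW.map_prod hst hS hU, integral_prod]
  · rw [integral_map hU'.aemeasurable]
    · refine integral_congr_ae (Filter.Eventually.of_forall fun ω => ?_)
      simp only [Function.uncurry_apply_pair]
      rw [integral_map (by fun_prop)]
      exact (hG.comp (measurable_const.prodMk measurable_id)).aestronglyMeasurable
    · exact (hG.stronglyMeasurable.integral_prod_right').aestronglyMeasurable
  · exact Integrable.of_bound hG.aestronglyMeasurable B
      (Filter.Eventually.of_forall fun x => by simpa [Function.uncurry] using hB x.1 x.2)

/-- The even moments `E[g ^ (2 r)]` of a standard Gaussian variable. -/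
noncomputable def gaussMoment (r : ℕ) : ℝ≥0∞ := ∫⁻ z, ENNReal.ofReal (z ^ (2 * r)) ∂gaussianReal 0 1

lemma integrable_abs_pow_gaussian (n : ℕ) :
    Integrable (fun z : ℝ => |z| ^ n) (gaussianReal 0 1) := by
  have h := (memLp_id_gaussianReal (μ := 0) (v := 1) (n : ℝ≥0)).integrable_norm_pow'
  simpa using h

lemma integrable_pow_gaussian (n : ℕ) :
    Integrable (fun z : ℝ => z ^ n) (gaussianReal 0 1) := by
  refine (integrable_abs_pow_gaussian n).mono' (by fun_prop) (Filter.Eventually.of_forall ?_)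
  intro z
  simp

lemma gaussMoment_lt_top (r : ℕ) : gaussMoment r < ⊤ :=
  (integrable_pow_gaussian (2 * r)).lintegral_lt_top

lemma lintegral_gaussian_neg {f : ℝ → ℝ≥0∞} (hf : Measurable f) :
    ∫⁻ z, f (-z) ∂gaussianReal 0 1 = ∫⁻ z, f z ∂gaussianReal 0 1 := by
  have h : (gaussianReal 0 1).map (fun z : ℝ => -z) = gaussianReal 0 1 := by
    rw [gaussianReal_map_neg]; simp
  conv_rhs => rw [← h]
  rw [lintegral_map hf (by fun_prop)]

lemma pow_le_lintegral_gaussian (x σ : ℝ) (r : ℕ) :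
    ENNReal.ofReal (x ^ (2 * r))
      ≤ ∫⁻ z, ENNReal.ofReal ((x + σ * z) ^ (2 * r)) ∂gaussianReal 0 1 := by
  have hm : Measurable fun z : ℝ => ENNReal.ofReal ((x + σ * z) ^ (2 * r)) := by fun_prop
  have h1 := lintegral_gaussian_neg hm
  have h2 : 2 * ENNReal.ofReal (x ^ (2 * r))
      ≤ 2 * ∫⁻ z, ENNReal.ofReal ((x + σ * z) ^ (2 * r)) ∂gaussianReal 0 1 := by
    rw [two_mul (∫⁻ z, _ ∂_)]
    nth_rewrite 1 [← h1]
    rw [← lintegral_add_left (by fun_prop)]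
    calc 2 * ENNReal.ofReal (x ^ (2 * r))
        = ∫⁻ z, 2 * ENNReal.ofReal (x ^ (2 * r)) ∂gaussianReal 0 1 := by simp
      _ ≤ _ := by
        refine lintegral_mono fun z => ?_
        have e2 : (2 : ℝ≥0∞) = ENNReal.ofReal 2 := by simp
        have hE : Even (2 * r) := even_two_mul r
        rw [e2, ← ENNReal.ofReal_mul (by norm_num), ← ENNReal.ofReal_add (hE.pow_nonneg _)
          (hE.pow_nonneg _)]
        refine ENNReal.ofReal_le_ofReal ?_
        have hc := (hE.convexOn_pow (𝕜 := ℝ)).2 (mem_univ (x + σ * -z)) (mem_univ (x + σ * z))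
          (by norm_num : (0 : ℝ) ≤ 1 / 2) (by norm_num : (0 : ℝ) ≤ 1 / 2) (by norm_num)
        simp only [smul_eq_mul] at hc
        have : 1 / 2 * (x + σ * -z) + 1 / 2 * (x + σ * z) = x := by ring
        rw [this] at hc
        linarith
  exact (ENNReal.mul_le_mul_iff_right (by norm_num) (by norm_num)).1 h2

/-- Doob's maximal inequality for the even moments of a Brownian motion on a grid. -/
lemma IsBrownianOn.maximal_grid (hW : IsBrownianOn Pr ℱ W) (a k : ℝ≥0) (r n : ℕ) {ρ : ℝ}
    (hρ : 0 ≤ ρ) :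
    ENNReal.ofReal (ρ ^ (2 * r)) * Pr {ω | ∃ j : ℕ, j ≤ n ∧ ρ ≤ |W (a + j * k) ω - W a ω|}
      ≤ ENNReal.ofReal (((n * k : ℝ≥0) : ℝ) ^ r) * gaussMoment r := by
  set D : ℕ → Ω → ℝ := fun j ω => W (a + j * k) ω - W a ω with hD
  set N : ℕ → Set Ω := fun n => {ω | ∃ j : ℕ, j ≤ n ∧ ρ ≤ |D j ω|} with hN
  have hDm : ∀ j : ℕ, Measurable[ℱ (a + j * k)] (D j) := fun j =>
    (hW.adapted _).sub ((hW.adapted a).mono (ℱ.mono (by simp)) le_rfl)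
  have hDm' : ∀ j, Measurable (D j) := fun j => (hDm j).mono (ℱ.le _) le_rfl
  have hmono : ∀ i j : ℕ, i ≤ j → a + i * k ≤ a + j * k := by
    intro i j hij
    gcongr
  have hNm : ∀ n : ℕ, MeasurableSet[ℱ (a + n * k)] (N n) := by
    intro n
    have : N n = ⋃ j ∈ Finset.range (n + 1), {ω : Ω | ρ ≤ |D j ω|} := by
      ext ω; simp [hN]
    rw [this]
    refine Finset.measurableSet_biUnion _ fun j hj => ?_
    have hj' : j ≤ n := Nat.lt_succ_iff.1 (Finset.mem_range.1 hj)
    have hm : Measurable[ℱ (a + n * k)] (D j) := (hDm j).mono (ℱ.mono (hmono j n hj')) le_rfl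
    have hm2 : Measurable[ℱ (a + n * k)] (fun ω => |D j ω|) :=
      (continuous_abs.measurable).comp hm
    exact hm2 measurableSet_Ici
  have hNm' : ∀ n, MeasurableSet (N n) := fun n => ℱ.le _ _ (hNm n)
  -- on the event that the level has been passed, the even moment dominates the level
  have key : ∀ n, ENNReal.ofReal (ρ ^ (2 * r)) * Pr (N n)
      ≤ ∫⁻ ω in N n, ENNReal.ofReal (D n ω ^ (2 * r)) ∂Pr := by
    intro n
    induction n with
    | zero =>
      rw [← setLIntegral_const]
      refine setLIntegral_mono (by fun_prop) fun ω hω => ENNReal.ofReal_le_ofReal ?_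
      obtain ⟨j, hj, h⟩ := hω
      obtain rfl : j = 0 := by omega
      calc ρ ^ (2 * r) ≤ |D 0 ω| ^ (2 * r) := by gcongr
        _ = D 0 ω ^ (2 * r) := by rw [pow_mul, sq_abs, ← pow_mul]
    | succ n ih =>
      set A : Set Ω := {ω | ρ ≤ |D (n + 1) ω|} \ N n with hA
      have hAm : MeasurableSet A := by
        have : MeasurableSet {ω | ρ ≤ |D (n + 1) ω|} :=
          measurableSet_le measurable_const (hDm' (n + 1)).abs
        exact this.diff (hNm' n)
      have hU : N (n + 1) = N n ∪ A := by
        ext ω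
        simp only [hN, hA, mem_union, mem_sdiff, mem_ofPred_eq]
        constructor
        · rintro ⟨j, hj, h⟩
          by_cases hex : ∃ j : ℕ, j ≤ n ∧ ρ ≤ |D j ω|
          · exact Or.inl hex
          · have : j = n + 1 := by
              by_contra hne
              exact hex ⟨j, by omega, h⟩
            subst this
            exact Or.inr ⟨h, hex⟩
        · rintro (⟨j, hj, h⟩ | ⟨h, -⟩)
          · exact ⟨j, by omega, h⟩
          · exact ⟨n + 1, le_rfl, h⟩
      have hdisj : Disjoint (N n) A := disjoint_sdiff_right
      rw [hU, measure_union hdisj hAm, lintegral_union hAm hdisj, mul_add]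
      refine add_le_add (ih.trans ?_) ?_
      · have hst : a + n * k ≤ a + (n + 1 : ℕ) * k := hmono _ _ (Nat.le_succ n)
        have hstep := hW.lintegral_step hst (hNm n) (hDm n)
          (G := fun x z => ENNReal.ofReal ((x + z) ^ (2 * r))) (by
            unfold Function.uncurry; fun_prop)
        have e : ∀ ω, D n ω + (W (a + (n + 1 : ℕ) * k) ω - W (a + n * k) ω) = D (n + 1) ω := by
          intro ω; simp only [hD]; ring
        simp only [e] at hstep
        rw [hstep]
        exact lintegral_mono fun ω => pow_le_lintegral_gaussian _ _ _
      · rw [← setLIntegral_const]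
        refine setLIntegral_mono (by fun_prop) fun ω hω => ENNReal.ofReal_le_ofReal ?_
        calc ρ ^ (2 * r) ≤ |D (n + 1) ω| ^ (2 * r) := by gcongr; exact hω.1
          _ = D (n + 1) ω ^ (2 * r) := by rw [pow_mul, sq_abs, ← pow_mul]
  refine (key n).trans ((setLIntegral_le_lintegral _ _).trans (le_of_eq ?_))
  have hmap := hW.map_increment (s := a) (t := a + n * k) (by simp)
  have h1 := lintegral_map (μ := Pr) (f := fun x : ℝ => ENNReal.ofReal (x ^ (2 * r)))
    (by fun_prop) (hDm' n)
  rw [← h1]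
  have e : Pr.map (D n) = _ := hmap
  rw [e, lintegral_map (by fun_prop) (by fun_prop)]
  have e2 : ∀ z : ℝ, ENNReal.ofReal ((Real.sqrt ((a + n * k - a : ℝ≥0) : ℝ) * z) ^ (2 * r))
      = ENNReal.ofReal (((n * k : ℝ≥0) : ℝ) ^ r) * ENNReal.ofReal (z ^ (2 * r)) := by
    intro z
    rw [← ENNReal.ofReal_mul (by positivity), mul_pow, add_tsub_cancel_left, pow_mul (Real.sqrt _),
      Real.sq_sqrt (by positivity)]
  simp only [e2]
  rw [lintegral_const_mul _ (by fun_prop)]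
  rfl

end Brownian

end PosScheme

namespace PosScheme

section BrownianSup

variable {Ω : Type*} [mΩ : MeasurableSpace Ω] {Pr : Measure Ω} [IsProbabilityMeasure Pr]
  {ℱ : Filtration ℝ≥0 mΩ} {W : ℝ≥0 → Ω → ℝ}

/-- The supremum of `|W_t - W_a|` over the dyadic points `t` of `[a, a + ℓ]`. -/
noncomputable def dyadicSup (W : ℝ≥0 → Ω → ℝ) (a ℓ : ℝ≥0) (ω : Ω) : ℝ≥0∞ :=
  ⨆ m : ℕ, ⨆ j ∈ Finset.range (2 ^ m + 1),
    ENNReal.ofReal |W (a + (j : ℕ) * (ℓ / 2 ^ m)) ω - W a ω|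

lemma IsBrownianOn.measurable_dyadicSup (hW : IsBrownianOn Pr ℱ W) (a ℓ : ℝ≥0) :
    Measurable (dyadicSup W a ℓ) := by
  unfold dyadicSup
  refine Measurable.iSup fun m => ?_
  refine Measurable.biSup _ (Finset.countable_toSet _) fun j _ => ?_
  exact (((hW.measurable _).sub (hW.measurable a)).abs).ennreal_ofReal

/-- Gaussian moments of every order control the dyadic supremum: by the maximal inequality on each
dyadic grid, and by monotonicity along the grids. -/
lemma IsBrownianOn.dyadicSup_tail (hW : IsBrownianOn Pr ℱ W) (a ℓ : ℝ≥0) (r : ℕ) {ρ : ℝ}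
    (hρ : 0 < ρ) :
    Pr {ω | ENNReal.ofReal ρ < dyadicSup W a ℓ ω}
      ≤ ENNReal.ofReal ((ℓ : ℝ) ^ r / ρ ^ (2 * r)) * gaussMoment r := by
  set E : ℕ → Set Ω := fun m =>
    {ω | ∃ j : ℕ, j ≤ 2 ^ m ∧ ρ ≤ |W (a + j * (ℓ / 2 ^ m)) ω - W a ω|} with hE
  have hsub : {ω | ENNReal.ofReal ρ < dyadicSup W a ℓ ω} ⊆ ⋃ m, E m := by
    intro ω hω
    simp only [mem_ofPred_eq, dyadicSup, lt_iSup_iff] at hω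
    obtain ⟨m, j, hj, h⟩ := hω
    refine mem_iUnion.2 ⟨m, j, Nat.lt_succ_iff.1 (Finset.mem_range.1 hj), ?_⟩
    exact ((ENNReal.ofReal_lt_ofReal_iff_of_nonneg hρ.le).1 h).le
  have hmono : Monotone E := by
    refine monotone_nat_of_le_succ fun m ω hω => ?_
    obtain ⟨j, hj, h⟩ := hω
    refine ⟨2 * j, by rw [pow_succ]; omega, ?_⟩
    have e : ((2 * j : ℕ) : ℝ≥0) * (ℓ / 2 ^ (m + 1)) = j * (ℓ / 2 ^ m) := by
      push_cast
      rw [pow_succ]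
      field_simp
    rw [e]; exact h
  refine (measure_mono hsub).trans ?_
  rw [hmono.measure_iUnion]
  refine iSup_le fun m => ?_
  have h := hW.maximal_grid a (ℓ / 2 ^ m) r (2 ^ m) hρ.le
  have e : (((2 ^ m : ℕ) : ℝ≥0) * (ℓ / 2 ^ m)) = ℓ := by
    push_cast
    field_simp
  rw [e] at h
  have h0 : ENNReal.ofReal (ρ ^ (2 * r)) ≠ 0 := by
    simpa using (pow_pos hρ (2 * r))
  rw [ENNReal.ofReal_div_of_pos (by positivity), ENNReal.div_eq_inv_mul, mul_assoc,
    ← ENNReal.div_eq_inv_mul, ENNReal.le_div_iff_mul_le (Or.inl h0) (Or.inl ENNReal.ofReal_ne_top),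
    mul_comm]
  exact h

lemma IsBrownianOn.le_dyadicSup (hW : IsBrownianOn Pr ℱ W) (a ℓ : ℝ≥0) :
    ∀ᵐ ω ∂Pr, ∀ t, a ≤ t → t ≤ a + ℓ → ENNReal.ofReal |W t ω - W a ω| ≤ dyadicSup W a ℓ ω := by
  filter_upwards [hW.brownian.cont] with ω hω t hat htl
  rcases eq_or_ne ℓ 0 with hl | hl
  · have : t = a := le_antisymm (by simpa [hl] using htl) hat
    subst this
    simp
  have hl' : (0 : ℝ) < ℓ := by exact_mod_cast pos_iff_ne_zero.2 hl
  set u : ℝ := ((t : ℝ) - a) / ℓ with hu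
  have hu0 : 0 ≤ u := div_nonneg (sub_nonneg.2 (by exact_mod_cast hat)) hl'.le
  have hu1 : u ≤ 1 := by
    rw [hu, div_le_one hl']
    have : (t : ℝ) ≤ a + ℓ := by exact_mod_cast htl
    linarith
  set j : ℕ → ℕ := fun m => ⌊u * 2 ^ m⌋₊ with hj
  have hlim0 : Filter.Tendsto (fun m : ℕ => ((j m : ℝ)) / 2 ^ m) Filter.atTop (nhds u) :=
    (tendsto_nat_floor_mul_div_atTop hu0).comp
      (tendsto_pow_atTop_atTop_of_one_lt (by norm_num : (1 : ℝ) < 2))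
  have hlim : Filter.Tendsto (fun m : ℕ => a + (j m : ℝ≥0) * (ℓ / 2 ^ m)) Filter.atTop
      (nhds t) := by
    rw [← NNReal.tendsto_coe]
    have h2 := (hlim0.mul_const (ℓ : ℝ)).const_add (a : ℝ)
    have e : (a : ℝ) + u * ℓ = t := by rw [hu]; field_simp; ring
    rw [e] at h2
    refine h2.congr fun m => ?_
    push_cast
    ring
  have hlim2 : Filter.Tendsto
      (fun m : ℕ => ENNReal.ofReal |W (a + (j m : ℝ≥0) * (ℓ / 2 ^ m)) ω - W a ω|) Filter.atTop
      (nhds (ENNReal.ofReal |W t ω - W a ω|)) := by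
    refine ENNReal.tendsto_ofReal ?_
    exact (((hω.tendsto t).comp hlim).sub_const _).abs
  refine le_of_tendsto' hlim2 fun m => ?_
  unfold dyadicSup
  refine le_iSup_of_le m (le_iSup₂_of_le (j m) ?_ le_rfl)
  rw [Finset.mem_range, Nat.lt_succ_iff]
  refine Nat.floor_le_of_le ?_
  push_cast
  calc u * 2 ^ m ≤ 1 * 2 ^ m := by gcongr
    _ = 2 ^ m := one_mul _

/-- A random bound for `|W_t - W_0|` on `[0, T]` that has all moments. -/
lemma IsBrownianOn.exists_sup_bound (hW : IsBrownianOn Pr ℱ W) (T : ℝ≥0) :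
    ∃ S : Ω → ℝ, Measurable S ∧ (∀ ω, 0 ≤ S ω) ∧
      (∀ᵐ ω ∂Pr, ∀ t ≤ T, |W t ω - W 0 ω| ≤ S ω) ∧
      ∀ r : ℕ, ∫⁻ ω, ENNReal.ofReal (S ω ^ r) ∂Pr < ⊤ := by
  set Z := dyadicSup W 0 T with hZ
  have hZm : Measurable Z := hW.measurable_dyadicSup 0 T
  have htail := fun r : ℕ => fun ρ : ℝ => fun hρ : 0 < ρ => hW.dyadicSup_tail 0 T r (ρ := ρ) hρ
  have hfin : ∀ᵐ ω ∂Pr, Z ω ≠ ⊤ := by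
    rw [ae_iff]
    have hle : ∀ n : ℕ, Pr {ω | ¬ Z ω ≠ ⊤}
        ≤ ENNReal.ofReal ((T : ℝ) ^ 1 / ((n : ℝ) + 1) ^ (2 * 1)) * gaussMoment 1 := by
      intro n
      refine (measure_mono ?_).trans (htail 1 ((n : ℝ) + 1) (by positivity))
      intro ω hω
      have hω' : Z ω = ⊤ := by simpa using hω
      change ENNReal.ofReal _ < Z ω
      rw [hω']
      exact ENNReal.ofReal_lt_top
    have hlim : Filter.Tendsto (fun n : ℕ => ENNReal.ofReal ((T : ℝ) ^ 1 / ((n : ℝ) + 1) ^ (2 * 1))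
        * gaussMoment 1) Filter.atTop (nhds 0) := by
      have h1 : Filter.Tendsto (fun n : ℕ => (T : ℝ) ^ 1 / ((n : ℝ) + 1) ^ (2 * 1)) Filter.atTop
          (nhds 0) := by
        refine Filter.Tendsto.const_div_atTop ?_ _
        refine (Filter.tendsto_pow_atTop (by norm_num)).comp ?_
        exact Filter.tendsto_atTop_add_const_right _ _ tendsto_natCast_atTop_atTop
      have h2 := ENNReal.Tendsto.mul_const (ENNReal.tendsto_ofReal h1)
        (Or.inr (gaussMoment_lt_top 1).ne)
      simpa using h2
    exact le_antisymm (ge_of_tendsto' hlim hle) (zero_le)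
  refine ⟨fun ω => (Z ω).toReal, hZm.ennreal_toReal, fun ω => ENNReal.toReal_nonneg, ?_, ?_⟩
  · filter_upwards [hfin, hW.le_dyadicSup 0 T] with ω h1 h2 t ht
    have := h2 t (zero_le) (by simpa using ht)
    exact (ENNReal.ofReal_le_iff_le_toReal h1).1 this
  · intro r
    -- bound `S ^ r` by the sum of the level sets `{S > 2 ^ k}`
    have hpt : ∀ ω, ENNReal.ofReal ((Z ω).toReal ^ r) ≤ 1 + ∑' k : ℕ,
        ENNReal.ofReal ((2 : ℝ) ^ ((k + 1) * r)) *
          {ω | ENNReal.ofReal (2 ^ k) < Z ω}.indicator 1 ω := by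
      intro ω
      set s := (Z ω).toReal with hs
      have hs0 : 0 ≤ s := ENNReal.toReal_nonneg
      by_cases h1 : s ≤ 1
      · refine le_add_right ?_
        rw [← ENNReal.ofReal_one]
        exact ENNReal.ofReal_le_ofReal (pow_le_one₀ hs0 h1)
      · push Not at h1
        obtain ⟨k, hk1, hk2⟩ := exists_nat_pow_near h1.le (by norm_num : (1 : ℝ) < 2)
        obtain ⟨k, hk1, hk2⟩ : ∃ k : ℕ, (2 : ℝ) ^ k < s ∧ s ≤ 2 ^ (k + 1) := by
          rcases hk1.lt_or_eq with h | h
          · exact ⟨k, h, hk2.le⟩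
          · rcases Nat.eq_zero_or_pos k with h0 | h0
            · subst h0; simp at h; linarith
            · refine ⟨k - 1, ?_, ?_⟩
              · rw [← h]; exact pow_lt_pow_right₀ (by norm_num) (by omega)
              · rw [← h, Nat.sub_add_cancel h0]
        refine le_add_left (le_trans ?_ (ENNReal.le_tsum k))
        have hmem : ω ∈ {ω | ENNReal.ofReal (2 ^ k) < Z ω} := by
          have hne : Z ω ≠ ⊤ := by
            intro h
            rw [hs, h] at h1
            simp at h1
            linarith
          change ENNReal.ofReal (2 ^ k) < Z ω
          rw [← ENNReal.ofReal_toReal hne]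
          exact (ENNReal.ofReal_lt_ofReal_iff_of_nonneg (by positivity)).2 hk1
        rw [indicator_of_mem hmem, Pi.one_apply, mul_one]
        refine ENNReal.ofReal_le_ofReal ?_
        rw [pow_mul]
        exact pow_le_pow_left₀ hs0 hk2 r
    refine (lintegral_mono hpt).trans_lt ?_
    have hms : ∀ k : ℕ, MeasurableSet {ω | ENNReal.ofReal (2 ^ k) < Z ω} := fun k =>
      measurableSet_lt measurable_const hZm
    rw [lintegral_add_left measurable_const, lintegral_tsum]
    · simp only [lintegral_const, measure_univ, mul_one]
      refine ENNReal.add_lt_top.2 ⟨by simp, ?_⟩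
      have hterm : ∀ k : ℕ, ∫⁻ ω, ENNReal.ofReal ((2 : ℝ) ^ ((k + 1) * r)) *
          {ω | ENNReal.ofReal (2 ^ k) < Z ω}.indicator 1 ω ∂Pr
          ≤ (ENNReal.ofReal ((2 : ℝ) ^ r * (T : ℝ) ^ (r + 1)) * gaussMoment (r + 1))
            * (ENNReal.ofReal (1 / 4)) ^ k := by
        intro k
        rw [lintegral_const_mul _ (measurable_one.indicator (hms k)),
          lintegral_indicator_one (hms k)]
        refine (mul_le_mul_right (htail (r + 1) (2 ^ k) (by positivity)) _).trans ?_
        rw [← mul_assoc, ← ENNReal.ofReal_mul (by positivity), ← ENNReal.ofReal_pow (by norm_num),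
          mul_right_comm, ← ENNReal.ofReal_mul (by positivity)]
        refine mul_le_mul_left (ENNReal.ofReal_le_ofReal ?_) _
        rw [mul_div_assoc', div_le_iff₀ (by positivity)]
        have e1 : ((2 : ℝ) ^ k) ^ (2 * (r + 1)) = (2 ^ (k * r)) ^ 2 * 4 ^ k := by
          rw [show (4 : ℝ) = 2 ^ 2 by norm_num, ← pow_mul, ← pow_mul, ← pow_mul, ← pow_add]
          congr 1; ring
        have e2 : (2 : ℝ) ^ ((k + 1) * r) = 2 ^ (k * r) * 2 ^ r := by
          rw [← pow_add]; congr 1; ring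
        rw [e1, e2]
        have h4 : ((1 : ℝ) / 4) ^ k * 4 ^ k = 1 := by rw [← mul_pow]; norm_num
        have h5 : (1 : ℝ) ≤ 2 ^ (k * r) := one_le_pow₀ (by norm_num)
        have h6 : (0 : ℝ) ≤ 2 ^ r * (T : ℝ) ^ (r + 1) := by positivity
        calc (2 : ℝ) ^ (k * r) * 2 ^ r * (T : ℝ) ^ (r + 1)
            = (2 ^ r * (T : ℝ) ^ (r + 1)) * 2 ^ (k * r) := by ring
          _ ≤ (2 ^ r * (T : ℝ) ^ (r + 1)) * (2 ^ (k * r)) ^ 2 := by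
            gcongr
            nlinarith
          _ = 2 ^ r * (T : ℝ) ^ (r + 1) * (1 / 4) ^ k * ((2 ^ (k * r)) ^ 2 * 4 ^ k) := by
            linear_combination (- (2 ^ r * (T : ℝ) ^ (r + 1) * (2 ^ (k * r)) ^ 2)) * h4
      refine (ENNReal.tsum_le_tsum hterm).trans_lt ?_
      rw [ENNReal.tsum_mul_left, ENNReal.tsum_geometric]
      refine ENNReal.mul_lt_top (ENNReal.mul_lt_top ENNReal.ofReal_lt_top (gaussMoment_lt_top _)) ?_
      rw [ENNReal.inv_lt_top, tsub_pos_iff_lt, ← ENNReal.ofReal_one]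
      exact (ENNReal.ofReal_lt_ofReal_iff (by norm_num)).2 (by norm_num)
    · intro k
      exact (measurable_const.mul (measurable_one.indicator (hms k))).aemeasurable

end BrownianSup

end PosScheme

/-! ### Fractional Laurent polynomials and one-sided Lipschitz functions -/

namespace PosScheme

lemma FLP.eval_eq_sum (q : FLP) (x : ℝ) : q.eval x = ∑ s ∈ q.support, q s * x ^ s := rfl

/-- The explicit part of the drift is itself a fractional Laurent polynomial. -/
lemma muHat_eq_eval (q : FLP) (c x : ℝ) :
    muHat q.eval c x = FLP.eval (q - Finsupp.single (-1) c) x := by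
  unfold muHat FLP.eval
  rw [Finsupp.sum_sub_index (fun a b₁ b₂ => by ring), Finsupp.sum_single_index (by simp),
    Real.rpow_neg_one]

lemma rpow_le_mul_rpow {s d D m N x : ℝ} (hs : -d ≤ s) (hd : 0 ≤ d) (hD : s ≤ D) (hD0 : 0 ≤ D)
    (hm : 0 < m) (hm1 : m ≤ 1) (hN : 1 ≤ N) (hmx : m ≤ x) (hxN : x ≤ N) :
    x ^ s ≤ m ^ (-d) * N ^ D := by
  have h1 : 1 ≤ m ^ (-d) := Real.one_le_rpow_of_pos_of_le_one_of_nonpos hm hm1 (by linarith)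
  have h2 : 1 ≤ N ^ D := Real.one_le_rpow hN hD0
  have hx0 : 0 < x := hm.trans_le hmx
  rcases le_total 0 s with h | h
  · calc x ^ s ≤ N ^ s := Real.rpow_le_rpow hx0.le hxN h
      _ ≤ N ^ D := Real.rpow_le_rpow_of_exponent_le hN hD
      _ ≤ m ^ (-d) * N ^ D := le_mul_of_one_le_left (by positivity) h1
  · calc x ^ s ≤ m ^ s := Real.rpow_le_rpow_of_nonpos hm hmx h
      _ ≤ m ^ (-d) := Real.rpow_le_rpow_of_exponent_ge hm hm1 hs
      _ ≤ m ^ (-d) * N ^ D := le_mul_of_one_le_right (by positivity) h2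

/-- Growth and Lipschitz bounds of a fractional Laurent polynomial on `[m, N]`, `m ≤ 1 ≤ N`. -/
lemma FLP.exists_bound (q : FLP) {d : ℝ} (hd : 0 ≤ d) (hq : ∀ s ∈ q.support, -d ≤ s) :
    ∃ K D : ℝ, 1 ≤ K ∧ 0 ≤ D ∧ ∀ m N : ℝ, 0 < m → m ≤ 1 → 1 ≤ N →
      (∀ x, m ≤ x → x ≤ N → |q.eval x| ≤ K * (m ^ (-d) * N ^ D)) ∧
      (∀ x y, m ≤ x → x ≤ N → m ≤ y → y ≤ N →
        |q.eval x - q.eval y| ≤ K * (m ^ (-(d + 1)) * N ^ D) * |x - y|) := by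
  set K : ℝ := 1 + ∑ s ∈ q.support, |q s| * (1 + |s|) with hK
  set D : ℝ := ∑ s ∈ q.support, |s| with hD
  have hD0 : 0 ≤ D := Finset.sum_nonneg fun s _ => abs_nonneg s
  have hsD : ∀ s ∈ q.support, s ≤ D := fun s hs =>
    (le_abs_self s).trans (Finset.single_le_sum (f := fun s : ℝ => |s|)
      (fun s _ => abs_nonneg s) hs)
  refine ⟨K, D, ?_, hD0, fun m N hm hm1 hN => ⟨fun x hx hxN => ?_, fun x y hx hxN hy hyN => ?_⟩⟩
  · have : 0 ≤ ∑ s ∈ q.support, |q s| * (1 + |s|) := Finset.sum_nonneg fun s _ => by positivity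
    linarith
  · have hx0 : 0 < x := hm.trans_le hx
    have hpos : 0 ≤ m ^ (-d) * N ^ D := by positivity
    rw [FLP.eval_eq_sum]
    calc |∑ s ∈ q.support, q s * x ^ s| ≤ ∑ s ∈ q.support, |q s * x ^ s| :=
          Finset.abs_sum_le_sum_abs _ _
      _ ≤ ∑ s ∈ q.support, |q s| * (1 + |s|) * (m ^ (-d) * N ^ D) := by
          refine Finset.sum_le_sum fun s hs => ?_
          rw [abs_mul, abs_of_nonneg (Real.rpow_nonneg hx0.le s)]
          have h1 := rpow_le_mul_rpow (hq s hs) hd (hsD s hs) hD0 hm hm1 hN hx hxN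
          calc |q s| * x ^ s ≤ |q s| * (m ^ (-d) * N ^ D) := by gcongr
            _ ≤ |q s| * (1 + |s|) * (m ^ (-d) * N ^ D) := by
              gcongr
              exact le_mul_of_one_le_right (abs_nonneg _) (by linarith [abs_nonneg s])
      _ ≤ K * (m ^ (-d) * N ^ D) := by
          rw [← Finset.sum_mul]
          gcongr
          linarith
  · have hpos : 0 ≤ m ^ (-(d + 1)) * N ^ D := by positivity
    have hder : ∀ z ∈ Icc m N, HasDerivWithinAt q.eval
        (∑ s ∈ q.support, q s * (s * z ^ (s - 1))) (Icc m N) z := by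
      intro z hz
      have hz0 : z ≠ 0 := (hm.trans_le hz.1).ne'
      have : HasDerivAt (fun z => ∑ s ∈ q.support, q s * z ^ s)
          (∑ s ∈ q.support, q s * (s * z ^ (s - 1))) z := by
        refine HasDerivAt.fun_sum fun s _ => ?_
        exact (Real.hasDerivAt_rpow_const (Or.inl hz0)).const_mul _
      exact this.hasDerivWithinAt
    have hbound : ∀ z ∈ Icc m N, ‖∑ s ∈ q.support, q s * (s * z ^ (s - 1))‖
        ≤ K * (m ^ (-(d + 1)) * N ^ D) := by
      intro z hz
      have hz0 : 0 < z := hm.trans_le hz.1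
      rw [Real.norm_eq_abs]
      calc |∑ s ∈ q.support, q s * (s * z ^ (s - 1))|
          ≤ ∑ s ∈ q.support, |q s * (s * z ^ (s - 1))| := Finset.abs_sum_le_sum_abs _ _
        _ ≤ ∑ s ∈ q.support, |q s| * (1 + |s|) * (m ^ (-(d + 1)) * N ^ D) := by
            refine Finset.sum_le_sum fun s hs => ?_
            rw [abs_mul, abs_mul, abs_of_nonneg (Real.rpow_nonneg hz0.le _)]
            have h1 := rpow_le_mul_rpow (s := s - 1) (d := d + 1) (by linarith [hq s hs])
              (by linarith) (by linarith [hsD s hs] : s - 1 ≤ D) hD0 hm hm1 hN hz.1 hz.2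
            calc |q s| * (|s| * z ^ (s - 1)) ≤ |q s| * (|s| * (m ^ (-(d + 1)) * N ^ D)) := by
                  gcongr
              _ ≤ |q s| * ((1 + |s|) * (m ^ (-(d + 1)) * N ^ D)) := by
                  gcongr
                  linarith
              _ = _ := by ring
        _ ≤ K * (m ^ (-(d + 1)) * N ^ D) := by
            rw [← Finset.sum_mul]
            gcongr
            linarith
    have := (convex_Icc m N).norm_image_sub_le_of_norm_hasDerivWithin_le hder hbound
      ⟨hy, hyN⟩ ⟨hx, hxN⟩
    simpa only [Real.norm_eq_abs] using this

lemma FLP.continuousOn_eval (q : FLP) : ContinuousOn q.eval (Ioi 0) := by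
  have : ContinuousOn (fun x : ℝ => ∑ s ∈ q.support, q s * x ^ s) (Ioi 0) := by
    refine continuousOn_finsetSum _ fun s _ => ?_
    exact continuousOn_const.mul
      (continuousOn_id.rpow_const fun x hx => Or.inl (ne_of_gt hx))
  exact this

/-- A finite exponent bound: some `d ≥ 0` has `-d ≤ s` for all exponents `s`. -/
lemma FLP.exists_exponent_bound (q : FLP) : ∃ d : ℝ, 0 ≤ d ∧ ∀ s ∈ q.support, -d ≤ s := by
  refine ⟨∑ s ∈ q.support, |s|, Finset.sum_nonneg fun s _ => abs_nonneg s, fun s hs => ?_⟩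
  have h := Finset.single_le_sum (f := fun s : ℝ => |s|) (fun s _ => abs_nonneg s) hs
  have := neg_abs_le s
  linarith

/-- A one-sided Lipschitz function may tend to `+∞` at the origin, but not to `-∞`. -/
lemma OneSidedLipschitz.exists_lower {f : ℝ → ℝ} (hf : OneSidedLipschitz f) (B : ℝ) (hB : 0 < B) :
    ∃ C : ℝ, 0 < C ∧ ∀ x, 0 < x → x ≤ B → -C ≤ f x := by
  obtain ⟨L, hL, h⟩ := hf
  refine ⟨|f B| + L * B, by positivity, fun x hx hxB => ?_⟩
  rcases hxB.eq_or_lt with rfl | hlt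
  · have := neg_abs_le (f x)
    nlinarith
  · have h1 := h B x hB hx
    have h2 : f B - f x ≤ L * (B - x) := by
      have hp : 0 < B - x := sub_pos.2 hlt
      have : (f B - f x) * (B - x) ≤ (L * (B - x)) * (B - x) := by nlinarith
      exact le_of_mul_le_mul_right this hp
    have := neg_abs_le (f B)
    nlinarith

/-- A one-sided Lipschitz function grows at most linearly at infinity. -/
lemma OneSidedLipschitz.exists_upper {f : ℝ → ℝ} (hf : OneSidedLipschitz f) :
    ∃ C : ℝ, 0 < C ∧ ∀ x, 1 ≤ x → f x ≤ C * x := by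
  obtain ⟨L, hL, h⟩ := hf
  refine ⟨|f 1| + L, by positivity, fun x hx => ?_⟩
  rcases hx.eq_or_lt with rfl | hlt
  · have := le_abs_self (f 1)
    nlinarith
  · have h1 := h x 1 (by linarith) one_pos
    have h2 : f x - f 1 ≤ L * (x - 1) := by
      have hp : 0 < x - 1 := sub_pos.2 hlt
      have : (f x - f 1) * (x - 1) ≤ (L * (x - 1)) * (x - 1) := by nlinarith
      exact le_of_mul_le_mul_right this hp
    have := le_abs_self (f 1)
    nlinarith [abs_nonneg (f 1)]

lemma OneSidedLipschitz.sub_le {f : ℝ → ℝ} {L : ℝ}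
    (h : ∀ x y : ℝ, 0 < x → 0 < y → (f x - f y) * (x - y) ≤ L * (x - y) ^ 2)
    {x y : ℝ} (hy : 0 < y) (hxy : y ≤ x) : f x - f y ≤ L * (x - y) := by
  rcases hxy.eq_or_lt with rfl | hlt
  · simp
  · have hp : 0 < x - y := sub_pos.2 hlt
    have h1 := h x y (hy.trans hlt) hy
    have : (f x - f y) * (x - y) ≤ (L * (x - y)) * (x - y) := by nlinarith
    exact le_of_mul_le_mul_right this hp

end PosScheme

/-! ### The scheme along a single path -/

namespace PosScheme

/-- The constants behind the hypotheses on the correction functions `P h` and on the explicit part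
`f` of the drift. -/
structure SchemeBounds (T : ℝ≥0) (P : ℝ≥0 → ℝ → ℝ) (f : ℝ → ℝ) (c K L m₁ m₂ : ℝ) : Prop where
  T_pos : 0 < T
  c_pos : 0 < c
  K_ge : 1 ≤ K
  L_pos : 0 < L
  m₁_nonneg : 0 ≤ m₁
  m₂_nonneg : 0 ≤ m₂
  osl : ∀ x y : ℝ, 0 < x → 0 < y → (f x - f y) * (x - y) ≤ L * (x - y) ^ 2
  pos : ∀ h, IsStepSize T h → ∀ x, 0 < x → 0 < P h x
  contr : ∀ h, IsStepSize T h → ∀ x y, 0 < x → 0 < y → |P h x - P h y| ≤ |x - y|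
  close : ∀ h, IsStepSize T h → ∀ x, 0 < x →
    |P h x - x| ≤ K * (h : ℝ) ^ 2 * (1 + x ^ (-m₁) + x ^ m₂)
  growth : ∀ h, IsStepSize T h → ∀ x, 0 < x → |f (P h x)| ≤ K * (Real.sqrt h)⁻¹ + K * x
  lip : ∀ h, IsStepSize T h → ∀ x y, 0 < x → 0 < y →
    |f (P h x) - f (P h y)| ≤ K * (Real.sqrt h)⁻¹ * |x - y|

lemma rpow_neg_half_eq (h : ℝ≥0) : (h : ℝ) ^ (-(1 / 2) : ℝ) = (Real.sqrt h)⁻¹ := by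
  rw [Real.rpow_neg h.coe_nonneg, Real.sqrt_eq_rpow]

/-- The assumptions on the correction and on the corrected drift, with their constants merged. -/
lemma exists_schemeBounds {T : ℝ≥0} (hT : 0 < T) {P : ℝ≥0 → ℝ → ℝ} {μ : ℝ → ℝ} {c m₁ : ℝ}
    (hc : 0 < c) (hμ : OneSidedLipschitz (muHat μ c)) (hP : IsCorrection T P m₁)
    (hμP : CorrectedDriftBound T P μ c) :
    ∃ K L m₂ : ℝ, SchemeBounds T P (muHat μ c) c K L m₁ m₂ := by
  obtain ⟨L, hL, hosl⟩ := hμ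
  obtain ⟨hm₁, hpos, hcontr, C₁, m₂, hC₁, hm₂, hclose⟩ := hP
  obtain ⟨C₂, hC₂, hbd⟩ := hμP
  refine ⟨1 + C₁ + C₂, L, m₂, hT, hc, by linarith, hL, hm₁, hm₂, hosl, hpos, hcontr, ?_, ?_, ?_⟩
  · intro h hh x hx
    refine (hclose h hh x hx).trans ?_
    rw [abs_of_pos hx]
    have : 0 ≤ (h : ℝ) ^ 2 * (1 + x ^ (-m₁) + x ^ m₂) := by positivity
    nlinarith
  · intro h hh x hx
    refine ((hbd h hh).1 x hx).trans ?_
    rw [abs_of_pos hx, rpow_neg_half_eq]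
    have h1 : 0 ≤ (Real.sqrt h)⁻¹ := by positivity
    refine max_le ?_ ?_ <;> nlinarith
  · intro h hh x y hx hy
    refine ((hbd h hh).2 x y hx hy).trans ?_
    rw [rpow_neg_half_eq]
    have h1 : 0 ≤ (Real.sqrt h)⁻¹ * |x - y| := by positivity
    nlinarith

lemma IsStepSize.pos {T h : ℝ≥0} (hT : 0 < T) (hh : IsStepSize T h) : 0 < (h : ℝ) := by
  obtain ⟨M, hM, rfl, -⟩ := hh
  have : 0 < T / (M : ℝ≥0) := div_pos hT (by exact_mod_cast hM)
  exact_mod_cast this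

lemma IsStepSize.le_one {T h : ℝ≥0} (hh : IsStepSize T h) : (h : ℝ) ≤ 1 := by
  obtain ⟨M, hM, -, h1⟩ := hh
  exact_mod_cast h1

/-- The explicit part `y ↦ P_h(y) + h f(P_h(y))` of one step of the scheme. -/
def schemeMap (P : ℝ≥0 → ℝ → ℝ) (f : ℝ → ℝ) (h : ℝ≥0) (y : ℝ) : ℝ := P h y + h * f (P h y)

/-- The numerical solution along one path `w` of the (scaled) noise. -/
def SchemePath (P : ℝ≥0 → ℝ → ℝ) (f : ℝ → ℝ) (c : ℝ) (h : ℝ≥0) (M : ℕ) (x₀ : ℝ) (w Y : ℕ → ℝ) :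
    Prop :=
  Y 0 = x₀ ∧ ∀ n < M, 0 < Y (n + 1) ∧
    Y (n + 1) = schemeMap P f h (Y n) + c * h * (Y (n + 1))⁻¹ + (w (n + 1) - w n)

lemma SchemePath.pos {P : ℝ≥0 → ℝ → ℝ} {f : ℝ → ℝ} {c : ℝ} {h : ℝ≥0} {M : ℕ} {x₀ : ℝ}
    {w Y : ℕ → ℝ} (hY : SchemePath P f c h M x₀ w Y) (hx₀ : 0 < x₀) {n : ℕ} (hn : n ≤ M) :
    0 < Y n := by
  rcases n with _ | n
  · rw [hY.1]; exact hx₀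
  · exact (hY.2 n (by omega)).1

/-- A discrete Gronwall inequality. -/
lemma discrete_gronwall {a : ℕ → ℝ} {u b : ℝ} (hu : 0 ≤ u) (hb : 0 ≤ b) (ha : 0 ≤ a 0) {M : ℕ}
    (h : ∀ n < M, a (n + 1) ≤ (1 + u) * a n + b) {n : ℕ} (hn : n ≤ M) :
    a n ≤ Real.exp (u * n) * (a 0 + n * b) := by
  have key : ∀ n ≤ M, a n ≤ (1 + u) ^ n * (a 0 + n * b) := by
    intro n
    induction n with
    | zero => intro _; simp
    | succ n ih =>
      intro hn
      have h1 := ih (by omega)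
      have h2 : 1 ≤ (1 + u) ^ (n + 1) := one_le_pow₀ (by linarith)
      calc a (n + 1) ≤ (1 + u) * a n + b := h n (by omega)
        _ ≤ (1 + u) * ((1 + u) ^ n * (a 0 + n * b)) + (1 + u) ^ (n + 1) * b := by
          gcongr
          exact le_mul_of_one_le_left hb h2
        _ = _ := by push_cast; ring
  refine (key n hn).trans ?_
  have h3 : (1 + u) ^ n ≤ Real.exp (u * n) := by
    calc (1 + u) ^ n ≤ (Real.exp u) ^ n := by
          gcongr
          linarith [Real.add_one_le_exp u]
      _ = Real.exp (u * n) := by rw [← Real.exp_nat_mul]; ring_nf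
  gcongr

section Bounds

variable {T : ℝ≥0} {P : ℝ≥0 → ℝ → ℝ} {f : ℝ → ℝ} {c K L m₁ m₂ : ℝ}

lemma SchemeBounds.close_one_le (B : SchemeBounds T P f c K L m₁ m₂) {h : ℝ≥0}
    (hh : IsStepSize T h) {x : ℝ} (hx : 1 ≤ x) : |P h x - x| ≤ 3 * K * (h : ℝ) ^ 2 * x ^ m₂ := by
  have hK := B.K_ge
  refine (B.close h hh x (by linarith)).trans ?_
  have h1 : x ^ (-m₁) ≤ 1 := Real.rpow_le_one_of_one_le_of_nonpos hx (by linarith [B.m₁_nonneg])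
  have h2 : 1 ≤ x ^ m₂ := Real.one_le_rpow hx B.m₂_nonneg
  have h3 : 0 ≤ K * (h : ℝ) ^ 2 := by positivity
  nlinarith

/-- Contractivity makes `x ↦ P_h(x) - x` nonincreasing, so near `0` the correction can lower the
argument only by a multiple of `h²`, whatever the exponent `m₁`. -/
lemma SchemeBounds.le_P (B : SchemeBounds T P f c K L m₁ m₂) {h : ℝ≥0} (hh : IsStepSize T h)
    {x N : ℝ} (hx : 0 < x) (hN : 1 ≤ N) (hxN : x ≤ N) :
    x - 3 * K * (h : ℝ) ^ 2 * N ^ m₂ ≤ P h x := by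
  have hK := B.K_ge
  rcases le_total x 1 with h1 | h1
  · have h2 := (abs_le.1 (B.close_one_le hh le_rfl)).1
    have h3 := (abs_le.1 (B.contr h hh 1 x one_pos hx)).2
    rw [abs_of_nonneg (by linarith)] at h3
    rw [Real.one_rpow] at h2
    have h4 : 1 ≤ N ^ m₂ := Real.one_le_rpow hN B.m₂_nonneg
    have h5 : 0 ≤ 3 * K * (h : ℝ) ^ 2 := by positivity
    nlinarith
  · have h2 := (abs_le.1 (B.close_one_le hh h1)).1
    have h4 : x ^ m₂ ≤ N ^ m₂ := Real.rpow_le_rpow hx.le hxN B.m₂_nonneg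
    have h5 : 0 ≤ 3 * K * (h : ℝ) ^ 2 := by positivity
    nlinarith

lemma SchemeBounds.P_le (B : SchemeBounds T P f c K L m₁ m₂) {h : ℝ≥0} (hh : IsStepSize T h)
    {x : ℝ} (hx : 0 < x) : P h x ≤ 2 + 3 * K + x := by
  have hK := B.K_ge
  have h2 := (abs_le.1 (B.close_one_le hh le_rfl)).2
  have h3 := (abs_le.1 (B.contr h hh x 1 hx one_pos)).2
  have h6 : |x - 1| ≤ x + 1 := abs_le.2 ⟨by linarith, by linarith⟩
  have h4 := hh.le_one
  have h5 : (h : ℝ) ^ 2 ≤ 1 := pow_le_one₀ h.coe_nonneg h4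
  rw [Real.one_rpow] at h2
  nlinarith

/-- The one-sided Lipschitz condition and the `h^(-1/2)`-Lipschitz bound make the explicit part of
the step Lipschitz with constant `1 + O(h)`. -/
lemma SchemeBounds.schemeMap_lip (B : SchemeBounds T P f c K L m₁ m₂) {h : ℝ≥0}
    (hh : IsStepSize T h) {x y : ℝ} (hx : 0 < x) (hy : 0 < y) :
    |schemeMap P f h x - schemeMap P f h y| ≤ (1 + (L + K ^ 2) * h) * |x - y| := by
  have hK := B.K_ge
  have hL := B.L_pos
  have hpos := hh.pos B.T_pos
  refine abs_le_of_sq_le_sq ?_ (by positivity)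
  unfold schemeMap
  set p := P h x - P h y with hp
  set g := f (P h x) - f (P h y) with hg
  have e : P h x + h * f (P h x) - (P h y + h * f (P h y)) = p + h * g := by rw [hp, hg]; ring
  rw [e]
  have h1 : p ^ 2 ≤ (x - y) ^ 2 := sq_le_sq.2 (B.contr h hh x y hx hy)
  have h2 : g * p ≤ L * p ^ 2 := B.osl _ _ (B.pos h hh x hx) (B.pos h hh y hy)
  have h3 : g ^ 2 ≤ K ^ 2 * (h : ℝ)⁻¹ * (x - y) ^ 2 := by
    have h4 := B.lip h hh x y hx hy
    rw [← hg] at h4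
    have h5 := pow_le_pow_left₀ (abs_nonneg _) h4 2
    rw [sq_abs, mul_pow, mul_pow, sq_abs, inv_pow, Real.sq_sqrt h.coe_nonneg] at h5
    exact h5
  have h6 : (h : ℝ) ^ 2 * (K ^ 2 * (h : ℝ)⁻¹ * (x - y) ^ 2) = h * K ^ 2 * (x - y) ^ 2 := by
    field_simp
  have h7 : (h : ℝ) ^ 2 * g ^ 2 ≤ h * K ^ 2 * (x - y) ^ 2 := by
    rw [← h6]; gcongr
  rw [mul_pow, sq_abs]
  have h8 : (h : ℝ) * (g * p) ≤ h * (L * (x - y) ^ 2) := by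
    refine mul_le_mul_of_nonneg_left (h2.trans ?_) hpos.le
    gcongr
  have h9 : 0 ≤ ((L + K ^ 2) * h) ^ 2 * (x - y) ^ 2 := by positivity
  have h10 : 0 ≤ (h : ℝ) * K ^ 2 * (x - y) ^ 2 := by positivity
  nlinarith

/-- One step of the scheme cannot come closer to `0` than this. -/
lemma SchemeBounds.inv_step_le (B : SchemeBounds T P f c K L m₁ m₂) {h : ℝ≥0}
    (hh : IsStepSize T h) {y y' Δ : ℝ} (hy : 0 < y) (hy' : 0 < y')
    (he : y' = schemeMap P f h y + c * h * y'⁻¹ + Δ) :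
    y'⁻¹ ≤ (1 + 2 * K / c) * ((Real.sqrt h)⁻¹ + y + |Δ| / h) := by
  have hK := B.K_ge
  have hc := B.c_pos
  have hpos := hh.pos B.T_pos
  have hs : 0 < Real.sqrt h := Real.sqrt_pos.2 hpos
  have hq : 0 ≤ 2 * K / c := by positivity
  have hΔ : 0 ≤ |Δ| / h := by positivity
  have hsi : 0 < (Real.sqrt h)⁻¹ := by positivity
  rcases le_total (Real.sqrt h) y' with h1 | h1
  · have h2 : y'⁻¹ ≤ (Real.sqrt h)⁻¹ := inv_anti₀ hs h1
    have h3 : 0 ≤ 2 * K / c * ((Real.sqrt h)⁻¹ + y + |Δ| / h) := by positivity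
    nlinarith
  · have h2 : c * h * y'⁻¹ ≤ Real.sqrt h + h * (K * (Real.sqrt h)⁻¹ + K * y) + |Δ| := by
      have h3 := neg_abs_le (f (P h y))
      have h4 := B.growth h hh y hy
      have h5 := B.pos h hh y hy
      have h6 := neg_abs_le Δ
      unfold schemeMap at he
      have h7 : (h : ℝ) * (-(K * (Real.sqrt h)⁻¹ + K * y)) ≤ h * f (P h y) := by
        gcongr
        linarith
      linarith
    have h8 : (h : ℝ) * (Real.sqrt h)⁻¹ = Real.sqrt h := by
      rw [← div_eq_mul_inv, Real.div_sqrt]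
    have h9 : c * h * y'⁻¹ ≤ (2 * K) * (h * ((Real.sqrt h)⁻¹ + y + |Δ| / h)) := by
      have e : (h : ℝ) * ((Real.sqrt h)⁻¹ + y + |Δ| / h) = Real.sqrt h + h * y + |Δ| := by
        rw [mul_add, mul_add, h8, mul_div_cancel₀ _ hpos.ne']
      rw [e]
      have h10 : (h : ℝ) * (K * (Real.sqrt h)⁻¹ + K * y) = K * Real.sqrt h + K * (h * y) := by
        linear_combination K * h8
      rw [h10] at h2
      have : 0 ≤ (h : ℝ) * y := by positivity
      nlinarith [abs_nonneg Δ]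
    have h11 : y'⁻¹ ≤ 2 * K / c * ((Real.sqrt h)⁻¹ + y + |Δ| / h) := by
      have h12 : y'⁻¹ = (c * h * y'⁻¹) / (c * h) := by field_simp
      rw [h12, div_le_iff₀ (by positivity)]
      refine h9.trans (le_of_eq ?_)
      field_simp
    nlinarith

end Bounds

/-- For arguments `≥ 1` the corrected drift grows polynomially, uniformly in the step size. -/
lemma SchemeBounds.exists_growth {T : ℝ≥0} {P : ℝ≥0 → ℝ → ℝ} {q : FLP} {c K L m₁ m₂ : ℝ}
    (B : SchemeBounds T P (muHat q.eval c) c K L m₁ m₂) :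
    ∃ (C : ℝ) (D : ℕ), 1 ≤ C ∧ ∀ h, IsStepSize T h → ∀ x, 1 ≤ x →
      |x - schemeMap P (muHat q.eval c) h x| ≤ C * h * x ^ D := by
  obtain ⟨d, hd, hqd⟩ := (q - Finsupp.single (-1) c : FLP).exists_exponent_bound
  obtain ⟨K₁, D₁, hK₁, hD₁, hb⟩ := (q - Finsupp.single (-1) c : FLP).exists_bound hd hqd
  have hK := B.K_ge
  have hm₂ := B.m₂_nonneg
  obtain ⟨D, hD⟩ := exists_nat_ge (D₁ + m₂ + 1)
  set C₁ : ℝ := K₁ * ((1 / 2) ^ (-d) * 2 ^ D₁) with hC₁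
  have hC₁0 : 0 ≤ C₁ := by positivity
  refine ⟨1 + 3 * K + C₁ + 6 * K ^ 2 + K, D, ?_, fun h hh x hx => ?_⟩
  · nlinarith
  have hh1 := hh.le_one
  have hpos := hh.pos B.T_pos
  have hx0 : 0 < x := by linarith
  have hpow : ∀ e : ℝ, 0 ≤ e → e ≤ D → x ^ e ≤ x ^ D := fun e _ he => by
    rw [← Real.rpow_natCast]; exact Real.rpow_le_rpow_of_exponent_le hx he
  have hxD : 1 ≤ x ^ D := one_le_pow₀ hx
  have hcl := B.close_one_le hh hx
  have hx2 := hpow m₂ hm₂ (by linarith)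
  have hhsq : (h : ℝ) ^ 2 ≤ h := by nlinarith
  have hcl' : |P h x - x| ≤ 3 * K * (h * x ^ D) := by
    refine hcl.trans ?_
    rw [mul_assoc (3 * K)]
    gcongr
  have hdr : |muHat q.eval c (P h x)| ≤ (C₁ + 6 * K ^ 2 + K) * x ^ D := by
    by_cases hcase : |P h x - x| ≤ x / 2
    · have h2 := abs_le.1 hcase
      rw [muHat_eq_eval]
      have h3 := (hb (1 / 2) (2 * x) (by norm_num) (by norm_num) (by linarith)).1 (P h x)
        (by linarith) (by linarith)
      refine h3.trans ?_
      rw [Real.mul_rpow (by norm_num) hx0.le]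
      have h4 := hpow D₁ hD₁ (by linarith)
      calc K₁ * ((1 / 2) ^ (-d) * (2 ^ D₁ * x ^ D₁)) = C₁ * x ^ D₁ := by rw [hC₁]; ring
        _ ≤ C₁ * x ^ D := by gcongr
        _ ≤ _ := by gcongr; nlinarith
    · push Not at hcase
      -- here the correction is large, which forces `x` to be large compared with `1 / h`
      have h2 : 1 ≤ 6 * K * (h : ℝ) ^ 2 * x ^ m₂ := by linarith
      have hs : 0 < Real.sqrt h := Real.sqrt_pos.2 hpos
      have h3 : (Real.sqrt h)⁻¹ ≤ 6 * K * x ^ m₂ := by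
        have hs1 : Real.sqrt h ≤ 1 := Real.sqrt_le_one.2 hh1
        have h4 : (h : ℝ) ^ 2 ≤ Real.sqrt h := by
          have := Real.sq_sqrt hpos.le
          nlinarith [mul_pos hs hs]
        rw [inv_le_iff_one_le_mul₀ hs]
        refine h2.trans ?_
        have : 0 ≤ 6 * K * x ^ m₂ := by positivity
        nlinarith
      refine (B.growth h hh x hx0).trans ?_
      have h5 : x ≤ x ^ D := by simpa using hpow 1 (by norm_num) (by linarith)
      calc K * (Real.sqrt h)⁻¹ + K * x ≤ K * (6 * K * x ^ D) + K * x ^ D := by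
            gcongr
            exact h3.trans (by gcongr)
        _ = (6 * K ^ 2 + K) * x ^ D := by ring
        _ ≤ _ := by gcongr; linarith
  have e : x - schemeMap P (muHat q.eval c) h x
      = -(P h x - x) - h * muHat q.eval c (P h x) := by unfold schemeMap; ring
  rw [e]
  calc |-(P h x - x) - h * muHat q.eval c (P h x)|
      ≤ |P h x - x| + h * |muHat q.eval c (P h x)| := by
        refine (abs_sub _ _).trans ?_
        rw [abs_neg, abs_mul, abs_of_pos hpos]
    _ ≤ 3 * K * (h * x ^ D) + h * ((C₁ + 6 * K ^ 2 + K) * x ^ D) := by gcongr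
    _ ≤ (1 + 3 * K + C₁ + 6 * K ^ 2 + K) * h * x ^ D := by
      have : 0 ≤ (h : ℝ) * x ^ D := by positivity
      nlinarith

/-- A pathwise polynomial bound of the numerical solution in terms of the noise, uniform in the
step size: compare with the reference path `1 + S + w`, which stays in `[1, 1 + 2 S]`. -/
lemma SchemeBounds.exists_path_bound {T : ℝ≥0} {P : ℝ≥0 → ℝ → ℝ} {q : FLP} {c K L m₁ m₂ : ℝ}
    (B : SchemeBounds T P (muHat q.eval c) c K L m₁ m₂) {x₀ : ℝ} (hx₀ : 0 < x₀) :
    ∃ (C : ℝ) (D : ℕ), 1 ≤ C ∧ 1 ≤ D ∧ ∀ (M : ℕ) (h : ℝ≥0), 0 < M → h = T / M → h ≤ 1 →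
      ∀ (w Y : ℕ → ℝ) (S : ℝ), (∀ n ≤ M, |w n| ≤ S) →
      SchemePath P (muHat q.eval c) c h M x₀ w Y → ∀ n ≤ M, Y n ≤ C * (1 + S) ^ D := by
  obtain ⟨C₁, D, hC₁, hg⟩ := B.exists_growth
  have hc := B.c_pos
  have hL := B.L_pos
  set E := Real.exp ((L + K ^ 2) * T) with hE
  have hE1 : 1 ≤ E := Real.one_le_exp (by positivity)
  refine ⟨E * (2 + x₀ + T * (C₁ * 2 ^ D + c)) + 2, D + 1, ?_, by omega, ?_⟩
  · have : 0 ≤ E * (2 + x₀ + T * (C₁ * 2 ^ D + c)) := by positivity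
    linarith
  intro M h hM hhT hh1 w Y S hwS hY n hn
  have hh : IsStepSize T h := ⟨M, hM, hhT, hh1⟩
  have hpos := hh.pos B.T_pos
  have hS : 0 ≤ S := (abs_nonneg _).trans (hwS 0 (by omega))
  have hhM : (h : ℝ) * M = T := by
    have hM' : (M : ℝ≥0) ≠ 0 := by exact_mod_cast hM.ne'
    have : h * M = T := by rw [hhT]; field_simp
    exact_mod_cast this
  set x : ℕ → ℝ := fun n => 1 + S + w n with hx
  have hx1 : ∀ n ≤ M, 1 ≤ x n := fun n hn => by
    have := (abs_le.1 (hwS n hn)).1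
    simp only [hx]; linarith
  have hx2 : ∀ n ≤ M, x n ≤ 2 * (1 + S) := fun n hn => by
    have := (abs_le.1 (hwS n hn)).2
    simp only [hx]; linarith
  set b : ℝ := h * ((C₁ * 2 ^ D + c) * (1 + S) ^ D) with hb
  have hrec : ∀ n < M, |x (n + 1) - Y (n + 1)|
      ≤ (1 + (L + K ^ 2) * h) * |x n - Y n| + b := by
    intro n hn
    obtain ⟨hy1, hye⟩ := hY.2 n hn
    have hy0 : 0 < Y n := hY.pos hx₀ hn.le
    have hxn := hx1 n hn.le
    have hxn1 := hx1 (n + 1) (by omega)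
    have hxp : 0 < x (n + 1) := by linarith
    have hlip := B.schemeMap_lip hh (x := x n) (y := Y n) (by linarith) hy0
    have hgr := hg h hh (x n) hxn
    set A := schemeMap P (muHat q.eval c) h with hA
    have hxrec : x (n + 1) = x n + (w (n + 1) - w n) := by simp only [hx]; ring
    -- the implicit terms have the opposite sign of the error
    have hmain : (x (n + 1) - Y (n + 1)) * (1 + c * h / (x (n + 1) * Y (n + 1)))
        = (A (x n) - A (Y n)) + ((x n - A (x n)) - c * h * (x (n + 1))⁻¹) := by
      have : c * h * (Y (n + 1))⁻¹ = Y (n + 1) - A (Y n) - (w (n + 1) - w n) := by linarith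
      have h3 : (x (n + 1) - Y (n + 1)) * (c * h / (x (n + 1) * Y (n + 1)))
          = c * h * (Y (n + 1))⁻¹ - c * h * (x (n + 1))⁻¹ := by
        field_simp
      rw [mul_add, h3, this]
      rw [hxrec]; ring
    have h4 : 1 ≤ 1 + c * h / (x (n + 1) * Y (n + 1)) := by
      have : 0 ≤ c * h / (x (n + 1) * Y (n + 1)) := by positivity
      linarith
    have h5 : |x (n + 1) - Y (n + 1)|
        ≤ |(x (n + 1) - Y (n + 1)) * (1 + c * h / (x (n + 1) * Y (n + 1)))| := by
      rw [abs_mul, abs_of_nonneg (by linarith : (0 : ℝ) ≤ 1 + c * h / (x (n + 1) * Y (n + 1)))]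
      exact le_mul_of_one_le_right (abs_nonneg _) h4
    refine h5.trans ?_
    rw [hmain]
    refine (abs_add_le _ _).trans (add_le_add hlip ((abs_sub _ _).trans ?_))
    have h6 : |c * h * (x (n + 1))⁻¹| ≤ c * h := by
      rw [abs_of_nonneg (by positivity)]
      exact mul_le_of_le_one_right (by positivity) (inv_le_one_of_one_le₀ hxn1)
    have h7 : x n ^ D ≤ 2 ^ D * (1 + S) ^ D := by
      rw [← mul_pow]
      exact pow_le_pow_left₀ (by linarith) (hx2 n hn.le) D
    have h8 : (1 : ℝ) ≤ (1 + S) ^ D := one_le_pow₀ (by linarith)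
    calc |x n - A (x n)| + |c * h * (x (n + 1))⁻¹|
        ≤ C₁ * h * (2 ^ D * (1 + S) ^ D) + c * h * (1 + S) ^ D := by
          refine add_le_add (hgr.trans (by gcongr)) (h6.trans ?_)
          exact le_mul_of_one_le_right (by positivity) h8
      _ = b := by rw [hb]; ring
  have hgr := discrete_gronwall (a := fun n => |x n - Y n|) (u := (L + K ^ 2) * h) (b := b)
    (by positivity) (by positivity) (abs_nonneg _) hrec hn
  have hnM : (h : ℝ) * n ≤ T := by
    rw [← hhM]
    gcongr
  have hexp : Real.exp ((L + K ^ 2) * h * n) ≤ E := by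
    rw [hE]
    refine Real.exp_le_exp.2 ?_
    rw [mul_assoc]
    gcongr
  have hS1 : 1 ≤ 1 + S := by linarith
  have hSD : (1 + S) ^ D ≤ (1 + S) ^ (D + 1) := pow_le_pow_right₀ hS1 (by omega)
  have hS1D : (1 + S) ≤ (1 + S) ^ (D + 1) := by
    simpa using pow_le_pow_right₀ hS1 (by omega : 1 ≤ D + 1)
  have ha0 : |x 0 - Y 0| ≤ (2 + x₀) * (1 + S) := by
    have h1 := hx1 0 (by omega)
    have h2 := hx2 0 (by omega)
    rw [hY.1]
    rw [abs_le]
    constructor <;> nlinarith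
  have hnb : n * b ≤ T * ((C₁ * 2 ^ D + c) * (1 + S) ^ (D + 1)) := by
    calc n * b = (h * n) * ((C₁ * 2 ^ D + c) * (1 + S) ^ D) := by rw [hb]; ring
      _ ≤ T * ((C₁ * 2 ^ D + c) * (1 + S) ^ (D + 1)) := by gcongr
  have hx0' : |x 0 - Y 0| ≤ (2 + x₀) * (1 + S) ^ (D + 1) := ha0.trans (by gcongr)
  have hYx : Y n ≤ x n + |x n - Y n| := by linarith [neg_abs_le (x n - Y n)]
  calc Y n ≤ x n + |x n - Y n| := hYx
    _ ≤ 2 * (1 + S) ^ (D + 1)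
        + E * ((2 + x₀) * (1 + S) ^ (D + 1) + T * ((C₁ * 2 ^ D + c) * (1 + S) ^ (D + 1))) := by
      refine add_le_add ((hx2 n hn).trans (by linarith)) (hgr.trans ?_)
      gcongr
    _ = _ := by ring

end PosScheme

/-! ### The exact solution along a single path -/

namespace PosScheme

/-- A positive path `x` driven by the drift `μ` and the noise path `v`, in real time. -/
structure SolPath (μ : ℝ → ℝ) (x₀ : ℝ) (v x : ℝ → ℝ) : Prop where
  cont : Continuous x
  pos : ∀ t, 0 < x t
  eqn : ∀ t, 0 ≤ t → x t = x₀ + (∫ s in (0 : ℝ)..t, μ (x s)) + v t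

lemma IsPositiveSolution.ae_solPath {Ω : Type*} [mΩ : MeasurableSpace Ω] {Pr : Measure Ω}
    {ℱ : Filtration ℝ≥0 mΩ} {W : ℝ≥0 → Ω → ℝ} {μ : ℝ → ℝ} {σ x₀ : ℝ} {X : ℝ≥0 → Ω → ℝ}
    (hX : IsPositiveSolution Pr ℱ W μ σ x₀ X) :
    ∀ᵐ ω ∂Pr, SolPath μ x₀ (fun t => σ * (W t.toNNReal ω - W 0 ω)) (fun t => X t.toNNReal ω) := by
  filter_upwards [hX.continuous, hX.pos, hX.eqn] with ω h1 h2 h3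
  refine ⟨h1.comp continuous_real_toNNReal, fun t => h2 _, fun t ht => ?_⟩
  have := h3 t.toNNReal
  rwa [Real.coe_toNNReal t ht] at this

section SolPath

variable {μ : ℝ → ℝ} {x₀ : ℝ} {v x : ℝ → ℝ}

lemma SolPath.continuous_drift (hx : SolPath μ x₀ v x) (hμ : ContinuousOn μ (Ioi 0)) :
    Continuous fun s => μ (x s) :=
  hμ.comp_continuous hx.cont hx.pos

lemma SolPath.sub_eq (hx : SolPath μ x₀ v x) (hμ : ContinuousOn μ (Ioi 0)) {s t : ℝ} (hs : 0 ≤ s)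
    (hst : s ≤ t) : x t - x s = (∫ u in s..t, μ (x u)) + (v t - v s) := by
  have hc := hx.continuous_drift hμ
  rw [hx.eqn t (hs.trans hst), hx.eqn s hs,
    ← intervalIntegral.integral_add_adjacent_intervals (hc.intervalIntegrable 0 s)
      (hc.intervalIntegrable s t)]
  ring

/-- If the drift is nonnegative near `0`, the path cannot drop by more than the noise does. -/
lemma SolPath.le_of_noise (hx : SolPath μ x₀ v x) (hμ : ContinuousOn μ (Ioi 0)) {η ρ a s : ℝ}
    (ha : 0 ≤ a) (has : a ≤ s) (hη : ∀ y, 0 < y → y ≤ 2 * η → 0 ≤ μ y) (hρ : 2 * ρ ≤ η)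
    (hxa : 2 * η ≤ x a) (hv : ∀ u, a ≤ u → u ≤ s → |v u - v a| ≤ ρ) : η ≤ x s := by
  by_contra hlt
  push Not at hlt
  set A : Set ℝ := Icc a s ∩ {u | 2 * η ≤ x u} with hA
  have hAc : IsCompact A := isCompact_Icc.inter_right (isClosed_le continuous_const hx.cont)
  obtain ⟨u, ⟨⟨hau, hus⟩, hu⟩, hmax⟩ := hAc.exists_isGreatest ⟨a, ⟨le_rfl, has⟩, hxa⟩
  have hint : 0 ≤ ∫ r in u..s, μ (x r) := by
    refine intervalIntegral.integral_nonneg_of_ae_restrict hus ?_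
    have hne : ∀ᵐ r ∂volume.restrict (Icc u s), r ≠ u :=
      ae_restrict_of_ae (Measure.ae_ne volume u)
    filter_upwards [hne, ae_restrict_mem measurableSet_Icc] with r hr1 hr2
    refine hη _ (hx.pos r) ?_
    by_contra hcon
    push Not at hcon
    exact hr1 (le_antisymm (hmax ⟨⟨hau.trans hr2.1, hr2.2⟩, hcon.le⟩) hr2.1)
  have h1 := hx.sub_eq hμ (ha.trans hau) hus
  have h2 := abs_le.1 (hv u hau hus)
  have h3 := abs_le.1 (hv s has le_rfl)
  have h4 : 2 * η ≤ x u := hu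
  linarith [h2.1, h2.2, h3.1, h3.2]

/-- A pathwise linear bound of the exact solution in terms of the noise. -/
lemma OneSidedLipschitz.exists_path_bound (hosl : OneSidedLipschitz μ)
    (hμ : ContinuousOn μ (Ioi 0)) (hx₀ : 0 < x₀) {T : ℝ} (hT : 0 ≤ T) :
    ∃ C : ℝ, 1 ≤ C ∧ ∀ (v x : ℝ → ℝ) (S : ℝ), SolPath μ x₀ v x →
      (∀ t, 0 ≤ t → t ≤ T → |v t| ≤ S) → ∀ t, 0 ≤ t → t ≤ T → x t ≤ C * (1 + S) := by
  obtain ⟨C, hC, hup⟩ := hosl.exists_upper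
  have hE : 1 ≤ Real.exp ((2 * C + 1) * T) := Real.one_le_exp (by positivity)
  refine ⟨2 * (1 + x₀) * Real.exp ((2 * C + 1) * T), by nlinarith, ?_⟩
  intro v x S hx hv t ht htT
  have hS : 0 ≤ S := (abs_nonneg _).trans (hv 0 le_rfl hT)
  set a₀ : ℝ := 1 + x₀ + S with ha₀
  set φ : ℝ → ℝ := fun t => x₀ + ∫ s in (0 : ℝ)..t, μ (x s) with hφ
  have hc := hx.continuous_drift hμ
  have hφd : ∀ t, HasDerivAt φ (μ (x t)) t := fun t => by
    have := (intervalIntegral.integral_hasDerivAt_right (hc.intervalIntegrable 0 t)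
      (hc.stronglyMeasurableAtFilter _ _) hc.continuousAt).const_add x₀
    exact this
  have key := image_le_of_deriv_right_lt_deriv_boundary (f := φ) (f' := fun t => μ (x t))
    (a := 0) (b := T) (fun t _ => (hφd t).continuousAt.continuousWithinAt)
    (fun t _ => (hφd t).hasDerivWithinAt)
    (B := fun t => a₀ * Real.exp ((2 * C + 1) * t))
    (B' := fun t => a₀ * (Real.exp ((2 * C + 1) * t) * (2 * C + 1)))
    (by simp only [hφ, intervalIntegral.integral_same, mul_zero, Real.exp_zero]; linarith)
    (fun t => by
      have h1 : HasDerivAt (fun t : ℝ => (2 * C + 1) * t) (2 * C + 1) t := by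
        simpa using (hasDerivAt_id t).const_mul (2 * C + 1)
      exact h1.exp.const_mul a₀)
    (fun t htm heq => by
      have h1 : 1 ≤ Real.exp ((2 * C + 1) * t) := Real.one_le_exp (by have := htm.1; positivity)
      have h2 := hx.eqn t htm.1
      have h3 := abs_le.1 (hv t htm.1 htm.2.le)
      have h4 : x t = a₀ * Real.exp ((2 * C + 1) * t) + v t := by
        rw [h2, ← heq]
      have ha1 : 1 ≤ a₀ := by linarith
      have h5 : a₀ ≤ a₀ * Real.exp ((2 * C + 1) * t) := le_mul_of_one_le_right (by linarith) h1
      have h6 : 1 ≤ x t := by linarith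
      have h7 := hup (x t) h6
      have h8 : x t ≤ 2 * (a₀ * Real.exp ((2 * C + 1) * t)) := by linarith
      calc μ (x t) ≤ C * (2 * (a₀ * Real.exp ((2 * C + 1) * t))) := h7.trans (by gcongr)
        _ < a₀ * (Real.exp ((2 * C + 1) * t) * (2 * C + 1)) := by nlinarith)
  have h1 := key ⟨ht, htT⟩
  have h2 := hx.eqn t ht
  have h3 := (abs_le.1 (hv t ht htT)).2
  have h4 : Real.exp ((2 * C + 1) * t) ≤ Real.exp ((2 * C + 1) * T) :=
    Real.exp_le_exp.2 (by gcongr)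
  have h5 : x t ≤ a₀ * Real.exp ((2 * C + 1) * T) + S := by
    have : φ t ≤ a₀ * Real.exp ((2 * C + 1) * T) := h1.trans (by gcongr)
    rw [h2]
    exact add_le_add this h3
  have h6 : a₀ ≤ (1 + x₀) * (1 + S) := by nlinarith
  have h7 : S ≤ (1 + x₀) * (1 + S) * Real.exp ((2 * C + 1) * T) := by
    have : S ≤ (1 + x₀) * (1 + S) := by nlinarith
    exact this.trans (le_mul_of_one_le_right (by positivity) hE)
  calc x t ≤ a₀ * Real.exp ((2 * C + 1) * T) + S := h5
    _ ≤ (1 + x₀) * (1 + S) * Real.exp ((2 * C + 1) * T)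
        + (1 + x₀) * (1 + S) * Real.exp ((2 * C + 1) * T) := by gcongr
    _ = _ := by ring

end SolPath

end PosScheme

/-! ### Comparing the scheme with the exact solution along a single path -/

namespace PosScheme

set_option maxHeartbeats 1000000 in
/-- The one-sided comparison of the numerical and the exact path. As long as the exact path stays
above `η`, the implicit term and the one-sided Lipschitz condition only help the numerical path,
and the errors that can push it below the exact one are the oscillation of the drift of the exact
path within the steps. -/
lemma SchemeBounds.compare {T : ℝ≥0} {P : ℝ≥0 → ℝ → ℝ} {μ : ℝ → ℝ} {c K L m₁ m₂ : ℝ}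
    (B : SchemeBounds T P (muHat μ c) c K L m₁ m₂) (hμ : ContinuousOn μ (Ioi 0))
    {x₀ : ℝ} {M : ℕ} {h : ℝ≥0} (hM : 0 < M) (hhT : h = T / M) (hh1 : h ≤ 1)
    {v x : ℝ → ℝ} (hx : SolPath μ x₀ v x) {Y : ℕ → ℝ}
    (hY : SchemePath P (muHat μ c) c h M x₀ (fun n => v (n * h)) Y) (hv0 : v 0 = 0)
    {η N Λ ρ : ℝ} (hη : 0 < η) (hN : 1 ≤ N)
    (hμbd : ∀ y, η ≤ y → y ≤ N → |μ y| ≤ Λ)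
    (hμlip : ∀ y z, η ≤ y → y ≤ N → η ≤ z → z ≤ N → |μ y - μ z| ≤ Λ * |y - z|)
    (hμhlip : ∀ y z, η ≤ y → y ≤ N → η ≤ z → z ≤ N →
      |muHat μ c y - muHat μ c z| ≤ Λ * |y - z|)
    (hηΛ : 1 ≤ η ^ 2 * Λ) (hNΛ : N ^ m₂ ≤ Λ) (hhΛ : h * Λ ≤ 1) (hρη : 2 * ρ ≤ η)
    (hμpos : ∀ y, 0 < y → y ≤ 2 * η → 0 ≤ μ y)
    (hsmall : Real.exp (L * T) *
      (T * ((1 + L) * (3 * K) * (h * Λ) + (1 + c) * (Λ * (h * Λ + ρ)))) ≤ η)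
    (hxN : ∀ t : ℝ, 0 ≤ t → t ≤ T → x t ≤ N) (hYN : ∀ n ≤ M, 2 + 3 * K + Y n ≤ N)
    (hosc : ∀ n < M, ∀ s, (n : ℝ) * h ≤ s → s ≤ ((n + 1 : ℕ) : ℝ) * h →
      |v s - v ((n : ℝ) * h)| ≤ ρ)
    (hxη : ∀ n ≤ M, 2 * η ≤ x (n * h)) :
    ∀ n ≤ M, x (n * h) - Y n ≤ η := by
  have hh : IsStepSize T h := ⟨M, hM, hhT, hh1⟩
  have hpos := hh.pos B.T_pos
  have hle1 := hh.le_one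
  have hK := B.K_ge
  have hc := B.c_pos
  have hL := B.L_pos
  have hρ0 : 0 ≤ ρ := (abs_nonneg _).trans
    (hosc 0 hM 0 (by simp) (by positivity))
  have hΛ0 : 0 < Λ := by
    by_contra hcon
    push Not at hcon
    nlinarith [sq_nonneg η]
  have hx₀ : 0 < x₀ := by
    have := hx.eqn 0 le_rfl
    rw [intervalIntegral.integral_same, hv0] at this
    have h2 := hx.pos 0
    linarith
  have hhM : (h : ℝ) * M = T := by
    have hM' : (M : ℝ≥0) ≠ 0 := by exact_mod_cast hM.ne'
    have : h * M = T := by rw [hhT]; field_simp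
    exact_mod_cast this
  have htime : ∀ n ≤ M, (n : ℝ) * h ≤ T := fun n hn => by
    rw [← hhM, mul_comm]
    gcongr
  set b : ℝ := (1 + L) * (3 * K * (h : ℝ) ^ 2 * Λ) + (1 + c) * (h * (Λ * (h * Λ + ρ))) with hb
  have hrec : ∀ n < M, max (x ((n + 1 : ℕ) * h) - Y (n + 1)) 0
      ≤ (1 + L * h) * max (x (n * h) - Y n) 0 + b := by
    intro n hn
    have hn1 : n + 1 ≤ M := hn
    have hstep : (n : ℝ) * h ≤ ((n + 1 : ℕ) : ℝ) * h := by
      gcongr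
      simp
    have hlen : ((n + 1 : ℕ) : ℝ) * h - n * h = h := by push_cast; ring
    have hn0 : 0 ≤ (n : ℝ) * h := by positivity
    -- between the grid points the exact path stays in `[η, N]`
    have hxs : ∀ s, (n : ℝ) * h ≤ s → s ≤ ((n + 1 : ℕ) : ℝ) * h → η ≤ x s ∧ x s ≤ N := by
      intro s hs1 hs2
      refine ⟨hx.le_of_noise hμ hn0 hs1 hμpos hρη (hxη n hn.le)
        (fun u hu1 hu2 => hosc n hn u hu1 (hu2.trans hs2)), ?_⟩
      exact hxN s (hn0.trans hs1) (hs2.trans (htime _ hn1))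
    have hinc : ∀ s, (n : ℝ) * h ≤ s → s ≤ ((n + 1 : ℕ) : ℝ) * h →
        |x s - x (n * h)| ≤ h * Λ + ρ := by
      intro s hs1 hs2
      rw [hx.sub_eq hμ hn0 hs1]
      refine (abs_add_le _ _).trans (add_le_add ?_ (hosc n hn s hs1 hs2))
      have h1 : ‖∫ u in (n * h : ℝ)..s, μ (x u)‖ ≤ Λ * |s - n * h| := by
        refine intervalIntegral.norm_integral_le_of_norm_le_const fun u hu => ?_
        rw [uIoc_of_le hs1] at hu
        have := hxs u hu.1.le (hu.2.trans hs2)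
        exact hμbd _ this.1 this.2
      rw [Real.norm_eq_abs, abs_of_nonneg (by linarith : (0 : ℝ) ≤ s - n * h)] at h1
      refine h1.trans ?_
      rw [mul_comm]
      gcongr
      linarith
    set xn := x (n * h) with hxn
    set xn1 := x ((n + 1 : ℕ) * h) with hxn1
    have hxnb := hxs (n * h) le_rfl hstep
    have hxn1b := hxs ((n + 1 : ℕ) * h) hstep le_rfl
    rw [← hxn] at hxnb
    rw [← hxn1] at hxn1b
    have hxn0 : 0 < xn := hx.pos _
    have hxn10 : 0 < xn1 := hx.pos _
    obtain ⟨hy1, hye⟩ := hY.2 n hn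
    have hy0 : 0 < Y n := hY.pos hx₀ hn.le
    set I : ℝ := (∫ u in (n * h : ℝ)..((n + 1 : ℕ) * h : ℝ), μ (x u)) - h * μ xn with hI
    have hIb : |I| ≤ h * (Λ * (h * Λ + ρ)) := by
      have hcd := hx.continuous_drift hμ
      have e : I = ∫ u in (n * h : ℝ)..((n + 1 : ℕ) * h : ℝ), (μ (x u) - μ xn) := by
        rw [intervalIntegral.integral_sub (hcd.intervalIntegrable _ _)
          intervalIntegrable_const, intervalIntegral.integral_const, hlen, smul_eq_mul]
      rw [e]
      have h1 : ‖∫ u in (n * h : ℝ)..((n + 1 : ℕ) * h : ℝ), (μ (x u) - μ xn)‖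
          ≤ (Λ * (h * Λ + ρ)) * |((n + 1 : ℕ) * h : ℝ) - n * h| := by
        refine intervalIntegral.norm_integral_le_of_norm_le_const fun u hu => ?_
        rw [uIoc_of_le hstep] at hu
        have h2 := hxs u hu.1.le hu.2
        refine (hμlip _ _ h2.1 h2.2 hxnb.1 hxnb.2).trans ?_
        gcongr
        exact hinc u hu.1.le hu.2
      rw [hlen, abs_of_pos hpos] at h1
      exact h1.trans_eq (by ring)
    set J : ℝ := c * h * (xn⁻¹ - xn1⁻¹) with hJ
    have hJb : |J| ≤ c * (h * (Λ * (h * Λ + ρ))) := by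
      have h1 : |xn⁻¹ - xn1⁻¹| ≤ Λ * (h * Λ + ρ) := by
        have e : xn⁻¹ - xn1⁻¹ = (xn1 - xn) / (xn * xn1) := by field_simp
        rw [e, abs_div, abs_of_pos (mul_pos hxn0 hxn10), div_le_iff₀ (mul_pos hxn0 hxn10)]
        have h2 := hinc ((n + 1 : ℕ) * h) hstep le_rfl
        have h3 : η ^ 2 ≤ xn * xn1 := by
          rw [sq]; exact mul_le_mul hxnb.1 hxn1b.1 hη.le hxn0.le
        have h4 : 1 ≤ Λ * (xn * xn1) := by nlinarith
        calc |xn1 - xn| ≤ (h * Λ + ρ) * 1 := by rw [mul_one]; exact h2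
          _ ≤ (h * Λ + ρ) * (Λ * (xn * xn1)) := by gcongr
          _ = _ := by ring
      rw [hJ, abs_mul, abs_of_pos (by positivity)]
      calc c * h * |xn⁻¹ - xn1⁻¹| ≤ c * h * (Λ * (h * Λ + ρ)) := by gcongr
        _ = _ := by ring
    -- the deterministic parts of the two steps
    set y := P h (Y n) with hyP
    have hyp : 0 < y := B.pos h hh _ hy0
    have hA : (xn + h * muHat μ c xn) - (y + h * muHat μ c y)
        ≤ (1 + L * h) * (max (xn - Y n) 0 + 3 * K * (h : ℝ) ^ 2 * Λ) := by
      rcases le_total y xn with h1 | h1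
      · have h2 := OneSidedLipschitz.sub_le B.osl hyp h1
        have h3 := B.le_P hh hy0 hN (by linarith [hYN n hn.le])
        have h4 : xn - y ≤ max (xn - Y n) 0 + 3 * K * (h : ℝ) ^ 2 * Λ := by
          have h5 : 3 * K * (h : ℝ) ^ 2 * N ^ m₂ ≤ 3 * K * (h : ℝ) ^ 2 * Λ := by gcongr
          have h6 := le_max_left (xn - Y n) 0
          linarith
        calc (xn + h * muHat μ c xn) - (y + h * muHat μ c y)
            = (xn - y) + h * (muHat μ c xn - muHat μ c y) := by ring
          _ ≤ (xn - y) + h * (L * (xn - y)) := by gcongr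
          _ = (1 + L * h) * (xn - y) := by ring
          _ ≤ _ := by gcongr
      · -- the explicit step is monotone on `[η, N]`, as `h * Λ ≤ 1`
        have h2 : y ≤ N := (B.P_le hh hy0).trans (hYN n hn.le)
        have h3 := hμhlip xn y hxnb.1 hxnb.2 (hxnb.1.trans h1) h2
        rw [abs_of_nonpos (by linarith : xn - y ≤ 0)] at h3
        have h4 : (h : ℝ) * (muHat μ c xn - muHat μ c y) ≤ y - xn := by
          calc (h : ℝ) * (muHat μ c xn - muHat μ c y) ≤ h * (Λ * -(xn - y)) := by
                gcongr
                exact (le_abs_self _).trans h3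
            _ = (h * Λ) * (y - xn) := by ring
            _ ≤ 1 * (y - xn) := by
                gcongr
            _ = y - xn := one_mul _
        have h5 : 0 ≤ (1 + L * h) * (max (xn - Y n) 0 + 3 * K * (h : ℝ) ^ 2 * Λ) := by
          have := le_max_right (xn - Y n) 0
          positivity
        linarith
    have hb0 : 0 ≤ b := by positivity
    refine max_le ?_ (by positivity)
    rcases le_total (xn1 - Y (n + 1)) 0 with h1 | h1
    · exact h1.trans (by positivity)
    · have h2 := hx.sub_eq hμ hn0 hstep
      rw [← hxn, ← hxn1] at h2
      -- the implicit term pushes the lower of the two paths up more strongly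
      have h3 : c * h * xn1⁻¹ ≤ c * h * (Y (n + 1))⁻¹ := by
        gcongr
        linarith
      have h4 : h * μ xn = h * muHat μ c xn + c * h * xn⁻¹ := by
        unfold muHat; ring
      have h5 := (abs_le.1 hIb).2
      have h6 := (abs_le.1 hJb).2
      have h7 : schemeMap P (muHat μ c) h (Y n) = y + h * muHat μ c y := rfl
      rw [h7] at hye
      have h8 : xn1 - Y (n + 1) ≤ ((xn + h * muHat μ c xn) - (y + h * muHat μ c y)) + I + J := by
        have e1 : xn1 = xn + (I + h * μ xn) + (v ((n + 1 : ℕ) * h) - v (n * h)) := by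
          rw [hI]; linarith
        rw [hJ]
        rw [h4] at e1
        linarith
      have h9 : (1 + L * h) * (3 * K * (h : ℝ) ^ 2 * Λ) ≤ (1 + L) * (3 * K * (h : ℝ) ^ 2 * Λ) := by
        gcongr
        nlinarith
      rw [mul_add] at hA
      linarith
  intro n hn
  have hgr := discrete_gronwall (a := fun n => max (x (n * h) - Y n) 0) (u := L * h) (b := b)
    (by positivity) (by positivity) (le_max_right _ _) hrec hn
  have h0 : max (x ((0 : ℕ) * h) - Y 0) 0 = 0 := by
    have h1 := hx.eqn 0 le_rfl
    rw [intervalIntegral.integral_same, hv0] at h1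
    rw [hY.1]
    simp only [Nat.cast_zero, zero_mul, h1]
    simp
  simp only [h0, zero_add] at hgr
  have hnT : (h : ℝ) * n ≤ T := by rw [mul_comm]; exact htime n hn
  have hexp : Real.exp (L * h * n) ≤ Real.exp (L * T) := by
    refine Real.exp_le_exp.2 ?_
    rw [mul_assoc]
    gcongr
  have hnb : n * b ≤ T * ((1 + L) * (3 * K) * (h * Λ) + (1 + c) * (Λ * (h * Λ + ρ))) := by
    calc n * b = (h * n) * ((1 + L) * (3 * K) * (h * Λ) + (1 + c) * (Λ * (h * Λ + ρ))) := by
          rw [hb]; ring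
      _ ≤ _ := by gcongr
  calc x (n * h) - Y n ≤ max (x (n * h) - Y n) 0 := le_max_left _ _
    _ ≤ Real.exp (L * h * n) * (n * b) := hgr
    _ ≤ _ := by gcongr
    _ ≤ η := hsmall

end PosScheme

/-! ### A singular explicit drift forces a strong correction -/

namespace PosScheme

open Filter Topology

/-- The leading behaviour of a fractional Laurent polynomial at `0`. -/
lemma FLP.tendsto_mul_eval (q : FLP) {d : ℝ} (hq : ∀ s ∈ q.support, -d ≤ s) :
    Tendsto (fun x => x ^ d * q.eval x) (𝓝[>] 0) (𝓝 (q (-d))) := by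
  have h1 : ∀ s ∈ q.support, Tendsto (fun x : ℝ => q s * x ^ (s + d)) (𝓝[>] 0)
      (𝓝 (if s = -d then q s else 0)) := by
    intro s hs
    split_ifs with h
    · subst h
      simp
    · have hpos : 0 < s + d := by
        rcases (hq s hs).lt_or_eq with h2 | h2
        · linarith
        · exact absurd h2.symm h
      have h3 : Tendsto (fun x : ℝ => x ^ (s + d)) (𝓝 0) (𝓝 0) := by
        have := (Real.continuousAt_rpow_const 0 (s + d) (Or.inr hpos.le)).tendsto
        rwa [Real.zero_rpow hpos.ne'] at this
      simpa using (h3.mono_left nhdsWithin_le_nhds).const_mul (q s)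
  have h2 := tendsto_finsetSum q.support h1
  have e : ∑ s ∈ q.support, (if s = -d then q s else 0) = q (-d) := by
    rw [Finset.sum_ite_eq']
    split_ifs with h
    · rfl
    · exact (Finsupp.notMem_support_iff.1 h).symm
  rw [e] at h2
  refine h2.congr' ?_
  filter_upwards [self_mem_nhdsWithin] with x hx
  have hx0 : (0 : ℝ) < x := hx
  rw [FLP.eval_eq_sum, Finset.mul_sum]
  refine Finset.sum_congr rfl fun s _ => ?_
  rw [Real.rpow_add hx0]
  ring

/-- If the explicit part of the drift has the leading exponent `-d ≤ -1` at `0`, the correction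
has to move the points of size `h ^ γ` for every `γ > 1 / (2 (d + 1))`, since the corrected drift
is `h^(-1/2)`-Lipschitz. Hence its consistency exponent is at least `4 d + 3`. -/
lemma SchemeBounds.four_mul_add_three_le {T : ℝ≥0} {P : ℝ≥0 → ℝ → ℝ} {q : FLP}
    {c K L m₁ m₂ : ℝ} (B : SchemeBounds T P (muHat q.eval c) c K L m₁ m₂) {d : ℝ} (hd : 1 ≤ d)
    (hmem : -d ∈ (q - Finsupp.single (-1) c : FLP).support)
    (hq : ∀ s ∈ (q - Finsupp.single (-1) c : FLP).support, -d ≤ s) : 4 * d + 3 ≤ m₁ := by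
  by_contra hcon
  push Not at hcon
  have hK := B.K_ge
  have hm₁ := B.m₁_nonneg
  have hm₂ := B.m₂_nonneg
  have hT := B.T_pos
  -- at the scale `h ^ γ` the correction is negligible as `γ < 2 / (m₁ + 1)`, whereas the drift is
  -- steeper than `h ^ (-1/2)` as `γ > 1 / (2 (d + 1))`
  obtain ⟨γ, hγ1, hγ2⟩ : ∃ γ : ℝ, 1 / (2 * (d + 1)) < γ ∧ γ < 2 / (m₁ + 1) := by
    refine exists_between ?_
    rw [div_lt_div_iff₀ (by linarith) (by linarith)]
    linarith
  have hγ0 : 0 < γ := lt_trans (by positivity) hγ1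
  have hγ1' : 0 < γ * (d + 1) - 1 / 2 := by
    rw [div_lt_iff₀ (by linarith)] at hγ1
    linarith
  have hγ2' : 0 < 2 - γ * (m₁ + 1) := by
    rw [lt_div_iff₀ (by linarith)] at hγ2
    linarith
  obtain ⟨M₀, hM₀⟩ := exists_nat_ge T
  set h : ℕ → ℝ≥0 := fun k => T / ((M₀ + k + 1 : ℕ) : ℝ≥0) with hh
  have hstep : ∀ k, IsStepSize T (h k) := fun k => by
    refine ⟨M₀ + k + 1, by omega, rfl, ?_⟩
    rw [hh]
    refine div_le_one_of_le₀ (hM₀.trans ?_) (zero_le)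
    push_cast
    rw [add_assoc]
    exact le_self_add
  have hpos : ∀ k, 0 < (h k : ℝ) := fun k => (hstep k).pos hT
  have hle : ∀ k, (h k : ℝ) ≤ 1 := fun k => (hstep k).le_one
  have hlim : Tendsto (fun k => (h k : ℝ)) atTop (𝓝 0) := by
    have h1 : Tendsto (fun k : ℕ => (T : ℝ) / ((M₀ + k + 1 : ℕ) : ℝ)) atTop (𝓝 0) := by
      refine Tendsto.const_div_atTop ?_ _
      refine tendsto_natCast_atTop_atTop.comp ?_
      exact tendsto_atTop_mono (fun k => by simp only [id]; omega) tendsto_id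
    refine h1.congr fun k => ?_
    simp [hh]
  have hpow : ∀ e : ℝ, 0 < e → Tendsto (fun k => (h k : ℝ) ^ e) atTop (𝓝 0) := fun e he => by
    have := (Real.continuousAt_rpow_const 0 e (Or.inr he.le)).tendsto.comp hlim
    rwa [Real.zero_rpow he.ne'] at this
  set x : ℕ → ℝ := fun k => (h k : ℝ) ^ γ with hx
  have hx0 : ∀ k, 0 < x k := fun k => Real.rpow_pos_of_pos (hpos k) _
  have hxlim : Tendsto x atTop (𝓝 0) := hpow γ hγ0
  have hxsmall : ∀ᶠ k in atTop, 2 * x k ≤ 1 := by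
    filter_upwards [hxlim.eventually (gt_mem_nhds (by norm_num : (0 : ℝ) < 1 / 2))] with k hk
    linarith
  -- the correction is negligible relative to `x k`
  have hrel : ∀ a : ℝ, 1 ≤ a → a ≤ 2 → Tendsto (fun k => P (h k) (a * x k) / x k) atTop (𝓝 a) := by
    intro a ha1 ha2
    have hb : ∀ᶠ k in atTop, ‖P (h k) (a * x k) / x k - a‖
        ≤ 3 * K * (h k : ℝ) ^ (2 - γ * (m₁ + 1)) := by
      filter_upwards [hxsmall] with k hk
      have hxk := hx0 k
      have hak : 0 < a * x k := by positivity
      have hxk1 : x k ≤ 1 := by linarith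
      have hak1 : a * x k ≤ 1 := by nlinarith
      have h1 := B.close (h k) (hstep k) (a * x k) hak
      have h2 : (a * x k) ^ (-m₁) ≤ x k ^ (-m₁) :=
        Real.rpow_le_rpow_of_nonpos hxk (by nlinarith) (by linarith)
      have h3 : (1 : ℝ) ≤ x k ^ (-m₁) :=
        Real.one_le_rpow_of_pos_of_le_one_of_nonpos hxk hxk1 (by linarith)
      have h4 : (a * x k) ^ m₂ ≤ 1 := Real.rpow_le_one hak.le hak1 hm₂
      have h5 : |P (h k) (a * x k) - a * x k| ≤ 3 * K * ((h k : ℝ) ^ 2 * x k ^ (-m₁)) := by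
        refine h1.trans ?_
        calc K * (h k : ℝ) ^ 2 * (1 + (a * x k) ^ (-m₁) + (a * x k) ^ m₂)
            ≤ K * (h k : ℝ) ^ 2 * (x k ^ (-m₁) + x k ^ (-m₁) + x k ^ (-m₁)) := by
              gcongr
              exact h4.trans h3
          _ = _ := by ring
      have e : P (h k) (a * x k) / x k - a = (P (h k) (a * x k) - a * x k) / x k := by
        field_simp
      rw [e, Real.norm_eq_abs, abs_div, abs_of_pos hxk, div_le_iff₀ hxk]
      refine h5.trans (le_of_eq ?_)
      have e2 : (h k : ℝ) ^ (2 - γ * (m₁ + 1)) * x k = (h k : ℝ) ^ 2 * x k ^ (-m₁) := by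
        simp only [hx]
        rw [← Real.rpow_add (hpos k), ← Real.rpow_mul (hpos k).le, ← Real.rpow_natCast,
          ← Real.rpow_add (hpos k)]
        congr 1
        push_cast
        ring
      rw [mul_assoc (3 * K), e2]
    have h0 : Tendsto (fun k => 3 * K * (h k : ℝ) ^ (2 - γ * (m₁ + 1))) atTop (𝓝 0) := by
      simpa using (hpow _ hγ2').const_mul (3 * K)
    have := squeeze_zero_norm' hb h0
    simpa using this.add_const a
  set f := muHat q.eval c with hf
  set α := (q - Finsupp.single (-1) c : FLP) (-d) with hα
  have hα0 : α ≠ 0 := Finsupp.mem_support_iff.1 hmem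
  have hg := FLP.tendsto_mul_eval (q - Finsupp.single (-1) c : FLP) hq
  have hval : ∀ a : ℝ, 1 ≤ a → a ≤ 2 →
      Tendsto (fun k => x k ^ d * f (P (h k) (a * x k))) atTop (𝓝 (α * (a ^ d)⁻¹)) := by
    intro a ha1 ha2
    have ha0 : 0 < a := by linarith
    have hr := hrel a ha1 ha2
    have hPlim : Tendsto (fun k => P (h k) (a * x k)) atTop (𝓝[>] 0) := by
      refine tendsto_nhdsWithin_iff.2 ⟨?_, Eventually.of_forall fun k =>
        B.pos (h k) (hstep k) _ (mul_pos ha0 (hx0 k))⟩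
      have := hr.mul hxlim
      rw [mul_zero] at this
      refine this.congr fun k => ?_
      exact div_mul_cancel₀ _ (hx0 k).ne'
    have h1 := hg.comp hPlim
    have h2 : Tendsto (fun k => ((P (h k) (a * x k) / x k) ^ d)⁻¹) atTop (𝓝 ((a ^ d)⁻¹)) :=
      (hr.rpow_const (Or.inl ha0.ne')).inv₀ (Real.rpow_pos_of_pos ha0 _).ne'
    refine (h1.mul h2).congr fun k => ?_
    have hp := B.pos (h k) (hstep k) _ (mul_pos ha0 (hx0 k))
    simp only [Function.comp, hf]
    rw [muHat_eq_eval, Real.div_rpow hp.le (hx0 k).le]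
    have := (Real.rpow_pos_of_pos hp d).ne'
    field_simp
  -- the corrected drift at `x k` and at `2 * x k` would have the same leading coefficient, which is
  -- absurd as `2 ^ d ≠ 1`
  have hdiff := ((hval 1 le_rfl (by norm_num)).sub (hval 2 (by norm_num) le_rfl)).norm
  have hzero : Tendsto (fun k => ‖x k ^ d * f (P (h k) (1 * x k))
      - x k ^ d * f (P (h k) (2 * x k))‖) atTop (𝓝 0) := by
    have h0 : Tendsto (fun k => K * (h k : ℝ) ^ (γ * (d + 1) - 1 / 2)) atTop (𝓝 0) := by
      simpa using (hpow _ hγ1').const_mul K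
    refine squeeze_zero (fun k => norm_nonneg _) (fun k => ?_) h0
    have hxk := hx0 k
    have h1 := B.lip (h k) (hstep k) (1 * x k) (2 * x k) (by linarith) (by linarith)
    have e : |1 * x k - 2 * x k| = x k := by
      rw [show 1 * x k - 2 * x k = -x k by ring, abs_neg, abs_of_pos hxk]
    rw [e, ← rpow_neg_half_eq] at h1
    rw [← mul_sub, Real.norm_eq_abs, abs_mul, abs_of_pos (Real.rpow_pos_of_pos hxk d)]
    calc x k ^ d * |f (P (h k) (1 * x k)) - f (P (h k) (2 * x k))|
        ≤ x k ^ d * (K * (h k : ℝ) ^ (-(1 / 2) : ℝ) * x k) := by gcongr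
      _ = K * ((x k ^ d * x k ^ (1 : ℝ)) * (h k : ℝ) ^ (-(1 / 2) : ℝ)) := by
        rw [Real.rpow_one]; ring
      _ = K * (h k : ℝ) ^ (γ * (d + 1) - 1 / 2) := by
        rw [← Real.rpow_add hxk]
        simp only [hx]
        rw [← Real.rpow_mul (hpos k).le, ← Real.rpow_add (hpos k)]
        congr 2
  have huniq := tendsto_nhds_unique hdiff hzero
  rw [norm_eq_zero, ← mul_sub, Real.one_rpow, inv_one] at huniq
  have h2d : (1 : ℝ) < 2 ^ d := Real.one_lt_rpow (by norm_num) (by linarith)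
  have h3 : ((2 : ℝ) ^ d)⁻¹ < 1 := inv_lt_one_of_one_lt₀ h2d
  rcases mul_eq_zero.1 huniq with h4 | h4
  · exact hα0 h4
  · linarith

end PosScheme

/-! ### Crude bounds of the numerical solution -/

namespace PosScheme

section Crude

variable {Ω : Type*} [mΩ : MeasurableSpace Ω] {Pr : Measure Ω} [IsProbabilityMeasure Pr]
  {ℱ : Filtration ℝ≥0 mΩ} {W : ℝ≥0 → Ω → ℝ}

lemma toNNReal_natCast_mul (n : ℕ) (h : ℝ≥0) : ((n : ℝ) * (h : ℝ)).toNNReal = n * h := by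
  rw [← NNReal.coe_natCast, ← NNReal.coe_mul, Real.toNNReal_coe]

lemma IsSchemeSolution.ae_schemePath {μ : ℝ → ℝ} {σ x₀ c : ℝ} {P : ℝ≥0 → ℝ → ℝ} {h : ℝ≥0} {M : ℕ}
    {Y : ℕ → Ω → ℝ} (hY : IsSchemeSolution Pr W μ σ x₀ c P h M Y) :
    ∀ᵐ ω ∂Pr, SchemePath P (muHat μ c) c h M x₀ (fun n => σ * (W (n * h) ω - W 0 ω))
      (fun n => Y n ω) := by
  filter_upwards [hY] with ω hω
  refine ⟨hω.1, fun n hn => ⟨(hω.2 n hn).1, ?_⟩⟩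
  have h1 := (hω.2 n hn).2
  unfold schemeMap
  linear_combination h1

lemma natCast_mul_le {T h : ℝ≥0} {M : ℕ} (hM : 0 < M) (hhT : h = T / M) {n : ℕ} (hn : n ≤ M) :
    (n : ℝ≥0) * h ≤ T := by
  have hM' : (M : ℝ≥0) ≠ 0 := by exact_mod_cast hM.ne'
  calc (n : ℝ≥0) * h ≤ M * h := by gcongr
    _ = T := by rw [hhT]; field_simp

/-- A random variable `S` with all moments that bounds the scaled noise, and with it, uniformly in
the step size `h`, the numerical solution and `h` times its inverse. -/
lemma SchemeBounds.exists_crude_bound (hW : IsBrownianOn Pr ℱ W) {T : ℝ≥0} {P : ℝ≥0 → ℝ → ℝ}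
    {q : FLP} {c K L m₁ m₂ : ℝ} (B : SchemeBounds T P (muHat q.eval c) c K L m₁ m₂) {x₀ : ℝ}
    (hx₀ : 0 < x₀) (σ : ℝ) :
    ∃ (S : Ω → ℝ) (C : ℝ) (D : ℕ), Measurable S ∧ (∀ ω, 0 ≤ S ω) ∧
      (∀ r : ℕ, ∫⁻ ω, ENNReal.ofReal ((1 + S ω) ^ r) ∂Pr < ⊤) ∧ 1 ≤ C ∧ 1 ≤ D ∧
      (∀ᵐ ω ∂Pr, ∀ t ≤ T, |σ * (W t ω - W 0 ω)| ≤ S ω) ∧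
      ∀ (M : ℕ) (h : ℝ≥0), 0 < M → h = T / M → h ≤ 1 →
        ∀ Y : ℕ → Ω → ℝ, IsSchemeSolution Pr W q.eval σ x₀ c P h M Y →
        ∀ᵐ ω ∂Pr, ∀ n ≤ M, 0 < Y n ω ∧ Y n ω ≤ C * (1 + S ω) ^ D ∧
          (Y n ω)⁻¹ ≤ C * (h : ℝ)⁻¹ * (1 + S ω) ^ D := by
  obtain ⟨S₀, hS₀m, hS₀0, hS₀b, hS₀r⟩ := hW.exists_sup_bound T
  obtain ⟨C₁, D, hC₁, hD, hb⟩ := B.exists_path_bound hx₀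
  have hK := B.K_ge
  have hc := B.c_pos
  have hq : 0 ≤ 2 * K / c := by positivity
  set C : ℝ := C₁ + x₀⁻¹ + (1 + 2 * K / c) * (3 + C₁) with hC
  have hSb : ∀ᵐ ω ∂Pr, ∀ t ≤ T, |σ * (W t ω - W 0 ω)| ≤ |σ| * S₀ ω := by
    filter_upwards [hS₀b] with ω hω t ht
    rw [abs_mul]
    exact mul_le_mul_of_nonneg_left (hω t ht) (abs_nonneg σ)
  refine ⟨fun ω => |σ| * S₀ ω, C, D, hS₀m.const_mul _, fun ω => by have := hS₀0 ω; positivity, ?_,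
    ?_, hD, hSb, ?_⟩
  · intro r
    have hle : ∀ ω, ENNReal.ofReal ((1 + |σ| * S₀ ω) ^ r)
        ≤ ENNReal.ofReal (2 ^ r) + ENNReal.ofReal ((2 * |σ|) ^ r) * ENNReal.ofReal (S₀ ω ^ r) := by
      intro ω
      have h0 := hS₀0 ω
      rw [← ENNReal.ofReal_mul (by positivity),
        ← ENNReal.ofReal_add (by positivity) (by positivity)]
      refine ENNReal.ofReal_le_ofReal ?_
      rw [← mul_pow]
      rcases le_total 1 (|σ| * S₀ ω) with h1 | h1
      · refine (pow_le_pow_left₀ (by positivity) (by linarith : 1 + |σ| * S₀ ω ≤ 2 * |σ| * S₀ ω)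
          r).trans ?_
        exact le_add_of_nonneg_left (by positivity)
      · refine (pow_le_pow_left₀ (by positivity) (by linarith : 1 + |σ| * S₀ ω ≤ 2) r).trans ?_
        exact le_add_of_nonneg_right (by positivity)
    refine (lintegral_mono hle).trans_lt ?_
    rw [lintegral_add_left measurable_const, lintegral_const_mul' _ _ ENNReal.ofReal_ne_top]
    simp only [lintegral_const, measure_univ, mul_one]
    exact ENNReal.add_lt_top.2 ⟨ENNReal.ofReal_lt_top,
      ENNReal.mul_lt_top ENNReal.ofReal_lt_top (hS₀r r)⟩
  · have h1 : 0 < x₀⁻¹ := by positivity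
    have : 0 ≤ (1 + 2 * K / c) * (3 + C₁) := by positivity
    linarith
  · intro M h hM hhT hh1 Y hY
    have hh : IsStepSize T h := ⟨M, hM, hhT, hh1⟩
    have hpos := hh.pos B.T_pos
    have hle1 := hh.le_one
    filter_upwards [hY.ae_schemePath, hSb] with ω hω hSω n hn
    set S := |σ| * S₀ ω with hS
    have hS0 : 0 ≤ S := by have := hS₀0 ω; positivity
    have hw : ∀ n ≤ M, |σ * (W (n * h) ω - W 0 ω)| ≤ S := fun n hn =>
      hSω _ (natCast_mul_le hM hhT hn)
    have hYb := hb M h hM hhT hh1 _ _ S hw hω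
    have hS1 : 1 ≤ (1 + S) ^ D := one_le_pow₀ (by linarith)
    have hS1' : 1 + S ≤ (1 + S) ^ D := le_self_pow₀ (by linarith) (by omega)
    have hx0i : 0 < x₀⁻¹ := by positivity
    have hinv1 : 1 ≤ (h : ℝ)⁻¹ := (one_le_inv₀ hpos).2 hle1
    refine ⟨hω.pos hx₀ hn, (hYb n hn).trans ?_, ?_⟩
    · gcongr
      have : 0 ≤ (1 + 2 * K / c) * (3 + C₁) := by positivity
      linarith
    · rcases n with _ | n
      · have h00 : Y 0 ω = x₀ := hω.1
        rw [h00]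
        have h1 : x₀⁻¹ ≤ C := by
          have : 0 ≤ (1 + 2 * K / c) * (3 + C₁) := by positivity
          linarith
        calc x₀⁻¹ ≤ C * 1 * 1 := by simpa using h1
          _ ≤ C * (h : ℝ)⁻¹ * (1 + S) ^ D := by gcongr
      · have hn' : n < M := by omega
        have h1 := B.inv_step_le hh (hω.pos hx₀ hn'.le) (hω.2 n hn').1 (hω.2 n hn').2
        refine h1.trans ?_
        have h2 : (Real.sqrt h)⁻¹ ≤ (h : ℝ)⁻¹ := by
          refine inv_anti₀ hpos ?_
          exact Real.le_sqrt_of_sq_le (by nlinarith)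
        have h3 : |σ * (W ((n + 1 : ℕ) * h) ω - W 0 ω) - σ * (W (n * h) ω - W 0 ω)|
            ≤ 2 * (1 + S) := by
          refine (abs_sub _ _).trans ?_
          have := hw (n + 1) hn
          have := hw n hn'.le
          linarith
        have h4 := hYb n hn'.le
        calc (1 + 2 * K / c) * ((Real.sqrt h)⁻¹ + Y n ω
              + |σ * (W ((n + 1 : ℕ) * h) ω - W 0 ω) - σ * (W (n * h) ω - W 0 ω)| / h)
            ≤ (1 + 2 * K / c) * ((h : ℝ)⁻¹ * (1 + S) ^ D + C₁ * ((h : ℝ)⁻¹ * (1 + S) ^ D)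
              + 2 * ((h : ℝ)⁻¹ * (1 + S) ^ D)) := by
              gcongr
              · exact h2.trans (le_mul_of_one_le_right (by positivity) hS1)
              · exact h4.trans (mul_le_mul_of_nonneg_left
                  (le_mul_of_one_le_left (by positivity) hinv1) (by positivity))
              · rw [div_eq_inv_mul]
                calc (h : ℝ)⁻¹ * _ ≤ (h : ℝ)⁻¹ * (2 * (1 + S) ^ D) := by
                      gcongr
                      exact h3.trans (by gcongr)
                  _ = _ := by ring
          _ = ((1 + 2 * K / c) * (3 + C₁)) * (h : ℝ)⁻¹ * (1 + S) ^ D := by ring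
          _ ≤ C * (h : ℝ)⁻¹ * (1 + S) ^ D := by
              gcongr
              linarith

end Crude

/-- A comparison of the form `A ≤ C₁ + C₂ E[sup X^(-2p)]` suffices, as `X` starts at `x₀`. -/
lemma IsPositiveSolution.ofReal_le_lintegral {Ω : Type*} [mΩ : MeasurableSpace Ω] {Pr : Measure Ω}
    [IsProbabilityMeasure Pr] {ℱ : Filtration ℝ≥0 mΩ} {W : ℝ≥0 → Ω → ℝ} {μ : ℝ → ℝ} {σ x₀ : ℝ}
    {X : ℝ≥0 → Ω → ℝ} (hX : IsPositiveSolution Pr ℱ W μ σ x₀ X) (T : ℝ≥0) (hx₀ : 0 < x₀)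
    {p pmax : ℝ} (hp : 1 ≤ p) (hpm : p ≤ pmax) :
    ENNReal.ofReal ((1 + x₀) ^ (-(2 * pmax)))
      ≤ ∫⁻ ω, (⨆ t ∈ Icc (0 : ℝ≥0) T, ENNReal.ofReal (|X t ω| ^ (-(2 * p)))) ∂Pr := by
  have h1 : ∀ᵐ ω ∂Pr, ENNReal.ofReal ((1 + x₀) ^ (-(2 * pmax)))
      ≤ ⨆ t ∈ Icc (0 : ℝ≥0) T, ENNReal.ofReal (|X t ω| ^ (-(2 * p))) := by
    filter_upwards [hX.eqn] with ω hω
    have h0 := hω 0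
    simp only [NNReal.coe_zero, intervalIntegral.integral_same, sub_self, mul_zero, add_zero] at h0
    refine le_iSup₂_of_le (0 : ℝ≥0) ⟨le_rfl, zero_le⟩ (ENNReal.ofReal_le_ofReal ?_)
    rw [h0, abs_of_pos hx₀]
    calc (1 + x₀) ^ (-(2 * pmax)) ≤ (1 + x₀) ^ (-(2 * p)) :=
          Real.rpow_le_rpow_of_exponent_le (by linarith) (by linarith)
      _ ≤ x₀ ^ (-(2 * p)) := Real.rpow_le_rpow_of_nonpos hx₀ (by linarith) (by linarith)
  calc ENNReal.ofReal ((1 + x₀) ^ (-(2 * pmax)))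
      = ∫⁻ _, ENNReal.ofReal ((1 + x₀) ^ (-(2 * pmax))) ∂Pr := by simp
    _ ≤ _ := lintegral_mono_ae h1

end PosScheme

/-! ### The scheme follows the exact path when the drift is strongly singular -/

namespace PosScheme

open Filter Topology

lemma eventually_mul_rpow_le_one (C : ℝ) {a : ℝ} (ha : 0 < a) :
    ∀ᶠ h : ℝ in 𝓝[>] 0, C * h ^ a ≤ 1 := by
  have h1 : Tendsto (fun h : ℝ => C * h ^ a) (𝓝[>] 0) (𝓝 0) := by
    have h2 : ContinuousAt (fun h : ℝ => C * h ^ a) 0 :=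
      continuousAt_const.mul (Real.continuousAt_rpow_const _ _ (Or.inr ha.le))
    have h3 := h2.tendsto
    simp only [Real.zero_rpow ha.ne', mul_zero] at h3
    exact h3.mono_left nhdsWithin_le_nhds
  exact h1.eventually_le_const one_pos

lemma exists_of_eventually_pos {Q : ℝ → Prop} (h : ∀ᶠ x in 𝓝[>] (0 : ℝ), Q x) :
    ∃ h₀ : ℝ, 0 < h₀ ∧ h₀ ≤ 1 ∧ ∀ x, 0 < x → x ≤ h₀ → Q x := by
  obtain ⟨u, hu, hQ⟩ := mem_nhdsGT_iff_exists_Ioc_subset.1 h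
  exact ⟨min u 1, lt_min hu one_pos, min_le_right _ _,
    fun x hx hxu => hQ ⟨hx, hxu.trans (min_le_left _ _)⟩⟩

set_option maxHeartbeats 1000000 in
/-- If the lowest exponent of the explicit drift is at most `-1`, the exact path stays above
`2 h ^ θ` on the grid, and noise and noise increments have their typical size up to a factor
`h ^ (-ε)`, then the numerical path is at least half of the exact one. -/
lemma SchemeBounds.exists_window {T : ℝ≥0} {P : ℝ≥0 → ℝ → ℝ} {q : FLP} {c K L m₁ m₂ : ℝ}
    (B : SchemeBounds T P (muHat q.eval c) c K L m₁ m₂) (hosl : OneSidedLipschitz q.eval)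
    {d : ℝ} (hd : 1 ≤ d) (hq : ∀ s ∈ (q - Finsupp.single (-1) c : FLP).support, -d ≤ s)
    {x₀ : ℝ} (hx₀ : 0 < x₀) :
    ∃ ε : ℝ, 0 < ε ∧ ε ≤ 9 / 100 ∧ ∃ C h₀ : ℝ, 0 < C ∧ 0 < h₀ ∧ h₀ ≤ 1 ∧
      ∀ (M : ℕ) (h : ℝ≥0), 0 < M → h = T / M → h ≤ 1 → (h : ℝ) ≤ h₀ →
      ∀ (v x : ℝ → ℝ) (Y : ℕ → ℝ), SolPath q.eval x₀ v x → v 0 = 0 →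
        SchemePath P (muHat q.eval c) c h M x₀ (fun n => v (n * h)) Y →
        (∀ t : ℝ, 0 ≤ t → t ≤ T → |v t| ≤ (h : ℝ) ^ (-ε)) →
        (∀ n < M, ∀ s, (n : ℝ) * h ≤ s → s ≤ ((n + 1 : ℕ) : ℝ) * h →
          |v s - v ((n : ℝ) * h)| ≤ (h : ℝ) ^ (1 / 2 - ε)) →
        (∀ n ≤ M, (Y n)⁻¹ ≤ C * (h : ℝ) ^ (-(1 / 2) - ε)) ∧
        ((∀ n ≤ M, 2 * (h : ℝ) ^ (5 / (10 * d + 22)) ≤ x (n * h)) →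
          ∀ n ≤ M, x (n * h) ≤ 2 * Y n) := by
  have hμc : ContinuousOn q.eval (Ioi 0) := q.continuousOn_eval
  have hK := B.K_ge
  have hc := B.c_pos
  have hL := B.L_pos
  have hm₂ := B.m₂_nonneg
  have hqq : ∀ s ∈ q.support, -d ≤ s := by
    intro s hs
    by_cases h1 : s = -1
    · linarith
    · refine hq s ?_
      rw [Finsupp.mem_support_iff] at hs ⊢
      rw [Finsupp.sub_apply, Finsupp.single_apply, if_neg (fun h => h1 h.symm), sub_zero]
      exact hs
  obtain ⟨Ka, Da, hKa, hDa, ha⟩ := q.exists_bound (by linarith : (0 : ℝ) ≤ d) hqq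
  obtain ⟨Kb, Db, hKb, hDb, hb⟩ := FLP.exists_bound (q - Finsupp.single (-1) c : FLP)
    (by linarith : (0 : ℝ) ≤ d) hq
  obtain ⟨Cx, hCx, hx⟩ := hosl.exists_path_bound hμc hx₀ T.coe_nonneg
  obtain ⟨Cy, Dy, hCy, hDy, hy⟩ := B.exists_path_bound hx₀
  obtain ⟨Cl, hCl, hlow⟩ := OneSidedLipschitz.exists_lower (f := muHat q.eval c)
    ⟨L, hL, B.osl⟩ 1 one_pos
  -- the errors are of order `h ^ (1 / 2 - θ * (d + 1))`, so that they are smaller than `h ^ θ` for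
  -- `θ < 1 / (2 * (d + 2))`; the value chosen is `1 / (2 * (d + 2.2))`
  set θ : ℝ := 5 / (10 * d + 22) with hθ
  set D₁ : ℝ := Da + Db + m₂ with hD₁
  have hD₁0 : 0 ≤ D₁ := by positivity
  have hθ0 : 0 < θ := by positivity
  have hθd : θ * (10 * d + 22) = 5 := by rw [hθ]; field_simp
  set D' : ℝ := Dy * D₁ with hD'
  have hD'0 : 0 ≤ D' := by positivity
  have hDy1 : (1 : ℝ) ≤ Dy := by exact_mod_cast hDy
  -- room left in the exponents, of which `ε` may use up a part
  set g : ℝ := θ / 20 with hg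
  have hg0 : 0 < g := by positivity
  set ε : ℝ := min (9 / 100) (g / (2 * D' + 2 * Dy + 1)) with hε
  have hε0 : 0 < ε := lt_min (by norm_num) (by positivity)
  have hε1 : ε ≤ 9 / 100 := min_le_left _ _
  have hε2 : ε * (2 * D' + 2 * Dy + 1) ≤ g := by
    have h1 : ε ≤ g / (2 * D' + 2 * Dy + 1) := min_le_right _ _
    rwa [le_div_iff₀ (by positivity)] at h1
  have hθ6 : θ * 32 ≤ 5 := by
    have := mul_le_mul_of_nonneg_left hd hθ0.le
    linarith
  have hθd1 : θ * (d + 1) = 1 / 2 - 6 / 5 * θ := by linarith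
  have hεD' : 0 ≤ ε * D' ∧ ε * D' ≤ θ / 40 := by
    refine ⟨by positivity, ?_⟩
    have : 0 ≤ ε * Dy := by positivity
    rw [hg] at hε2
    linarith
  have hεDy : ε ≤ ε * Dy ∧ ε * Dy ≤ θ / 40 := by
    refine ⟨le_mul_of_one_le_right hε0.le hDy1, ?_⟩
    rw [hg] at hε2
    linarith [hεD'.1]
  set N₀ : ℝ := Cx * 2 + 2 + 3 * K + Cy * 2 ^ Dy with hN₀
  have hN₀1 : 1 ≤ N₀ := by
    have : 0 < Cy * 2 ^ Dy := by positivity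
    linarith
  set Λ₀ : ℝ := (Ka + Kb) * N₀ ^ D₁ with hΛ₀
  have hΛ₀1 : 1 ≤ Λ₀ := by
    have : 1 ≤ N₀ ^ D₁ := Real.one_le_rpow hN₀1 hD₁0
    nlinarith
  set A : ℝ := Real.exp (L * T) * (T * ((1 + L) * (3 * K) * Λ₀ + (1 + c) * (Λ₀ * (Λ₀ + 1))))
    with hA
  have hA0 : 0 ≤ A := by positivity
  obtain ⟨h₀, hh₀, hh₀1, hall⟩ := exists_of_eventually_pos
    ((eventually_mul_rpow_le_one A hg0).and
      ((eventually_mul_rpow_le_one Λ₀ hg0).and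
        ((eventually_mul_rpow_le_one 2 hg0).and
          ((eventually_mul_rpow_le_one (2 * Cl / c + 2) hθ0))))) 
  clear_value θ g ε D' D₁ N₀ Λ₀ A
  refine ⟨ε, hε0, hε1, (1 + 2 * K / c) * (2 + Cy * 2 ^ Dy) + x₀⁻¹, h₀, by positivity, hh₀, hh₀1, ?_⟩
  intro M h hM hhT hh1 hhh₀ v x Y hxP hv0 hYP hS hosc
  have hh : IsStepSize T h := ⟨M, hM, hhT, hh1⟩
  have hpos := hh.pos B.T_pos
  have hle1 := hh.le_one
  obtain ⟨e1, e2, e3, e4⟩ := hall h hpos hhh₀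
  have hmono : ∀ {a b : ℝ}, a ≤ b → (h : ℝ) ^ b ≤ (h : ℝ) ^ a := fun hab =>
    Real.rpow_le_rpow_of_exponent_ge hpos hle1 hab
  have hone : ∀ {a : ℝ}, a ≤ 0 → 1 ≤ (h : ℝ) ^ a := fun ha' =>
    Real.one_le_rpow_of_pos_of_le_one_of_nonpos hpos hle1 ha'
  have hSε : 1 ≤ (h : ℝ) ^ (-ε) := hone (by linarith)
  have hSD : (h : ℝ) ^ (-ε) ≤ (h : ℝ) ^ (-(ε * Dy)) := 
    hmono (by linarith [hεDy.1, hεDy.2, hεD'.1, hεD'.2])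
  have hSD1 : 1 ≤ (h : ℝ) ^ (-(ε * Dy)) := hSε.trans hSD
  have hYb : ∀ n ≤ M, Y n ≤ Cy * 2 ^ Dy * (h : ℝ) ^ (-(ε * Dy)) := by
    intro n hn
    have htime : ∀ n ≤ M, (n : ℝ) * h ≤ T := fun n hn => by
      have := natCast_mul_le hM hhT hn
      exact_mod_cast this
    have h1 := hy M h hM hhT hh1 (fun n => v (n * h)) Y ((h : ℝ) ^ (-ε))
      (fun n hn => hS ((n : ℝ) * h) (by positivity) (htime n hn)) hYP n hn
    refine h1.trans ?_
    rw [mul_assoc]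
    refine mul_le_mul_of_nonneg_left ?_ (by linarith)
    have h2 : (h : ℝ) ^ (-(ε * Dy)) = ((h : ℝ) ^ (-ε)) ^ Dy := by
      rw [← Real.rpow_natCast, ← Real.rpow_mul hpos.le]
      ring_nf
    rw [h2, ← mul_pow]
    exact pow_le_pow_left₀ (by positivity) (by linarith) _
  have hYpos : ∀ n ≤ M, 0 < Y n := fun n hn => hYP.pos hx₀ hn
  refine ⟨?_, ?_⟩
  · intro n hn
    have hlow' : 1 ≤ (h : ℝ) ^ (-(1 / 2) - ε) := hone (by linarith)
    rcases n with _ | n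
    · have h00 : Y 0 = x₀ := hYP.1
      rw [h00]
      have h2 : 0 ≤ (1 + 2 * K / c) * (2 + Cy * 2 ^ Dy) := by positivity
      have h3 : 0 < x₀⁻¹ := by positivity
      exact (le_add_of_nonneg_left h2).trans (le_mul_of_one_le_right (by linarith) hlow')
    · have hn' : n < M := hn
      have h1 := B.inv_step_le hh (hYpos n hn'.le) (hYP.2 n hn').1 (hYP.2 n hn').2
      have h2 : (Real.sqrt h)⁻¹ ≤ (h : ℝ) ^ (-(1 / 2) - ε) := by
        rw [← rpow_neg_half_eq]
        exact hmono (by linarith)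
      have h3 : |v ((n + 1 : ℕ) * h) - v (n * h)| / h ≤ (h : ℝ) ^ (-(1 / 2) - ε) := by
        rw [div_le_iff₀ hpos]
        refine (hosc n hn' _ (by gcongr; simp) le_rfl).trans (le_of_eq ?_)
        nth_rewrite 3 [← Real.rpow_one (h : ℝ)]
        rw [← Real.rpow_add hpos]
        ring_nf
      have h4 : Y n ≤ Cy * 2 ^ Dy * (h : ℝ) ^ (-(1 / 2) - ε) := by
        refine (hYb n hn'.le).trans ?_
        refine mul_le_mul_of_nonneg_left (hmono ?_) (by positivity)
        linarith [hεDy.1, hεDy.2]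
      have h5 : 0 < x₀⁻¹ := by positivity
      have h6 : 0 ≤ 2 * K / c := by positivity
      calc (Y (n + 1))⁻¹ ≤ (1 + 2 * K / c) * ((Real.sqrt h)⁻¹ + Y n
            + |v ((n + 1 : ℕ) * h) - v (n * h)| / h) := h1
        _ ≤ (1 + 2 * K / c) * ((h : ℝ) ^ (-(1 / 2) - ε) + Cy * 2 ^ Dy * (h : ℝ) ^ (-(1 / 2) - ε)
            + (h : ℝ) ^ (-(1 / 2) - ε)) := by gcongr
        _ = (1 + 2 * K / c) * (2 + Cy * 2 ^ Dy) * (h : ℝ) ^ (-(1 / 2) - ε) := by ring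
        _ ≤ _ := by gcongr; linarith
  · intro hxη
    set η : ℝ := (h : ℝ) ^ θ with hη
    have hη0 : 0 < η := by positivity
    have hη1 : η ≤ 1 := Real.rpow_le_one hpos.le hle1 hθ0.le
    set N : ℝ := N₀ * (h : ℝ) ^ (-(ε * Dy)) with hN
    have hN1 : 1 ≤ N := one_le_mul_of_one_le_of_one_le hN₀1 hSD1
    set Λ : ℝ := Λ₀ * (h : ℝ) ^ (-(θ * (d + 1)) - ε * D') with hΛ
    have hND : N ^ D₁ = N₀ ^ D₁ * (h : ℝ) ^ (-(ε * D')) := by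
      rw [hN, Real.mul_rpow (by linarith) (by positivity), ← Real.rpow_mul hpos.le, hD']
      ring_nf
    have hηd : η ^ (-(d + 1)) = (h : ℝ) ^ (-(θ * (d + 1))) := by
      rw [hη, ← Real.rpow_mul hpos.le]
      ring_nf
    have hΛeq : Λ = (Ka + Kb) * (η ^ (-(d + 1)) * N ^ D₁) := by
      rw [hΛ, hΛ₀, hND, hηd, sub_eq_add_neg, Real.rpow_add hpos]
      ring
    have hηd1 : 1 ≤ η ^ (-(d + 1)) :=
      Real.one_le_rpow_of_pos_of_le_one_of_nonpos hη0 hη1 (by linarith)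
    have hND1 : 1 ≤ N ^ D₁ := Real.one_le_rpow hN1 hD₁0
    have hΛ0 : 0 < Λ := by rw [hΛ]; positivity
    have hbound : ∀ K' e D'' : ℝ, 0 ≤ K' → K' ≤ Ka + Kb → e ≤ d + 1 → D'' ≤ D₁ →
        K' * (η ^ (-e) * N ^ D'') ≤ Λ := by
      intro K' e D'' h0 h1 h2 h3
      rw [hΛeq]
      have : η ^ (-e) ≤ η ^ (-(d + 1)) :=
        Real.rpow_le_rpow_of_exponent_ge hη0 hη1 (by linarith)
      have : N ^ D'' ≤ N ^ D₁ := Real.rpow_le_rpow_of_exponent_le hN1 h3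
      gcongr
    have hΛ1 : 1 ≤ Λ := by
      have h1 := hbound 1 0 0 zero_le_one (by linarith) (by linarith) hD₁0
      simpa using h1
    obtain ⟨ha1, ha2⟩ := ha η N hη0 hη1 hN1
    obtain ⟨hb1, hb2⟩ := hb η N hη0 hη1 hN1
    -- the three error terms are all at most `h ^ (θ + g)`
    have E1 : (h : ℝ) * Λ ≤ Λ₀ * (h : ℝ) ^ (θ + g) := by
      rw [hΛ, ← mul_assoc, mul_comm (h : ℝ), mul_assoc]
      refine mul_le_mul_of_nonneg_left ?_ (by linarith)
      nth_rewrite 1 [← Real.rpow_one (h : ℝ)]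
      rw [← Real.rpow_add hpos]
      exact hmono (by linarith [hεDy.1, hεDy.2, hεD'.1, hεD'.2])
    have E2 : Λ * ((h : ℝ) * Λ) ≤ Λ₀ * Λ₀ * (h : ℝ) ^ (θ + g) := by
      have : Λ * ((h : ℝ) * Λ) = Λ₀ * Λ₀ * (h : ℝ) ^ (1 + (-(θ * (d + 1)) - ε * D')
          + (-(θ * (d + 1)) - ε * D')) := by
        rw [Real.rpow_add hpos, Real.rpow_add hpos, Real.rpow_one, hΛ]
        ring
      rw [this]
      refine mul_le_mul_of_nonneg_left
        (hmono (by linarith [hεDy.1, hεDy.2, hεD'.1, hεD'.2])) (by positivity)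
    have E3 : Λ * (h : ℝ) ^ (1 / 2 - ε) ≤ Λ₀ * (h : ℝ) ^ (θ + g) := by
      rw [hΛ, mul_assoc, ← Real.rpow_add hpos]
      refine mul_le_mul_of_nonneg_left
        (hmono (by linarith [hεDy.1, hεDy.2, hεD'.1, hεD'.2])) (by linarith)
    have hsplit : (h : ℝ) ^ (θ + g) = (h : ℝ) ^ g * η := by
      rw [Real.rpow_add hpos, mul_comm]
    have hmain := B.compare hμc hM hhT hh1 hxP hYP hv0 (η := η) (N := N) (Λ := Λ)
      (ρ := (h : ℝ) ^ (1 / 2 - ε)) hη0 hN1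
      (fun y hy1 hy2 => (ha1 y hy1 hy2).trans
        (hbound _ _ _ (by linarith) (by linarith) (by linarith) (by linarith)))
      (fun y z hy1 hy2 hz1 hz2 => (ha2 y z hy1 hy2 hz1 hz2).trans
        (mul_le_mul_of_nonneg_right
          (hbound _ _ _ (by linarith) (by linarith) (by linarith) (by linarith)) (abs_nonneg _)))
      (fun y z hy1 hy2 hz1 hz2 => by
        rw [muHat_eq_eval, muHat_eq_eval]
        exact (hb2 y z hy1 hy2 hz1 hz2).trans (mul_le_mul_of_nonneg_right
          (hbound _ _ _ (by linarith) (by linarith) (by linarith) (by linarith)) (abs_nonneg _)))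
      ?_ ?_ ?_ ?_ ?_ ?_ ?_ ?_ hosc hxη
    · intro n hn
      have h1 := hmain n hn
      have h2 := hxη n hn
      linarith
    · rw [hΛ, hη, ← Real.rpow_natCast, ← Real.rpow_mul hpos.le, mul_left_comm,
        ← Real.rpow_add hpos]
      have : 1 ≤ (h : ℝ) ^ (θ * ((2 : ℕ) : ℝ) + (-(θ * (d + 1)) - ε * D')) := by
        refine hone ?_
        push_cast
        have : θ * 5 ≤ 1 := by linarith
        linarith [hεD'.1, hεD'.2]
      exact one_le_mul_of_one_le_of_one_le hΛ₀1 this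
    · have := hbound 1 0 m₂ zero_le_one (by linarith) (by linarith) (by linarith)
      simpa using this
    · refine E1.trans ?_
      rw [hsplit, ← mul_assoc]
      exact mul_le_one₀ e2 hη0.le hη1
    · have h1 : (h : ℝ) ^ (1 / 2 - ε) ≤ (h : ℝ) ^ (θ + g) :=
        hmono (by linarith [hεDy.1, hεDy.2, hεD'.1, hεD'.2])
      rw [hsplit] at h1
      calc 2 * (h : ℝ) ^ (1 / 2 - ε) ≤ 2 * ((h : ℝ) ^ g * η) := by linarith
        _ = (2 * (h : ℝ) ^ g) * η := by ring
        _ ≤ 1 * η := mul_le_mul_of_nonneg_right e3 hη0.le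
        _ = η := one_mul _
    · intro y hy0 hy2
      have hη2 : (2 * Cl / c + 2) * η ≤ 1 := e4
      have h3 : 0 < Cl / c := by positivity
      have h4 : Cl * (2 * η) ≤ c := by
        have h5 : 2 * Cl / c * η ≤ 1 := by linarith
        rw [div_mul_eq_mul_div, div_le_one hc] at h5
        linarith
      have hy1 : y ≤ 1 := by
        have : 0 ≤ 2 * Cl / c * η := by positivity
        linarith
      have h6 := hlow y hy0 hy1
      have h7 : q.eval y = muHat q.eval c y + c * y⁻¹ := by unfold muHat; ring
      have h8 : Cl ≤ c * y⁻¹ := by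
        rw [← div_eq_mul_inv, le_div_iff₀ hy0]
        exact (mul_le_mul_of_nonneg_left hy2 hCl.le).trans h4
      rw [h7]
      linarith
    · calc Real.exp (L * T) * (T * ((1 + L) * (3 * K) * (h * Λ)
            + (1 + c) * (Λ * (h * Λ + (h : ℝ) ^ (1 / 2 - ε)))))
          = Real.exp (L * T) * (T * ((1 + L) * (3 * K) * (h * Λ)
            + (1 + c) * (Λ * (h * Λ) + Λ * (h : ℝ) ^ (1 / 2 - ε)))) := by ring
        _ ≤ Real.exp (L * T) * (T * ((1 + L) * (3 * K) * (Λ₀ * (h : ℝ) ^ (θ + g))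
            + (1 + c) * (Λ₀ * Λ₀ * (h : ℝ) ^ (θ + g) + Λ₀ * (h : ℝ) ^ (θ + g)))) := by gcongr
        _ = (A * (h : ℝ) ^ g) * η := by rw [hsplit, hA]; ring
        _ ≤ 1 * η := by gcongr
        _ = η := one_mul _
    · intro t ht0 htT
      refine (hx v x _ hxP hS t ht0 htT).trans ?_
      rw [hN]
      have h1 : Cx * (1 + (h : ℝ) ^ (-ε)) ≤ Cx * 2 * (h : ℝ) ^ (-(ε * Dy)) := by
        rw [mul_assoc]
        exact mul_le_mul_of_nonneg_left (by linarith) (by linarith)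
      refine h1.trans (mul_le_mul_of_nonneg_right ?_ (by positivity))
      have : 0 < Cy * 2 ^ Dy := by positivity
      rw [hN₀]; linarith
    · intro n hn
      have h1 := hYb n hn
      rw [hN, hN₀]
      have h2 : 0 ≤ Cx * 2 * (h : ℝ) ^ (-(ε * Dy)) := by positivity
      have h3 : 2 + 3 * K ≤ (2 + 3 * K) * (h : ℝ) ^ (-(ε * Dy)) :=
        le_mul_of_one_le_right (by linarith) hSD1
      linarith

end PosScheme

namespace PosScheme

/-! ### Inverse moments when the explicit drift is strongly singular -/

lemma iSup_rpow_neg_le {M : ℕ} {y : ℕ → ℝ} {A p r : ℝ} (hA : 1 ≤ A) (hp : 0 ≤ p) (hr : 2 * p ≤ r)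
    (hy : ∀ n ≤ M, 0 < y n ∧ (y n)⁻¹ ≤ A) :
    (⨆ n ∈ Finset.range (M + 1), ENNReal.ofReal (|y n| ^ (-(2 * p)))) ≤ ENNReal.ofReal (A ^ r) := by
  refine iSup₂_le fun n hn => ENNReal.ofReal_le_ofReal ?_
  obtain ⟨h0, h1⟩ := hy n (by simpa [Nat.lt_succ_iff] using hn)
  rw [abs_of_pos h0, Real.rpow_neg h0.le, ← Real.inv_rpow h0.le]
  exact (Real.rpow_le_rpow (by positivity) h1 (by linarith)).trans
    (Real.rpow_le_rpow_of_exponent_le hA hr)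

section Moments

variable {Ω : Type*} [mΩ : MeasurableSpace Ω] {Pr : Measure Ω} [IsProbabilityMeasure Pr]
  {ℱ : Filtration ℝ≥0 mΩ} {W : ℝ≥0 → Ω → ℝ}

/-- For step sizes bounded away from `0` the crude bound on the scheme suffices. -/
lemma SchemeBounds.exists_moment_of_le (hW : IsBrownianOn Pr ℱ W) {T : ℝ≥0} {P : ℝ≥0 → ℝ → ℝ}
    {q : FLP} {c K L m₁ m₂ : ℝ} (B : SchemeBounds T P (muHat q.eval c) c K L m₁ m₂) {x₀ : ℝ}
    (hx₀ : 0 < x₀) (σ : ℝ) {h₀ : ℝ} (hh₀ : 0 < h₀) (p₀ : ℝ) :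
    ∃ C : ℝ, 0 < C ∧ ∀ p : ℝ, 1 ≤ p → p ≤ p₀ → ∀ (M : ℕ) (h : ℝ≥0), 0 < M → h = T / M → h ≤ 1 →
      h₀ ≤ h → ∀ Y : ℕ → Ω → ℝ, IsSchemeSolution Pr W q.eval σ x₀ c P h M Y →
        ∫⁻ ω, (⨆ n ∈ Finset.range (M + 1), ENNReal.ofReal (|Y n ω| ^ (-(2 * p)))) ∂Pr
          ≤ ENNReal.ofReal C := by
  obtain ⟨S, C, D, hSm, hS0, hSr, hC, hD, hSb, hY⟩ := B.exists_crude_bound hW hx₀ σ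
  set k : ℕ := ⌈2 * p₀⌉₊ with hk
  set I := ∫⁻ ω, ENNReal.ofReal ((1 + S ω) ^ (D * k)) ∂Pr with hI
  refine ⟨(ENNReal.ofReal ((C * (1 + h₀⁻¹)) ^ k) * I).toReal + 1, by positivity, ?_⟩
  intro p hp hpp₀ M h hM hhT hh1 hh₀h Y hYs
  have hfin : ENNReal.ofReal ((C * (1 + h₀⁻¹)) ^ k) * I ≠ ⊤ :=
    ENNReal.mul_ne_top ENNReal.ofReal_ne_top (hSr _).ne
  have hle : ∫⁻ ω, (⨆ n ∈ Finset.range (M + 1), ENNReal.ofReal (|Y n ω| ^ (-(2 * p)))) ∂Pr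
      ≤ ENNReal.ofReal ((C * (1 + h₀⁻¹)) ^ k) * I := by
    rw [hI, ← lintegral_const_mul _ (by fun_prop)]
    refine lintegral_mono_ae ?_
    filter_upwards [hY M h hM hhT hh1 Y hYs] with ω hω
    have hpos : (0 : ℝ) < h := hh₀.trans_le hh₀h
    have hS1 : 1 ≤ (1 + S ω) ^ D := one_le_pow₀ (by linarith [hS0 ω])
    have h0i : 0 < h₀⁻¹ := by positivity
    have hA : 1 ≤ C * (1 + h₀⁻¹) * (1 + S ω) ^ D :=
      one_le_mul_of_one_le_of_one_le (one_le_mul_of_one_le_of_one_le hC (by linarith)) hS1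
    have h1 := iSup_rpow_neg_le (p := p) (r := k) hA (by linarith)
      (by linarith [Nat.le_ceil (2 * p₀)]) (M := M) (y := fun n => Y n ω) (fun n hn => by
        refine ⟨(hω n hn).1, (hω n hn).2.2.trans ?_⟩
        have : (h : ℝ)⁻¹ ≤ h₀⁻¹ := inv_anti₀ hh₀ hh₀h
        gcongr
        linarith)
    refine h1.trans (le_of_eq ?_)
    have hS := hS0 ω
    rw [Real.rpow_natCast, ← ENNReal.ofReal_mul (by positivity), mul_pow, ← pow_mul]
  refine hle.trans ?_
  rw [← ENNReal.ofReal_toReal hfin]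
  refine ENNReal.ofReal_le_ofReal ?_
  rw [ENNReal.toReal_ofReal ENNReal.toReal_nonneg]
  linarith

/-- The event that the noise, or its oscillation within some step, exceeds its typical size by a
factor `h ^ (-ε)` has superpolynomially small probability. -/
lemma IsBrownianOn.exists_exceptional_bound (hW : IsBrownianOn Pr ℱ W) {T : ℝ≥0} (hT : 0 < T)
    {S : Ω → ℝ} (hSm : Measurable S)
    (hSr : ∀ r : ℕ, ∫⁻ ω, ENNReal.ofReal ((1 + S ω) ^ r) ∂Pr < ⊤) {σ : ℝ} (hσ : σ ≠ 0) {ε : ℝ}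
    (hε : 0 < ε) (k : ℕ) :
    ∃ C : ℝ, 0 ≤ C ∧ ∀ (M : ℕ) (h : ℝ≥0), 0 < M → h = T / M → h ≤ 1 →
      Pr ({ω | (h : ℝ) ^ (-ε) < S ω} ∪
        ⋃ n ∈ Finset.range M, {ω | ENNReal.ofReal ((h : ℝ) ^ (1 / 2 - ε) / |σ|)
          < dyadicSup W (n * h) h ω}) ≤ ENNReal.ofReal (C * (h : ℝ) ^ k) := by
  obtain ⟨j, hj⟩ := exists_nat_ge ((k : ℝ) / ε)
  obtain ⟨r, hr⟩ := exists_nat_ge (((k : ℝ) + 1) / (2 * ε))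
  rw [div_le_iff₀ hε] at hj
  rw [div_le_iff₀ (by positivity)] at hr
  set I := ∫⁻ ω, ENNReal.ofReal ((1 + S ω) ^ j) ∂Pr with hI
  have hIfin : I ≠ ⊤ := (hSr j).ne
  have hGfin : gaussMoment r ≠ ⊤ := (gaussMoment_lt_top r).ne
  refine ⟨I.toReal + T * |σ| ^ (2 * r) * (gaussMoment r).toReal, by positivity, ?_⟩
  intro M h hM hhT hh1
  have hh : IsStepSize T h := ⟨M, hM, hhT, hh1⟩
  have hpos := hh.pos hT
  have hle1 := hh.le_one
  have hσ' : 0 < |σ| := abs_pos.2 hσ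
  have hhM : (M : ℝ) * h = T := by
    have hM' : (M : ℝ≥0) ≠ 0 := by exact_mod_cast hM.ne'
    have : (M : ℝ≥0) * h = T := by rw [hhT]; field_simp
    exact_mod_cast this
  have hmono : ∀ {a b : ℝ}, a ≤ b → (h : ℝ) ^ b ≤ (h : ℝ) ^ a := fun hab =>
    Real.rpow_le_rpow_of_exponent_ge hpos hle1 hab
  have h1 : Pr {ω | (h : ℝ) ^ (-ε) < S ω} ≤ ENNReal.ofReal (I.toReal * (h : ℝ) ^ k) := by
    have hcheb := mul_meas_ge_le_lintegral (μ := Pr) (f := fun ω => ENNReal.ofReal ((1 + S ω) ^ j))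
      (by fun_prop) (ENNReal.ofReal ((h : ℝ) ^ (-(ε * j))))
    have hsub : {ω | (h : ℝ) ^ (-ε) < S ω} ⊆ {ω | ENNReal.ofReal ((h : ℝ) ^ (-(ε * j)))
        ≤ ENNReal.ofReal ((1 + S ω) ^ j)} := by
      intro ω hω
      simp only [mem_ofPred_eq] at hω ⊢
      refine ENNReal.ofReal_le_ofReal ?_
      have : (h : ℝ) ^ (-(ε * j)) = ((h : ℝ) ^ (-ε)) ^ j := by
        rw [← Real.rpow_natCast, ← Real.rpow_mul hpos.le]
        ring_nf
      rw [this]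
      exact pow_le_pow_left₀ (by positivity) (by linarith) _
    calc Pr {ω | (h : ℝ) ^ (-ε) < S ω}
        = ENNReal.ofReal ((h : ℝ) ^ (ε * j)) * (ENNReal.ofReal ((h : ℝ) ^ (-(ε * j)))
            * Pr {ω | (h : ℝ) ^ (-ε) < S ω}) := by
          rw [← mul_assoc, ← ENNReal.ofReal_mul (by positivity), ← Real.rpow_add hpos]
          simp
      _ ≤ ENNReal.ofReal ((h : ℝ) ^ (ε * j)) * I := by
          gcongr
          exact (mul_le_mul_right (measure_mono hsub) _).trans hcheb
      _ ≤ ENNReal.ofReal ((h : ℝ) ^ k) * I := by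
          gcongr
          rw [← Real.rpow_natCast]
          exact hmono (by linarith)
      _ = _ := by
          rw [mul_comm I.toReal, ENNReal.ofReal_mul (by positivity), ENNReal.ofReal_toReal hIfin]
  have h2 : ∀ n ∈ Finset.range M, Pr {ω | ENNReal.ofReal ((h : ℝ) ^ (1 / 2 - ε) / |σ|)
      < dyadicSup W (n * h) h ω}
      ≤ ENNReal.ofReal (|σ| ^ (2 * r) * (gaussMoment r).toReal * (h : ℝ) ^ (k + 1)) := by
    intro n _
    refine (hW.dyadicSup_tail (n * h) h r (by positivity)).trans ?_
    rw [mul_right_comm, ENNReal.ofReal_mul (by positivity), ENNReal.ofReal_toReal hGfin]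
    gcongr
    rw [div_pow, div_div_eq_mul_div, mul_comm, mul_div_assoc]
    gcongr
    rw [← Real.rpow_natCast, ← Real.rpow_natCast, ← Real.rpow_natCast, ← Real.rpow_mul hpos.le,
      ← Real.rpow_sub hpos]
    refine hmono ?_
    push_cast
    linarith
  calc Pr (_ ∪ _) ≤ Pr {ω | (h : ℝ) ^ (-ε) < S ω}
        + ∑ n ∈ Finset.range M, Pr {ω | ENNReal.ofReal ((h : ℝ) ^ (1 / 2 - ε) / |σ|)
          < dyadicSup W (n * h) h ω} :=
        (measure_union_le _ _).trans (add_le_add_right (measure_biUnion_finset_le _ _) _)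
    _ ≤ ENNReal.ofReal (I.toReal * (h : ℝ) ^ k) + ∑ n ∈ Finset.range M,
        ENNReal.ofReal (|σ| ^ (2 * r) * (gaussMoment r).toReal * (h : ℝ) ^ (k + 1)) :=
        add_le_add h1 (Finset.sum_le_sum h2)
    _ = ENNReal.ofReal ((I.toReal + T * |σ| ^ (2 * r) * (gaussMoment r).toReal) * (h : ℝ) ^ k) := by
        rw [Finset.sum_const, Finset.card_range, nsmul_eq_mul, ← ENNReal.ofReal_natCast,
          ← ENNReal.ofReal_mul (by positivity),
          ← ENNReal.ofReal_add (by positivity) (by positivity), ← hhM]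
        congr 1
        ring

set_option maxHeartbeats 1000000 in
/-- If the lowest exponent of the explicit drift is `-d ≤ -1`, then `m₁ ≥ 4 d + 3`, so that the
admissible inverse moments of `X` make it unlikely for `X` to leave the region where the scheme
follows it, and off that event crude bounds on the scheme suffice. -/
lemma SchemeBounds.exists_moment_of_singular (hW : IsBrownianOn Pr ℱ W) {T : ℝ≥0}
    {P : ℝ≥0 → ℝ → ℝ} {q : FLP} {c K L m₁ m₂ : ℝ}
    (B : SchemeBounds T P (muHat q.eval c) c K L m₁ m₂) (hosl : OneSidedLipschitz q.eval)
    {d : ℝ} (hd : 1 ≤ d) (hmem : -d ∈ (q - Finsupp.single (-1) c : FLP).support)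
    (hq : ∀ s ∈ (q - Finsupp.single (-1) c : FLP).support, -d ≤ s)
    {x₀ : ℝ} (hx₀ : 0 < x₀) {σ : ℝ} (hσ : σ ≠ 0) {X : ℝ≥0 → Ω → ℝ}
    (hX : IsPositiveSolution Pr ℱ W q.eval σ x₀ X) {pstar : ℝ≥0∞}
    (hinv : InverseMomentsBounded Pr X T pstar) {p₀ : ℝ} (hp₀ : 1 ≤ p₀)
    (hpstar : ENNReal.ofReal (2 * m₁ * p₀) ≤ pstar) :
    ∃ C : ℝ, 0 < C ∧ ∀ p : ℝ, 1 ≤ p → p ≤ p₀ → ∀ (M : ℕ) (h : ℝ≥0), 0 < M → h = T / M → h ≤ 1 →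
      ∀ Y : ℕ → Ω → ℝ, IsSchemeSolution Pr W q.eval σ x₀ c P h M Y →
        ∫⁻ ω, (⨆ n ∈ Finset.range (M + 1), ENNReal.ofReal (|Y n ω| ^ (-(2 * p)))) ∂Pr
          ≤ ENNReal.ofReal C *
            ∫⁻ ω, (⨆ t ∈ Icc (0 : ℝ≥0) T, ENNReal.ofReal (|X t ω| ^ (-(2 * p)))) ∂Pr
            + ENNReal.ofReal C := by
  have hm₁ := B.four_mul_add_three_le hd hmem hq
  have hT := B.T_pos
  obtain ⟨ε, hε, hε9, Cw, h₀, hCw, hh₀, hh₀1, hwin⟩ := B.exists_window hosl hd hq hx₀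
  obtain ⟨S, Cc, D, hSm, hS0, hSr, hCc, hD, hSb, hYc⟩ := B.exists_crude_bound hW hx₀ σ
  set k : ℕ := ⌈2 * p₀⌉₊ with hk
  have hkp : 2 * p₀ ≤ k := Nat.le_ceil _
  obtain ⟨Ce, hCe, hexc⟩ := hW.exists_exceptional_bound hT hSm hSr hσ hε (2 * k)
  obtain ⟨C₁, hC₁, hbig⟩ := B.exists_moment_of_le hW hx₀ σ hh₀ p₀
  set θ : ℝ := 5 / (10 * d + 22) with hθ
  have hθ0 : 0 < θ := by positivity
  set r : ℝ := 2 * m₁ * p₀ with hr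
  have hr0 : 0 < r := by
    have : 0 < m₁ := by linarith
    positivity
  set Q : ℝ≥0∞ := ⨆ t ∈ Icc (0 : ℝ≥0) T, ∫⁻ ω, ENNReal.ofReal (|X t ω| ^ (-r)) ∂Pr with hQ
  have hQfin : Q ≠ ⊤ := (hinv r hr0 hpstar).ne
  -- by Chebyshev and a union bound over `T / h` grid points, `X` is below `2 h ^ θ` somewhere on
  -- the grid with probability `O(h ^ (θ r - 1))`, which outweighs the bound `h ^ (-(1 + 2 ε) p₀)`
  -- of `Y ^ (-2 p₀)`
  have hexp : 0 ≤ θ * r - 1 - (1 + 2 * ε) * p₀ := by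
    have h1 : θ * (10 * d + 22) = 5 := by rw [hθ]; field_simp
    have h2 : θ * (4 * d + 3) * 32 ≥ 35 := by
      have : θ * 32 ≤ 5 := by
        have := mul_le_mul_of_nonneg_left hd hθ0.le
        linarith
      linarith
    have h3 : θ * r ≥ 2 * (35 / 32) * p₀ := by
      have : θ * (4 * d + 3) * p₀ ≤ θ * m₁ * p₀ := by gcongr
      have : 35 / 32 * p₀ ≤ θ * (4 * d + 3) * p₀ := by
        refine mul_le_mul_of_nonneg_right ?_ (by linarith)
        linarith
      rw [hr]
      linarith
    have h4 : ε * p₀ ≤ 9 / 100 * p₀ := by gcongr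
    linarith
  set I := ∫⁻ ω, ENNReal.ofReal ((1 + S ω) ^ (2 * D * k)) ∂Pr with hI
  have hIfin : I ≠ ⊤ := (hSr _).ne
  set A₁ : ℝ := (Cw + 1) ^ (2 * p₀) * 2 ^ r * (2 * T) with hA₁
  have hA₁0 : 0 ≤ A₁ := by positivity
  have h2X : 0 < (2 : ℝ) ^ (2 * p₀) := by positivity
  refine ⟨2 ^ (2 * p₀) + C₁ + A₁ * Q.toReal + Cc ^ k * I.toReal + Cc ^ k * Ce, by positivity, ?_⟩
  intro p hp hpp₀ M h hM hhT hh1 Y hYs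
  rcases le_total h₀ (h : ℝ) with hcase | hcase
  · refine (hbig p hp hpp₀ M h hM hhT hh1 hcase Y hYs).trans (le_add_left ?_)
    refine ENNReal.ofReal_le_ofReal ?_
    have : 0 ≤ A₁ * Q.toReal + Cc ^ k * I.toReal + Cc ^ k * Ce := by positivity
    linarith
  have hh : IsStepSize T h := ⟨M, hM, hhT, hh1⟩
  have hpos := hh.pos hT
  have hle1 := hh.le_one
  have hσ' : 0 < |σ| := abs_pos.2 hσ
  have hhM : (M : ℝ) * h = T := by
    have hM' : (M : ℝ≥0) ≠ 0 := by exact_mod_cast hM.ne'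
    have : (M : ℝ≥0) * h = T := by rw [hhT]; field_simp
    exact_mod_cast this
  set E : Set Ω := {ω | (h : ℝ) ^ (-ε) < S ω} ∪
    ⋃ n ∈ Finset.range M, {ω | ENNReal.ofReal ((h : ℝ) ^ (1 / 2 - ε) / |σ|)
      < dyadicSup W (n * h) h ω} with hE
  have hEm : MeasurableSet E := by
    refine (measurableSet_lt measurable_const hSm).union ?_
    refine Finset.measurableSet_biUnion _ fun n _ => ?_
    exact measurableSet_lt measurable_const (hW.measurable_dyadicSup _ _)
  have hEP := hexc M h hM hhT hh1
  rw [← hE] at hEP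
  -- `F₁` bounds the inverse power of `Y` where `X` comes close to `0` on the grid, `F₂ + F₃` bounds
  -- it on the exceptional event
  set F₁ : Ω → ℝ≥0∞ := fun ω => ENNReal.ofReal (((Cw + 1) * (h : ℝ) ^ (-(1 / 2) - ε)) ^ (2 * p₀)
    * (2 * (h : ℝ) ^ θ) ^ r) * ∑ n ∈ Finset.range (M + 1), ENNReal.ofReal (|X (n * h) ω| ^ (-r))
    with hF₁
  set F₂ : Ω → ℝ≥0∞ := fun ω => ENNReal.ofReal (Cc ^ k) * ENNReal.ofReal ((1 + S ω) ^ (2 * D * k))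
    with hF₂
  set F₃ : Ω → ℝ≥0∞ := fun ω => ENNReal.ofReal (Cc ^ k * ((h : ℝ)⁻¹) ^ (2 * k)) *
    E.indicator 1 ω with hF₃
  have hXm : ∀ t, Measurable (X t) := fun t => (hX.adapted t).mono (ℱ.le t) le_rfl
  have hF₁m : Measurable F₁ := by
    refine Measurable.const_mul (Finset.measurable_sum _ fun n _ => ?_) _
    have := hXm (n * h)
    fun_prop
  have hF₂m : Measurable F₂ := by fun_prop
  have hF₃m : Measurable F₃ := (measurable_one.indicator hEm).const_mul _
  have hosc : ∀ᵐ ω ∂Pr, ∀ n : ℕ, ∀ t, (n * h : ℝ≥0) ≤ t → t ≤ n * h + h →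
      ENNReal.ofReal |W t ω - W (n * h) ω| ≤ dyadicSup W (n * h) h ω :=
    ae_all_iff.2 fun n => hW.le_dyadicSup (n * h) h
  have hpt : ∀ᵐ ω ∂Pr, (⨆ n ∈ Finset.range (M + 1), ENNReal.ofReal (|Y n ω| ^ (-(2 * p))))
      ≤ ENNReal.ofReal (2 ^ (2 * p₀)) *
          (⨆ t ∈ Icc (0 : ℝ≥0) T, ENNReal.ofReal (|X t ω| ^ (-(2 * p))))
        + (F₁ ω + (F₂ ω + F₃ ω)) := by
    filter_upwards [hYc M h hM hhT hh1 Y hYs, hSb, hX.ae_solPath, hYs.ae_schemePath, hosc,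
      hX.pos] with ω hY1 hSω hXω hYω hoscω hXpos
    by_cases hωE : ω ∈ E
    · -- the exceptional event
      refine le_add_left (le_add_left ?_)
      have hS := hS0 ω
      have hS1 : 1 ≤ (1 + S ω) ^ D := one_le_pow₀ (by linarith)
      have hinv1 : 1 ≤ (h : ℝ)⁻¹ := (one_le_inv₀ hpos).2 hle1
      have h1 := iSup_rpow_neg_le (p := p) (r := k) (A := Cc * (h : ℝ)⁻¹ * (1 + S ω) ^ D)
        (one_le_mul_of_one_le_of_one_le (one_le_mul_of_one_le_of_one_le hCc hinv1) hS1)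
        (by linarith) (by linarith) (M := M) (y := fun n => Y n ω)
        (fun n hn => ⟨(hY1 n hn).1, (hY1 n hn).2.2⟩)
      refine h1.trans ?_
      simp only [hF₂, hF₃, indicator_of_mem hωE, Pi.one_apply, mul_one]
      rw [← ENNReal.ofReal_mul (by positivity), ← ENNReal.ofReal_add (by positivity)
        (by positivity), Real.rpow_natCast]
      refine ENNReal.ofReal_le_ofReal ?_
      have h2 : ((1 + S ω) ^ D) ^ k * ((h : ℝ)⁻¹) ^ k
          ≤ (1 + S ω) ^ (2 * D * k) + ((h : ℝ)⁻¹) ^ (2 * k) := by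
        have e1 : (1 + S ω) ^ (2 * D * k) = (((1 + S ω) ^ D) ^ k) ^ 2 := by
          rw [← pow_mul, ← pow_mul]; ring_nf
        have e2 : ((h : ℝ)⁻¹) ^ (2 * k) = (((h : ℝ)⁻¹) ^ k) ^ 2 := by
          rw [← pow_mul]; ring_nf
        rw [e1, e2]
        set u := ((1 + S ω) ^ D) ^ k
        set w := ((h : ℝ)⁻¹) ^ k
        linarith [sq_nonneg (u - w), sq_nonneg u, sq_nonneg w, sq_nonneg (u + w),
          (by ring : (u - w) ^ 2 = u ^ 2 - 2 * (u * w) + w ^ 2)]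
      calc (Cc * (h : ℝ)⁻¹ * (1 + S ω) ^ D) ^ k
          = Cc ^ k * (((1 + S ω) ^ D) ^ k * ((h : ℝ)⁻¹) ^ k) := by rw [mul_pow, mul_pow]; ring
        _ ≤ Cc ^ k * ((1 + S ω) ^ (2 * D * k) + ((h : ℝ)⁻¹) ^ (2 * k)) := by gcongr
        _ = _ := by ring
    · have hωE' := hωE
      simp only [hE, mem_union, mem_iUnion, mem_ofPred_eq, not_or, not_exists, not_lt,
        Finset.mem_range, exists_prop, not_and] at hωE'
      obtain ⟨hSle, hosle⟩ := hωE'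
      have hYω' : SchemePath P (muHat q.eval c) c h M x₀
          (fun n => (fun t : ℝ => σ * (W t.toNNReal ω - W 0 ω)) (n * h)) (fun n => Y n ω) := by
        simpa only [toNNReal_natCast_mul] using hYω
      have hw := hwin M h hM hhT hh1 hcase _ _ _ hXω (by simp) hYω' ?_ ?_
      · obtain ⟨hw1, hw2⟩ := hw
        simp only [toNNReal_natCast_mul] at hw2
        by_cases hlow : ∀ n ≤ M, 2 * (h : ℝ) ^ θ ≤ X (n * h) ω
        · -- the scheme follows the exact path
          refine le_add_right ?_
          have h3 := hw2 hlow
          refine iSup₂_le fun n hn => ?_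
          have hn' : n ≤ M := by simpa [Nat.lt_succ_iff] using hn
          have hXp := hXpos (n * h)
          have h4 := h3 n hn'
          have hYp := (hY1 n hn').1
          calc ENNReal.ofReal (|Y n ω| ^ (-(2 * p)))
              ≤ ENNReal.ofReal (2 ^ (2 * p₀)) * ENNReal.ofReal (|X (n * h) ω| ^ (-(2 * p))) := by
                rw [← ENNReal.ofReal_mul (by positivity), abs_of_pos hYp, abs_of_pos hXp]
                refine ENNReal.ofReal_le_ofReal ?_
                have h5 : (Y n ω) ^ (-(2 * p)) ≤ (X (n * h) ω / 2) ^ (-(2 * p)) :=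
                  Real.rpow_le_rpow_of_nonpos (by positivity) (by linarith) (by linarith)
                refine h5.trans ?_
                rw [Real.div_rpow hXp.le (by norm_num), div_eq_mul_inv,
                  ← Real.rpow_neg (by norm_num),
                  neg_neg, mul_comm]
                gcongr
                norm_num
            _ ≤ _ := by
                gcongr
                exact le_iSup₂_of_le (n * h : ℝ≥0) ⟨zero_le, natCast_mul_le hM hhT hn'⟩ le_rfl
        · -- the exact path comes close to `0`
          refine le_add_left (le_add_right ?_)
          push Not at hlow
          obtain ⟨m, hm, hXm'⟩ := hlow
          have hXp := hXpos (m * h)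
          have hone : 1 ≤ (h : ℝ) ^ (-(1 / 2) - ε) :=
            Real.one_le_rpow_of_pos_of_le_one_of_nonpos hpos hle1 (by linarith)
          have h1 := iSup_rpow_neg_le (p := p) (r := 2 * p₀)
            (A := (Cw + 1) * (h : ℝ) ^ (-(1 / 2) - ε))
            (one_le_mul_of_one_le_of_one_le (by linarith) hone)
            (by linarith) (by linarith) (M := M) (y := fun n => Y n ω)
            (fun n hn => ⟨(hY1 n hn).1, (hw1 n hn).trans (by gcongr; linarith)⟩)
          refine h1.trans ?_
          simp only [hF₁]
          have h2 : 1 ≤ (2 * (h : ℝ) ^ θ) ^ r * (X (m * h) ω) ^ (-r) := by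
            rw [Real.rpow_neg hXp.le, ← div_eq_mul_inv, ← Real.div_rpow (by positivity) hXp.le]
            exact Real.one_le_rpow ((one_le_div hXp).2 hXm'.le) hr0.le
          calc ENNReal.ofReal (((Cw + 1) * (h : ℝ) ^ (-(1 / 2) - ε)) ^ (2 * p₀))
              ≤ ENNReal.ofReal (((Cw + 1) * (h : ℝ) ^ (-(1 / 2) - ε)) ^ (2 * p₀)
                * (2 * (h : ℝ) ^ θ) ^ r) * ENNReal.ofReal (|X (m * h) ω| ^ (-r)) := by
                rw [← ENNReal.ofReal_mul (by positivity), abs_of_pos hXp, mul_assoc]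
                exact ENNReal.ofReal_le_ofReal (le_mul_of_one_le_right (by positivity) h2)
            _ ≤ _ := by
                gcongr
                exact Finset.single_le_sum (f := fun n : ℕ => ENNReal.ofReal (|X (n * h) ω| ^ (-r)))
                  (fun _ _ => zero_le) (Finset.mem_range.2 (Nat.lt_succ_of_le hm))
      · intro t ht htT
        refine (hSω t.toNNReal ?_).trans hSle
        exact Real.toNNReal_le_iff_le_coe.2 htT
      · intro n hn s hs1 hs2
        simp only [toNNReal_natCast_mul]
        have hs0 : 0 ≤ s := le_trans (by positivity) hs1
        have e1 : (n * h : ℝ≥0) ≤ s.toNNReal := by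
          rw [Real.le_toNNReal_iff_coe_le hs0]; exact_mod_cast hs1
        have e2 : s.toNNReal ≤ n * h + h := by
          rw [Real.toNNReal_le_iff_le_coe]
          push_cast at hs2 ⊢
          linarith
        have h1 := (hoscω n s.toNNReal e1 e2).trans (hosle n hn)
        rw [ENNReal.ofReal_le_ofReal_iff (by positivity), le_div_iff₀ hσ'] at h1
        calc |σ * (W s.toNNReal ω - W 0 ω) - σ * (W (n * h) ω - W 0 ω)|
            = |W s.toNNReal ω - W (n * h) ω| * |σ| := by rw [← abs_mul]; congr 1; ring
          _ ≤ _ := h1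
  have hint₁ : ∫⁻ ω, F₁ ω ∂Pr ≤ ENNReal.ofReal (A₁ * Q.toReal) := by
    have hsum : ∫⁻ ω, ∑ n ∈ Finset.range (M + 1), ENNReal.ofReal (|X (n * h) ω| ^ (-r)) ∂Pr
        ≤ ENNReal.ofReal (2 * M) * Q := by
      rw [lintegral_finsetSum _ (fun n _ => by have := hXm (n * h); fun_prop)]
      calc ∑ n ∈ Finset.range (M + 1), ∫⁻ ω, ENNReal.ofReal (|X (n * h) ω| ^ (-r)) ∂Pr
          ≤ ∑ n ∈ Finset.range (M + 1), Q := by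
            refine Finset.sum_le_sum fun n hn => ?_
            exact le_iSup₂_of_le (f := fun (t : ℝ≥0) (_ : t ∈ Icc (0 : ℝ≥0) T) =>
              ∫⁻ ω, ENNReal.ofReal (|X t ω| ^ (-r)) ∂Pr) (n * h : ℝ≥0)
              ⟨zero_le, natCast_mul_le hM hhT (by simpa [Nat.lt_succ_iff] using hn)⟩ le_rfl
        _ = ENNReal.ofReal ((M : ℝ) + 1) * Q := by
            rw [Finset.sum_const, Finset.card_range, nsmul_eq_mul, ← ENNReal.ofReal_natCast]
            push_cast
            rfl
        _ ≤ _ := by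
            gcongr
            have : (1 : ℝ) ≤ M := by exact_mod_cast hM
            linarith
    simp only [hF₁]
    rw [lintegral_const_mul _ (Finset.measurable_sum _ fun n _ => by
      have := hXm (n * h); fun_prop)]
    refine (mul_le_mul_right hsum _).trans ?_
    rw [ENNReal.ofReal_mul hA₁0, ENNReal.ofReal_toReal hQfin, ← mul_assoc,
      ← ENNReal.ofReal_mul (by positivity)]
    gcongr
    rw [Real.mul_rpow (by positivity) (by positivity),
      Real.mul_rpow (by positivity) (by positivity), ← Real.rpow_mul hpos.le,
      ← Real.rpow_mul hpos.le]
    have hMh : (M : ℝ) = T * (h : ℝ) ^ (-1 : ℝ) := by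
      rw [← hhM, Real.rpow_neg_one]; field_simp
    calc (Cw + 1) ^ (2 * p₀) * (h : ℝ) ^ ((-(1 / 2) - ε) * (2 * p₀)) * (2 ^ r * (h : ℝ) ^ (θ * r))
          * (2 * M)
        = A₁ * ((h : ℝ) ^ ((-(1 / 2) - ε) * (2 * p₀)) * (h : ℝ) ^ (θ * r)
            * (h : ℝ) ^ (-1 : ℝ)) := by
          rw [hMh, hA₁]; ring
      _ = A₁ * (h : ℝ) ^ (θ * r - 1 - (1 + 2 * ε) * p₀) := by
          rw [← Real.rpow_add hpos, ← Real.rpow_add hpos]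
          ring_nf
      _ ≤ A₁ * 1 := by
          gcongr
          exact Real.rpow_le_one hpos.le hle1 hexp
      _ = A₁ := mul_one _
  have hint₂ : ∫⁻ ω, F₂ ω ∂Pr = ENNReal.ofReal (Cc ^ k * I.toReal) := by
    simp only [hF₂]
    rw [lintegral_const_mul _ (by fun_prop), ENNReal.ofReal_mul (by positivity),
      ENNReal.ofReal_toReal hIfin]
  have hint₃ : ∫⁻ ω, F₃ ω ∂Pr ≤ ENNReal.ofReal (Cc ^ k * Ce) := by
    simp only [hF₃]
    rw [lintegral_const_mul _ (measurable_one.indicator hEm), lintegral_indicator_one hEm]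
    refine (mul_le_mul_right hEP _).trans ?_
    rw [← ENNReal.ofReal_mul (by positivity)]
    refine ENNReal.ofReal_le_ofReal (le_of_eq ?_)
    rw [inv_pow]
    field_simp
  calc ∫⁻ ω, (⨆ n ∈ Finset.range (M + 1), ENNReal.ofReal (|Y n ω| ^ (-(2 * p)))) ∂Pr
      ≤ ∫⁻ ω, (ENNReal.ofReal (2 ^ (2 * p₀)) *
          (⨆ t ∈ Icc (0 : ℝ≥0) T, ENNReal.ofReal (|X t ω| ^ (-(2 * p))))
        + (F₁ ω + (F₂ ω + F₃ ω))) ∂Pr := lintegral_mono_ae hpt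
    _ = ENNReal.ofReal (2 ^ (2 * p₀)) *
          ∫⁻ ω, (⨆ t ∈ Icc (0 : ℝ≥0) T, ENNReal.ofReal (|X t ω| ^ (-(2 * p)))) ∂Pr
        + (∫⁻ ω, F₁ ω ∂Pr + (∫⁻ ω, F₂ ω ∂Pr + ∫⁻ ω, F₃ ω ∂Pr)) := by
        rw [lintegral_add_right (g := fun ω => F₁ ω + (F₂ ω + F₃ ω)) _
          (hF₁m.add (hF₂m.add hF₃m)), lintegral_const_mul' _ _ ENNReal.ofReal_ne_top,
          lintegral_add_left hF₁m, lintegral_add_left hF₂m]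
    _ ≤ ENNReal.ofReal (2 ^ (2 * p₀)) *
          ∫⁻ ω, (⨆ t ∈ Icc (0 : ℝ≥0) T, ENNReal.ofReal (|X t ω| ^ (-(2 * p)))) ∂Pr
        + (ENNReal.ofReal (A₁ * Q.toReal) + (ENNReal.ofReal (Cc ^ k * I.toReal)
          + ENNReal.ofReal (Cc ^ k * Ce))) := by
        rw [hint₂]
        gcongr
    _ ≤ _ := by
        have n1 : 0 ≤ A₁ * Q.toReal := by positivity
        have n2 : 0 ≤ Cc ^ k * I.toReal := by positivity
        have n3 : 0 ≤ Cc ^ k * Ce := by positivity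
        rw [← ENNReal.ofReal_add n2 n3, ← ENNReal.ofReal_add n1 (by linarith)]
        exact add_le_add (mul_le_mul_left (ENNReal.ofReal_le_ofReal (by linarith)) _)
          (ENNReal.ofReal_le_ofReal (by linarith))

end Moments

end PosScheme

/-! ### The implicit step and its one-step expectation -/

namespace PosScheme

/-- The positive root `y` of `y = z + c / y`, that is, the implicit step of the scheme. -/
noncomputable def implicitRoot (c z : ℝ) : ℝ := (z + Real.sqrt (z ^ 2 + 4 * c)) / 2

section Root

variable {c : ℝ}

lemma abs_lt_sqrt (hc : 0 < c) (z : ℝ) : |z| < Real.sqrt (z ^ 2 + 4 * c) :=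
  Real.lt_sqrt_of_sq_lt (by rw [sq_abs]; linarith)

lemma implicitRoot_pos (hc : 0 < c) (z : ℝ) : 0 < implicitRoot c z := by
  have := abs_lt_sqrt hc z
  have := neg_abs_le z
  unfold implicitRoot
  linarith

lemma implicitRoot_sq (hc : 0 < c) (z : ℝ) :
    implicitRoot c z ^ 2 = z * implicitRoot c z + c := by
  have h := Real.sq_sqrt (by positivity : (0 : ℝ) ≤ z ^ 2 + 4 * c)
  unfold implicitRoot
  linear_combination h / 4

lemma implicitRoot_eq (hc : 0 < c) (z : ℝ) :
    implicitRoot c z = z + c / implicitRoot c z := by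
  have h := implicitRoot_sq hc z
  have hp := implicitRoot_pos hc z
  field_simp
  linarith

lemma eq_implicitRoot (hc : 0 < c) {y z : ℝ} (hy : 0 < y) (h : y = z + c * y⁻¹) :
    y = implicitRoot c z := by
  have h1 : y ^ 2 = z * y + c := by
    have : y * y = (z + c * y⁻¹) * y := by rw [← h]
    rw [add_mul, mul_assoc, inv_mul_cancel₀ hy.ne'] at this
    linarith
  have h2 := implicitRoot_sq hc z
  have hp := implicitRoot_pos hc z
  have h3 : (y - implicitRoot c z) * (y * implicitRoot c z + c) = 0 := by
    linear_combination (implicitRoot c z) * h1 - y * h2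
  have h4 : 0 < y * implicitRoot c z + c := by positivity
  rcases mul_eq_zero.1 h3 with h5 | h5
  · linarith
  · linarith

lemma le_implicitRoot (hc : 0 < c) (z : ℝ) : z ≤ implicitRoot c z := by
  have := abs_lt_sqrt hc z
  have := le_abs_self z
  unfold implicitRoot
  linarith

lemma implicitRoot_mono (hc : 0 < c) {w z : ℝ} (h : w ≤ z) :
    implicitRoot c w ≤ implicitRoot c z := by
  by_contra hlt
  push Not at hlt
  have e1 := implicitRoot_eq hc w
  have e2 := implicitRoot_eq hc z
  have : c / implicitRoot c w ≤ c / implicitRoot c z :=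
    div_le_div_of_nonneg_left hc.le (implicitRoot_pos hc z) hlt.le
  linarith

lemma implicitRoot_sub_le (hc : 0 < c) {w z : ℝ} (h : w ≤ z) :
    implicitRoot c z - (z - w) ≤ implicitRoot c w := by
  have e1 := implicitRoot_eq hc w
  have e2 := implicitRoot_eq hc z
  have : c / implicitRoot c z ≤ c / implicitRoot c w :=
    div_le_div_of_nonneg_left hc.le (implicitRoot_pos hc w) (implicitRoot_mono hc h)
  linarith

lemma implicitRoot_scale {h : ℝ} (hh : 0 < h) (z : ℝ) :
    implicitRoot (c * h) (Real.sqrt h * z) = Real.sqrt h * implicitRoot c z := by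
  have h1 : Real.sqrt h ^ 2 = h := Real.sq_sqrt hh.le
  have h2 : Real.sqrt ((Real.sqrt h * z) ^ 2 + 4 * (c * h)) =
      Real.sqrt h * Real.sqrt (z ^ 2 + 4 * c) := by
    rw [← Real.sqrt_mul hh.le]
    congr 1
    rw [mul_pow, h1]
    ring
  unfold implicitRoot
  rw [h2]
  ring

lemma continuous_implicitRoot (c : ℝ) : Continuous (implicitRoot c) := by
  unfold implicitRoot
  fun_prop

lemma implicitRoot_le_of_nonneg_sq (hc : 0 < c) (z : ℝ) : implicitRoot c z ^ 2 ≤ z ^ 2 + 2 * c := by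
  have h1 := implicitRoot_sq hc z
  have h := Real.sq_sqrt (by positivity : (0 : ℝ) ≤ z ^ 2 + 4 * c)
  have h0 := Real.sqrt_nonneg (z ^ 2 + 4 * c)
  unfold implicitRoot
  nlinarith [sq_nonneg (z - Real.sqrt (z ^ 2 + 4 * c))]

/-- The implicit term is `(c / Φ(z))² = Φ(-z)²`. -/
lemma div_implicitRoot (hc : 0 < c) (z : ℝ) : c / implicitRoot c z = implicitRoot c (-z) := by
  have hp := implicitRoot_pos hc z
  refine eq_implicitRoot hc (by positivity) ?_
  have := implicitRoot_eq hc z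
  have h2 : c * (c / implicitRoot c z)⁻¹ = implicitRoot c z := by field_simp
  rw [h2]
  linarith

end Root

/-! #### A fourth-order Taylor bound -/

lemma exists_eq_mul_of_hasDerivAt {f f' : ℝ → ℝ} {l x : ℝ} (hl : l < 0) (hx : l < x) (hx0 : x ≠ 0)
    (hf : ∀ y, l < y → HasDerivAt f (f' y) y) (h0 : f 0 = 0) :
    ∃ ξ, l < ξ ∧ 0 < ξ * x ∧ f x = f' ξ * x := by
  rcases lt_or_gt_of_ne hx0 with h | h
  · obtain ⟨ξ, ⟨h1, h2⟩, h3⟩ := exists_hasDerivAt_eq_slope f f' h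
      (fun y hy => (hf y (hx.trans_le hy.1)).continuousAt.continuousWithinAt)
      (fun y hy => hf y (hx.trans hy.1))
    refine ⟨ξ, hx.trans h1, mul_pos_of_neg_of_neg h2 h, ?_⟩
    rw [h3, h0]
    field_simp
    ring
  · obtain ⟨ξ, ⟨h1, h2⟩, h3⟩ := exists_hasDerivAt_eq_slope f f' h
      (fun y hy => (hf y (hl.trans_le hy.1)).continuousAt.continuousWithinAt)
      (fun y hy => hf y (hl.trans hy.1))
    refine ⟨ξ, hl.trans h1, mul_pos h1 h, ?_⟩
    rw [h3, h0]
    field_simp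
    ring

lemma mul_nonneg_of_hasDerivAt {f f' : ℝ → ℝ} {l : ℝ} (hl : l < 0)
    (hf : ∀ y, l < y → HasDerivAt f (f' y) y) (h0 : f 0 = 0) (h' : ∀ y, l < y → 0 ≤ f' y) :
    ∀ x, l < x → 0 ≤ x * f x := by
  intro x hx
  rcases eq_or_ne x 0 with rfl | hx0
  · simp
  · obtain ⟨ξ, h1, h2, h3⟩ := exists_eq_mul_of_hasDerivAt hl hx hx0 hf h0
    rw [h3]
    have := mul_nonneg (h' ξ h1) (sq_nonneg x)
    linarith

lemma nonneg_of_hasDerivAt {f f' : ℝ → ℝ} {l : ℝ} (hl : l < 0)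
    (hf : ∀ y, l < y → HasDerivAt f (f' y) y) (h0 : f 0 = 0) (h' : ∀ y, l < y → 0 ≤ y * f' y) :
    ∀ x, l < x → 0 ≤ f x := by
  intro x hx
  rcases eq_or_ne x 0 with rfl | hx0
  · rw [h0]
  · obtain ⟨ξ, h1, h2, h3⟩ := exists_eq_mul_of_hasDerivAt hl hx hx0 hf h0
    rw [h3]
    have h4 : 0 ≤ (ξ * f' ξ) * (ξ * x) := mul_nonneg (h' ξ h1) h2.le
    have h5 : 0 < ξ ^ 2 := by
      have : ξ ≠ 0 := fun h => by simp [h] at h2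
      positivity
    have h6 : 0 ≤ (f' ξ * x) * ξ ^ 2 := by linarith
    exact nonneg_of_mul_nonneg_left h6 h5

lemma hasDerivAt_one_add_rpow (e : ℝ) {x : ℝ} (hx : -1 < x) :
    HasDerivAt (fun y : ℝ => (1 + y) ^ e) (e * (1 + x) ^ (e - 1)) x := by
  have h1 : HasDerivAt (fun y : ℝ => 1 + y) 1 x := (hasDerivAt_id x).const_add 1
  have := h1.rpow_const (p := e) (Or.inl (by linarith))
  simpa [mul_comm, mul_assoc, mul_left_comm] using this

/-- The Taylor polynomial of order three bounds `(1 + x) ^ (-a)` from above on all of `(-1, ∞)`,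
with a remainder that takes the singularity at `-1` into account. -/
lemma exists_taylor_bound {a : ℝ} (ha : 0 < a) :
    ∃ C : ℝ, 0 < C ∧ ∀ x, -1 < x → (1 + x) ^ (-a) ≤
      1 - a * x + a * (a + 1) / 2 * x ^ 2 - a * (a + 1) * (a + 2) / 6 * x ^ 3
        + C * (x ^ 4 * (1 + (1 + x) ^ (-a))) := by
  set C₁ : ℝ := a * (a + 1) * (a + 2) * (a + 3) * 2 ^ (a + 4) / 24 with hC₁
  have hC₁0 : 0 < C₁ := by positivity
  set C₂ : ℝ := 16 * (1 + a + a * (a + 1) / 2 + a * (a + 1) * (a + 2) / 6) with hC₂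
  have hC₂0 : 0 < C₂ := by positivity
  refine ⟨C₁ + C₂ + 16, by positivity, fun x hx => ?_⟩
  have hp : 0 < (1 + x) ^ (-a) := Real.rpow_pos_of_pos (by linarith) _
  rcases lt_or_ge (-(1 / 2)) x with hx2 | hx2
  · have hd : ∀ (e : ℝ) (y : ℝ), -(1 / 2) < y →
        HasDerivAt (fun y : ℝ => (1 + y) ^ e) (e * (1 + y) ^ (e - 1)) y := fun e y hy =>
      hasDerivAt_one_add_rpow e (by linarith)
    have hl : (-(1 / 2) : ℝ) < 0 := by norm_num
    have key : 0 ≤ 1 - a * x + a * (a + 1) / 2 * x ^ 2 - a * (a + 1) * (a + 2) / 6 * x ^ 3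
        + C₁ * x ^ 4 - (1 + x) ^ (-a) := by
      refine nonneg_of_hasDerivAt (f := fun x => 1 - a * x + a * (a + 1) / 2 * x ^ 2
        - a * (a + 1) * (a + 2) / 6 * x ^ 3 + C₁ * x ^ 4 - (1 + x) ^ (-a))
        (f' := fun x => - a + a * (a + 1) * x - a * (a + 1) * (a + 2) / 2 * x ^ 2
          + 4 * C₁ * x ^ 3 + a * (1 + x) ^ (-a - 1)) hl ?_ (by simp) ?_ x hx2
      · intro y hy
        have := (((((hasDerivAt_const y (1 : ℝ)).sub ((hasDerivAt_id y).const_mul a)).add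
          ((hasDerivAt_pow 2 y).const_mul (a * (a + 1) / 2))).sub
          ((hasDerivAt_pow 3 y).const_mul (a * (a + 1) * (a + 2) / 6))).add
          ((hasDerivAt_pow 4 y).const_mul C₁)).sub (hd (-a) y hy)
        refine this.congr_deriv ?_
        push_cast
        ring
      refine mul_nonneg_of_hasDerivAt (f' := fun x => a * (a + 1) - a * (a + 1) * (a + 2) * x
          + 12 * C₁ * x ^ 2 - a * (a + 1) * (1 + x) ^ (-a - 2)) hl ?_ (by simp) ?_
      · intro y hy
        have := (((((hasDerivAt_const y (-a : ℝ)).add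
          ((hasDerivAt_id y).const_mul (a * (a + 1)))).sub
          ((hasDerivAt_pow 2 y).const_mul (a * (a + 1) * (a + 2) / 2))).add
          ((hasDerivAt_pow 3 y).const_mul (4 * C₁))).add
          ((hd (-a - 1) y hy).const_mul a))
        refine this.congr_deriv ?_
        have e : (-a - 1 - 1 : ℝ) = -a - 2 := by ring
        rw [e]
        push_cast
        ring
      refine nonneg_of_hasDerivAt (f' := fun x => - (a * (a + 1) * (a + 2))
          + 24 * C₁ * x + a * (a + 1) * (a + 2) * (1 + x) ^ (-a - 3)) hl ?_ (by simp) ?_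
      · intro y hy
        have := (((hasDerivAt_const y (a * (a + 1) : ℝ)).sub
          ((hasDerivAt_id y).const_mul (a * (a + 1) * (a + 2)))).add
          ((hasDerivAt_pow 2 y).const_mul (12 * C₁))).sub
          ((hd (-a - 2) y hy).const_mul (a * (a + 1)))
        refine this.congr_deriv ?_
        have e : (-a - 2 - 1 : ℝ) = -a - 3 := by ring
        rw [e]
        push_cast
        ring
      refine mul_nonneg_of_hasDerivAt (f' := fun x => 24 * C₁
        - a * (a + 1) * (a + 2) * (a + 3) * (1 + x) ^ (-a - 4)) hl ?_ (by simp) ?_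
      · intro y hy
        have := ((hasDerivAt_const y (-(a * (a + 1) * (a + 2)) : ℝ)).add
          ((hasDerivAt_id y).const_mul (24 * C₁))).add
          ((hd (-a - 3) y hy).const_mul (a * (a + 1) * (a + 2)))
        refine this.congr_deriv ?_
        have e : (-a - 3 - 1 : ℝ) = -a - 4 := by ring
        rw [e]
        ring
      intro y hy
      have h1 : (1 + y) ^ (-a - 4) ≤ 2 ^ (a + 4) := by
        have h2 : (1 + y) ^ (-a - 4) ≤ (1 / 2 : ℝ) ^ (-a - 4) :=
          Real.rpow_le_rpow_of_nonpos (by norm_num) (by linarith) (by linarith)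
        have h3 : (1 / 2 : ℝ) ^ (-a - 4) = 2 ^ (a + 4) := by
          rw [one_div, Real.inv_rpow (by norm_num), ← Real.rpow_neg (by norm_num)]
          ring_nf
        rwa [h3] at h2
      have h4 : a * (a + 1) * (a + 2) * (a + 3) * (1 + y) ^ (-a - 4)
          ≤ a * (a + 1) * (a + 2) * (a + 3) * 2 ^ (a + 4) := by gcongr
      rw [hC₁]
      linarith
    have h5 : C₁ * x ^ 4 ≤ (C₁ + C₂ + 16) * (x ^ 4 * (1 + (1 + x) ^ (-a))) := by
      have h6 : 0 ≤ x ^ 4 := by positivity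
      calc C₁ * x ^ 4 ≤ (C₁ + C₂ + 16) * (x ^ 4 * 1) := by
            rw [mul_one]; gcongr; linarith
        _ ≤ _ := by gcongr; linarith
    linarith
  · have hx4 : 1 ≤ 16 * x ^ 4 := by
      have h1 : 1 / 4 ≤ x ^ 2 := by nlinarith
      have h2 : x ^ 4 = (x ^ 2) ^ 2 := by ring
      rw [h2]; nlinarith
    have hx1 : |x| ≤ 1 := abs_le.2 ⟨by linarith, by linarith⟩
    have hx3 : x ^ 3 ≤ 1 := by
      calc x ^ 3 ≤ |x ^ 3| := le_abs_self _
        _ = |x| ^ 3 := abs_pow _ _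
        _ ≤ 1 := pow_le_one₀ (abs_nonneg _) hx1
    have h1 : (1 + x) ^ (-a) ≤ 16 * (x ^ 4 * (1 + x) ^ (-a)) := by nlinarith
    have h2 : -(1 - a * x + a * (a + 1) / 2 * x ^ 2 - a * (a + 1) * (a + 2) / 6 * x ^ 3)
        ≤ C₂ * x ^ 4 := by
      have h3 : a * (a + 1) * (a + 2) / 6 * x ^ 3 ≤ a * (a + 1) * (a + 2) / 6 * 1 := by gcongr
      have h4 : a * x ≤ 0 := mul_nonpos_of_nonneg_of_nonpos ha.le (by linarith)
      have h5 : 0 ≤ a * (a + 1) / 2 * x ^ 2 := by positivity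
      have h6 : (1 + a + a * (a + 1) / 2 + a * (a + 1) * (a + 2) / 6) * 1
          ≤ (1 + a + a * (a + 1) / 2 + a * (a + 1) * (a + 2) / 6) * (16 * x ^ 4) := by gcongr
      have h7 : 0 < a * (a + 1) / 2 := by positivity
      have h8 : C₂ * x ^ 4
        = (1 + a + a * (a + 1) / 2 + a * (a + 1) * (a + 2) / 6) * (16 * x ^ 4) := by
        rw [hC₂]; ring
      linarith
    have h9 : 0 ≤ x ^ 4 := by positivity
    have h10 : 0 ≤ x ^ 4 * (1 + x) ^ (-a) := by positivity
    have h11 : 0 ≤ C₁ * (x ^ 4 * (1 + (1 + x) ^ (-a))) := by positivity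
    have h12 : 0 ≤ C₂ * (x ^ 4 * (1 + x) ^ (-a)) := by positivity
    linarith

end PosScheme

namespace PosScheme

section OneStep

variable {c : ℝ}

/-- A displacement by `s` changes the regularised square `y² + A` by a factor of order `1 + s²` at
most, downwards. -/
lemma implicitRoot_crude (hc : 0 < c) {A y s : ℝ} (hA : 1 ≤ A) (hy : 0 ≤ y) :
    y ^ 2 + A ≤ (4 + 4 * s ^ 2) * (implicitRoot c (y + s) ^ 2 + A) := by
  have h1 := le_implicitRoot hc (y + s)
  have hp := implicitRoot_pos hc (y + s)
  set φ := implicitRoot c (y + s)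
  rcases le_total (2 * |s|) y with h | h
  · have h2 : y ≤ 2 * φ := by
      have := neg_abs_le s
      linarith
    have h3 : y ^ 2 ≤ (2 * φ) ^ 2 := pow_le_pow_left₀ hy h2 2
    have h4 : 0 ≤ 4 * s ^ 2 * (φ ^ 2 + A) := by positivity
    have h5 : (2 * φ) ^ 2 = 4 * φ ^ 2 := by ring
    linarith
  · have h3 : y ^ 2 ≤ (2 * |s|) ^ 2 := pow_le_pow_left₀ hy h 2
    have h4 : (2 * |s|) ^ 2 = 4 * s ^ 2 := by rw [mul_pow, sq_abs]; ring
    have h5 : 4 * s ^ 2 * 1 ≤ 4 * s ^ 2 * A := by gcongr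
    have h6 : 0 ≤ (4 + 4 * s ^ 2) * φ ^ 2 := by positivity
    linarith

/-- The convexity of the implicit step gives it a drift of at least `c`, at every `y ≥ 0`. -/
lemma exists_implicitRoot_tangent (hc : 0 < c) {y : ℝ} (hy : 0 ≤ y) :
    ∃ k : ℝ, ∀ s, c + k * s ≤ implicitRoot c (y + s) ^ 2 - y ^ 2 := by
  set p := implicitRoot c y with hp
  have hp0 := implicitRoot_pos hc y
  rw [← hp] at hp0
  set m := p ^ 2 / (p ^ 2 + c) with hm
  refine ⟨2 * p * m, fun s => ?_⟩
  set φ := implicitRoot c (y + s) with hφ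
  have hφ0 : 0 < φ := implicitRoot_pos hc (y + s)
  have e1 : p ^ 2 = y * p + c := implicitRoot_sq hc y
  have e2 : φ ^ 2 = (y + s) * φ + c := implicitRoot_sq hc (y + s)
  have hyp : y ≤ p := le_implicitRoot hc y
  have h1 : m * s ≤ φ - p := by
    rw [hm, div_mul_eq_mul_div, div_le_iff₀ (by positivity)]
    have h2 : s * (φ * p) = (φ - p) * (φ * p + c) := by
      linear_combination φ * e1 - p * e2
    have h3 : 0 ≤ ((φ - p) * (p ^ 2 + c) - p ^ 2 * s) * φ := by
      have : ((φ - p) * (p ^ 2 + c) - p ^ 2 * s) * φ = c * (φ - p) ^ 2 := by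
        linear_combination (-p) * h2
      rw [this]; positivity
    have := nonneg_of_mul_nonneg_left h3 hφ0
    linarith
  have h2 : p * (m * s) ≤ p * (φ - p) := mul_le_mul_of_nonneg_left h1 hp0.le
  linarith [sq_nonneg (φ - p), mul_le_mul_of_nonneg_left hyp hy]

/-- The expansion of the implicit step: its square exceeds `y²` by the Itô terms, up to a defect
`η` which is small when `y` is large. -/
lemma implicitRoot_sq_eq (hc : 0 < c) {y : ℝ} (hy : 0 ≤ y) (s : ℝ) :
    ∃ η : ℝ, implicitRoot c (y + s) ^ 2 - y ^ 2 = 2 * y * s + s ^ 2 + 2 * c - η ∧ 0 ≤ η ∧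
      η ≤ s ^ 2 + 2 * c ∧ η * (1 + y ^ 2) ≤ (3 + 6 * c + 2 * c ^ 2) * (1 + |s|) ^ 4 := by
  set φ := implicitRoot c (y + s) with hφ
  have hφ0 : 0 < φ := implicitRoot_pos hc (y + s)
  have e2 : φ = (y + s) + c / φ := implicitRoot_eq hc (y + s)
  set t := c / φ with ht
  have ht0 : 0 < t := by positivity
  have htφ : t * φ = c := by rw [ht]; field_simp
  have h1 : t ≤ implicitRoot c (-s) := by
    rw [ht, div_implicitRoot hc]
    exact implicitRoot_mono hc (by linarith)
  have h2 : t ^ 2 ≤ s ^ 2 + 2 * c := by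
    calc t ^ 2 ≤ implicitRoot c (-s) ^ 2 := pow_le_pow_left₀ ht0.le h1 2
      _ ≤ (-s) ^ 2 + 2 * c := implicitRoot_le_of_nonneg_sq hc _
      _ = _ := by ring
  refine ⟨t ^ 2, ?_, by positivity, h2, ?_⟩
  · have : (φ - t) ^ 2 = (y + s) ^ 2 := by rw [e2]; ring
    linear_combination this + 2 * htφ
  · have hyφ : y ≤ φ + |s| := by
      have := neg_abs_le s
      linarith
    have h3 : t * y ≤ c + t * |s| := by
      calc t * y ≤ t * (φ + |s|) := by gcongr
        _ = c + t * |s| := by rw [mul_add, htφ]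
    have h4 : t ^ 2 * y ^ 2 ≤ 2 * c ^ 2 + 2 * (t ^ 2 * s ^ 2) := by
      calc t ^ 2 * y ^ 2 = (t * y) ^ 2 := by ring
        _ ≤ (c + t * |s|) ^ 2 := pow_le_pow_left₀ (by positivity) h3 2
        _ ≤ 2 * c ^ 2 + 2 * (t * |s|) ^ 2 := by linarith [sq_nonneg (c - t * |s|)]
        _ = _ := by rw [mul_pow, sq_abs]
    have h5 : t ^ 2 * s ^ 2 ≤ (s ^ 2 + 2 * c) * s ^ 2 := by gcongr
    set Z := 1 + |s| with hZ
    have hZ1 : 1 ≤ Z := by rw [hZ]; linarith [abs_nonneg s]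
    have hsZ : s ^ 2 ≤ Z ^ 2 := by
      rw [← sq_abs s]
      exact pow_le_pow_left₀ (abs_nonneg s) (by rw [hZ]; linarith) 2
    have hZ2 : 1 ≤ Z ^ 2 := one_le_pow₀ hZ1
    have hZ4 : Z ^ 4 = Z ^ 2 * Z ^ 2 := by ring
    have h6 : Z ^ 2 ≤ Z ^ 4 := by rw [hZ4]; exact le_mul_of_one_le_left (by positivity) hZ2
    have h7 : s ^ 2 * s ^ 2 ≤ Z ^ 4 := by rw [hZ4]; gcongr
    have h8 : (4 * c) * s ^ 2 ≤ (4 * c) * Z ^ 4 := by gcongr; linarith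
    have h9 : (2 * c + 2 * c ^ 2) * 1 ≤ (2 * c + 2 * c ^ 2) * Z ^ 4 := by gcongr; linarith
    linarith

set_option maxHeartbeats 800000 in
/-- The expansion of the regularised inverse power under an implicit step with displacement `s`,
relative to its value before the step. The terms that are odd in `s` are kept explicitly, as they
vanish on averaging over a centred Gaussian `s`; the remainder is at most of
order `v²`. -/
lemma exists_pointwise_bound (hc : 0 < c) {a : ℝ} (ha : 0 < a) :
    ∃ (G : ℝ) (N : ℕ), 0 < G ∧ 4 ≤ N ∧ ∀ A y s v : ℝ, 1 ≤ A → 0 ≤ y → v = (y ^ 2 + A)⁻¹ →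
      ((implicitRoot c (y + s) ^ 2 + A) * v) ^ (-a) ≤
        1 - a * ((implicitRoot c (y + s) ^ 2 - y ^ 2) * v)
        + 2 * a * (a + 1) * y ^ 2 * s ^ 2 * v ^ 2
        + a * (a + 1) / 2 * (4 * y * s ^ 3 + 8 * c * y * s) * v ^ 2
        - a * (a + 1) * (a + 2) / 6 * (8 * y ^ 3 * s ^ 3) * v ^ 3
        + G * (1 + |s|) ^ N * v ^ 2 := by
  obtain ⟨Ct, hCt, htay⟩ := exists_taylor_bound ha
  set k := ⌈a⌉₊ with hk
  set c₁ : ℝ := 1 + 2 * c with hc₁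
  set cq : ℝ := 3 + 6 * c + 2 * c ^ 2 with hcq
  have hc₁0 : 0 < c₁ := by positivity
  have hcq0 : 0 < cq := by positivity
  set G₁ : ℝ := a * (a + 1) / 2 * (4 * cq + c₁ ^ 2) with hG₁
  set G₂ : ℝ := a * (a + 1) * (a + 2) / 6 * (6 * c₁ ^ 2) with hG₂
  set G₃ : ℝ := Ct * (8 * (16 + c₁ ^ 4) * (2 * 8 ^ k)) with hG₃
  refine ⟨G₁ + G₂ + G₃, 8 + 2 * k, by positivity, by omega, ?_⟩
  intro A y s v hA hy hv
  obtain ⟨η, hη, hη0, hη1, hη2⟩ := implicitRoot_sq_eq hc hy s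
  have hcr := implicitRoot_crude hc (s := s) hA hy
  have hφ0 := implicitRoot_pos hc (y + s)
  set φ := implicitRoot c (y + s) with hφ
  have hR : 1 ≤ y ^ 2 + A := by linarith [sq_nonneg y]
  have hR0 : 0 < y ^ 2 + A := by linarith
  have hv0 : 0 < v := by rw [hv]; positivity
  have hvR : v * (y ^ 2 + A) = 1 := by rw [hv]; field_simp
  have hv1 : v ≤ 1 := by rw [hv]; exact inv_le_one_of_one_le₀ hR
  have hy2v : y ^ 2 * v ≤ 1 := by
    rw [← hvR, mul_comm]
    gcongr
    linarith
  have hyv : y * v ≤ 1 := by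
    have h1 : y ≤ y ^ 2 + A := by linarith [sq_nonneg (y - 1), sq_nonneg y]
    rw [← hvR, mul_comm]
    gcongr
  set u := s ^ 2 + 2 * c - η with hu
  have hu0 : 0 ≤ u := by linarith
  set Z := 1 + |s| with hZ
  have hs0 := abs_nonneg s
  have hZ1 : 1 ≤ Z := by rw [hZ]; linarith
  have hsZ1 : |s| ≤ Z := by rw [hZ]; linarith
  have hsZ : s ^ 2 ≤ Z ^ 2 := by
    rw [← sq_abs s]
    exact pow_le_pow_left₀ hs0 hsZ1 2
  have hZ2 : 1 ≤ Z ^ 2 := one_le_pow₀ hZ1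
  have hu1 : u ≤ c₁ * Z ^ 2 := by
    have : 2 * c * 1 ≤ 2 * c * Z ^ 2 := by gcongr
    rw [hc₁]; linarith
  have hu2 : u ^ 2 ≤ c₁ ^ 2 * Z ^ 4 := by
    calc u ^ 2 ≤ (c₁ * Z ^ 2) ^ 2 := pow_le_pow_left₀ hu0 hu1 2
      _ = _ := by ring
  set x := (φ ^ 2 - y ^ 2) * v with hx
  have hxe : x = (2 * y * s + u) * v := by rw [hx, hη]; ring
  have h1x : 1 + x = (φ ^ 2 + A) * v := by
    rw [hx]; linear_combination (-1 : ℝ) * hvR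
  have h1x0 : 0 < 1 + x := by rw [h1x]; positivity
  have hpow : ∀ i j : ℕ, i ≤ j → Z ^ i ≤ Z ^ j := fun i j hij => pow_le_pow_right₀ hZ1 hij
  have hZN : ∀ i : ℕ, i ≤ 8 + 2 * k → Z ^ i ≤ Z ^ (8 + 2 * k) := fun i hi => hpow i _ hi
  -- the quadratic term
  have t2 : x ^ 2 ≤ (4 * y ^ 2 * s ^ 2 + (4 * y * s ^ 3 + 8 * c * y * s)) * v ^ 2
      + (4 * cq + c₁ ^ 2) * Z ^ (8 + 2 * k) * v ^ 2 := by
    have h1 : -(s * (y * η)) ≤ Z * (cq * Z ^ 4) := by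
      have h2 : y * η ≤ cq * Z ^ 4 := by
        refine le_trans ?_ hη2
        have : y ≤ 1 + y ^ 2 := by linarith [sq_nonneg (y - 1), sq_nonneg y]
        calc y * η ≤ (1 + y ^ 2) * η := by gcongr
          _ = _ := by ring
      have h3 : 0 ≤ y * η := by positivity
      calc -(s * (y * η)) = -s * (y * η) := by ring
        _ ≤ |s| * (y * η) := mul_le_mul_of_nonneg_right (neg_le_abs s) h3
        _ ≤ Z * (cq * Z ^ 4) := by gcongr
    have h4 : (2 * y * s + u) ^ 2 ≤ 4 * y ^ 2 * s ^ 2 + (4 * y * s ^ 3 + 8 * c * y * s)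
        + (4 * cq + c₁ ^ 2) * Z ^ (8 + 2 * k) := by
      have e : (2 * y * s + u) ^ 2 = 4 * y ^ 2 * s ^ 2 + (4 * y * s ^ 3 + 8 * c * y * s)
          + 4 * (-(s * (y * η))) + u ^ 2 := by rw [hu]; ring
      have h5 : Z * (cq * Z ^ 4) ≤ cq * Z ^ (8 + 2 * k) := by
        calc Z * (cq * Z ^ 4) = cq * Z ^ 5 := by ring
          _ ≤ _ := by gcongr; omega
      have h6 : c₁ ^ 2 * Z ^ 4 ≤ c₁ ^ 2 * Z ^ (8 + 2 * k) := by gcongr; omega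
      rw [e]
      linarith
    calc x ^ 2 = (2 * y * s + u) ^ 2 * v ^ 2 := by rw [hxe]; ring
      _ ≤ (4 * y ^ 2 * s ^ 2 + (4 * y * s ^ 3 + 8 * c * y * s)
        + (4 * cq + c₁ ^ 2) * Z ^ (8 + 2 * k)) * v ^ 2 := by gcongr
      _ = _ := by ring
  -- the cubic term
  have t3 : -(x ^ 3) ≤ -(8 * y ^ 3 * s ^ 3) * v ^ 3 + 6 * c₁ ^ 2 * Z ^ (8 + 2 * k) * v ^ 2 := by
    have e : -(x ^ 3) = -(8 * y ^ 3 * s ^ 3) * v ^ 3 - 12 * (y ^ 2 * s ^ 2 * u * v ^ 3)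
        - 6 * (y * v * (s * u ^ 2) * v ^ 2) - u ^ 3 * v ^ 3 := by rw [hxe]; ring
    have h1 : 0 ≤ y ^ 2 * s ^ 2 * u * v ^ 3 := by positivity
    have h2 : 0 ≤ u ^ 3 * v ^ 3 := by positivity
    have h3 : -(y * v * (s * u ^ 2) * v ^ 2) ≤ c₁ ^ 2 * Z ^ (8 + 2 * k) * v ^ 2 := by
      have h4 : 0 ≤ y * v := by positivity
      have h5 : -(y * v * (s * u ^ 2)) ≤ c₁ ^ 2 * Z ^ (8 + 2 * k) := by
        calc -(y * v * (s * u ^ 2)) = y * v * (-s * u ^ 2) := by ring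
          _ ≤ y * v * (|s| * u ^ 2) := by
              gcongr
              exact neg_le_abs s
          _ ≤ 1 * (Z * (c₁ ^ 2 * Z ^ 4)) := by gcongr
          _ = c₁ ^ 2 * Z ^ 5 := by ring
          _ ≤ _ := by gcongr; omega
      calc -(y * v * (s * u ^ 2) * v ^ 2) = -(y * v * (s * u ^ 2)) * v ^ 2 := by ring
        _ ≤ _ := by gcongr
    rw [e]
    linarith
  -- the remainder
  have t4 : x ^ 4 * (1 + (1 + x) ^ (-a))
      ≤ 8 * (16 + c₁ ^ 4) * (2 * 8 ^ k) * Z ^ (8 + 2 * k) * v ^ 2 := by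
    have h1 : x ^ 4 ≤ 8 * (16 + c₁ ^ 4) * Z ^ 8 * v ^ 2 := by
      have h2 : (2 * y * s + u) ^ 4 ≤ 8 * (16 * (y ^ 2) ^ 2 * (s ^ 2) ^ 2 + (u ^ 2) ^ 2) := by
        have e1 : ∀ p q : ℝ, (p + q) ^ 4 ≤ 8 * (p ^ 4 + q ^ 4) := fun p q => by
          have h1 : (p + q) ^ 2 ≤ 2 * (p ^ 2 + q ^ 2) := by linarith [sq_nonneg (p - q)]
          have h2 : ((p + q) ^ 2) ^ 2 ≤ (2 * (p ^ 2 + q ^ 2)) ^ 2 :=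
            pow_le_pow_left₀ (sq_nonneg _) h1 2
          have h3 := sq_nonneg (p ^ 2 - q ^ 2)
          have e : (p + q) ^ 4 = ((p + q) ^ 2) ^ 2 := by ring
          rw [e]
          linarith
        refine (e1 _ _).trans (le_of_eq ?_)
        ring
      have h3 : (s ^ 2) ^ 2 ≤ Z ^ 8 := by
        calc (s ^ 2) ^ 2 ≤ (Z ^ 2) ^ 2 := pow_le_pow_left₀ (sq_nonneg _) hsZ 2
          _ = Z ^ 4 := by ring
          _ ≤ Z ^ 8 := hpow 4 8 (by norm_num)
      have h4 : (u ^ 2) ^ 2 ≤ c₁ ^ 4 * Z ^ 8 := by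
        calc (u ^ 2) ^ 2 ≤ (c₁ ^ 2 * Z ^ 4) ^ 2 := pow_le_pow_left₀ (sq_nonneg _) hu2 2
          _ = _ := by ring
      have h5 : (y ^ 2) ^ 2 * v ^ 4 ≤ v ^ 2 := by
        calc (y ^ 2) ^ 2 * v ^ 4 = (y ^ 2 * v) ^ 2 * v ^ 2 := by ring
          _ ≤ 1 ^ 2 * v ^ 2 := by gcongr
          _ = v ^ 2 := by ring
      have h6 : v ^ 4 ≤ v ^ 2 := pow_le_pow_of_le_one hv0.le hv1 (by norm_num)
      calc x ^ 4 = (2 * y * s + u) ^ 4 * v ^ 4 := by rw [hxe]; ring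
        _ ≤ 8 * (16 * (y ^ 2) ^ 2 * (s ^ 2) ^ 2 + (u ^ 2) ^ 2) * v ^ 4 := by gcongr
        _ = 8 * (16 * (s ^ 2) ^ 2 * ((y ^ 2) ^ 2 * v ^ 4) + (u ^ 2) ^ 2 * v ^ 4) := by ring
        _ ≤ 8 * (16 * Z ^ 8 * v ^ 2 + c₁ ^ 4 * Z ^ 8 * v ^ 2) := by gcongr
        _ = _ := by ring
    have h2 : 1 + (1 + x) ^ (-a) ≤ 2 * 8 ^ k * Z ^ (2 * k) := by
      have h3 : (1 + x)⁻¹ ≤ 8 * Z ^ 2 := by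
        rw [h1x, inv_le_comm₀ (by positivity) (by positivity), hv]
        rw [← div_eq_mul_inv, le_div_iff₀ hR0, inv_mul_le_iff₀ (by positivity)]
        refine hcr.trans ?_
        gcongr
        linarith
      have h8 : 1 ≤ 8 * Z ^ 2 := by linarith
      have h4 : (1 + x) ^ (-a) ≤ 8 ^ k * Z ^ (2 * k) := by
        rw [Real.rpow_neg h1x0.le, ← Real.inv_rpow h1x0.le]
        calc (1 + x)⁻¹ ^ a ≤ (8 * Z ^ 2) ^ a := Real.rpow_le_rpow (by positivity) h3 ha.le
          _ ≤ (8 * Z ^ 2) ^ (k : ℝ) := Real.rpow_le_rpow_of_exponent_le h8 (Nat.le_ceil a)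
          _ = 8 ^ k * Z ^ (2 * k) := by rw [Real.rpow_natCast, mul_pow, ← pow_mul]
      have h5 : 1 ≤ (8 : ℝ) ^ k * Z ^ (2 * k) :=
        one_le_mul_of_one_le_of_one_le (one_le_pow₀ (by norm_num)) (one_le_pow₀ hZ1)
      linarith
    have h3 : 0 ≤ 1 + (1 + x) ^ (-a) := by positivity
    calc x ^ 4 * (1 + (1 + x) ^ (-a))
        ≤ (8 * (16 + c₁ ^ 4) * Z ^ 8 * v ^ 2) * (2 * 8 ^ k * Z ^ (2 * k)) :=
          mul_le_mul h1 h2 h3 (by positivity)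
      _ = _ := by rw [pow_add]; ring
  have ht := htay x (by linarith)
  rw [← h1x]
  refine ht.trans ?_
  have r2 := mul_le_mul_of_nonneg_left t2 (by positivity : 0 ≤ a * (a + 1) / 2)
  have r3 := mul_le_mul_of_nonneg_left t3 (by positivity : 0 ≤ a * (a + 1) * (a + 2) / 6)
  have r4 := mul_le_mul_of_nonneg_left t4 hCt.le
  have eG : (G₁ + G₂ + G₃) * Z ^ (8 + 2 * k) * v ^ 2
      = a * (a + 1) / 2 * ((4 * cq + c₁ ^ 2) * Z ^ (8 + 2 * k) * v ^ 2)
        + a * (a + 1) * (a + 2) / 6 * (6 * c₁ ^ 2 * Z ^ (8 + 2 * k) * v ^ 2)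
        + Ct * (8 * (16 + c₁ ^ 4) * (2 * 8 ^ k) * Z ^ (8 + 2 * k) * v ^ 2) := by
    rw [hG₁, hG₂, hG₃]; ring
  rw [eG]
  linarith

end OneStep

end PosScheme

namespace PosScheme

section GaussianStep

lemma integral_gaussian_pow_one : ∫ z, z ∂gaussianReal 0 1 = 0 := by
  simp

lemma integral_gaussian_pow_two : ∫ z, z ^ 2 ∂gaussianReal 0 1 = 1 := by
  have h := variance_id_gaussianReal (μ := 0) (v := 1)
  rw [variance_of_integral_eq_zero (by fun_prop) (by simp)] at h
  simpa using h

lemma integral_gaussian_pow_three : ∫ z, z ^ 3 ∂gaussianReal 0 1 = 0 := by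
  have h : (gaussianReal 0 1).map (fun z : ℝ => -z) = gaussianReal 0 1 := by
    rw [gaussianReal_map_neg]; simp
  have h1 : ∫ z, z ^ 3 ∂gaussianReal 0 1 = ∫ z, (-z) ^ 3 ∂gaussianReal 0 1 := by
    conv_lhs => rw [← h]
    rw [integral_map (by fun_prop) (by fun_prop)]
  have h2 : ∫ z : ℝ, (-z) ^ 3 ∂gaussianReal 0 1 = -∫ z, z ^ 3 ∂gaussianReal 0 1 := by
    rw [← integral_neg]
    congr 1
    ext z
    ring
  linarith

lemma integrable_one_add_abs_pow (σ : ℝ) (N : ℕ) :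
    Integrable (fun z : ℝ => (1 + |σ * z|) ^ N) (gaussianReal 0 1) := by
  have h : ∀ z : ℝ, (1 + |σ * z|) ^ N = ∑ m ∈ Finset.range (N + 1),
      (|σ| ^ (N - m) * (N.choose m : ℝ)) * |z| ^ (N - m) := by
    intro z
    rw [add_pow]
    refine Finset.sum_congr rfl fun m _ => ?_
    rw [one_pow, abs_mul, mul_pow]
    ring
  simp_rw [h]
  exact integrable_finsetSum _ fun m _ => (integrable_abs_pow_gaussian _).const_mul _

/-- The Gaussian average of a function that is bounded by a cubic polynomial and a remainder: the
odd moments drop out. -/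
lemma lintegral_le_of_cubic {f : ℝ → ℝ} (hf : ∀ z, 0 ≤ f z) {σ α₀ α₁ α₂ α₃ α₄ : ℝ} {N : ℕ}
    (h : ∀ z, f z ≤ α₀ + α₁ * z + α₂ * z ^ 2 + α₃ * z ^ 3 + α₄ * (1 + |σ * z|) ^ N) :
    ∫⁻ z, ENNReal.ofReal (f z) ∂gaussianReal 0 1
      ≤ ENNReal.ofReal (α₀ + α₂ + α₄ * ∫ z, (1 + |σ * z|) ^ N ∂gaussianReal 0 1) := by
  have i1 : Integrable (fun z : ℝ => α₁ * z) (gaussianReal 0 1) := by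
    have := (integrable_pow_gaussian 1).const_mul α₁
    simpa using this
  have i2 := (integrable_pow_gaussian 2).const_mul α₂
  have i3 := (integrable_pow_gaussian 3).const_mul α₃
  have i4 := (integrable_one_add_abs_pow σ N).const_mul α₄
  have i0 : Integrable (fun _ : ℝ => α₀) (gaussianReal 0 1) := integrable_const _
  have i01 : Integrable (fun z : ℝ => α₀ + α₁ * z) (gaussianReal 0 1) := i0.add i1
  have i012 : Integrable (fun z : ℝ => α₀ + α₁ * z + α₂ * z ^ 2) (gaussianReal 0 1) := i01.add i2
  have i0123 : Integrable (fun z : ℝ => α₀ + α₁ * z + α₂ * z ^ 2 + α₃ * z ^ 3)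
      (gaussianReal 0 1) := i012.add i3
  have i01234 : Integrable (fun z : ℝ => α₀ + α₁ * z + α₂ * z ^ 2 + α₃ * z ^ 3
      + α₄ * (1 + |σ * z|) ^ N) (gaussianReal 0 1) := i0123.add i4
  have hI : ∫ z, (α₀ + α₁ * z + α₂ * z ^ 2 + α₃ * z ^ 3 + α₄ * (1 + |σ * z|) ^ N) ∂gaussianReal 0 1
      = α₀ + α₂ + α₄ * ∫ z, (1 + |σ * z|) ^ N ∂gaussianReal 0 1 := by
    rw [integral_add i0123 i4, integral_add i012 i3, integral_add i01 i2, integral_add i0 i1,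
      integral_const_mul, integral_const_mul, integral_const_mul, integral_const_mul,
      integral_gaussian_pow_one, integral_gaussian_pow_two,
      integral_gaussian_pow_three]
    simp
  rw [← hI, ofReal_integral_eq_lintegral_ofReal i01234
    (Filter.Eventually.of_forall fun z => (hf z).trans (h z))]
  exact lintegral_mono fun z => ENNReal.ofReal_le_ofReal (h z)

set_option maxHeartbeats 1000000 in
/-- The one-step expectation of the regularised inverse power `(y² + A) ^ (-b/2)` under the implicit
step with `h = 1`. For `b ≤ 2 c / σ² - 1` it decreases, with a gain of relative order `y⁻²` for
`b < 2 c / σ² - 1` and `y⁻⁴` in general. The gain of order `y⁻⁴` is due to the regularisation: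
large `A` makes the second order term of the expansion smaller by a multiple of `A`. For small `y`
the expansion is replaced by the convexity of the implicit step. -/
lemma exists_gaussian_step {c σ b β : ℝ} (hc : 0 < c) (hσ : σ ≠ 0) (hb : 0 < b) (hbβ : b ≤ β)
    (hβ : β = 2 * c / σ ^ 2 - 1) :
    ∃ A₀ : ℝ, 1 ≤ A₀ ∧ ∀ A, A₀ ≤ A → ∃ κ : ℝ, 0 < κ ∧ κ ≤ 1 ∧ ∀ y, 0 ≤ y →
      ∫⁻ z, ENNReal.ofReal ((implicitRoot c (y + σ * z) ^ 2 + A) ^ (-(b / 2))) ∂gaussianReal 0 1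
        ≤ ENNReal.ofReal ((y ^ 2 + A) ^ (-(b / 2)) *
          (1 - κ * (β - b) * (y ^ 2 + A)⁻¹ - κ * (y ^ 2 + A)⁻¹ ^ 2)) := by
  set a := b / 2 with ha
  have ha0 : 0 < a := by positivity
  obtain ⟨G, N, hG, hN, hpt⟩ := exists_pointwise_bound hc ha0
  set m := ∫ z, (1 + |σ * z|) ^ N ∂gaussianReal 0 1 with hm
  have hm0 : 0 ≤ m := integral_nonneg fun z => by positivity
  have hσ2 : 0 < σ ^ 2 := by positivity
  have hβσ : σ ^ 2 * (β + 1) = 2 * c := by rw [hβ]; field_simp; ring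
  -- below the threshold `y² = κ₀ (y² + A)` the second order term is at most half of the gain from
  -- the tangent of the implicit step
  set κ₀ : ℝ := c / (4 * (a + 1) * σ ^ 2) with hκ₀
  have hκ₀0 : 0 < κ₀ := by positivity
  have hκ₀e : 2 * (a + 1) * σ ^ 2 * κ₀ = c / 2 := by rw [hκ₀]; field_simp; norm_num
  set cq : ℝ := 3 + 6 * c + 2 * c ^ 2 with hcq
  have hcq0 : 0 < cq := by positivity
  set G' : ℝ := G + a * (cq / κ₀) with hG'
  have hG'0 : 0 < G' := by positivity
  -- the two summands make the regularisation dominate the remainder above and below the threshold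
  set A₀ : ℝ := 1 + (G' * m + 1) / (2 * a * (a + 1) * σ ^ 2) + 4 * (G * m) / (a * c) with hA₀
  have hA₀1 : 1 ≤ A₀ := by
    have h1 : 0 ≤ (G' * m + 1) / (2 * a * (a + 1) * σ ^ 2) := by positivity
    have h2 : 0 ≤ 4 * (G * m) / (a * c) := by positivity
    linarith
  refine ⟨A₀, hA₀1, fun A hA => ?_⟩
  have hA1 : 1 ≤ A := hA₀1.trans hA
  have hAa : G' * m + 1 ≤ 2 * a * (a + 1) * σ ^ 2 * A := by
    have h1 : (G' * m + 1) / (2 * a * (a + 1) * σ ^ 2) ≤ A := by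
      have h2 : 0 ≤ 4 * (G * m) / (a * c) := by positivity
      linarith
    rw [div_le_iff₀ (by positivity)] at h1
    linarith
  have hAb : 4 * (G * m) ≤ a * c * A := by
    have h1 : 4 * (G * m) / (a * c) ≤ A := by
      have h2 : 0 ≤ (G' * m + 1) / (2 * a * (a + 1) * σ ^ 2) := by positivity
      linarith
    rw [div_le_iff₀ (by positivity)] at h1
    linarith
  set κ : ℝ := min (min (a * σ ^ 2) 1) (a * c / 4 / (β - b + 1)) with hκ
  have hβb : 0 ≤ β - b := by linarith
  have hκ0 : 0 < κ := lt_min (lt_min (by positivity) one_pos) (by positivity)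
  have hκ1 : κ ≤ a * σ ^ 2 := (min_le_left _ _).trans (min_le_left _ _)
  have hκ2 : κ ≤ 1 := (min_le_left _ _).trans (min_le_right _ _)
  have hκ3 : κ * (β - b + 1) ≤ a * c / 4 := by
    have : κ ≤ a * c / 4 / (β - b + 1) := min_le_right _ _
    rwa [le_div_iff₀ (by positivity)] at this
  refine ⟨κ, hκ0, hκ2, fun y hy => ?_⟩
  set R := y ^ 2 + A with hR
  have hR1 : 1 ≤ R := by rw [hR]; linarith [sq_nonneg y]
  have hR0 : 0 < R := by linarith
  set v := R⁻¹ with hv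
  have hv0 : 0 < v := by positivity
  have hv1 : v ≤ 1 := inv_le_one_of_one_le₀ hR1
  have hvR : R * v = 1 := mul_inv_cancel₀ hR0.ne'
  have hfac : ∀ z, (implicitRoot c (y + σ * z) ^ 2 + A) ^ (-a)
      = R ^ (-a) * ((implicitRoot c (y + σ * z) ^ 2 + A) * v) ^ (-a) := by
    intro z
    rw [← Real.mul_rpow hR0.le (by positivity)]
    congr 1
    rw [mul_left_comm, hvR, mul_one]
  simp_rw [hfac]
  have hint : ∫⁻ z, ENNReal.ofReal (((implicitRoot c (y + σ * z) ^ 2 + A) * v) ^ (-a))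
      ∂gaussianReal 0 1 ≤ ENNReal.ofReal (1 - κ * (β - b) * v - κ * v ^ 2) := by
    have hf0 : ∀ z, 0 ≤ ((implicitRoot c (y + σ * z) ^ 2 + A) * v) ^ (-a) := fun z => by positivity
    have hsz : ∀ z, (σ * z) ^ 2 = σ ^ 2 * z ^ 2 := fun z => mul_pow _ _ _
    rcases le_total (κ₀ * R) (y ^ 2) with hcase | hcase
    · -- far from the origin the error `η` in the expansion of the square of the step is negligible
      have hbd : ∀ z, ((implicitRoot c (y + σ * z) ^ 2 + A) * v) ^ (-a) ≤
          (1 - a * (2 * c) * v)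
          + (-(2 * a * y * σ * v) + a * (a + 1) / 2 * (8 * c * y * σ) * v ^ 2) * z
          + (-(a * σ ^ 2 * v) + 2 * a * (a + 1) * y ^ 2 * σ ^ 2 * v ^ 2) * z ^ 2
          + (a * (a + 1) / 2 * (4 * y * σ ^ 3) * v ^ 2
            - a * (a + 1) * (a + 2) / 6 * (8 * y ^ 3 * σ ^ 3) * v ^ 3) * z ^ 3
          + (G' * v ^ 2) * (1 + |σ * z|) ^ N := by
        intro z
        have h1 := hpt A y (σ * z) v hA1 hy rfl
        obtain ⟨η, e1, e2, e3, e4⟩ := implicitRoot_sq_eq hc hy (σ * z)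
        rw [← hcq] at e4
        have h2 : a * (η * v) ≤ a * (cq / κ₀) * v ^ 2 * (1 + |σ * z|) ^ N := by
          have h3 : η * (κ₀ * R) ≤ cq * (1 + |σ * z|) ^ 4 := by
            refine le_trans ?_ e4
            gcongr
            linarith
          have h4 : (1 + |σ * z|) ^ 4 ≤ (1 + |σ * z|) ^ N :=
            pow_le_pow_right₀ (by linarith [abs_nonneg (σ * z)]) hN
          have h5 : η ≤ cq / κ₀ * v * (1 + |σ * z|) ^ N := by
            calc η = η * (κ₀ * R) * (v / κ₀) := by
                  have : κ₀ * R * (v / κ₀) = R * v := by field_simp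
                  rw [mul_assoc, this, hvR, mul_one]
              _ ≤ cq * (1 + |σ * z|) ^ N * (v / κ₀) := by
                  exact mul_le_mul_of_nonneg_right
                    (h3.trans (mul_le_mul_of_nonneg_left h4 hcq0.le)) (by positivity)
              _ = _ := by ring
          calc a * (η * v) ≤ a * (cq / κ₀ * v * (1 + |σ * z|) ^ N * v) := by gcongr
            _ = _ := by ring
        rw [e1] at h1
        rw [hG']
        refine h1.trans ?_
        have e : 1 - a * ((2 * y * (σ * z) + (σ * z) ^ 2 + 2 * c - η) * v)
            = 1 - a * (2 * c) * v - 2 * a * y * σ * v * z - a * σ ^ 2 * v * z ^ 2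
              + a * (η * v) := by
          ring
        rw [e]
        linarith
      refine (lintegral_le_of_cubic hf0 hbd).trans (ENNReal.ofReal_le_ofReal ?_)
      rw [← hm]
      have e1 : y ^ 2 * v = 1 - A * v := by
        have : (y ^ 2 + A) * v = 1 := hvR
        linarith
      have e2 : 2 * a * (a + 1) * y ^ 2 * σ ^ 2 * v ^ 2
          = 2 * a * (a + 1) * σ ^ 2 * v - 2 * a * (a + 1) * σ ^ 2 * A * v ^ 2 := by
        have : 2 * a * (a + 1) * y ^ 2 * σ ^ 2 * v ^ 2
          = 2 * a * (a + 1) * σ ^ 2 * v * (y ^ 2 * v) := by ring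
        rw [this, e1]; ring
      have e3 : (G' * m + 1) * v ^ 2 ≤ 2 * a * (a + 1) * σ ^ 2 * A * v ^ 2 := by gcongr
      have e4 : κ * (β - b) * v ≤ a * σ ^ 2 * (β - b) * v := by gcongr
      have e5 : κ * v ^ 2 ≤ 1 * v ^ 2 := by gcongr
      have e6 : a * σ ^ 2 * (β - b) * v
          = a * (2 * c) * v + a * σ ^ 2 * v - 2 * a * (a + 1) * σ ^ 2 * v := by
        have : b = 2 * a := by rw [ha]; ring
        rw [this]
        linear_combination a * v * hβσ
      rw [e2]
      linarith
    · -- close to the origin the square of the step lies above a tangent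
      obtain ⟨k, hk⟩ := exists_implicitRoot_tangent hc hy
      have hbd : ∀ z, ((implicitRoot c (y + σ * z) ^ 2 + A) * v) ^ (-a) ≤
          (1 - a * c * v)
          + (-(a * k * σ * v) + a * (a + 1) / 2 * (8 * c * y * σ) * v ^ 2) * z
          + (2 * a * (a + 1) * y ^ 2 * σ ^ 2 * v ^ 2) * z ^ 2
          + (a * (a + 1) / 2 * (4 * y * σ ^ 3) * v ^ 2
            - a * (a + 1) * (a + 2) / 6 * (8 * y ^ 3 * σ ^ 3) * v ^ 3) * z ^ 3
          + (G * v ^ 2) * (1 + |σ * z|) ^ N := by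
        intro z
        have h1 := hpt A y (σ * z) v hA1 hy rfl
        have h2 : a * ((c + k * (σ * z)) * v)
            ≤ a * ((implicitRoot c (y + σ * z) ^ 2 - y ^ 2) * v) := by
          gcongr
          exact hk _
        refine h1.trans ?_
        linarith
      refine (lintegral_le_of_cubic hf0 hbd).trans (ENNReal.ofReal_le_ofReal ?_)
      rw [← hm]
      have e1 : y ^ 2 * v ≤ κ₀ := by
        calc y ^ 2 * v ≤ κ₀ * R * v := by gcongr
          _ = κ₀ := by rw [mul_assoc, hvR, mul_one]
      have e2 : 2 * a * (a + 1) * y ^ 2 * σ ^ 2 * v ^ 2 ≤ a * c / 2 * v := by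
        calc 2 * a * (a + 1) * y ^ 2 * σ ^ 2 * v ^ 2
            = 2 * a * (a + 1) * σ ^ 2 * v * (y ^ 2 * v) := by ring
          _ ≤ 2 * a * (a + 1) * σ ^ 2 * v * κ₀ := by gcongr
          _ = a * v * (2 * (a + 1) * σ ^ 2 * κ₀) := by ring
          _ = _ := by rw [hκ₀e]; ring
      have hAv : A * v ≤ 1 := by
        rw [← hvR]
        gcongr
        rw [hR]; linarith [sq_nonneg y]
      have e3 : 4 * (G * v ^ 2 * m) ≤ a * c * v := by
        calc 4 * (G * v ^ 2 * m) = 4 * (G * m) * v ^ 2 := by ring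
          _ ≤ a * c * A * v ^ 2 := by gcongr
          _ = a * c * v * (A * v) := by ring
          _ ≤ a * c * v * 1 := by gcongr
          _ = _ := mul_one _
      have e4 : κ * (β - b) * v + κ * v ^ 2 ≤ a * c / 4 * v := by
        have h1 : κ * v ^ 2 ≤ κ * v := by
          gcongr
          nlinarith
        calc κ * (β - b) * v + κ * v ^ 2 ≤ κ * (β - b) * v + κ * v := by linarith
          _ = κ * (β - b + 1) * v := by ring
          _ ≤ _ := by gcongr
      linarith
  calc ∫⁻ z, ENNReal.ofReal (R ^ (-a) * ((implicitRoot c (y + σ * z) ^ 2 + A) * v) ^ (-a))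
        ∂gaussianReal 0 1
      = ENNReal.ofReal (R ^ (-a)) * ∫⁻ z, ENNReal.ofReal (((implicitRoot c (y + σ * z) ^ 2 + A) * v)
          ^ (-a)) ∂gaussianReal 0 1 := by
        rw [← lintegral_const_mul' _ _ ENNReal.ofReal_ne_top]
        congr 1
        ext z
        rw [ENNReal.ofReal_mul (by positivity)]
    _ ≤ ENNReal.ofReal (R ^ (-a)) * ENNReal.ofReal (1 - κ * (β - b) * v - κ * v ^ 2) :=
        mul_le_mul_right hint _
    _ = _ := by rw [← ENNReal.ofReal_mul (by positivity)]

/-- Raising the exponent beyond the critical one, the regularised inverse power still grows at most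
by a constant factor in one step. -/
lemma exists_gaussian_step_crude {c : ℝ} (hc : 0 < c) (σ : ℝ) (b : ℝ) (hb : 0 ≤ b) :
    ∃ C : ℝ, 0 < C ∧ ∀ A y, 1 ≤ A → 0 ≤ y →
      ∫⁻ z, ENNReal.ofReal ((implicitRoot c (y + σ * z) ^ 2 + A) ^ (-b)) ∂gaussianReal 0 1
        ≤ ENNReal.ofReal (C * (y ^ 2 + A) ^ (-b)) := by
  set k := ⌈b⌉₊ with hk
  set m := ∫ z, (1 + |σ * z|) ^ (2 * k) ∂gaussianReal 0 1 with hm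
  have hm0 : 0 ≤ m := integral_nonneg fun z => by positivity
  refine ⟨8 ^ k * m + 1, by positivity, fun A y hA hy => ?_⟩
  have hR0 : 0 < y ^ 2 + A := by positivity
  have hbd : ∀ z, (implicitRoot c (y + σ * z) ^ 2 + A) ^ (-b)
      ≤ 0 + 0 * z + 0 * z ^ 2 + 0 * z ^ 3
        + ((y ^ 2 + A) ^ (-b) * 8 ^ k) * (1 + |σ * z|) ^ (2 * k) := by
    intro z
    have h1 := implicitRoot_crude hc (s := σ * z) hA hy
    set Q := implicitRoot c (y + σ * z) ^ 2 + A with hQ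
    have hQ0 : 0 < Q := by rw [hQ]; positivity
    have h2 : 4 + 4 * (σ * z) ^ 2 ≤ 8 * (1 + |σ * z|) ^ 2 := by
      rw [← sq_abs (σ * z)]
      have := abs_nonneg (σ * z)
      nlinarith
    have h3 : 1 ≤ 8 * (1 + |σ * z|) ^ 2 := by nlinarith [sq_nonneg (σ * z)]
    have h4 : Q ^ (-b) ≤ (y ^ 2 + A) ^ (-b) * (8 * (1 + |σ * z|) ^ 2) ^ b := by
      rw [Real.rpow_neg hQ0.le, Real.rpow_neg hR0.le, inv_mul_eq_div, inv_eq_one_div,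
        div_le_div_iff₀ (by positivity) (by positivity), one_mul,
        ← Real.mul_rpow (by positivity) hQ0.le]
      exact Real.rpow_le_rpow hR0.le (h1.trans (by gcongr)) hb
    have h5 : (8 * (1 + |σ * z|) ^ 2) ^ b ≤ 8 ^ k * (1 + |σ * z|) ^ (2 * k) := by
      calc (8 * (1 + |σ * z|) ^ 2) ^ b ≤ (8 * (1 + |σ * z|) ^ 2) ^ (k : ℝ) :=
            Real.rpow_le_rpow_of_exponent_le h3 (Nat.le_ceil b)
        _ = _ := by rw [Real.rpow_natCast, mul_pow, ← pow_mul]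
    calc Q ^ (-b) ≤ (y ^ 2 + A) ^ (-b) * (8 ^ k * (1 + |σ * z|) ^ (2 * k)) :=
          h4.trans (by gcongr)
      _ = _ := by ring
  refine (lintegral_le_of_cubic (fun z => by positivity) hbd).trans (ENNReal.ofReal_le_ofReal ?_)
  rw [← hm]
  have : 0 ≤ (y ^ 2 + A) ^ (-b) := by positivity
  nlinarith

end GaussianStep

end PosScheme

/-! ### Supermartingale estimates for Markov chains driven by Brownian increments -/

namespace PosScheme

section Chain

variable {Ω : Type*} [mΩ : MeasurableSpace Ω] {Pr : Measure Ω} [IsProbabilityMeasure Pr]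
  {ℱ : Filtration ℝ≥0 mΩ} {W : ℝ≥0 → Ω → ℝ}

/-- The chain `U_{n+1} = Ψ(U_n, W_{(n+1)h} - W_{nh})`. -/
noncomputable def brownianChain (W : ℝ≥0 → Ω → ℝ) (Ψ : ℝ → ℝ → ℝ) (h : ℝ≥0) (x₀ : ℝ) :
    ℕ → Ω → ℝ
  | 0, _ => x₀
  | n + 1, ω => Ψ (brownianChain W Ψ h x₀ n ω) (W ((n + 1 : ℕ) * h) ω - W (n * h) ω)

lemma IsBrownianOn.measurable_chain (hW : IsBrownianOn Pr ℱ W) {Ψ : ℝ → ℝ → ℝ}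
    (hΨ : Measurable (Function.uncurry Ψ)) (h : ℝ≥0) (x₀ : ℝ) (n : ℕ) :
    Measurable[ℱ (n * h)] (brownianChain W Ψ h x₀ n) := by
  induction n with
  | zero => exact measurable_const
  | succ n ih =>
    have hle : (n : ℝ≥0) * h ≤ (n + 1 : ℕ) * h := by gcongr; simp
    have h1 : Measurable[ℱ ((n + 1 : ℕ) * h)] (fun ω => W ((n + 1 : ℕ) * h) ω - W (n * h) ω) :=
      (hW.adapted _).sub ((hW.adapted _).mono (ℱ.mono hle) le_rfl)
    exact hΨ.comp ((ih.mono (ℱ.mono hle) le_rfl).prodMk h1)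

lemma IsBrownianOn.lintegral_chain_step (hW : IsBrownianOn Pr ℱ W) {Ψ : ℝ → ℝ → ℝ}
    (hΨ : Measurable (Function.uncurry Ψ)) (h : ℝ≥0) (x₀ : ℝ) (n : ℕ) {S : Set Ω}
    (hS : MeasurableSet[ℱ (n * h)] S) {V : ℝ → ℝ≥0∞} (hV : Measurable V) :
    ∫⁻ ω in S, V (brownianChain W Ψ h x₀ (n + 1) ω) ∂Pr
      = ∫⁻ ω in S, ∫⁻ z, V (Ψ (brownianChain W Ψ h x₀ n ω) (Real.sqrt h * z)) ∂gaussianReal 0 1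
        ∂Pr := by
  have hle : (n : ℝ≥0) * h ≤ (n + 1 : ℕ) * h := by gcongr; simp
  have h1 := hW.lintegral_step hle hS (hW.measurable_chain hΨ h x₀ n)
    (G := fun y δ => V (Ψ y δ)) (hV.comp hΨ)
  have h2 : ((n + 1 : ℕ) * h - n * h : ℝ≥0) = h := by
    push_cast
    rw [add_mul, one_mul, add_tsub_cancel_left]
  rw [h2] at h1
  exact h1

variable {Ψ : ℝ → ℝ → ℝ} {h : ℝ≥0} {x₀ : ℝ} {V g e : ℝ → ℝ≥0∞}

lemma lintegral_step_le (hW : IsBrownianOn Pr ℱ W) (hΨ : Measurable (Function.uncurry Ψ))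
    (hV : Measurable V) (hg : Measurable g) (he : Measurable e)
    (hpos : ∀ n ω, 0 < brownianChain W Ψ h x₀ n ω)
    (hstep : ∀ y, 0 < y →
      ∫⁻ z, V (Ψ y (Real.sqrt h * z)) ∂gaussianReal 0 1 + g y ≤ V y + e y)
    (n : ℕ) {S : Set Ω} (hS : MeasurableSet[ℱ (n * h)] S) :
    ∫⁻ ω in S, V (brownianChain W Ψ h x₀ (n + 1) ω) ∂Pr
        + ∫⁻ ω in S, g (brownianChain W Ψ h x₀ n ω) ∂Pr
      ≤ ∫⁻ ω in S, V (brownianChain W Ψ h x₀ n ω) ∂Pr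
        + ∫⁻ ω in S, e (brownianChain W Ψ h x₀ n ω) ∂Pr := by
  have hm : Measurable (brownianChain W Ψ h x₀ n) :=
    (hW.measurable_chain hΨ h x₀ n).mono (ℱ.le _) le_rfl
  rw [hW.lintegral_chain_step hΨ h x₀ n hS hV,
    ← lintegral_add_right _ (g := fun ω => g (brownianChain W Ψ h x₀ n ω)) (hg.comp hm),
    ← lintegral_add_right _ (g := fun ω => e (brownianChain W Ψ h x₀ n ω)) (he.comp hm)]
  exact lintegral_mono fun ω => hstep _ (hpos n ω)

/-- The gains in a supermartingale inequality sum up to at most the initial value and the errors. -/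
lemma lintegral_add_sum_le (hW : IsBrownianOn Pr ℱ W) (hΨ : Measurable (Function.uncurry Ψ))
    (hV : Measurable V) (hg : Measurable g) (he : Measurable e)
    (hpos : ∀ n ω, 0 < brownianChain W Ψ h x₀ n ω)
    (hstep : ∀ y, 0 < y →
      ∫⁻ z, V (Ψ y (Real.sqrt h * z)) ∂gaussianReal 0 1 + g y ≤ V y + e y) (n : ℕ) :
    ∫⁻ ω, V (brownianChain W Ψ h x₀ n ω) ∂Pr
        + ∑ m ∈ Finset.range n, ∫⁻ ω, g (brownianChain W Ψ h x₀ m ω) ∂Pr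
      ≤ V x₀ + ∑ m ∈ Finset.range n, ∫⁻ ω, e (brownianChain W Ψ h x₀ m ω) ∂Pr := by
  induction n with
  | zero => simp [brownianChain]
  | succ n ih =>
    have h1 := lintegral_step_le hW hΨ hV hg he hpos hstep n (S := univ) MeasurableSet.univ
    simp only [Measure.restrict_univ] at h1
    rw [Finset.sum_range_succ, Finset.sum_range_succ]
    calc ∫⁻ ω, V (brownianChain W Ψ h x₀ (n + 1) ω) ∂Pr
          + (∑ m ∈ Finset.range n, ∫⁻ ω, g (brownianChain W Ψ h x₀ m ω) ∂Pr
            + ∫⁻ ω, g (brownianChain W Ψ h x₀ n ω) ∂Pr)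
        = (∫⁻ ω, V (brownianChain W Ψ h x₀ (n + 1) ω) ∂Pr
            + ∫⁻ ω, g (brownianChain W Ψ h x₀ n ω) ∂Pr)
          + ∑ m ∈ Finset.range n, ∫⁻ ω, g (brownianChain W Ψ h x₀ m ω) ∂Pr := by ring
      _ ≤ (∫⁻ ω, V (brownianChain W Ψ h x₀ n ω) ∂Pr
            + ∫⁻ ω, e (brownianChain W Ψ h x₀ n ω) ∂Pr)
          + ∑ m ∈ Finset.range n, ∫⁻ ω, g (brownianChain W Ψ h x₀ m ω) ∂Pr := by gcongr
      _ = (∫⁻ ω, V (brownianChain W Ψ h x₀ n ω) ∂Pr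
            + ∑ m ∈ Finset.range n, ∫⁻ ω, g (brownianChain W Ψ h x₀ m ω) ∂Pr)
          + ∫⁻ ω, e (brownianChain W Ψ h x₀ n ω) ∂Pr := by ring
      _ ≤ _ := by rw [← add_assoc]; gcongr

/-- The maximal inequality for a nonnegative supermartingale with errors. -/
lemma maximal_inequality (hW : IsBrownianOn Pr ℱ W) (hΨ : Measurable (Function.uncurry Ψ))
    (hV : Measurable V) (he : Measurable e)
    (hpos : ∀ n ω, 0 < brownianChain W Ψ h x₀ n ω)
    (hstep : ∀ y, 0 < y →
      ∫⁻ z, V (Ψ y (Real.sqrt h * z)) ∂gaussianReal 0 1 ≤ V y + e y) (lam : ℝ≥0∞) (n : ℕ) :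
    lam * Pr {ω | ∃ m ≤ n, lam ≤ V (brownianChain W Ψ h x₀ m ω)}
      ≤ V x₀ + ∑ m ∈ Finset.range n, ∫⁻ ω, e (brownianChain W Ψ h x₀ m ω) ∂Pr := by
  set U := brownianChain W Ψ h x₀ with hU
  have hUm : ∀ m : ℕ, Measurable[ℱ (m * h)] (U m) := hW.measurable_chain hΨ h x₀
  set N : ℕ → Set Ω := fun n => {ω | ∃ m ≤ n, lam ≤ V (U m ω)} with hN
  have hmono : ∀ i j : ℕ, i ≤ j → (i : ℝ≥0) * h ≤ j * h := fun i j hij => by gcongr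
  have hNm : ∀ n : ℕ, MeasurableSet[ℱ (n * h)] (N n) := by
    intro n
    have : N n = ⋃ m ∈ Finset.range (n + 1), {ω | lam ≤ V (U m ω)} := by
      ext ω
      simp [hN]
    rw [this]
    refine Finset.measurableSet_biUnion _ fun m hm => ?_
    have hm' : m ≤ n := Nat.lt_succ_iff.1 (Finset.mem_range.1 hm)
    exact measurableSet_le measurable_const
      (hV.comp ((hUm m).mono (ℱ.mono (hmono m n hm')) le_rfl))
  have key : ∀ n, lam * Pr (N n) + ∫⁻ ω in (N n)ᶜ, V (U n ω) ∂Pr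
      ≤ V x₀ + ∑ m ∈ Finset.range n, ∫⁻ ω, e (U m ω) ∂Pr := by
    intro n
    induction n with
    | zero =>
      have h0 : ∀ ω, V (U 0 ω) = V x₀ := fun ω => rfl
      by_cases hx : lam ≤ V x₀
      · have : N 0 = univ := by
          ext ω
          simp [hN, h0, hx]
        simp [this, hx]
      · have : N 0 = ∅ := by
          ext ω
          simpa [hN, h0] using hx
        simp [this, h0]
    | succ n ih =>
      have hsub : N n ⊆ N (n + 1) := fun ω ⟨m, hm, h1⟩ => ⟨m, hm.trans (Nat.le_succ n), h1⟩
      have hNn : MeasurableSet (N n) := ℱ.le _ _ (hNm n)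
      have hNn1 : MeasurableSet (N (n + 1)) := ℱ.le _ _ (hNm (n + 1))
      have hstep' := lintegral_step_le hW hΨ hV (g := 0) measurable_const he hpos
        (fun y hy => by simpa using hstep y hy) n (hNm n).compl
      simp only [Pi.zero_apply, lintegral_zero, add_zero] at hstep'
      have hnew : lam * Pr (N (n + 1) \ N n)
          ≤ ∫⁻ ω in N (n + 1) \ N n, V (U (n + 1) ω) ∂Pr := by
        rw [← setLIntegral_const]
        refine setLIntegral_mono' (hNn1.diff hNn) fun ω hω => ?_
        obtain ⟨⟨m, hm, h1⟩, h2⟩ := hω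
        rcases Nat.lt_or_ge n m with h3 | h3
        · have : m = n + 1 := le_antisymm hm h3
          rwa [← this]
        · exact absurd ⟨m, h3, h1⟩ h2
      have hsplit : (N n)ᶜ = (N (n + 1) \ N n) ∪ (N (n + 1))ᶜ := by
        ext ω
        by_cases h1 : ω ∈ N (n + 1)
        · simp [h1]
        · have : ω ∉ N n := fun h2 => h1 (hsub h2)
          simp [h1, this]
      have hdisj : Disjoint (N (n + 1) \ N n) (N (n + 1))ᶜ :=
        disjoint_left.2 fun ω h1 h2 => h2 h1.1
      have hmeas : Pr (N (n + 1)) = Pr (N n) + Pr (N (n + 1) \ N n) := by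
        rw [measure_sdiff hsub hNn.nullMeasurableSet (measure_ne_top _ _),
          add_tsub_cancel_of_le (measure_mono hsub)]
      rw [Finset.sum_range_succ, ← add_assoc]
      calc lam * Pr (N (n + 1)) + ∫⁻ ω in (N (n + 1))ᶜ, V (U (n + 1) ω) ∂Pr
          = lam * Pr (N n) + lam * Pr (N (n + 1) \ N n)
            + ∫⁻ ω in (N (n + 1))ᶜ, V (U (n + 1) ω) ∂Pr := by rw [hmeas, mul_add]
        _ ≤ lam * Pr (N n) + ∫⁻ ω in N (n + 1) \ N n, V (U (n + 1) ω) ∂Pr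
            + ∫⁻ ω in (N (n + 1))ᶜ, V (U (n + 1) ω) ∂Pr := by gcongr
        _ = lam * Pr (N n) + ∫⁻ ω in (N n)ᶜ, V (U (n + 1) ω) ∂Pr := by
            rw [add_assoc, ← lintegral_union hNn1.compl hdisj, ← hsplit]
        _ ≤ lam * Pr (N n) + (∫⁻ ω in (N n)ᶜ, V (U n ω) ∂Pr
            + ∫⁻ ω in (N n)ᶜ, e (U n ω) ∂Pr) := by gcongr
        _ = lam * Pr (N n) + ∫⁻ ω in (N n)ᶜ, V (U n ω) ∂Pr
            + ∫⁻ ω in (N n)ᶜ, e (U n ω) ∂Pr := by rw [add_assoc]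
        _ ≤ _ := add_le_add ih (setLIntegral_le_lintegral _ _)
  exact le_self_add.trans (key n)

end Chain

end PosScheme

/-! ### A potential function for the scheme -/

namespace PosScheme

section Potential

/-- A weaker singularity at the origin is dominated by a small multiple of a stronger one. -/
lemma rpow_neg_le_add {e e' ε : ℝ} (he : 0 < e) (hee : e < e') (hε : 0 < ε) :
    ∃ C : ℝ, 0 < C ∧ ∀ ρ : ℝ, 0 < ρ → ρ ^ (-e) ≤ ε * ρ ^ (-e') + C := by
  have hd : 0 < e' - e := by linarith
  set ρ₀ := ε ^ (1 / (e' - e)) with hρ₀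
  have hρ₀0 : 0 < ρ₀ := by positivity
  refine ⟨ρ₀ ^ (-e), by positivity, fun ρ hρ => ?_⟩
  rcases le_total ρ ρ₀ with h | h
  · have h1 : ρ ^ (e' - e) ≤ ε := by
      calc ρ ^ (e' - e) ≤ ρ₀ ^ (e' - e) := Real.rpow_le_rpow hρ.le h hd.le
        _ = ε := by
          rw [hρ₀, ← Real.rpow_mul hε.le, one_div_mul_cancel hd.ne', Real.rpow_one]
    have h2 : ρ ^ (-e) = ρ ^ (e' - e) * ρ ^ (-e') := by
      rw [← Real.rpow_add hρ]; ring_nf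
    rw [h2]
    have : 0 < ρ₀ ^ (-e) := by positivity
    have : ρ ^ (e' - e) * ρ ^ (-e') ≤ ε * ρ ^ (-e') := by gcongr
    linarith
  · have h1 : ρ ^ (-e) ≤ ρ₀ ^ (-e) := Real.rpow_le_rpow_of_nonpos hρ₀0 h (by linarith)
    have : 0 ≤ ε * ρ ^ (-e') := by positivity
    linarith

lemma one_sub_rpow_neg_le {e t : ℝ} (he : 0 < e) (ht : 0 ≤ t) (ht2 : t ≤ 1 / 2) :
    (1 - t) ^ (-e) ≤ 1 + 2 * e * Real.exp e * t := by
  have h1 : (1 - t)⁻¹ ≤ Real.exp (2 * t) := by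
    rw [inv_le_iff_one_le_mul₀ (by linarith)]
    have := Real.add_one_le_exp (2 * t)
    nlinarith
  have h2 : (1 - t) ^ (-e) ≤ Real.exp (2 * e * t) := by
    rw [Real.rpow_neg (by linarith), ← Real.inv_rpow (by linarith)]
    calc (1 - t)⁻¹ ^ e ≤ (Real.exp (2 * t)) ^ e :=
          Real.rpow_le_rpow (inv_nonneg.2 (by linarith)) h1 he.le
      _ = Real.exp (2 * e * t) := by rw [← Real.exp_mul]; ring_nf
  have h3 : Real.exp (2 * e * t) ≤ 1 + 2 * e * t * Real.exp (2 * e * t) := by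
    have h4 := Real.add_one_le_exp (-(2 * e * t))
    rw [Real.exp_neg] at h4
    have h5 := Real.exp_pos (2 * e * t)
    have h6 := mul_le_mul_of_nonneg_right h4 h5.le
    rw [inv_mul_cancel₀ h5.ne'] at h6
    linarith
  have h7 : Real.exp (2 * e * t) ≤ Real.exp e := Real.exp_le_exp.2 (by nlinarith)
  have h8 : 2 * e * t * Real.exp (2 * e * t) ≤ 2 * e * t * Real.exp e := by gcongr
  linarith

/-- Lowering the argument of a regularised inverse power `(φ² + b) ^ (-e)` by `δ ≤ √b / 4`. -/
lemma shift_rpow_le {e b δ φ w : ℝ} (he : 0 < e) (hb : 0 < b) (hδ : 0 ≤ δ) (hδb : 16 * δ ^ 2 ≤ b)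
    (hφ : 0 ≤ φ) (hφw : φ - δ ≤ w) :
    (w ^ 2 + b) ^ (-e)
      ≤ (φ ^ 2 + b) ^ (-e) + 4 * e * Real.exp e * δ * (φ ^ 2 + b) ^ (-(e + 1 / 2)) := by
  set ρ := φ ^ 2 + b with hρ
  have hρ0 : 0 < ρ := by positivity
  have hs0 : 0 < Real.sqrt ρ := Real.sqrt_pos.2 hρ0
  have hss : Real.sqrt ρ ^ 2 = ρ := Real.sq_sqrt hρ0.le
  have hφs : φ ≤ Real.sqrt ρ := Real.le_sqrt_of_sq_le (by rw [hρ]; linarith)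
  have hδs : 4 * δ ≤ Real.sqrt ρ := Real.le_sqrt_of_sq_le (by rw [hρ]; nlinarith [sq_nonneg φ])
  set t := 2 * δ / Real.sqrt ρ with ht
  have ht0 : 0 ≤ t := by positivity
  have ht2 : t ≤ 1 / 2 := by
    rw [ht, div_le_iff₀ hs0]; linarith
  have hts : t * ρ = 2 * δ * Real.sqrt ρ := by
    rw [ht]
    nth_rewrite 2 [← hss]
    field_simp
  have h1 : ρ * (1 - t) ≤ w ^ 2 + b := by
    have h2 : φ ^ 2 - 2 * φ * δ ≤ w ^ 2 := by
      rcases le_total δ φ with h | h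
      · have : (φ - δ) ^ 2 ≤ w ^ 2 := pow_le_pow_left₀ (by linarith) hφw 2
        nlinarith [sq_nonneg δ]
      · nlinarith [sq_nonneg w]
    have h3 : 2 * φ * δ ≤ t * ρ := by
      rw [hts]
      have := mul_le_mul_of_nonneg_right hφs hδ
      linarith
    have h4 : ρ * (1 - t) = φ ^ 2 + b - t * ρ := by rw [hρ]; ring
    rw [h4]
    linarith
  have h5 : (w ^ 2 + b) ^ (-e) ≤ (ρ * (1 - t)) ^ (-e) :=
    Real.rpow_le_rpow_of_nonpos (mul_pos hρ0 (by linarith)) h1 (by linarith)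
  rw [Real.mul_rpow hρ0.le (by linarith)] at h5
  have h6 := mul_le_mul_of_nonneg_left (one_sub_rpow_neg_le he ht0 ht2)
    (by positivity : 0 ≤ ρ ^ (-e))
  have h7 : ρ ^ (-e) * t = 2 * δ * ρ ^ (-(e + 1 / 2)) := by
    have : ρ ^ (-(e + 1 / 2)) = ρ ^ (-e) * (Real.sqrt ρ)⁻¹ := by
      rw [Real.sqrt_eq_rpow, ← Real.rpow_neg hρ0.le, ← Real.rpow_add hρ0]
      ring_nf
    rw [this, ht]
    ring
  calc (w ^ 2 + b) ^ (-e) ≤ ρ ^ (-e) * (1 + 2 * e * Real.exp e * t) := h5.trans h6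
    _ = ρ ^ (-e) + 2 * e * Real.exp e * (ρ ^ (-e) * t) := by ring
    _ = _ := by rw [h7]; ring

lemma rpow_neg_le_mul_rpow {h y e : ℝ} {D : ℕ} (hh : 0 < h) (hy : 0 < y)
    (hhy : 1 ≤ h * y ^ (2 * D)) (he : 0 ≤ e) :
    h ^ (-e) ≤ h * (1 + y) ^ ((D : ℝ) * (2 * (e + 1))) := by
  have h1 : 1 ≤ (h * y ^ (2 * D)) ^ (e + 1) := Real.one_le_rpow hhy (by linarith)
  have h2 : (h * y ^ (2 * D)) ^ (e + 1) = h ^ (e + 1) * y ^ ((D : ℝ) * (2 * (e + 1))) := by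
    rw [Real.mul_rpow hh.le (by positivity), ← Real.rpow_natCast y, ← Real.rpow_mul hy.le]
    push_cast
    ring_nf
  calc h ^ (-e) = h ^ (-e) * 1 := (mul_one _).symm
    _ ≤ h ^ (-e) * (h ^ (e + 1) * y ^ ((D : ℝ) * (2 * (e + 1)))) := by
        rw [← h2]; gcongr
    _ = h * y ^ ((D : ℝ) * (2 * (e + 1))) := by
        rw [← mul_assoc, ← Real.rpow_add hh]
        have : -e + (e + 1) = 1 := by ring
        rw [this, Real.rpow_one]
    _ ≤ _ := by
        gcongr
        linarith

lemma lintegral_four {α : Type*} [MeasurableSpace α] (ν : Measure α) {f₁ g₁ f₂ g₂ : α → ℝ≥0∞}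
    (hf₁ : Measurable f₁) (hg₁ : Measurable g₁) (hf₂ : Measurable f₂) (hg₂ : Measurable g₂)
    (a b : ℝ≥0∞) :
    ∫⁻ z, ((f₁ z + a * g₁ z) + (f₂ z + b * g₂ z)) ∂ν
      = (∫⁻ z, f₁ z ∂ν + a * ∫⁻ z, g₁ z ∂ν) + (∫⁻ z, f₂ z ∂ν + b * ∫⁻ z, g₂ z ∂ν) := by
  rw [← lintegral_const_mul _ hg₁, ← lintegral_const_mul _ hg₂, ← lintegral_add_left hf₁,
    ← lintegral_add_left hf₂]
  exact lintegral_add_left (hf₁.add (hg₁.const_mul _)) _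

/-- The step estimates for general step size `h`, by scaling. -/
lemma lintegral_scale_step {c h σ y A e : ℝ} (hh : 0 < h) (hA : 0 < A) :
    ∫⁻ z, ENNReal.ofReal ((implicitRoot (c * h) (y + σ * (Real.sqrt h * z)) ^ 2 + A * h) ^ (-e))
        ∂gaussianReal 0 1
      = ENNReal.ofReal (h ^ (-e)) * ∫⁻ z, ENNReal.ofReal
        ((implicitRoot c (y / Real.sqrt h + σ * z) ^ 2 + A) ^ (-e)) ∂gaussianReal 0 1 := by
  have hs : 0 < Real.sqrt h := Real.sqrt_pos.2 hh
  have hss : Real.sqrt h ^ 2 = h := Real.sq_sqrt hh.le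
  rw [← lintegral_const_mul' _ _ ENNReal.ofReal_ne_top]
  congr 1
  ext z
  rw [← ENNReal.ofReal_mul (by positivity), ← Real.mul_rpow hh.le (by positivity)]
  congr 2
  have : y + σ * (Real.sqrt h * z) = Real.sqrt h * (y / Real.sqrt h + σ * z) := by
    field_simp
  rw [this, implicitRoot_scale hh, mul_pow, hss]
  ring

lemma rpow_scale {h y A e : ℝ} (hh : 0 < h) (hA : 0 < A) :
    h ^ (-e) * ((y / Real.sqrt h) ^ 2 + A) ^ (-e) = (y ^ 2 + A * h) ^ (-e) := by
  have hss : Real.sqrt h ^ 2 = h := Real.sq_sqrt hh.le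
  rw [← Real.mul_rpow hh.le (by positivity), div_pow, hss]
  congr 1
  field_simp

lemma inv_scale {h y A : ℝ} (hh : 0 < h) (hA : 0 < A) :
    ((y / Real.sqrt h) ^ 2 + A)⁻¹ = h * (y ^ 2 + A * h)⁻¹ := by
  have hss : Real.sqrt h ^ 2 = h := Real.sq_sqrt hh.le
  rw [div_pow, hss]
  have : 0 < y ^ 2 + A * h := by positivity
  have : 0 < y ^ 2 / h + A := by positivity
  field_simp

end Potential

variable {T : ℝ≥0} {P : ℝ≥0 → ℝ → ℝ} {q : FLP} {c K L m₁ m₂ : ℝ}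

/-- The explicit part of a step is at most `O(h)` below the identity: near `0` because the drift
is bounded below and `P` lowers its argument only by `O(h²)`, and away from `0` by polynomial
growth. -/
lemma SchemeBounds.exists_le_schemeMap (B : SchemeBounds T P (muHat q.eval c) c K L m₁ m₂) :
    ∃ (C : ℝ) (D : ℕ), 1 ≤ C ∧ 1 ≤ D ∧ ∀ h, IsStepSize T h → ∀ y, 0 < y →
      y - C * h * (1 + y ^ D) ≤ schemeMap P (muHat q.eval c) h y := by
  obtain ⟨C₁, D, hC₁, hg⟩ := B.exists_growth
  have hK := B.K_ge
  have hL := B.L_pos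
  obtain ⟨C₂, hC₂, hlow⟩ := OneSidedLipschitz.exists_lower (f := muHat q.eval c)
    ⟨L, hL, B.osl⟩ (3 + 3 * K) (by linarith)
  refine ⟨C₁ + 3 * K + C₂, D + 1, by linarith, by omega, fun h hh y hy => ?_⟩
  have hpos := hh.pos B.T_pos
  have hle1 := hh.le_one
  have hyD : 0 < y ^ (D + 1) := by positivity
  rcases le_total 1 y with h1 | h1
  · have h2 := (abs_le.1 (hg h hh y h1)).2
    have h3 : y ^ D ≤ y ^ (D + 1) := pow_le_pow_right₀ h1 (Nat.le_succ D)
    have h4 : C₁ * h * y ^ D ≤ (C₁ + 3 * K + C₂) * h * (1 + y ^ (D + 1)) := by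
      gcongr
      · linarith
      · linarith
    linarith
  · have h2 := B.le_P hh hy le_rfl h1
    rw [Real.one_rpow, mul_one] at h2
    have h3 := hlow _ (B.pos h hh y hy) ((B.P_le hh hy).trans (by linarith))
    have h4 : (h : ℝ) ^ 2 ≤ h := by nlinarith
    have h5 : 3 * K * (h : ℝ) ^ 2 ≤ 3 * K * h := by gcongr
    have h6 : (h : ℝ) * -C₂ ≤ h * muHat q.eval c (P h y) := by gcongr
    have h7 : (C₁ + 3 * K + C₂) * h * 1 ≤ (C₁ + 3 * K + C₂) * h * (1 + y ^ (D + 1)) := by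
      gcongr
      linarith
    have h8 : 0 ≤ C₁ * (h : ℝ) := by positivity
    unfold schemeMap
    linarith

set_option maxHeartbeats 1000000 in
/-- The potential `ρ ^ (-β/2) + ρ ^ (-β/2 + 1/4)`, `ρ = y² + A h`, is a supermartingale of the
scheme up to errors of order `h`, and decreases on average by at least `κ h² ρ ^ (-β/2 - 2)`. The
second summand is there to absorb the perturbations of lower order. -/
lemma SchemeBounds.exists_potential_step (B : SchemeBounds T P (muHat q.eval c) c K L m₁ m₂)
    {σ β : ℝ} (hσ : σ ≠ 0) (hβ : β = 2 * c / σ ^ 2 - 1) (hβ1 : 1 ≤ β) :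
    ∃ (A κ C : ℝ) (r : ℕ), 1 ≤ A ∧ 0 < κ ∧ 0 < C ∧ ∀ h, IsStepSize T h → ∀ y, 0 < y →
      ∫⁻ z, ENNReal.ofReal
          ((implicitRoot (c * h) (schemeMap P (muHat q.eval c) h y + σ * (Real.sqrt h * z)) ^ 2
              + A * h) ^ (-(β / 2))
          + (implicitRoot (c * h) (schemeMap P (muHat q.eval c) h y + σ * (Real.sqrt h * z)) ^ 2
              + A * h) ^ (-(β / 2 - 1 / 4))) ∂gaussianReal 0 1
        + ENNReal.ofReal (κ * h ^ 2 * (y ^ 2 + A * h) ^ (-(β / 2 + 2)))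
      ≤ ENNReal.ofReal ((y ^ 2 + A * h) ^ (-(β / 2)) + (y ^ 2 + A * h) ^ (-(β / 2 - 1 / 4)))
        + ENNReal.ofReal (C * h * (1 + y) ^ r) := by
  have hc := B.c_pos
  obtain ⟨Cs, D, hCs, hD, hlow⟩ := B.exists_le_schemeMap
  obtain ⟨A₁, hA₁, hg₁⟩ := exists_gaussian_step hc hσ (by linarith : 0 < β) le_rfl hβ
  obtain ⟨A₂, hA₂, hg₂⟩ := exists_gaussian_step hc hσ (by linarith : 0 < β - 1 / 2)
    (by linarith) hβ
  set A : ℝ := max (max A₁ A₂) (64 * Cs ^ 2) with hA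
  obtain ⟨κ₁, hκ₁, hκ₁1, hg₁⟩ := hg₁ A ((le_max_left _ _).trans (le_max_left _ _))
  obtain ⟨κ₂, hκ₂, hκ₂1, hg₂⟩ := hg₂ A ((le_max_right _ _).trans (le_max_left _ _))
  have hA1 : 1 ≤ A := hA₁.trans ((le_max_left _ _).trans (le_max_left _ _))
  have hACs : 64 * Cs ^ 2 ≤ A := le_max_right _ _
  have hA0 : 0 < A := by linarith
  set e₁ : ℝ := β / 2 with he₁
  set e₂ : ℝ := β / 2 - 1 / 4 with he₂
  have he₁0 : 0 < e₁ := by rw [he₁]; linarith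
  have he₂0 : 0 < e₂ := by rw [he₂]; linarith
  obtain ⟨G₁, hG₁, hc₁⟩ := exists_gaussian_step_crude hc σ (e₁ + 1 / 2) (by linarith)
  obtain ⟨G₂, hG₂, hc₂⟩ := exists_gaussian_step_crude hc σ (e₂ + 1 / 2) (by linarith)
  set b₁ : ℝ := 4 * e₁ * Real.exp e₁ with hb₁
  set b₂ : ℝ := 4 * e₂ * Real.exp e₂ with hb₂
  have hb₁0 : 0 < b₁ := by positivity
  have hb₂0 : 0 < b₂ := by positivity
  set g₁ : ℝ := b₁ * Cs * G₁ with hg₁'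
  set g₂ : ℝ := b₂ * Cs * G₂ with hg₂'
  have hg₁0 : 0 < g₁ := by positivity
  have hg₂0 : 0 < g₂ := by positivity
  -- the perturbations are absorbed by half of the gain of the second summand each
  obtain ⟨E₁, hE₁, hab₁⟩ := rpow_neg_le_add (e := e₁ + 1 / 2) (e' := e₂ + 1)
    (ε := κ₂ / (8 * g₁)) (by linarith) (by rw [he₁, he₂]; linarith) (by positivity)
  obtain ⟨E₂, hE₂, hab₂⟩ := rpow_neg_le_add (e := e₂ + 1 / 2) (e' := e₂ + 1)
    (ε := κ₂ / (8 * g₂)) (by linarith) (by linarith) (by positivity)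
  obtain ⟨r, hr⟩ := exists_nat_ge ((D : ℝ) * (2 * (e₁ + 1)) + D)
  have hrD : D ≤ r := by
    have : (D : ℝ) ≤ r := by
      have : 0 ≤ (D : ℝ) * (2 * (e₁ + 1)) := by positivity
      linarith
    exact_mod_cast this
  refine ⟨A, κ₁, 2 * g₁ * (1 + E₁) + 2 * g₂ * (1 + E₂) + 2 + κ₁, r, hA1, hκ₁, by positivity, ?_⟩
  intro h hh y hy
  have hpos := hh.pos B.T_pos
  have hle1 := hh.le_one
  have hch : 0 < c * h := by positivity
  have hyr : 1 ≤ (1 + y) ^ r := one_le_pow₀ (by linarith)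
  have hyDr : y ^ D ≤ (1 + y) ^ r := by
    calc y ^ D ≤ (1 + y) ^ D := pow_le_pow_left₀ hy.le (by linarith) D
      _ ≤ (1 + y) ^ r := pow_le_pow_right₀ (by linarith) hrD
  set a := schemeMap P (muHat q.eval c) h y with ha
  set ρ := y ^ 2 + A * h with hρ
  have hAh : 0 < A * h := by positivity
  have hρ0 : 0 < ρ := by positivity
  set δ := Cs * h * (1 + y ^ D) with hδ
  have hδ0 : 0 ≤ δ := by positivity
  have haδ : y - δ ≤ a := hlow h hh y hy
  rcases le_total ((h : ℝ) * y ^ (2 * D)) 1 with hcase | hcase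
  · -- the perturbation is at most of the order of the regularisation
    have hδA : 16 * δ ^ 2 ≤ A * h := by
      have h1 : (h : ℝ) * (1 + y ^ D) ^ 2 ≤ 4 := by
        have h2 : (1 + y ^ D) ^ 2 ≤ 2 + 2 * y ^ (2 * D) := by
          have : y ^ (2 * D) = (y ^ D) ^ 2 := by rw [← pow_mul]; ring_nf
          rw [this]
          linarith [sq_nonneg (1 - y ^ D)]
        calc (h : ℝ) * (1 + y ^ D) ^ 2 ≤ h * (2 + 2 * y ^ (2 * D)) := by gcongr
          _ ≤ 4 := by linarith
      calc 16 * δ ^ 2 = 16 * Cs ^ 2 * h * (h * (1 + y ^ D) ^ 2) := by rw [hδ]; ring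
        _ ≤ 16 * Cs ^ 2 * h * 4 := by gcongr
        _ = 64 * Cs ^ 2 * h := by ring
        _ ≤ A * h := by gcongr
    have hroot : ∀ z, implicitRoot (c * h) (y + σ * (Real.sqrt h * z)) - δ
        ≤ implicitRoot (c * h) (a + σ * (Real.sqrt h * z)) := by
      intro z
      have h1 := implicitRoot_sub_le hch (w := y - δ + σ * (Real.sqrt h * z))
        (z := y + σ * (Real.sqrt h * z)) (by linarith)
      have h2 := implicitRoot_mono hch (w := y - δ + σ * (Real.sqrt h * z))
        (z := a + σ * (Real.sqrt h * z)) (by linarith)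
      linarith
    have hpt : ∀ (e : ℝ), 0 < e → ∀ z,
        (implicitRoot (c * h) (a + σ * (Real.sqrt h * z)) ^ 2 + A * h) ^ (-e)
        ≤ (implicitRoot (c * h) (y + σ * (Real.sqrt h * z)) ^ 2 + A * h) ^ (-e)
          + 4 * e * Real.exp e * δ *
            (implicitRoot (c * h) (y + σ * (Real.sqrt h * z)) ^ 2 + A * h) ^ (-(e + 1 / 2)) :=
      fun e he z => shift_rpow_le he hAh hδ0 hδA (implicitRoot_pos hch _).le (hroot z)
    have hys : 0 ≤ y / Real.sqrt h := by positivity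
    have hI₁ : ∫⁻ z, ENNReal.ofReal ((implicitRoot (c * h) (y + σ * (Real.sqrt h * z)) ^ 2
        + A * h) ^ (-e₁)) ∂gaussianReal 0 1
        ≤ ENNReal.ofReal (ρ ^ (-e₁) - κ₁ * h ^ 2 * ρ ^ (-(e₁ + 2))) := by
      rw [lintegral_scale_step hpos hA0]
      refine (mul_le_mul_right (hg₁ _ hys) _).trans ?_
      rw [← ENNReal.ofReal_mul (by positivity), ← mul_assoc, rpow_scale hpos hA0,
        inv_scale hpos hA0, ← hρ]
      refine ENNReal.ofReal_le_ofReal (le_of_eq ?_)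
      have : ρ ^ (-(e₁ + 2)) = ρ ^ (-e₁) * ρ⁻¹ ^ 2 := by
        rw [← Real.rpow_neg_one, ← Real.rpow_natCast, ← Real.rpow_mul hρ0.le, ← Real.rpow_add hρ0]
        norm_num
        ring_nf
      rw [this]
      ring
    have hI₂ : ∫⁻ z, ENNReal.ofReal ((implicitRoot (c * h) (y + σ * (Real.sqrt h * z)) ^ 2
        + A * h) ^ (-e₂)) ∂gaussianReal 0 1
        ≤ ENNReal.ofReal (ρ ^ (-e₂) - κ₂ / 2 * h * ρ ^ (-(e₂ + 1))) := by
      rw [lintegral_scale_step hpos hA0]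
      have h1 := hg₂ _ hys
      have h2 : (β - 1 / 2) / 2 = e₂ := by rw [he₂]; ring
      rw [h2] at h1
      refine (mul_le_mul_right h1 _).trans ?_
      rw [← ENNReal.ofReal_mul (by positivity), ← mul_assoc, rpow_scale hpos hA0,
        inv_scale hpos hA0, ← hρ]
      refine ENNReal.ofReal_le_ofReal ?_
      have : ρ ^ (-(e₂ + 1)) = ρ ^ (-e₂) * ρ⁻¹ := by
        rw [← Real.rpow_neg_one, ← Real.rpow_add hρ0]
        ring_nf
      rw [this]
      have h3 : 0 ≤ ρ ^ (-e₂) * (κ₂ * (h * ρ⁻¹) ^ 2) := by positivity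
      linarith
    have hJ : ∀ (e G : ℝ), (∀ A y, 1 ≤ A → 0 ≤ y →
        ∫⁻ z, ENNReal.ofReal ((implicitRoot c (y + σ * z) ^ 2 + A) ^ (-e)) ∂gaussianReal 0 1
        ≤ ENNReal.ofReal (G * (y ^ 2 + A) ^ (-e))) →
        ∫⁻ z, ENNReal.ofReal ((implicitRoot (c * h) (y + σ * (Real.sqrt h * z)) ^ 2
        + A * h) ^ (-e)) ∂gaussianReal 0 1 ≤ ENNReal.ofReal (G * ρ ^ (-e)) := by
      intro e G hG
      rw [lintegral_scale_step hpos hA0]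
      refine (mul_le_mul_right (hG A _ hA1 hys) _).trans ?_
      rw [← ENNReal.ofReal_mul (by positivity), mul_left_comm, rpow_scale hpos hA0]
    have hJ₁ := hJ _ _ hc₁
    have hJ₂ := hJ _ _ hc₂
    have hmeas : ∀ e : ℝ, Measurable fun z => ENNReal.ofReal
        ((implicitRoot (c * h) (y + σ * (Real.sqrt h * z)) ^ 2 + A * h) ^ (-e)) := by
      intro e
      have := continuous_implicitRoot (c * h)
      have : Measurable fun z => implicitRoot (c * h) (y + σ * (Real.sqrt h * z)) :=
        (this.comp (by fun_prop)).measurable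
      fun_prop
    have hsum : ∫⁻ z, ENNReal.ofReal
          ((implicitRoot (c * h) (a + σ * (Real.sqrt h * z)) ^ 2 + A * h) ^ (-e₁)
          + (implicitRoot (c * h) (a + σ * (Real.sqrt h * z)) ^ 2 + A * h) ^ (-e₂))
          ∂gaussianReal 0 1
        ≤ (ENNReal.ofReal (ρ ^ (-e₁) - κ₁ * h ^ 2 * ρ ^ (-(e₁ + 2)))
          + ENNReal.ofReal (b₁ * δ) * ENNReal.ofReal (G₁ * ρ ^ (-(e₁ + 1 / 2))))
          + (ENNReal.ofReal (ρ ^ (-e₂) - κ₂ / 2 * h * ρ ^ (-(e₂ + 1)))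
          + ENNReal.ofReal (b₂ * δ) * ENNReal.ofReal (G₂ * ρ ^ (-(e₂ + 1 / 2)))) := by
      refine le_trans (lintegral_mono (g := fun z =>
        (ENNReal.ofReal ((implicitRoot (c * h) (y + σ * (Real.sqrt h * z)) ^ 2 + A * h) ^ (-e₁))
          + ENNReal.ofReal (b₁ * δ) * ENNReal.ofReal
            ((implicitRoot (c * h) (y + σ * (Real.sqrt h * z)) ^ 2 + A * h) ^ (-(e₁ + 1 / 2))))
        + (ENNReal.ofReal ((implicitRoot (c * h) (y + σ * (Real.sqrt h * z)) ^ 2 + A * h) ^ (-e₂))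
          + ENNReal.ofReal (b₂ * δ) * ENNReal.ofReal
            ((implicitRoot (c * h) (y + σ * (Real.sqrt h * z)) ^ 2 + A * h) ^ (-(e₂ + 1 / 2)))))
          fun z => ?_) ?_
      · have h1 := hpt e₁ he₁0 z
        have h2 := hpt e₂ he₂0 z
        rw [← hb₁] at h1
        rw [← hb₂] at h2
        dsimp only
        rw [← ENNReal.ofReal_mul (by positivity), ← ENNReal.ofReal_mul (by positivity),
          ← ENNReal.ofReal_add (by positivity) (by positivity),
          ← ENNReal.ofReal_add (by positivity) (by positivity),
          ← ENNReal.ofReal_add (by positivity) (by positivity)]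
        exact ENNReal.ofReal_le_ofReal (add_le_add h1 h2)
      · refine (lintegral_four _ (hmeas e₁) (hmeas (e₁ + 1 / 2)) (hmeas e₂)
          (hmeas (e₂ + 1 / 2)) _ _).trans_le ?_
        gcongr
    -- the gains are smaller than the potential, as `h ≤ ρ`
    have hhρ : (h : ℝ) * ρ⁻¹ ≤ 1 := by
      rw [← div_eq_mul_inv, div_le_one hρ0, hρ]
      have : (h : ℝ) ≤ A * h := le_mul_of_one_le_left hpos.le hA1
      linarith [sq_nonneg y]
    have n1 : 0 ≤ ρ ^ (-e₁) - κ₁ * h ^ 2 * ρ ^ (-(e₁ + 2)) := by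
      have e : ρ ^ (-(e₁ + 2)) = ρ ^ (-e₁) * ρ⁻¹ ^ 2 := by
        rw [← Real.rpow_neg_one, ← Real.rpow_natCast, ← Real.rpow_mul hρ0.le, ← Real.rpow_add hρ0]
        norm_num
        ring_nf
      have h1 : κ₁ * (h * ρ⁻¹) ^ 2 ≤ 1 :=
        mul_le_one₀ hκ₁1 (by positivity) (pow_le_one₀ (by positivity) hhρ)
      have h2 := mul_le_mul_of_nonneg_left h1 (by positivity : 0 ≤ ρ ^ (-e₁))
      rw [e]
      linarith
    have n2 : 0 ≤ ρ ^ (-e₂) - κ₂ / 2 * h * ρ ^ (-(e₂ + 1)) := by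
      have e : ρ ^ (-(e₂ + 1)) = ρ ^ (-e₂) * ρ⁻¹ := by
        rw [← Real.rpow_neg_one, ← Real.rpow_add hρ0]
        ring_nf
      have h1 : κ₂ / 2 * (h * ρ⁻¹) ≤ 1 := mul_le_one₀ (by linarith) (by positivity) hhρ
      have h2 := mul_le_mul_of_nonneg_left h1 (by positivity : 0 ≤ ρ ^ (-e₂))
      rw [e]
      linarith
    have hpert : b₁ * δ * (G₁ * ρ ^ (-(e₁ + 1 / 2))) + b₂ * δ * (G₂ * ρ ^ (-(e₂ + 1 / 2)))
        ≤ κ₂ / 2 * h * ρ ^ (-(e₂ + 1))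
          + (2 * g₁ * (1 + E₁) + 2 * g₂ * (1 + E₂)) * h * (1 + y) ^ r := by
      have e1 : b₁ * δ * (G₁ * ρ ^ (-(e₁ + 1 / 2)))
          = g₁ * h * (1 + y ^ D) * ρ ^ (-(e₁ + 1 / 2)) := by rw [hδ, hg₁']; ring
      have e2 : b₂ * δ * (G₂ * ρ ^ (-(e₂ + 1 / 2)))
          = g₂ * h * (1 + y ^ D) * ρ ^ (-(e₂ + 1 / 2)) := by rw [hδ, hg₂']; ring
      have hgen : ∀ g e E : ℝ, 0 < g → 0 < E → 0 < e →
          ρ ^ (-e) ≤ κ₂ / (8 * g) * ρ ^ (-(e₂ + 1)) + E →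
          g * h * (1 + y ^ D) * ρ ^ (-e)
            ≤ κ₂ / 4 * h * ρ ^ (-(e₂ + 1)) + 2 * g * (1 + E) * h * (1 + y) ^ r := by
        intro g e E hg hE he hab
        rcases le_total y 1 with hy1 | hy1
        · have h1 : y ^ D ≤ 1 := pow_le_one₀ hy.le hy1
          calc g * h * (1 + y ^ D) * ρ ^ (-e)
              ≤ g * h * 2 * (κ₂ / (8 * g) * ρ ^ (-(e₂ + 1)) + E) := by gcongr; linarith
            _ = κ₂ / 4 * h * ρ ^ (-(e₂ + 1)) + 2 * g * E * h * 1 := by field_simp; ring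
            _ ≤ κ₂ / 4 * h * ρ ^ (-(e₂ + 1)) + 2 * g * (1 + E) * h * (1 + y) ^ r := by
                gcongr
                linarith
        · have hρ1 : 1 ≤ ρ := by
            have : 1 ≤ y ^ 2 := one_le_pow₀ hy1
            rw [hρ]; linarith
          have h1 : ρ ^ (-e) ≤ 1 := Real.rpow_le_one_of_one_le_of_nonpos hρ1 (by linarith)
          have h2 : 0 ≤ κ₂ / 4 * h * ρ ^ (-(e₂ + 1)) := by positivity
          calc g * h * (1 + y ^ D) * ρ ^ (-e)
              ≤ g * h * ((1 + y) ^ r + (1 + y) ^ r) * 1 := by gcongr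
            _ = 2 * g * 1 * h * (1 + y) ^ r := by ring
            _ ≤ 2 * g * (1 + E) * h * (1 + y) ^ r := by gcongr; linarith
            _ ≤ _ := by linarith
      have r1 := hgen g₁ (e₁ + 1 / 2) E₁ hg₁0 hE₁ (by linarith) (hab₁ ρ hρ0)
      have r2 := hgen g₂ (e₂ + 1 / 2) E₂ hg₂0 hE₂ (by linarith) (hab₂ ρ hρ0)
      rw [e1, e2]
      linarith
    refine (add_le_add_left hsum _).trans ?_
    have p1 : 0 ≤ b₁ * δ := by positivity
    have p2 : 0 ≤ b₂ * δ := by positivity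
    have p3 : 0 ≤ G₁ * ρ ^ (-(e₁ + 1 / 2)) := by positivity
    have p4 : 0 ≤ G₂ * ρ ^ (-(e₂ + 1 / 2)) := by positivity
    rw [← ENNReal.ofReal_mul p1, ← ENNReal.ofReal_mul p2, ← ENNReal.ofReal_add n1 (by positivity),
      ← ENNReal.ofReal_add n2 (by positivity),
      ← ENNReal.ofReal_add (add_nonneg n1 (mul_nonneg p1 p3)) (add_nonneg n2 (mul_nonneg p2 p4))]
    refine le_of_eq_of_le (ENNReal.ofReal_add (add_nonneg (add_nonneg n1 (mul_nonneg p1 p3))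
      (add_nonneg n2 (mul_nonneg p2 p4))) (by positivity)).symm ?_
    refine le_of_le_of_eq (ENNReal.ofReal_le_ofReal ?_)
      (ENNReal.ofReal_add (by positivity) (by positivity))
    have : 0 ≤ (2 + κ₁) * h * (1 + y) ^ r := by positivity
    linarith
  · -- for large arguments the crude bound on the potential suffices
    have hy1 : 1 ≤ y := by
      by_contra hlt
      push Not at hlt
      have h1 : y ^ (2 * D) < 1 := pow_lt_one₀ hy.le hlt (by omega)
      have h2 : (h : ℝ) * y ^ (2 * D) < 1 := by
        calc (h : ℝ) * y ^ (2 * D) ≤ 1 * y ^ (2 * D) := by gcongr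
          _ < 1 := by linarith
      linarith
    have hρ1 : 1 ≤ ρ := by
      have : 1 ≤ y ^ 2 := one_le_pow₀ hy1
      rw [hρ]; linarith
    have hpow : (h : ℝ) ^ (-e₁) ≤ h * (1 + y) ^ r := by
      refine (rpow_neg_le_mul_rpow hpos hy hcase he₁0.le).trans ?_
      rw [← Real.rpow_natCast (1 + y)]
      gcongr
      · linarith
      · have : (0 : ℝ) ≤ D := by positivity
        linarith
    have hpt : ∀ z : ℝ, (z ^ 2 + A * h) ^ (-e₁) + (z ^ 2 + A * h) ^ (-e₂)
        ≤ 2 * (h * (1 + y) ^ r) := by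
      intro z
      have h0 : (h : ℝ) ≤ z ^ 2 + A * h := by
        have : (h : ℝ) ≤ A * h := le_mul_of_one_le_left hpos.le hA1
        linarith [sq_nonneg z]
      have h1 : (z ^ 2 + A * h) ^ (-e₁) ≤ (h : ℝ) ^ (-e₁) :=
        Real.rpow_le_rpow_of_nonpos hpos h0 (by linarith)
      have h2 : (z ^ 2 + A * h) ^ (-e₂) ≤ (h : ℝ) ^ (-e₂) :=
        Real.rpow_le_rpow_of_nonpos hpos h0 (by linarith)
      have h3 : (h : ℝ) ^ (-e₂) ≤ (h : ℝ) ^ (-e₁) :=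
        Real.rpow_le_rpow_of_exponent_ge hpos hle1 (by rw [he₁, he₂]; linarith)
      linarith
    have hgain : κ₁ * h ^ 2 * ρ ^ (-(e₁ + 2)) ≤ κ₁ * (h * (1 + y) ^ r) := by
      have h1 : ρ ^ (-(e₁ + 2)) ≤ 1 := Real.rpow_le_one_of_one_le_of_nonpos hρ1 (by linarith)
      have h2 : (h : ℝ) ^ 2 ≤ h := by nlinarith
      calc κ₁ * h ^ 2 * ρ ^ (-(e₁ + 2)) ≤ κ₁ * h * 1 := by gcongr
        _ ≤ κ₁ * h * (1 + y) ^ r := by gcongr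
        _ = _ := by ring
    refine le_add_left ?_
    calc _ ≤ ∫⁻ _, ENNReal.ofReal (2 * (h * (1 + y) ^ r)) ∂gaussianReal 0 1
          + ENNReal.ofReal (κ₁ * (h * (1 + y) ^ r)) := by
          refine add_le_add (lintegral_mono fun z => ENNReal.ofReal_le_ofReal ?_)
            (ENNReal.ofReal_le_ofReal hgain)
          exact hpt _
      _ = ENNReal.ofReal (2 * (h * (1 + y) ^ r) + κ₁ * (h * (1 + y) ^ r)) := by
          rw [lintegral_const, measure_univ, mul_one, ← ENNReal.ofReal_add (by positivity)
            (by positivity)]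
      _ ≤ _ := by
          refine ENNReal.ofReal_le_ofReal ?_
          have : 0 ≤ (2 * g₁ * (1 + E₁) + 2 * g₂ * (1 + E₂)) * (h * (1 + y) ^ r) := by positivity
          linarith

end PosScheme

namespace PosScheme

variable {T : ℝ≥0} {P : ℝ≥0 → ℝ → ℝ} {q : FLP} {c K L m₁ m₂ : ℝ}

/-- A step can end below `√h` only if it starts at a height of order `√h`, up to Gaussian tails, or
at a large height. -/
lemma SchemeBounds.exists_small_step (B : SchemeBounds T P (muHat q.eval c) c K L m₁ m₂)
    (σ : ℝ) {β A : ℝ} (hβ : 0 < β) (hA : 1 ≤ A) :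
    ∃ (C : ℝ) (N r : ℕ), 0 < C ∧ ∀ h, IsStepSize T h → ∀ y z, 0 < y → ∀ y',
      y' = implicitRoot (c * h) (schemeMap P (muHat q.eval c) h y + σ * (Real.sqrt h * z)) →
      y' ≤ Real.sqrt h →
      y' ^ (-β) ≤ C * (1 + |1 * z|) ^ N *
        (h ^ 2 * (y ^ 2 + A * h) ^ (-(β / 2 + 2)) + h * (1 + y) ^ r) := by
  have hc := B.c_pos
  have hK := B.K_ge
  obtain ⟨Cs, D, hCs, hD, hlow⟩ := B.exists_le_schemeMap
  set C₀ : ℝ := 1 + 2 * K / c with hC₀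
  have hC₀0 : 0 < C₀ := by positivity
  set C₁ : ℝ := 1 + 2 * Cs + |σ| with hC₁
  have hσ0 := abs_nonneg σ
  have hC₁0 : 0 < C₁ := by positivity
  set C₂ : ℝ := C₀ * (1 + C₁ + |σ|) with hC₂
  have hC₂0 : 0 < C₂ := by positivity
  obtain ⟨N, hN⟩ := exists_nat_ge (2 * β + 4)
  obtain ⟨r, hr⟩ := exists_nat_ge ((D : ℝ) * (2 * (β / 2 + 1)) + β)
  refine ⟨C₂ ^ β * (C₁ ^ 2 + A) ^ (β / 2 + 2) + C₂ ^ β, N, r, by positivity, ?_⟩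
  intro h hh y z hy y' hy' hle
  have hpos := hh.pos B.T_pos
  have hle1 := hh.le_one
  have hch : 0 < c * h := by positivity
  have hs : 0 < Real.sqrt h := Real.sqrt_pos.2 hpos
  have hss : Real.sqrt h ^ 2 = h := Real.sq_sqrt hpos.le
  have hs1 : Real.sqrt h ≤ 1 := Real.sqrt_le_one.2 hle1
  have hsrp : Real.sqrt h ^ (-β) = (h : ℝ) ^ (-(β / 2)) := by
    rw [Real.sqrt_eq_rpow, ← Real.rpow_mul hpos.le]; ring_nf
  set s := Real.sqrt h with hsdef
  have hy'0 : 0 < y' := by rw [hy']; exact implicitRoot_pos hch _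
  rw [one_mul]
  set Z := 1 + |z| with hZ
  have hz0 := abs_nonneg z
  have hZ1 : 1 ≤ Z := by rw [hZ]; linarith
  have hzZ : |z| ≤ Z := by rw [hZ]; linarith
  have hZN : ∀ e : ℝ, e ≤ 2 * β + 4 → Z ^ e ≤ Z ^ N := fun e he => by
    rw [← Real.rpow_natCast]
    exact Real.rpow_le_rpow_of_exponent_le hZ1 (he.trans hN)
  set ρ := y ^ 2 + A * h with hρ
  have hρ0 : 0 < ρ := by positivity
  have hinv : y'⁻¹ ≤ C₀ * s⁻¹ * (1 + s * y + |σ| * |z|) := by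
    have h1 := B.inv_step_le hh hy hy'0 (Δ := σ * (s * z)) (by
      have := implicitRoot_eq hch (schemeMap P (muHat q.eval c) h y + σ * (s * z))
      rw [← hy'] at this
      rw [div_eq_mul_inv] at this
      linarith)
    refine h1.trans (le_of_eq ?_)
    have h2 : |σ * (s * z)| / h = s⁻¹ * (|σ| * |z|) := by
      rw [abs_mul, abs_mul, abs_of_pos hs, div_eq_iff hpos.ne', ← hss]
      field_simp
    have h3 : s⁻¹ * s = 1 := inv_mul_cancel₀ hs.ne'
    simp only [h2, ← hsdef]
    linear_combination (-(C₀ * y)) * h3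
  have hcomb : ∀ u : ℝ, 0 ≤ u → y'⁻¹ ≤ C₂ * s⁻¹ * u →
      y' ^ (-β) ≤ C₂ ^ β * (h : ℝ) ^ (-(β / 2)) * u ^ β := by
    intro u hu hyu
    rw [Real.rpow_neg hy'0.le, ← Real.inv_rpow hy'0.le]
    refine (Real.rpow_le_rpow (by positivity) hyu hβ.le).trans (le_of_eq ?_)
    rw [Real.mul_rpow (by positivity) hu, Real.mul_rpow hC₂0.le (by positivity),
      Real.inv_rpow hs.le, ← Real.rpow_neg hs.le, hsrp]
  rcases le_total ((h : ℝ) * y ^ (2 * D)) 1 with hcase | hcase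
  · -- the explicit part lowers `y` by `O(√h)`, so that ending below `√h` forces `y = O(√h Z)`
    have hsy : s * y ^ D ≤ 1 := by
      have h1 : (s * y ^ D) ^ 2 ≤ 1 := by
        calc (s * y ^ D) ^ 2 = s ^ 2 * y ^ (2 * D) := by rw [mul_pow, ← pow_mul]; ring_nf
          _ ≤ 1 := by rw [hss]; exact hcase
      exact (sq_le_one_iff₀ (by positivity)).1 h1
    have hδ : Cs * h * (1 + y ^ D) ≤ 2 * Cs * s := by
      calc Cs * h * (1 + y ^ D) = Cs * s * (s + s * y ^ D) := by rw [← hss]; ring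
        _ ≤ Cs * s * (1 + 1) := by gcongr
        _ = _ := by ring
    have hys : y ≤ s * (C₁ * Z) := by
      have h1 := hlow h hh y hy
      have h2 := le_implicitRoot hch (schemeMap P (muHat q.eval c) h y + σ * (s * z))
      rw [← hy'] at h2
      have h3 : -(σ * (s * z)) ≤ s * (|σ| * |z|) := by
        calc -(σ * (s * z)) ≤ |σ * (s * z)| := neg_le_abs _
          _ = s * (|σ| * |z|) := by rw [abs_mul, abs_mul, abs_of_pos hs]; ring
      have h4 : y ≤ s * (1 + 2 * Cs + |σ| * |z|) := by linarith
      refine h4.trans ?_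
      gcongr
      calc 1 + 2 * Cs + |σ| * |z| ≤ (1 + 2 * Cs) * Z + |σ| * Z := by
            gcongr
            exact le_mul_of_one_le_right (by linarith) hZ1
        _ = C₁ * Z := by rw [hC₁]; ring
    have hρh : ρ ≤ h * ((C₁ ^ 2 + A) * Z ^ 2) := by
      have h1 : y ^ 2 ≤ h * (C₁ ^ 2 * Z ^ 2) := by
        calc y ^ 2 ≤ (s * (C₁ * Z)) ^ 2 := pow_le_pow_left₀ hy.le hys 2
          _ = s ^ 2 * (C₁ ^ 2 * Z ^ 2) := by ring
          _ = _ := by rw [hss]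
      have h2 : A * h * 1 ≤ A * h * Z ^ 2 := by gcongr; exact one_le_pow₀ hZ1
      rw [hρ]
      linarith
    have h1 : y' ^ (-β) ≤ C₂ ^ β * (h : ℝ) ^ (-(β / 2)) * Z ^ β := by
      refine hcomb Z (by linarith) (hinv.trans ?_)
      have h2 : 1 + s * y + |σ| * |z| ≤ (1 + C₁ + |σ|) * Z := by
        have h3 : s * y ≤ C₁ * Z := by
          calc s * y ≤ s * (s * (C₁ * Z)) := by gcongr
            _ ≤ 1 * (1 * (C₁ * Z)) := by gcongr
            _ = C₁ * Z := by ring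
        have h4 : |σ| * |z| ≤ |σ| * Z := by gcongr
        linarith
      calc C₀ * s⁻¹ * (1 + s * y + |σ| * |z|) ≤ C₀ * s⁻¹ * ((1 + C₁ + |σ|) * Z) := by gcongr
        _ = _ := by rw [hC₂]; ring
    have h2 : 1 ≤ (C₁ ^ 2 + A) ^ (β / 2 + 2) * Z ^ (β + 4) *
        ((h : ℝ) ^ (β / 2 + 2) * ρ ^ (-(β / 2 + 2))) := by
      have h3 : 1 ≤ (h * ((C₁ ^ 2 + A) * Z ^ 2) * ρ⁻¹) ^ (β / 2 + 2) := by
        refine Real.one_le_rpow ?_ (by linarith)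
        rw [← div_eq_mul_inv, one_le_div hρ0]
        exact hρh
      refine h3.trans (le_of_eq ?_)
      rw [Real.mul_rpow (by positivity) (by positivity), Real.mul_rpow hpos.le (by positivity),
        Real.mul_rpow (by positivity) (by positivity), Real.inv_rpow hρ0.le,
        ← Real.rpow_neg hρ0.le, ← Real.rpow_natCast Z, ← Real.rpow_mul (by linarith)]
      have : ((2 : ℕ) : ℝ) * (β / 2 + 2) = β + 4 := by push_cast; ring
      rw [this]
      ring
    have h3 : (h : ℝ) ^ (-(β / 2)) * (h : ℝ) ^ (β / 2 + 2) = h ^ 2 := by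
      rw [← Real.rpow_add hpos, ← Real.rpow_natCast]
      congr 1
      push_cast
      ring
    have h4 : Z ^ β * Z ^ (β + 4) ≤ Z ^ N := by
      rw [← Real.rpow_add (by linarith)]
      exact hZN _ (by linarith)
    calc y' ^ (-β) ≤ (C₂ ^ β * (h : ℝ) ^ (-(β / 2)) * Z ^ β) * 1 := by rw [mul_one]; exact h1
      _ ≤ (C₂ ^ β * (h : ℝ) ^ (-(β / 2)) * Z ^ β) *
          ((C₁ ^ 2 + A) ^ (β / 2 + 2) * Z ^ (β + 4) *
            ((h : ℝ) ^ (β / 2 + 2) * ρ ^ (-(β / 2 + 2)))) := by gcongr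
      _ = C₂ ^ β * (C₁ ^ 2 + A) ^ (β / 2 + 2) * (Z ^ β * Z ^ (β + 4)) *
          (((h : ℝ) ^ (-(β / 2)) * (h : ℝ) ^ (β / 2 + 2)) * ρ ^ (-(β / 2 + 2))) := by ring
      _ ≤ C₂ ^ β * (C₁ ^ 2 + A) ^ (β / 2 + 2) * Z ^ N * (h ^ 2 * ρ ^ (-(β / 2 + 2))) := by
          rw [h3]; gcongr
      _ ≤ (C₂ ^ β * (C₁ ^ 2 + A) ^ (β / 2 + 2) + C₂ ^ β) * Z ^ N *
          (h ^ 2 * ρ ^ (-(β / 2 + 2)) + h * (1 + y) ^ r) := by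
          gcongr
          · exact le_add_of_nonneg_right (by positivity)
          · exact le_add_of_nonneg_right (by positivity)
  · -- any negative power of `h` is bounded by a power of `y`
    have h1 : y' ^ (-β) ≤ C₂ ^ β * (h : ℝ) ^ (-(β / 2)) * ((1 + y) * Z) ^ β := by
      refine hcomb _ (by positivity) (hinv.trans ?_)
      have h2 : 1 + s * y + |σ| * |z| ≤ (1 + C₁ + |σ|) * ((1 + y) * Z) := by
        have h3 : s * y ≤ 1 * y := by gcongr
        have h4 : |σ| * |z| ≤ |σ| * ((1 + y) * Z) := by
          gcongr
          exact hzZ.trans (le_mul_of_one_le_left (by linarith) (by linarith))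
        have h5 : 1 + y ≤ (1 + y) * Z := le_mul_of_one_le_right (by linarith) hZ1
        have h6 : 0 ≤ C₁ * ((1 + y) * Z) := by positivity
        linarith
      calc C₀ * s⁻¹ * (1 + s * y + |σ| * |z|)
          ≤ C₀ * s⁻¹ * ((1 + C₁ + |σ|) * ((1 + y) * Z)) := by gcongr
        _ = _ := by rw [hC₂]; ring
    have h2 := rpow_neg_le_mul_rpow hpos hy hcase (by linarith : 0 ≤ β / 2)
    have h3 : (1 + y) ^ ((D : ℝ) * (2 * (β / 2 + 1))) * (1 + y) ^ β ≤ (1 + y) ^ r := by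
      rw [← Real.rpow_add (by linarith), ← Real.rpow_natCast]
      exact Real.rpow_le_rpow_of_exponent_le (by linarith) hr
    have h4 : Z ^ β ≤ Z ^ N := hZN _ (by linarith)
    calc y' ^ (-β) ≤ C₂ ^ β * (h : ℝ) ^ (-(β / 2)) * ((1 + y) * Z) ^ β := h1
      _ ≤ C₂ ^ β * (h * (1 + y) ^ ((D : ℝ) * (2 * (β / 2 + 1)))) * ((1 + y) ^ β * Z ^ β) := by
          gcongr
          exact (Real.mul_rpow (by linarith) (by linarith)).le
      _ = C₂ ^ β * Z ^ β * (h * ((1 + y) ^ ((D : ℝ) * (2 * (β / 2 + 1))) * (1 + y) ^ β)) := by ring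
      _ ≤ C₂ ^ β * Z ^ N * (h * (1 + y) ^ r) := by gcongr
      _ ≤ (C₂ ^ β * (C₁ ^ 2 + A) ^ (β / 2 + 2) + C₂ ^ β) * Z ^ N *
          (h ^ 2 * ρ ^ (-(β / 2 + 2)) + h * (1 + y) ^ r) := by
          gcongr
          · exact le_add_of_nonneg_left (by positivity)
          · exact le_add_of_nonneg_left (by positivity)

end PosScheme

/-! ### The probability that the numerical solution comes close to the origin -/

namespace PosScheme

section Tail

variable {Ω : Type*} [mΩ : MeasurableSpace Ω] {Pr : Measure Ω} [IsProbabilityMeasure Pr]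
  {ℱ : Filtration ℝ≥0 mΩ} {W : ℝ≥0 → Ω → ℝ} {T : ℝ≥0} {P : ℝ≥0 → ℝ → ℝ} {q : FLP}
  {c K L m₁ m₂ x₀ : ℝ}

/-- One step of the scheme as a function of the current state and the Brownian increment; the
value `0` replaces the explicit part at states that are not positive, which never occur. -/
noncomputable def schemeStep (P : ℝ≥0 → ℝ → ℝ) (f : ℝ → ℝ) (c σ : ℝ) (h : ℝ≥0) (y Δ : ℝ) : ℝ :=
  implicitRoot (c * h) ((Ioi 0).indicator (schemeMap P f h) y + σ * Δ)

lemma SchemeBounds.measurable_schemeStep {f : ℝ → ℝ} (B : SchemeBounds T P f c K L m₁ m₂)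
    {h : ℝ≥0} (hh : IsStepSize T h) (σ : ℝ) :
    Measurable (Function.uncurry (schemeStep P f c σ h)) := by
  have h1 : ContinuousOn (schemeMap P f h) (Ioi 0) := by
    have hP : LipschitzOnWith 1 (P h) (Ioi 0) := by
      refine LipschitzOnWith.of_dist_le_mul fun x hx y hy => ?_
      simpa [Real.dist_eq] using B.contr h hh x y hx hy
    have hf : LipschitzOnWith (Real.toNNReal (K * (Real.sqrt h)⁻¹)) (fun x => f (P h x))
        (Ioi 0) := by
      refine LipschitzOnWith.of_dist_le_mul fun x hx y hy => ?_
      rw [Real.dist_eq, Real.dist_eq, Real.coe_toNNReal _ (by have := B.K_ge; positivity)]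
      exact B.lip h hh x y hx hy
    exact hP.continuousOn.add (continuousOn_const.mul hf.continuousOn)
  have h2 : Measurable ((Ioi 0).indicator (schemeMap P f h)) := by
    rw [← piecewise_eq_indicator]
    exact h1.measurable_piecewise continuousOn_const measurableSet_Ioi
  exact (continuous_implicitRoot _).measurable.comp
    ((h2.comp measurable_fst).add (measurable_snd.const_mul σ))

lemma SchemeBounds.chain_pos {f : ℝ → ℝ} (B : SchemeBounds T P f c K L m₁ m₂) {h : ℝ≥0}
    (hh : IsStepSize T h) (σ : ℝ) (W : ℝ≥0 → Ω → ℝ) (hx₀ : 0 < x₀) (n : ℕ) (ω : Ω) :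
    0 < brownianChain W (schemeStep P f c σ h) h x₀ n ω := by
  have hch : 0 < c * h := mul_pos B.c_pos (hh.pos B.T_pos)
  cases n with
  | zero => exact hx₀
  | succ n => exact implicitRoot_pos hch _

lemma SchemeBounds.isSchemeSolution_chain {μ : ℝ → ℝ}
    (B : SchemeBounds T P (muHat μ c) c K L m₁ m₂) {h : ℝ≥0}
    (hh : IsStepSize T h) (σ : ℝ) (hx₀ : 0 < x₀) (M : ℕ) :
    IsSchemeSolution Pr W μ σ x₀ c P h M
      (brownianChain W (schemeStep P (muHat μ c) c σ h) h x₀) := by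
  have hch : 0 < c * h := mul_pos B.c_pos (hh.pos B.T_pos)
  refine Filter.Eventually.of_forall fun ω => ⟨rfl, fun n _ => ?_⟩
  have h1 := B.chain_pos hh σ W hx₀ n ω
  refine ⟨B.chain_pos hh σ W hx₀ (n + 1) ω, ?_⟩
  have h2 : brownianChain W (schemeStep P (muHat μ c) c σ h) h x₀ (n + 1) ω
      = implicitRoot (c * h) (schemeMap P (muHat μ c) h
          (brownianChain W (schemeStep P (muHat μ c) c σ h) h x₀ n ω)
          + σ * (W ((n + 1 : ℕ) * h) ω - W (n * h) ω)) := by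
    rw [brownianChain, schemeStep, indicator_of_mem (show _ ∈ Ioi (0 : ℝ) from h1)]
  have h3 := implicitRoot_eq hch (schemeMap P (muHat μ c) h
          (brownianChain W (schemeStep P (muHat μ c) c σ h) h x₀ n ω)
          + σ * (W ((n + 1 : ℕ) * h) ω - W (n * h) ω))
  rw [← h2, div_eq_mul_inv] at h3
  refine h3.trans ?_
  unfold schemeMap
  ring

/-- The equation of the scheme has only one positive solution. -/
lemma SchemeBounds.ae_eq_chain {μ : ℝ → ℝ}
    (B : SchemeBounds T P (muHat μ c) c K L m₁ m₂) {h : ℝ≥0}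
    (hh : IsStepSize T h) {σ : ℝ} (hx₀ : 0 < x₀) {M : ℕ} {Y : ℕ → Ω → ℝ}
    (hY : IsSchemeSolution Pr W μ σ x₀ c P h M Y) :
    ∀ᵐ ω ∂Pr, ∀ n ≤ M,
      Y n ω = brownianChain W (schemeStep P (muHat μ c) c σ h) h x₀ n ω := by
  have hch : 0 < c * h := mul_pos B.c_pos (hh.pos B.T_pos)
  filter_upwards [hY] with ω hω n
  induction n with
  | zero => exact fun _ => hω.1
  | succ n ih =>
    intro hn
    obtain ⟨h1, h2⟩ := hω.2 n hn
    have h3 := B.chain_pos hh σ W hx₀ n ω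
    rw [ih (by omega)] at h2
    rw [brownianChain, schemeStep, indicator_of_mem (show _ ∈ Ioi (0 : ℝ) from h3)]
    refine eq_implicitRoot hch h1 (h2.trans ?_)
    unfold schemeMap
    ring

/-- The numerical solution has moments of all orders, uniformly in the step size. -/
lemma SchemeBounds.exists_chain_moment (hW : IsBrownianOn Pr ℱ W)
    (B : SchemeBounds T P (muHat q.eval c) c K L m₁ m₂) (hx₀ : 0 < x₀) (σ : ℝ) (r : ℕ) :
    ∃ I : ℝ, 0 < I ∧ ∀ (M : ℕ) (h : ℝ≥0), 0 < M → h = T / M → h ≤ 1 → ∀ n ≤ M,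
      ∫⁻ ω, ENNReal.ofReal
        ((1 + brownianChain W (schemeStep P (muHat q.eval c) c σ h) h x₀ n ω) ^ r) ∂Pr
        ≤ ENNReal.ofReal I := by
  obtain ⟨S, C, D, hSm, hS0, hSr, hC, hD, -, hb⟩ := B.exists_crude_bound hW hx₀ σ
  refine ⟨(2 * C) ^ r * (∫⁻ ω, ENNReal.ofReal ((1 + S ω) ^ (D * r)) ∂Pr).toReal + 1,
    by positivity, ?_⟩
  intro M h hM hhT hh1 n hn
  have hh : IsStepSize T h := ⟨M, hM, hhT, hh1⟩
  calc ∫⁻ ω, ENNReal.ofReal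
        ((1 + brownianChain W (schemeStep P (muHat q.eval c) c σ h) h x₀ n ω) ^ r) ∂Pr
      ≤ ∫⁻ ω, ENNReal.ofReal ((2 * C) ^ r) * ENNReal.ofReal ((1 + S ω) ^ (D * r)) ∂Pr := by
        refine lintegral_mono_ae ?_
        filter_upwards [hb M h hM hhT hh1 _ (B.isSchemeSolution_chain hh σ hx₀ M)] with ω hω
        obtain ⟨h1, h2, -⟩ := hω n hn
        have hS := hS0 ω
        rw [← ENNReal.ofReal_mul (by positivity), pow_mul, ← mul_pow]
        refine ENNReal.ofReal_le_ofReal (pow_le_pow_left₀ (by linarith) ?_ r)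
        have h3 : 1 ≤ C * (1 + S ω) ^ D := one_le_mul_of_one_le_of_one_le hC
          (one_le_pow₀ (by linarith))
        linarith
    _ = ENNReal.ofReal ((2 * C) ^ r) * ∫⁻ ω, ENNReal.ofReal ((1 + S ω) ^ (D * r)) ∂Pr :=
        lintegral_const_mul' _ _ ENNReal.ofReal_ne_top
    _ = ENNReal.ofReal ((2 * C) ^ r
          * (∫⁻ ω, ENNReal.ofReal ((1 + S ω) ^ (D * r)) ∂Pr).toReal) := by
        rw [ENNReal.ofReal_mul (by positivity), ENNReal.ofReal_toReal (hSr _).ne]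
    _ ≤ _ := ENNReal.ofReal_le_ofReal (by linarith)

/-- Errors of order `h` in each step add up to a bounded quantity. -/
lemma sum_lintegral_le {M : ℕ} {h : ℝ≥0} (hM : 0 < M) (hhT : h = T / M) {C I : ℝ} (hC : 0 ≤ C)
    {F : ℕ → Ω → ℝ}
    (hF : ∀ n ≤ M, ∫⁻ ω, ENNReal.ofReal (F n ω) ∂Pr ≤ ENNReal.ofReal I) (hI : 0 ≤ I) :
    ∀ n ≤ M, ∑ m ∈ Finset.range n, ∫⁻ ω, ENNReal.ofReal (C * h * F m ω) ∂Pr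
      ≤ ENNReal.ofReal (C * T * I) := by
  intro n hn
  have hM' : (M : ℝ) ≠ 0 := by exact_mod_cast hM.ne'
  have hMh : (M : ℝ) * h = T := by
    rw [hhT]
    push_cast
    field_simp
  calc ∑ m ∈ Finset.range n, ∫⁻ ω, ENNReal.ofReal (C * h * F m ω) ∂Pr
      ≤ ∑ m ∈ Finset.range n, ENNReal.ofReal (C * h * I) := by
        refine Finset.sum_le_sum fun m hm => ?_
        have h1 : ∀ ω, ENNReal.ofReal (C * h * F m ω)
            = ENNReal.ofReal (C * h) * ENNReal.ofReal (F m ω) := fun ω =>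
          ENNReal.ofReal_mul (by positivity)
        simp only [h1]
        rw [lintegral_const_mul' _ _ ENNReal.ofReal_ne_top,
          ENNReal.ofReal_mul (p := C * h) (by positivity)]
        exact mul_le_mul_right (hF m ((Finset.mem_range.1 hm).le.trans hn)) _
    _ = ENNReal.ofReal (n * (C * h * I)) := by
        rw [Finset.sum_const, Finset.card_range, nsmul_eq_mul,
          ENNReal.ofReal_mul (p := (n : ℝ)) (by positivity), ENNReal.ofReal_natCast]
    _ ≤ ENNReal.ofReal (M * (C * h * I)) := by
        refine ENNReal.ofReal_le_ofReal ?_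
        gcongr
    _ = _ := by
        rw [← hMh]
        congr 1
        ring

/-- Uniformly in the step size, the numerical solution comes below `δ` with probability of order at
most `δ ^ β`, where `β = 2 c / σ² - 1` is the exponent of the scale function near the origin. -/
lemma SchemeBounds.exists_tail (hW : IsBrownianOn Pr ℱ W)
    (B : SchemeBounds T P (muHat q.eval c) c K L m₁ m₂) (hx₀ : 0 < x₀)
    {σ β : ℝ} (hσ : σ ≠ 0) (hβ : β = 2 * c / σ ^ 2 - 1) (hβ1 : 1 ≤ β) :
    ∃ C : ℝ, 0 < C ∧ ∀ (M : ℕ) (h : ℝ≥0), 0 < M → h = T / M → h ≤ 1 → ∀ δ : ℝ, 0 < δ →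
      Pr {ω | ∃ n ≤ M, brownianChain W (schemeStep P (muHat q.eval c) c σ h) h x₀ n ω ≤ δ}
        ≤ ENNReal.ofReal (C * δ ^ β) := by
  obtain ⟨A, κ, C₁, r₁, hA, hκ, hC₁, hpot⟩ := B.exists_potential_step hσ hβ hβ1
  obtain ⟨C₂, N, r₂, hC₂, hsmall⟩ := B.exists_small_step σ (by linarith : 0 < β) hA
  obtain ⟨I₁, hI₁, hm₁⟩ := B.exists_chain_moment hW hx₀ σ r₁
  obtain ⟨I₂, hI₂, hm₂⟩ := B.exists_chain_moment hW hx₀ σ r₂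
  have hT := B.T_pos
  set mN : ℝ := ∫ z, (1 + |1 * z|) ^ N ∂gaussianReal 0 1 with hmN
  have hmN0 : 0 ≤ mN := integral_nonneg fun z => by positivity
  have hmN' : ∫⁻ z, ENNReal.ofReal ((1 + |1 * z|) ^ N) ∂gaussianReal 0 1 = ENNReal.ofReal mN :=
    (ofReal_integral_eq_lintegral_ofReal (integrable_one_add_abs_pow 1 N)
      (Filter.Eventually.of_forall fun z => by positivity)).symm
  set G : ℝ := (x₀ ^ 2) ^ (-(β / 2)) + (x₀ ^ 2) ^ (-(β / 2 - 1 / 4)) + C₁ * T * I₁ with hG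
  have hG0 : 0 < G := by positivity
  set C₃ : ℝ := C₂ * mN * (G / κ + 1 * T * I₂) with hC₃
  have hC₃0 : 0 ≤ C₃ := by positivity
  refine ⟨G * (1 + A) ^ (β / 2) + x₀ ^ (-β) + C₃, by positivity, ?_⟩
  intro M h hM hhT hh1 δ hδ
  have hh : IsStepSize T h := ⟨M, hM, hhT, hh1⟩
  have hpos := hh.pos B.T_pos
  set Ψ := schemeStep P (muHat q.eval c) c σ h with hΨ
  set U := brownianChain W Ψ h x₀ with hU
  have hΨm : Measurable (Function.uncurry Ψ) := B.measurable_schemeStep hh σ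
  have hUpos : ∀ n ω, 0 < U n ω := B.chain_pos hh σ W hx₀
  have hUm : ∀ n, Measurable (U n) := fun n =>
    (hW.measurable_chain hΨm h x₀ n).mono (ℱ.le _) le_rfl
  have hΨe : ∀ y, 0 < y → ∀ Δ,
      Ψ y Δ = implicitRoot (c * h) (schemeMap P (muHat q.eval c) h y + σ * Δ) := by
    intro y hy Δ
    rw [hΨ, schemeStep, indicator_of_mem (show y ∈ Ioi (0 : ℝ) from hy)]
  set V : ℝ → ℝ≥0∞ := fun y =>
    ENNReal.ofReal ((y ^ 2 + A * h) ^ (-(β / 2)) + (y ^ 2 + A * h) ^ (-(β / 2 - 1 / 4))) with hV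
  set g : ℝ → ℝ≥0∞ := fun y =>
    ENNReal.ofReal (κ * h ^ 2 * (y ^ 2 + A * h) ^ (-(β / 2 + 2))) with hg
  set e : ℝ → ℝ≥0∞ := fun y => ENNReal.ofReal (C₁ * h * (1 + y) ^ r₁) with he
  have hVm : Measurable V := by fun_prop
  have hgm : Measurable g := by fun_prop
  have hem : Measurable e := by fun_prop
  have hstep : ∀ y, 0 < y →
      ∫⁻ z, V (Ψ y (Real.sqrt h * z)) ∂gaussianReal 0 1 + g y ≤ V y + e y := by
    intro y hy
    simp only [hV, hg, he, hΨe y hy]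
    exact hpot h hh y hy
  have hVx : V x₀ ≤ ENNReal.ofReal ((x₀ ^ 2) ^ (-(β / 2)) + (x₀ ^ 2) ^ (-(β / 2 - 1 / 4))) := by
    have h1 : x₀ ^ 2 ≤ x₀ ^ 2 + A * h := le_add_of_nonneg_right (by positivity)
    refine ENNReal.ofReal_le_ofReal (add_le_add ?_ ?_)
    · exact Real.rpow_le_rpow_of_nonpos (by positivity) h1 (by linarith)
    · exact Real.rpow_le_rpow_of_nonpos (by positivity) h1 (by linarith)
  have hEs : V x₀ + ∑ m ∈ Finset.range M, ∫⁻ ω, e (U m ω) ∂Pr ≤ ENNReal.ofReal G := by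
    rw [hG, ENNReal.ofReal_add (p := _ + _) (by positivity) (by positivity)]
    refine add_le_add hVx ?_
    exact sum_lintegral_le hM hhT hC₁.le (F := fun n ω => (1 + U n ω) ^ r₁) (hm₁ M h hM hhT hh1)
      hI₁.le M le_rfl
  have hδβ : 0 < δ ^ β := by positivity
  have hxβ : 0 < x₀ ^ (-β) := by positivity
  have hGA : 0 < G * (1 + A) ^ (β / 2) := by positivity
  rcases le_or_gt (Real.sqrt h) δ with hδh | hδh
  · -- above the scale `√h` the maximal inequality for the potential gives the right order
    have h1 := maximal_inequality hW hΨm hVm hem hUpos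
      (fun y hy => le_self_add.trans (hstep y hy))
      (ENNReal.ofReal (((1 + A) * δ ^ 2) ^ (-(β / 2)))) M
    have h2 := h1.trans hEs
    have hlam : 0 < ((1 + A) * δ ^ 2) ^ (-(β / 2)) := by positivity
    have h3 : {ω | ∃ n ≤ M, U n ω ≤ δ}
        ⊆ {ω | ∃ m ≤ M, ENNReal.ofReal (((1 + A) * δ ^ 2) ^ (-(β / 2))) ≤ V (U m ω)} := by
      rintro ω ⟨n, hn, hle⟩
      refine ⟨n, hn, ENNReal.ofReal_le_ofReal ?_⟩
      have h0 := hUpos n ω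
      have h4 : (h : ℝ) ≤ δ ^ 2 := by
        rw [← Real.sqrt_le_left hδ.le]
        exact hδh
      have h5 : U n ω ^ 2 + A * h ≤ (1 + A) * δ ^ 2 := by
        have h6 : U n ω ^ 2 ≤ δ ^ 2 := pow_le_pow_left₀ h0.le hle 2
        have h7 : A * h ≤ A * δ ^ 2 := by gcongr
        linarith
      refine (Real.rpow_le_rpow_of_nonpos (by positivity) h5 (by linarith)).trans ?_
      exact le_add_of_nonneg_right (by positivity)
    have h4 : Pr {ω | ∃ n ≤ M, U n ω ≤ δ}
        ≤ ENNReal.ofReal G / ENNReal.ofReal (((1 + A) * δ ^ 2) ^ (-(β / 2))) := by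
      rw [ENNReal.le_div_iff_mul_le (Or.inl (by simpa using hlam))
        (Or.inl ENNReal.ofReal_ne_top), mul_comm]
      exact (mul_le_mul_right (measure_mono h3) _).trans h2
    refine h4.trans ?_
    rw [← ENNReal.ofReal_div_of_pos hlam]
    refine ENNReal.ofReal_le_ofReal ?_
    have h5 : G / ((1 + A) * δ ^ 2) ^ (-(β / 2)) = G * (1 + A) ^ (β / 2) * δ ^ β := by
      rw [Real.rpow_neg (by positivity), div_inv_eq_mul, Real.mul_rpow (by positivity)
        (by positivity), ← Real.rpow_natCast δ, ← Real.rpow_mul hδ.le]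
      have : ((2 : ℕ) : ℝ) * (β / 2) = β := by push_cast; ring
      rw [this]
      ring
    rw [h5]
    gcongr
    linarith
  · rcases le_or_gt x₀ δ with hxδ | hxδ
    · refine prob_le_one.trans ?_
      rw [← ENNReal.ofReal_one]
      refine ENNReal.ofReal_le_ofReal ?_
      calc (1 : ℝ) = x₀ ^ (-β) * x₀ ^ β := by
            rw [← Real.rpow_add hx₀]
            simp
        _ ≤ x₀ ^ (-β) * δ ^ β := by gcongr
        _ ≤ _ := by
          gcongr
          linarith
    · -- below the scale `√h` the potential is flat; there the union bound over the steps is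
      -- summable against the gains `g` of the potential
      set F : ℝ → ℝ≥0∞ := (Iic (Real.sqrt h)).indicator fun y => ENNReal.ofReal (y ^ (-β)) with hF
      have hFm : Measurable F := Measurable.indicator (by fun_prop) measurableSet_Iic
      have hsub : {ω | ∃ n ≤ M, U n ω ≤ δ} ⊆ ⋃ n ∈ Finset.range M, {ω | U (n + 1) ω ≤ δ} := by
        rintro ω ⟨n, hn, hle⟩
        cases n with
        | zero => exact absurd hle (not_le.2 hxδ)
        | succ n =>
          simp only [mem_iUnion, Finset.mem_range]
          exact ⟨n, hn, hle⟩
      have hone : ∀ n, Pr {ω | U (n + 1) ω ≤ δ}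
          ≤ ENNReal.ofReal (δ ^ β) * ∫⁻ ω, F (U (n + 1) ω) ∂Pr := by
        intro n
        rw [← lintegral_const_mul' _ _ ENNReal.ofReal_ne_top,
          ← lintegral_indicator_one (measurableSet_le (hUm (n + 1)) measurable_const)]
        refine lintegral_mono fun ω => ?_
        by_cases hω' : U (n + 1) ω ≤ δ
        swap
        · rw [indicator_of_notMem (show ω ∉ {ω | U (n + 1) ω ≤ δ} from hω')]
          exact zero_le
        have h0 := hUpos (n + 1) ω
        rw [indicator_of_mem (show ω ∈ {ω | U (n + 1) ω ≤ δ} from hω')]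
        rw [hF, indicator_of_mem (show U (n + 1) ω ∈ Iic (Real.sqrt h) from hω'.trans hδh.le),
          ← ENNReal.ofReal_mul hδβ.le]
        simp only [Pi.one_apply]
        rw [← ENNReal.ofReal_one]
        refine ENNReal.ofReal_le_ofReal ?_
        calc (1 : ℝ) = U (n + 1) ω ^ β * U (n + 1) ω ^ (-β) := by
              rw [← Real.rpow_add h0]
              simp
          _ ≤ _ := by gcongr
      have htwo : ∀ n, ∫⁻ ω, F (U (n + 1) ω) ∂Pr
          ≤ ENNReal.ofReal (C₂ * mN / κ) * ∫⁻ ω, g (U n ω) ∂Pr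
            + ENNReal.ofReal (C₂ * mN) * ∫⁻ ω, ENNReal.ofReal (1 * h * (1 + U n ω) ^ r₂) ∂Pr := by
        intro n
        have h1 := hW.lintegral_chain_step hΨm h x₀ n (S := univ) MeasurableSet.univ hFm
        simp only [Measure.restrict_univ] at h1
        rw [← lintegral_const_mul' _ _ ENNReal.ofReal_ne_top,
          ← lintegral_const_mul' _ _ ENNReal.ofReal_ne_top,
          ← lintegral_add_left
            (f := fun ω => ENNReal.ofReal (C₂ * mN / κ) * g (U n ω))
            ((hgm.comp (hUm n)).const_mul _), h1]
        refine lintegral_mono fun ω => ?_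
        have h0 := hUpos n ω
        change ∫⁻ z, F (Ψ (U n ω) (Real.sqrt h * z)) ∂gaussianReal 0 1 ≤ _
        set y := U n ω with hy
        set Q : ℝ := h ^ 2 * (y ^ 2 + A * h) ^ (-(β / 2 + 2)) + h * (1 + y) ^ r₂ with hQ
        have hQ0 : 0 ≤ Q := by positivity
        calc ∫⁻ z, F (Ψ y (Real.sqrt h * z)) ∂gaussianReal 0 1
            ≤ ∫⁻ z, ENNReal.ofReal (C₂ * Q) * ENNReal.ofReal ((1 + |1 * z|) ^ N)
                ∂gaussianReal 0 1 := by
              refine lintegral_mono fun z => ?_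
              by_cases hy' : Ψ y (Real.sqrt h * z) ≤ Real.sqrt h
              · rw [hF, indicator_of_mem (show _ ∈ Iic (Real.sqrt h) from hy'),
                  ← ENNReal.ofReal_mul (by positivity)]
                refine ENNReal.ofReal_le_ofReal ((hsmall h hh y z h0 _ (hΨe y h0 _) hy').trans ?_)
                exact le_of_eq (by ring)
              · rw [hF, indicator_of_notMem (show _ ∉ Iic (Real.sqrt h) from hy')]
                exact zero_le
          _ = ENNReal.ofReal (C₂ * Q) * ENNReal.ofReal mN := by
              rw [lintegral_const_mul' _ _ ENNReal.ofReal_ne_top, hmN']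
          _ = _ := by
              rw [hg, ← ENNReal.ofReal_mul (by positivity), ← ENNReal.ofReal_mul (by positivity),
                ← ENNReal.ofReal_mul (by positivity), ← ENNReal.ofReal_add (by positivity)
                (by positivity)]
              congr 1
              rw [hQ]
              field_simp
      have hgs : ∑ n ∈ Finset.range M, ∫⁻ ω, g (U n ω) ∂Pr ≤ ENNReal.ofReal G := by
        refine le_trans ?_ ((lintegral_add_sum_le hW hΨm hVm hgm hem hUpos hstep M).trans hEs)
        exact le_add_left le_rfl
      have hes : ∑ n ∈ Finset.range M, ∫⁻ ω, ENNReal.ofReal (1 * h * (1 + U n ω) ^ r₂) ∂Pr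
          ≤ ENNReal.ofReal (1 * T * I₂) :=
        sum_lintegral_le hM hhT zero_le_one (F := fun n ω => (1 + U n ω) ^ r₂)
          (hm₂ M h hM hhT hh1) hI₂.le M le_rfl
      calc Pr {ω | ∃ n ≤ M, U n ω ≤ δ}
          ≤ ∑ n ∈ Finset.range M, Pr {ω | U (n + 1) ω ≤ δ} :=
            (measure_mono hsub).trans (measure_biUnion_finset_le _ _)
        _ ≤ ∑ n ∈ Finset.range M, ENNReal.ofReal (δ ^ β)
              * (ENNReal.ofReal (C₂ * mN / κ) * ∫⁻ ω, g (U n ω) ∂Pr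
            + ENNReal.ofReal (C₂ * mN)
              * ∫⁻ ω, ENNReal.ofReal (1 * h * (1 + U n ω) ^ r₂) ∂Pr) :=
            Finset.sum_le_sum fun n _ => (hone n).trans (mul_le_mul_right (htwo n) _)
        _ = ENNReal.ofReal (δ ^ β)
              * (ENNReal.ofReal (C₂ * mN / κ) * ∑ n ∈ Finset.range M, ∫⁻ ω, g (U n ω) ∂Pr
            + ENNReal.ofReal (C₂ * mN) * ∑ n ∈ Finset.range M,
              ∫⁻ ω, ENNReal.ofReal (1 * h * (1 + U n ω) ^ r₂) ∂Pr) := by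
            rw [← Finset.mul_sum, Finset.sum_add_distrib, ← Finset.mul_sum, ← Finset.mul_sum]
        _ ≤ ENNReal.ofReal (δ ^ β) * (ENNReal.ofReal (C₂ * mN / κ) * ENNReal.ofReal G
            + ENNReal.ofReal (C₂ * mN) * ENNReal.ofReal (1 * T * I₂)) := by gcongr
        _ = ENNReal.ofReal (C₃ * δ ^ β) := by
            rw [← ENNReal.ofReal_mul (by positivity), ← ENNReal.ofReal_mul (by positivity),
              ← ENNReal.ofReal_add (by positivity) (by positivity),
              ← ENNReal.ofReal_mul (by positivity)]
            congr 1
            rw [hC₃]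
            field_simp
        _ ≤ _ := by
            refine ENNReal.ofReal_le_ofReal ?_
            gcongr
            linarith

end Tail

end PosScheme

/-! ### Small-time expansion of Gaussian averages -/

namespace PosScheme

lemma abs_le_of_abs_deriv_le_pow {g g' : ℝ → ℝ} {B : ℝ} {n : ℕ} (hB : 0 ≤ B)
    (hg : ∀ x : ℝ, HasDerivAt g (g' x) x) (h0 : g 0 = 0) (hb : ∀ x : ℝ, |g' x| ≤ B * |x| ^ n)
    (x : ℝ) : |g x| ≤ B * |x| ^ (n + 1) := by
  have h1 := Convex.norm_image_sub_le_of_norm_hasDerivWithin_le (f := g) (f' := g')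
    (s := Metric.closedBall 0 |x|) (x := 0) (y := x) (C := B * |x| ^ n)
    (fun y _ => (hg y).hasDerivWithinAt)
    (fun y hy => by
      have hy' : |y| ≤ |x| := by simpa using hy
      exact (hb y).trans (by gcongr)) (convex_closedBall _ _) (by simp) (by simp)
  rw [h0, sub_zero, sub_zero, Real.norm_eq_abs, Real.norm_eq_abs] at h1
  calc |g x| ≤ B * |x| ^ n * |x| := h1
    _ = _ := by ring

/-- The second order Taylor expansion with a uniform remainder. -/
lemma exists_second_order_taylor {w : ℝ → ℝ} (hw : ContDiff ℝ 3 w) (hc : HasCompactSupport w) :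
    ∃ B : ℝ, 0 < B ∧ (∀ z, |w z| ≤ B) ∧ (∀ z, |deriv w z| ≤ B) ∧ (∀ z, |deriv (deriv w) z| ≤ B) ∧
      ∀ z Δ, |w (z + Δ) - (w z + deriv w z * Δ + deriv (deriv w) z * Δ ^ 2 / 2)|
        ≤ B * |Δ| ^ 3 := by
  have hw1 : ContDiff ℝ 2 (deriv w) := by
    have : ContDiff ℝ (2 + 1) w := by norm_num; exact hw
    exact this.deriv'
  have hw2 : ContDiff ℝ 1 (deriv (deriv w)) := by
    have : ContDiff ℝ (1 + 1) (deriv w) := by norm_num; exact hw1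
    exact this.deriv'
  have hw3 : ContDiff ℝ 0 (deriv (deriv (deriv w))) := by
    have : ContDiff ℝ (0 + 1) (deriv (deriv w)) := by norm_num; exact hw2
    exact this.deriv'
  obtain ⟨B₀, hB₀⟩ := hc.exists_bound_of_continuous hw.continuous
  obtain ⟨B₁, hB₁⟩ := hc.deriv.exists_bound_of_continuous hw1.continuous
  obtain ⟨B₂, hB₂⟩ := hc.deriv.deriv.exists_bound_of_continuous hw2.continuous
  obtain ⟨B₃, hB₃⟩ := hc.deriv.deriv.deriv.exists_bound_of_continuous hw3.continuous
  simp only [Real.norm_eq_abs] at hB₀ hB₁ hB₂ hB₃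
  have h0 := (abs_nonneg _).trans (hB₀ 0)
  have h1 := (abs_nonneg _).trans (hB₁ 0)
  have h2 := (abs_nonneg _).trans (hB₂ 0)
  have h3 := (abs_nonneg _).trans (hB₃ 0)
  set B := B₀ + B₁ + B₂ + B₃ + 1 with hB
  have hBpos : 0 < B := by positivity
  refine ⟨B, hBpos, fun z => (hB₀ z).trans (by linarith), fun z => (hB₁ z).trans (by linarith),
    fun z => (hB₂ z).trans (by linarith), fun z Δ => ?_⟩
  have d0 : ∀ x, HasDerivAt w (deriv w x) x := fun x =>
    (hw.differentiable (by norm_num) x).hasDerivAt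
  have d1 : ∀ x, HasDerivAt (deriv w) (deriv (deriv w) x) x := fun x =>
    (hw1.differentiable (by norm_num) x).hasDerivAt
  have d2 : ∀ x, HasDerivAt (deriv (deriv w)) (deriv (deriv (deriv w)) x) x := fun x =>
    (hw2.differentiable (by norm_num) x).hasDerivAt
  have e2 := abs_le_of_abs_deriv_le_pow (n := 0) hBpos.le
    (g := fun x => deriv (deriv w) (z + x) - deriv (deriv w) z)
    (g' := fun x => deriv (deriv (deriv w)) (z + x))
    (fun x => ((d2 (z + x)).comp_const_add z x).sub_const _) (by simp)
    (fun x => by simpa using (hB₃ (z + x)).trans (by linarith))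
  have e1 := abs_le_of_abs_deriv_le_pow (n := 1) hBpos.le
    (g := fun x => deriv w (z + x) - deriv w z - deriv (deriv w) z * x)
    (g' := fun x => deriv (deriv w) (z + x) - deriv (deriv w) z)
    (fun x => by
      have := (((d1 (z + x)).comp_const_add z x).sub_const (deriv w z)).sub
        ((hasDerivAt_id x).const_mul (deriv (deriv w) z))
      exact this.congr_deriv (by simp)) (by simp) e2
  have e0 := abs_le_of_abs_deriv_le_pow (n := 2) hBpos.le
    (g := fun x => w (z + x) - w z - deriv w z * x - deriv (deriv w) z * x ^ 2 / 2)
    (g' := fun x => deriv w (z + x) - deriv w z - deriv (deriv w) z * x)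
    (fun x => by
      have := ((((d0 (z + x)).comp_const_add z x).sub_const (w z)).sub
        ((hasDerivAt_id x).const_mul (deriv w z))).sub
        ((((hasDerivAt_id x).pow 2).const_mul (deriv (deriv w) z)).div_const 2)
      refine this.congr_deriv ?_
      simp
      ring) (by simp) e1 Δ
  refine le_trans (le_of_eq ?_) e0
  congr 1
  ring

/-- One Euler step with drift `m` and noise intensity `σ` over a time `k` changes the average of a
smooth function `w` by `k (m w' + σ² w'' / 2)`, up to `O(k ^ (3/2))`. -/
lemma exists_generator_bound {w : ℝ → ℝ} (hw : ContDiff ℝ 3 w) (hc : HasCompactSupport w)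
    (σ A : ℝ) : ∃ C : ℝ, 0 < C ∧ ∀ z m k : ℝ, 0 ≤ k → k ≤ 1 → |m| ≤ A →
      |∫ g, w (z + (k * m + σ * (Real.sqrt k * g))) ∂gaussianReal 0 1
        - (w z + k * (m * deriv w z + σ ^ 2 / 2 * deriv (deriv w) z))| ≤ C * (k * Real.sqrt k) := by
  obtain ⟨B, hB, hB0, hB1, hB2, hT⟩ := exists_second_order_taylor hw hc
  set A' : ℝ := max A 0 + 1 with hA'
  have hA0 : 1 ≤ A' := by rw [hA']; linarith [le_max_right A 0]
  have hAA : A ≤ A' := by rw [hA']; linarith [le_max_left A 0]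
  set m3 : ℝ := ∫ g, (1 + |σ * g|) ^ 3 ∂gaussianReal 0 1 with hm3
  have hm30 : 0 ≤ m3 := integral_nonneg fun g => by positivity
  refine ⟨B * A' ^ 3 * m3 + B * A' ^ 2, by positivity, ?_⟩
  intro z m k hk hk1 hm
  have hs : 0 ≤ Real.sqrt k := Real.sqrt_nonneg k
  have hs1 : Real.sqrt k ≤ 1 := Real.sqrt_le_one.2 hk1
  have hss : Real.sqrt k ^ 2 = k := Real.sq_sqrt hk
  set s := Real.sqrt k with hsdef
  set Q : ℝ → ℝ := fun g => w z + deriv w z * (k * m + σ * (s * g))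
    + deriv (deriv w) z * (k * m + σ * (s * g)) ^ 2 / 2 with hQ
  have hQ' : ∀ g, Q g = (w z + deriv w z * (k * m) + deriv (deriv w) z * (k * m) ^ 2 / 2)
      + (deriv w z * (σ * s) + deriv (deriv w) z * (k * m) * (σ * s)) * g
      + (deriv (deriv w) z * (σ * s) ^ 2 / 2) * g ^ 2 := fun g => by
    simp only [hQ]; ring
  have i1 : Integrable (fun g : ℝ => g) (gaussianReal 0 1) := by
    simpa using integrable_pow_gaussian 1
  have i2 : Integrable (fun g : ℝ => g ^ 2) (gaussianReal 0 1) := integrable_pow_gaussian 2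
  have i01 : Integrable (fun g : ℝ =>
      (w z + deriv w z * (k * m) + deriv (deriv w) z * (k * m) ^ 2 / 2)
      + (deriv w z * (σ * s) + deriv (deriv w) z * (k * m) * (σ * s)) * g) (gaussianReal 0 1) :=
    (integrable_const _).add (i1.const_mul _)
  have iQ : Integrable Q (gaussianReal 0 1) := by
    simp only [funext hQ']
    exact i01.add (i2.const_mul _)
  have hQint : ∫ g, Q g ∂gaussianReal 0 1
      = w z + k * (m * deriv w z + σ ^ 2 / 2 * deriv (deriv w) z)
        + deriv (deriv w) z * (k * m) ^ 2 / 2 := by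
    simp only [funext hQ']
    rw [integral_add i01 (i2.const_mul _), integral_add (integrable_const _) (i1.const_mul _),
      integral_const_mul, integral_const_mul, integral_gaussian_pow_two, integral_gaussian_pow_one]
    simp only [integral_const, probReal_univ, one_smul]
    rw [mul_pow σ s, hss]
    ring
  have iw : Integrable (fun g => w (z + (k * m + σ * (s * g)))) (gaussianReal 0 1) := by
    refine Integrable.of_bound ?_ B (Filter.Eventually.of_forall fun g => ?_)
    · exact (hw.continuous.comp (by fun_prop)).aestronglyMeasurable
    · rw [Real.norm_eq_abs]; exact hB0 _
  have hdiff : |∫ g, w (z + (k * m + σ * (s * g))) ∂gaussianReal 0 1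
      - ∫ g, Q g ∂gaussianReal 0 1| ≤ B * A' ^ 3 * m3 * (k * s) := by
    rw [← integral_sub iw iQ]
    refine (abs_integral_le_integral_abs).trans ?_
    calc ∫ g, |w (z + (k * m + σ * (s * g))) - Q g| ∂gaussianReal 0 1
        ≤ ∫ g, (B * A' ^ 3 * (k * s)) * (1 + |σ * g|) ^ 3 ∂gaussianReal 0 1 := by
          refine integral_mono (iw.sub iQ).abs
            ((integrable_one_add_abs_pow σ 3).const_mul _) fun g => ?_
          refine (hT z (k * m + σ * (s * g))).trans ?_
          have h1 : |k * m + σ * (s * g)| ≤ s * (A' * (1 + |σ * g|)) := by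
            calc |k * m + σ * (s * g)| ≤ |k * m| + |σ * (s * g)| := abs_add_le _ _
              _ = s * s * |m| + s * |σ * g| := by
                rw [abs_mul, abs_of_nonneg hk, ← hss, mul_left_comm σ s g, abs_mul s,
                  abs_of_nonneg hs]
                ring
              _ ≤ s * 1 * A' + s * (A' * |σ * g|) := by
                gcongr
                · exact hm.trans hAA
                · exact le_mul_of_one_le_left (abs_nonneg _) hA0
              _ = _ := by ring
          calc B * |k * m + σ * (s * g)| ^ 3 ≤ B * (s * (A' * (1 + |σ * g|))) ^ 3 := by gcongr
            _ = B * A' ^ 3 * (s ^ 2 * s) * (1 + |σ * g|) ^ 3 := by ring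
            _ = _ := by rw [hss]
      _ = _ := by rw [integral_const_mul]; ring
  rw [hQint] at hdiff
  have hrest : |deriv (deriv w) z * (k * m) ^ 2 / 2| ≤ B * A' ^ 2 * (k * s) := by
    have hks : k ≤ s := by rw [← hss]; nlinarith
    rw [abs_div, abs_mul, abs_of_nonneg (by norm_num : (0 : ℝ) ≤ 2), abs_pow, abs_mul,
      abs_of_nonneg hk]
    have h1 : |deriv (deriv w) z| * (k * |m|) ^ 2 ≤ B * (k * A') ^ 2 := by
      gcongr
      · exact hB2 z
      · exact hm.trans hAA
    have h2 : B * (k * A') ^ 2 ≤ B * A' ^ 2 * (k * s) := by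
      calc B * (k * A') ^ 2 = B * A' ^ 2 * (k * k) := by ring
        _ ≤ _ := by gcongr
    have h3 : 0 ≤ |deriv (deriv w) z| * (k * |m|) ^ 2 := by positivity
    linarith
  rw [abs_le] at hdiff hrest ⊢
  constructor <;> linarith [hdiff.1, hdiff.2, hrest.1, hrest.2]

end PosScheme

/-! ### A subsolution of the backward equation that blows up at the origin -/

namespace PosScheme

open Filter Topology

/-- The function `x ^ (-b) exp(-(κ x ^ η + θ x))` on `(0, ∞)`, a perturbation of the power
`x ^ (-b)`. -/
noncomputable def perturbedPower (b κ η θ x : ℝ) : ℝ :=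
  x ^ (-b) * Real.exp (-(κ * x ^ η + θ * x))

lemma perturbedPower_pos (b κ η θ : ℝ) {x : ℝ} (hx : 0 < x) : 0 < perturbedPower b κ η θ x := by
  unfold perturbedPower
  positivity

lemma hasDerivAt_perturbedPower (b κ η θ : ℝ) {x : ℝ} (hx : 0 < x) :
    HasDerivAt (perturbedPower b κ η θ)
      (-(b * x⁻¹ + κ * η * x ^ (η - 1) + θ) * perturbedPower b κ η θ x) x := by
  have h1 : HasDerivAt (fun y : ℝ => y ^ (-b)) (-b * x ^ (-b - 1)) x :=
    Real.hasDerivAt_rpow_const (Or.inl hx.ne')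
  have h2 : HasDerivAt (fun y : ℝ => -(κ * y ^ η + θ * y))
      (-(κ * (η * x ^ (η - 1)) + θ * 1)) x :=
    (((Real.hasDerivAt_rpow_const (Or.inl hx.ne')).const_mul κ).add
      ((hasDerivAt_id x).const_mul θ)).neg
  refine (h1.mul h2.exp).congr_deriv ?_
  unfold perturbedPower
  rw [Real.rpow_sub_one hx.ne' (-b)]
  ring

lemma deriv_perturbedPower (b κ η θ : ℝ) {x : ℝ} (hx : 0 < x) :
    deriv (perturbedPower b κ η θ) x
      = -(b * x⁻¹ + κ * η * x ^ (η - 1) + θ) * perturbedPower b κ η θ x :=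
  (hasDerivAt_perturbedPower b κ η θ hx).deriv

lemma deriv_deriv_perturbedPower (b κ η θ : ℝ) {x : ℝ} (hx : 0 < x) :
    deriv (deriv (perturbedPower b κ η θ)) x
      = ((b * x⁻¹ + κ * η * x ^ (η - 1) + θ) ^ 2
          + (b * x⁻¹ ^ 2 + κ * η * (1 - η) * x ^ (η - 1) * x⁻¹)) * perturbedPower b κ η θ x := by
  have he : deriv (perturbedPower b κ η θ) =ᶠ[𝓝 x]
      fun y => -(b * y⁻¹ + κ * η * y ^ (η - 1) + θ) * perturbedPower b κ η θ y := by
    filter_upwards [lt_mem_nhds hx] with y hy using deriv_perturbedPower b κ η θ hy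
  rw [he.deriv_eq]
  have h1 : HasDerivAt (fun y : ℝ => -(b * y⁻¹ + κ * η * y ^ (η - 1) + θ))
      (-(b * (-(x ^ 2)⁻¹) + κ * η * ((η - 1) * x ^ (η - 1 - 1)))) x :=
    ((((hasDerivAt_inv hx.ne').const_mul b).add
      ((Real.hasDerivAt_rpow_const (Or.inl hx.ne')).const_mul (κ * η))).add_const θ).neg
  refine HasDerivAt.deriv ((h1.mul (hasDerivAt_perturbedPower b κ η θ hx)).congr_deriv ?_)
  rw [Real.rpow_sub_one hx.ne' (η - 1)]
  field_simp
  ring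

lemma contDiffAt_perturbedPower (b κ η θ : ℝ) {x : ℝ} (hx : 0 < x) :
    ContDiffAt ℝ 3 (perturbedPower b κ η θ) x := by
  have h1 : ∀ a : ℝ, ContDiffAt ℝ 3 (fun y : ℝ => y ^ a) x := fun a =>
    Real.contDiffAt_rpow_const_of_ne hx.ne'
  exact (h1 _).mul ((contDiffAt_const.mul (h1 _)).add (contDiffAt_const.mul contDiffAt_id)).neg.exp

lemma perturbedPower_le {b κ η θ x y : ℝ} (hb : 0 ≤ b) (hκ : 0 ≤ κ) (hθ : 0 ≤ θ)
    (hy : 0 < y) (hyx : y ≤ x) : perturbedPower b κ η θ x ≤ y ^ (-b) := by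
  have hx : 0 < x := hy.trans_le hyx
  unfold perturbedPower
  calc x ^ (-b) * Real.exp (-(κ * x ^ η + θ * x)) ≤ y ^ (-b) * 1 := by
        gcongr ?_ * ?_
        · exact Real.rpow_le_rpow_of_nonpos hy hyx (by linarith)
        · rw [Real.exp_le_one_iff]
          have : 0 ≤ κ * x ^ η + θ * x := by positivity
          linarith
    _ = _ := mul_one _

/-- The two inequalities behind the subsolution property; here `i = 1 / x` and `e = x ^ (η - 1)`. -/
lemma drift_le_of_le {b η C w σ μ i e : ℝ} (hb : 1 ≤ b) (hC : 0 ≤ C)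
    (hi : 0 < i) (he : 0 < e) (hw : 2 * C * b ≤ w * (1 - η)) (hwC : 2 * C ≤ w)
    (hμ : μ ≤ σ ^ 2 * ((b + 1) / 2 * i + C * e)) :
    μ ≤ σ ^ 2 * (b * i + w * e) ∧
      μ * (b * i + w * e)
        ≤ σ ^ 2 / 2 * ((b * i + w * e) ^ 2 + (b * i ^ 2 + w * (1 - η) * e * i)) := by
  have hσ := sq_nonneg σ
  have hw0 : 0 ≤ w := by linarith
  constructor
  · refine hμ.trans (mul_le_mul_of_nonneg_left (add_le_add ?_ ?_) hσ)
    · exact mul_le_mul_of_nonneg_right (by linarith) hi.le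
    · exact mul_le_mul_of_nonneg_right (by linarith) he.le
  · have hρ : 0 ≤ b * i + w * e := by positivity
    refine (mul_le_mul_of_nonneg_right hμ hρ).trans ?_
    have h1 : 0 ≤ ((b - 1) * w + w * (1 - η) - 2 * C * b) * (e * i) := by
      have : 0 ≤ (b - 1) * w := mul_nonneg (by linarith) hw0
      exact mul_nonneg (by linarith) (by positivity)
    have h2 : 0 ≤ w * (w - 2 * C) * e ^ 2 :=
      mul_nonneg (mul_nonneg hw0 (by linarith)) (by positivity)
    have h3 : 0 ≤ σ ^ 2 / 2 * (((b - 1) * w + w * (1 - η) - 2 * C * b) * (e * i)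
        + w * (w - 2 * C) * e ^ 2) := by positivity
    linarith

/-- The bound of the drift near the origin when `μ - c / x` has no exponent `≤ -1`. -/
lemma FLP.exists_drift_bound (q : FLP) (c : ℝ)
    (hq : ∀ s ∈ (q - Finsupp.single (-1) c).support, -1 < s) {N : ℝ} (hN : 1 ≤ N) :
    ∃ η C : ℝ, 0 < η ∧ η < 1 ∧ 0 ≤ C ∧ ∀ x, 0 < x → x ≤ N →
      q.eval x ≤ c * x⁻¹ + C * x ^ (η - 1) := by
  set q' : FLP := q - Finsupp.single (-1) c with hq'
  obtain ⟨η, hη0, hη1, hη⟩ : ∃ η : ℝ, 0 < η ∧ η < 1 ∧ ∀ s ∈ q'.support, -(1 - η) ≤ s := by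
    have h1 : ∀ᶠ η : ℝ in 𝓝[>] 0, ∀ s ∈ q'.support, -(1 - η) ≤ s := by
      rw [Filter.eventually_all_finset]
      intro s hs
      have h2 : ∀ᶠ η : ℝ in 𝓝 0, η < s + 1 := gt_mem_nhds (by linarith [hq s hs])
      filter_upwards [nhdsWithin_le_nhds h2] with η h3
      linarith
    have h2 : ∀ᶠ η : ℝ in 𝓝[>] 0, η < 1 := nhdsWithin_le_nhds (gt_mem_nhds one_pos)
    obtain ⟨η, ⟨h3, h4⟩, h5⟩ := ((h1.and h2).and self_mem_nhdsWithin).exists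
    exact ⟨η, h5, h4, h3⟩
  obtain ⟨K, D, hK, hD, hb⟩ := q'.exists_bound (by linarith : 0 ≤ 1 - η) hη
  refine ⟨η, K * N ^ D * N ^ (1 - η), hη0, hη1, by positivity, fun x hx hxN => ?_⟩
  have h1 : q.eval x = c * x⁻¹ + q'.eval x := by
    have := muHat_eq_eval q c x
    rw [← hq', muHat] at this
    linarith
  rw [h1]
  gcongr
  have hNη : 1 ≤ N ^ (1 - η) := Real.one_le_rpow hN (by linarith)
  have hND : 0 ≤ K * N ^ D := by positivity
  rcases le_total x 1 with h2 | h2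
  · have h3 := (le_abs_self _).trans ((hb x N hx h2 hN).1 x le_rfl hxN)
    refine h3.trans ?_
    have h4 : -(1 - η) = η - 1 := by ring
    rw [h4]
    have h5 : 0 ≤ x ^ (η - 1) := by positivity
    calc K * (x ^ (η - 1) * N ^ D) = K * N ^ D * 1 * x ^ (η - 1) := by ring
      _ ≤ _ := by gcongr
  · have h3 := (le_abs_self _).trans ((hb 1 N one_pos le_rfl hN).1 x h2 hxN)
    refine h3.trans ?_
    rw [Real.one_rpow, one_mul]
    have h5 : 1 ≤ N ^ (1 - η) * x ^ (η - 1) := by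
      calc (1 : ℝ) = x ^ (1 - η) * x ^ (η - 1) := by
            rw [← Real.rpow_add hx]; simp
        _ ≤ _ := by
            gcongr
    calc K * N ^ D = K * N ^ D * 1 := by ring
      _ ≤ K * N ^ D * (N ^ (1 - η) * x ^ (η - 1)) := by gcongr
      _ = _ := by ring

/-- A smooth compactly supported function on the line that agrees with the perturbed power on an
interval `[δ, N]` and is, up to a factor in `[0, 1]` that does not depend on the parameters of the
perturbed power, equal to it everywhere. -/
lemma exists_cutoff {δ N : ℝ} (hδ : 0 < δ) (hN : δ < N) :
    ∃ χ : ℝ → ℝ, Measurable χ ∧ (∀ x, 0 ≤ χ x) ∧ (∀ x, χ x ≤ 1) ∧ (∀ x, x ≤ δ / 2 → χ x = 0) ∧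
      (∀ x, δ ≤ x → x ≤ N → χ x = 1) ∧ ∀ b κ η θ : ℝ,
        ContDiff ℝ 3 (fun x => χ x * perturbedPower b κ η θ x) ∧
        HasCompactSupport (fun x => χ x * perturbedPower b κ η θ x) := by
  let φ : ContDiffBump ((δ + N) / 2) := ⟨(N - δ) / 2, (N - δ) / 2 + δ / 2, by linarith, by linarith⟩
  have h0 : ∀ x, x ≤ δ / 2 → φ x = 0 := by
    intro x hx
    refine φ.zero_of_le_dist ?_
    rw [Real.dist_eq, abs_of_nonpos (by linarith)]
    change (N - δ) / 2 + δ / 2 ≤ _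
    linarith
  refine ⟨φ, φ.continuous.measurable, fun x => φ.nonneg, fun x => φ.le_one, h0, ?_, ?_⟩
  · intro x h1 h2
    refine φ.one_of_mem_closedBall ?_
    rw [Metric.mem_closedBall, Real.dist_eq, abs_le]
    change -((N - δ) / 2) ≤ _ ∧ _ ≤ (N - δ) / 2
    constructor <;> linarith
  · intro b κ η θ
    refine ⟨contDiff_iff_contDiffAt.2 fun x => ?_, φ.hasCompactSupport.mul_right⟩
    rcases le_or_gt x 0 with hx | hx
    · have h1 : (fun x => φ x * perturbedPower b κ η θ x) =ᶠ[𝓝 x] fun _ => 0 := by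
        filter_upwards [gt_mem_nhds (show x < δ / 2 by linarith)] with y hy
        rw [h0 y hy.le, zero_mul]
      exact contDiffAt_const.congr_of_eventuallyEq h1
    · exact φ.contDiffAt.mul (contDiffAt_perturbedPower b κ η θ hx)

end PosScheme

/-! ### Lower bounds for the probability that an Euler chain comes close to the origin -/

namespace PosScheme

open Filter Topology

/-- The function `f(r, x) = χ(x) s(x) (exp(θ (v r - x)) - 1)`, with `r` the remaining time, `s` the
perturbed power and `χ` a cutoff. Where it is positive, `f` is a subsolution of the backward
equation of an Euler chain whose drift satisfies `m(z) ≤ σ² ((b + 1) / (2 z) + C z ^ (η - 1))`. -/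
lemma exists_subsolution {σ b η C κ θ v δ N T A : ℝ} {m : ℝ → ℝ} (hb : 1 ≤ b)
    (hC : 0 ≤ C) (hw : 2 * C * b ≤ κ * η * (1 - η)) (hwC : 2 * C ≤ κ * η) (hκ : 0 ≤ κ)
    (hθ : 0 < θ) (hv : 0 < v) (hvθ : v ≤ σ ^ 2 * θ / 2) (hδ : 0 < δ) (hN : δ < N)
    (hA : ∀ z, |m z| ≤ A)
    (hm : ∀ z, δ < z → z < N → m z ≤ σ ^ 2 * ((b + 1) / 2 * z⁻¹ + C * z ^ (η - 1))) :
    ∃ (f : ℝ → ℝ → ℝ) (D C' : ℝ), (∀ r, Measurable (f r)) ∧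
      (∀ r x, r ≤ T → |f r x| ≤ D) ∧
      (∀ r x, δ ≤ x → x ≤ N → f r x = perturbedPower b κ η 0 x * (Real.exp (θ * (v * r - x)) - 1)) ∧
      (∀ r x, r ≤ T → x ≤ δ → f r x ≤ (δ / 2) ^ (-b) * Real.exp (θ * v * T)) ∧
      (∀ r x, v * r ≤ x → f r x ≤ 0) ∧ 0 < C' ∧
      ∀ r z k, k ≤ r → r ≤ T → 0 ≤ k → k ≤ 1 → δ < z → z < N → z < v * r →
        f r z - C' * (k * Real.sqrt k)
          ≤ ∫ g, f (r - k) (z + (k * m z + σ * (Real.sqrt k * g))) ∂gaussianReal 0 1 := by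
  obtain ⟨χ, hχm, hχ0, hχ1, hχz, hχo, hχs⟩ := exists_cutoff hδ hN
  set U : ℝ → ℝ := fun x => χ x * perturbedPower b κ η θ x with hU
  set S : ℝ → ℝ := fun x => χ x * perturbedPower b κ η 0 x with hS
  obtain ⟨hUd, hUc⟩ := hχs b κ η θ
  obtain ⟨hSd, hSc⟩ := hχs b κ η 0
  change ContDiff ℝ 3 U at hUd
  change HasCompactSupport U at hUc
  change ContDiff ℝ 3 S at hSd
  change HasCompactSupport S at hSc
  obtain ⟨B, hB, hB0, hB1, hB2, -⟩ := exists_second_order_taylor hUd hUc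
  obtain ⟨B', hB', hB0', -⟩ := exists_second_order_taylor hSd hSc
  obtain ⟨C₁, hC₁, hG₁⟩ := exists_generator_bound hUd hUc σ A
  obtain ⟨C₂, hC₂, hG₂⟩ := exists_generator_bound hSd hSc σ A
  set E : ℝ := Real.exp (θ * v * T) with hE
  have hE0 : 0 < E := Real.exp_pos _
  have hA0 : 0 ≤ A := (abs_nonneg _).trans (hA 0)
  have hUS : ∀ x, U x = S x * Real.exp (-(θ * x)) := by
    intro x
    simp only [hU, hS, perturbedPower]
    rw [mul_assoc, mul_assoc, ← Real.exp_add]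
    ring_nf
  have hUpos : ∀ x, 0 ≤ U x := by
    intro x
    rcases le_or_gt x (δ / 2) with h1 | h1
    · simp [hU, hχz x h1]
    · exact mul_nonneg (hχ0 x) (perturbedPower_pos _ _ _ _ (by linarith)).le
  have hSpos : ∀ x, 0 ≤ S x := by
    intro x
    rcases le_or_gt x (δ / 2) with h1 | h1
    · simp [hS, hχz x h1]
    · exact mul_nonneg (hχ0 x) (perturbedPower_pos _ _ _ _ (by linarith)).le
  set f : ℝ → ℝ → ℝ := fun r x => Real.exp (θ * v * r) * U x - S x with hf
  have hfe : ∀ r x, f r x = S x * (Real.exp (θ * (v * r - x)) - 1) := by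
    intro r x
    simp only [hf]
    rw [hUS, mul_sub, mul_sub, Real.exp_sub, Real.exp_neg]
    ring_nf
  have hexpT : ∀ r, r ≤ T → Real.exp (θ * v * r) ≤ E := fun r hr =>
    Real.exp_le_exp.2 (by gcongr)
  set C' : ℝ := E * (C₁ + θ * v * (A * B + σ ^ 2 / 2 * B + C₁)) + C₂ with hC'
  refine ⟨f, E * B + B', C', fun r => ?_, ?_, ?_, ?_, ?_, by positivity, ?_⟩
  · exact (hUd.continuous.measurable.const_mul _).sub hSd.continuous.measurable
  · intro r x hr
    refine (abs_sub _ _).trans (add_le_add ?_ (hB0' x))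
    rw [abs_mul, abs_of_pos (Real.exp_pos _)]
    exact mul_le_mul (hexpT r hr) (hB0 x) (abs_nonneg _) hE0.le
  · intro r x h1 h2
    rw [hfe]
    simp only [hS]
    rw [hχo x h1 h2, one_mul]
  · intro r x hr hx
    have h1 : f r x ≤ E * U x := by
      have := mul_le_mul_of_nonneg_right (hexpT r hr) (hUpos x)
      simp only [hf]
      linarith [hSpos x]
    refine h1.trans ?_
    rw [mul_comm E]
    refine mul_le_mul_of_nonneg_right ?_ hE0.le
    rcases le_or_gt x (δ / 2) with h2 | h2
    · simp only [hU, hχz x h2, zero_mul]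
      positivity
    · have h3 := perturbedPower_le (κ := κ) (η := η) (θ := θ) (b := b) (by linarith) hκ hθ.le
        (by linarith : 0 < δ / 2) h2.le
      calc U x ≤ 1 * perturbedPower b κ η θ x := by
            simp only [hU]
            gcongr
            · exact (perturbedPower_pos _ _ _ _ (by linarith)).le
            · exact hχ1 x
        _ ≤ _ := by rw [one_mul]; exact h3
  · intro r x hx
    rw [hfe]
    refine mul_nonpos_of_nonneg_of_nonpos (hSpos x) ?_
    rw [sub_nonpos, Real.exp_le_one_iff]
    exact mul_nonpos_of_nonneg_of_nonpos hθ.le (by linarith)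
  · intro r z k hkr hrT hk hk1 hzδ hzN hzv
    have hz : 0 < z := hδ.trans hzδ
    have hs : 0 ≤ Real.sqrt k := Real.sqrt_nonneg k
    have hs1 : Real.sqrt k ≤ 1 := Real.sqrt_le_one.2 hk1
    have hss : Real.sqrt k ^ 2 = k := Real.sq_sqrt hk
    have hks : k ≤ Real.sqrt k := by
      calc k = Real.sqrt k * Real.sqrt k := by rw [← sq, hss]
        _ ≤ Real.sqrt k * 1 := by gcongr
        _ = _ := mul_one _
    have hev : ∀ θ', (fun x => χ x * perturbedPower b κ η θ' x)
        =ᶠ[𝓝 z] perturbedPower b κ η θ' := by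
      intro θ'
      filter_upwards [lt_mem_nhds hzδ, gt_mem_nhds hzN] with x h1 h2
      rw [hχo x h1.le h2.le, one_mul]
    have hU0 : U z = perturbedPower b κ η θ z := (hev θ).eq_of_nhds
    have hS0 : S z = perturbedPower b κ η 0 z := (hev 0).eq_of_nhds
    have hU1 : deriv U z = -(b * z⁻¹ + κ * η * z ^ (η - 1) + θ) * U z := by
      rw [(hev θ).deriv_eq, deriv_perturbedPower _ _ _ _ hz, hU0]
    have hS1 : deriv S z = -(b * z⁻¹ + κ * η * z ^ (η - 1) + 0) * S z := by
      rw [(hev 0).deriv_eq, deriv_perturbedPower _ _ _ _ hz, hS0]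
    have hU2 : deriv (deriv U) z = ((b * z⁻¹ + κ * η * z ^ (η - 1) + θ) ^ 2
          + (b * z⁻¹ ^ 2 + κ * η * (1 - η) * z ^ (η - 1) * z⁻¹)) * U z := by
      rw [(hev θ).deriv.deriv_eq, deriv_deriv_perturbedPower _ _ _ _ hz, hU0]
    have hS2 : deriv (deriv S) z = ((b * z⁻¹ + κ * η * z ^ (η - 1) + 0) ^ 2
          + (b * z⁻¹ ^ 2 + κ * η * (1 - η) * z ^ (η - 1) * z⁻¹)) * S z := by
      rw [(hev 0).deriv.deriv_eq, deriv_deriv_perturbedPower _ _ _ _ hz, hS0]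
    have hmz := hA z
    obtain ⟨ha, hb'⟩ := drift_le_of_le (w := κ * η) (η := η) hb hC (inv_pos.2 hz)
      (Real.rpow_pos_of_pos hz (η - 1)) hw hwC (hm z hzδ hzN)
    set μ := m z with hμ
    set ρ : ℝ := b * z⁻¹ + κ * η * z ^ (η - 1) with hρ
    set d : ℝ := b * z⁻¹ ^ 2 + κ * η * (1 - η) * z ^ (η - 1) * z⁻¹ with hd
    set LU : ℝ := μ * deriv U z + σ ^ 2 / 2 * deriv (deriv U) z with hLU
    set LS : ℝ := μ * deriv S z + σ ^ 2 / 2 * deriv (deriv S) z with hLS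
    set JU : ℝ := ∫ g, U (z + (k * μ + σ * (Real.sqrt k * g))) ∂gaussianReal 0 1 with hJU
    set JS : ℝ := ∫ g, S (z + (k * μ + σ * (Real.sqrt k * g))) ∂gaussianReal 0 1 with hJS
    have iU : Integrable (fun g => U (z + (k * μ + σ * (Real.sqrt k * g)))) (gaussianReal 0 1) := by
      refine Integrable.of_bound ?_ B (Filter.Eventually.of_forall fun g => ?_)
      · exact (hUd.continuous.comp (by fun_prop)).aestronglyMeasurable
      · rw [Real.norm_eq_abs]; exact hB0 _
    have iS : Integrable (fun g => S (z + (k * μ + σ * (Real.sqrt k * g)))) (gaussianReal 0 1) := by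
      refine Integrable.of_bound ?_ B' (Filter.Eventually.of_forall fun g => ?_)
      · exact (hSd.continuous.comp (by fun_prop)).aestronglyMeasurable
      · rw [Real.norm_eq_abs]; exact hB0' _
    have hint : ∫ g, f (r - k) (z + (k * μ + σ * (Real.sqrt k * g))) ∂gaussianReal 0 1
        = Real.exp (θ * v * (r - k)) * JU - JS := by
      simp only [hf]
      rw [integral_sub (iU.const_mul _) iS, integral_const_mul]
    rw [hint]
    have hJ1 : -(C₁ * (k * Real.sqrt k)) ≤ JU - (U z + k * LU) ∧
        JU - (U z + k * LU) ≤ C₁ * (k * Real.sqrt k) := abs_le.1 (hG₁ z μ k hk hk1 hmz)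
    have hJ2 : -(C₂ * (k * Real.sqrt k)) ≤ JS - (S z + k * LS) ∧
        JS - (S z + k * LS) ≤ C₂ * (k * Real.sqrt k) := abs_le.1 (hG₂ z μ k hk hk1 hmz)
    have hJU0 : 0 ≤ JU := integral_nonneg fun g => hUpos _
    set τ : ℝ := Real.exp (θ * v * r) with hτ
    have hτ0 : 0 < τ := Real.exp_pos _
    have hτE : τ ≤ E := hexpT r hrT
    have hτk : τ * (1 - θ * v * k) ≤ Real.exp (θ * v * (r - k)) := by
      have h1 : Real.exp (θ * v * (r - k)) = τ * Real.exp (-(θ * v * k)) := by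
        rw [hτ, ← Real.exp_add]; ring_nf
      rw [h1]
      gcongr
      linarith [Real.add_one_le_exp (-(θ * v * k))]
    have hLUb : LU ≤ A * B + σ ^ 2 / 2 * B := by
      have h1 : μ * deriv U z ≤ A * B := by
        refine (le_abs_self _).trans ?_
        rw [abs_mul]
        exact mul_le_mul hmz (hB1 z) (abs_nonneg _) hA0
      have h2 : σ ^ 2 / 2 * deriv (deriv U) z ≤ σ ^ 2 / 2 * B :=
        mul_le_mul_of_nonneg_left ((le_abs_self _).trans (hB2 z)) (by positivity)
      linarith
    have hks0 : 0 ≤ k * Real.sqrt k := mul_nonneg hk hs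
    have hJUu : JU ≤ U z + (A * B + σ ^ 2 / 2 * B + C₁) * Real.sqrt k := by
      have h1 : k * LU ≤ (A * B + σ ^ 2 / 2 * B) * Real.sqrt k := by
        calc k * LU ≤ k * (A * B + σ ^ 2 / 2 * B) := by gcongr
          _ ≤ Real.sqrt k * (A * B + σ ^ 2 / 2 * B) := by gcongr
          _ = _ := mul_comm _ _
      have h2 : C₁ * (k * Real.sqrt k) ≤ C₁ * (1 * Real.sqrt k) := by gcongr
      linarith [hJ1.2]
    have hθvk : 0 ≤ θ * v * k := by positivity
    -- the backward operator applied to `f` at remaining time `r`: it splits into the contributions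
    -- of the perturbed power and of the exponential factor, both nonnegative where `f` is
    have hmain : 0 ≤ τ * (LU - θ * v * U z) - LS := by
      have hSz : 0 ≤ S z := hSpos z
      have hτU : 1 ≤ τ * Real.exp (-(θ * z)) := by
        rw [hτ, ← Real.exp_add, Real.one_le_exp_iff]
        have : 0 ≤ θ * (v * r - z) := mul_nonneg hθ.le (by linarith)
        linarith
      set ε := τ * Real.exp (-(θ * z)) with hε
      have e1 : τ * (LU - θ * v * U z) - LS
          = S z * ((ε - 1) * (σ ^ 2 / 2 * (ρ ^ 2 + d) - μ * ρ)
            + ε * θ * ((σ ^ 2 * ρ - μ) + (σ ^ 2 * θ / 2 - v))) := by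
        rw [hLU, hLS, hU1, hU2, hS1, hS2, hUS z, hε]
        ring
      rw [e1]
      refine mul_nonneg hSz (add_nonneg (mul_nonneg (by linarith) (by linarith)) ?_)
      exact mul_nonneg (mul_nonneg (by linarith) hθ.le) (by linarith)
    have h1 : τ * (1 - θ * v * k) * JU ≤ Real.exp (θ * v * (r - k)) * JU :=
      mul_le_mul_of_nonneg_right hτk hJU0
    have h2 : τ * (JU - θ * v * k * (U z + (A * B + σ ^ 2 / 2 * B + C₁) * Real.sqrt k))
        ≤ τ * (1 - θ * v * k) * JU := by
      have := mul_le_mul_of_nonneg_left hJUu (mul_nonneg hτ0.le hθvk)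
      linarith
    have h3 : τ * (U z + k * LU - C₁ * (k * Real.sqrt k)) ≤ τ * JU :=
      mul_le_mul_of_nonneg_left (by linarith [hJ1.1]) hτ0.le
    have h4 : τ * ((C₁ + θ * v * (A * B + σ ^ 2 / 2 * B + C₁)) * (k * Real.sqrt k))
        ≤ E * ((C₁ + θ * v * (A * B + σ ^ 2 / 2 * B + C₁)) * (k * Real.sqrt k)) := by gcongr
    have h5 : 0 ≤ k * (τ * (LU - θ * v * U z) - LS) := mul_nonneg hk hmain
    have h6 : f r z = τ * U z - S z := rfl
    rw [h6, hC']
    linarith [hJ2.2]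

section Hitting

variable {Ω : Type*} [mΩ : MeasurableSpace Ω] {Pr : Measure Ω} [IsProbabilityMeasure Pr]
  {ℱ : Filtration ℝ≥0 mΩ} {W : ℝ≥0 → Ω → ℝ}

/-- One step of the Euler scheme with drift `m`. -/
noncomputable def eulerStep (m : ℝ → ℝ) (σ : ℝ) (k : ℝ≥0) (y Δ : ℝ) : ℝ := y + (k * m y + σ * Δ)

lemma measurable_eulerStep {m : ℝ → ℝ} (hm : Measurable m) (σ : ℝ) (k : ℝ≥0) :
    Measurable (Function.uncurry (eulerStep m σ k)) :=
  measurable_fst.add (((hm.comp measurable_fst).const_mul _).add (measurable_snd.const_mul σ))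

/-- Dynkin's inequality for a subsolution `f` (with the remaining time as its first argument) that
is at most `F` below `δ` and nonpositive beyond `v r`. -/
lemma IsBrownianOn.le_hitting (hW : IsBrownianOn Pr ℱ W) {m : ℝ → ℝ} (hm : Measurable m) (σ : ℝ)
    {f : ℝ → ℝ → ℝ} {D C' δ N v F x₀ : ℝ} {T k : ℝ≥0} {M : ℕ} (hM : 0 < M) (hk : k = T / M)
    (hk1 : k ≤ 1) (hδ : 0 < δ) (hv : 0 < v) (hvN : v * T ≤ N) (hF : 0 ≤ F) (hC' : 0 ≤ C')
    (hfm : ∀ r : ℝ, Measurable (f r)) (hfD : ∀ r x : ℝ, r ≤ T → |f r x| ≤ D)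
    (hfδ : ∀ r x : ℝ, r ≤ T → x ≤ δ → f r x ≤ F) (hf0 : ∀ r x : ℝ, v * r ≤ x → f r x ≤ 0)
    (hstep : ∀ r z k : ℝ, k ≤ r → r ≤ T → 0 ≤ k → k ≤ 1 → δ < z → z < N → z < v * r →
        f r z - C' * (k * Real.sqrt k)
          ≤ ∫ g, f (r - k) (z + (k * m z + σ * (Real.sqrt k * g))) ∂gaussianReal 0 1)
    (hδx : δ < x₀) (hxT : x₀ < v * T) :
    f T x₀ ≤ F * Pr.real {ω | ∃ n ≤ M, brownianChain W (eulerStep m σ k) k x₀ n ω ≤ δ}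
      + M * (C' * (k * Real.sqrt k)) := by
  set Z := brownianChain W (eulerStep m σ k) k x₀ with hZ
  have hΨ : Measurable (Function.uncurry (eulerStep m σ k)) := measurable_eulerStep hm σ k
  have hZF : ∀ n : ℕ, Measurable[ℱ (n * k)] (Z n) := hW.measurable_chain hΨ k x₀
  have hZm : ∀ n, Measurable (Z n) := fun n => (hZF n).mono (ℱ.le _) le_rfl
  have hM' : (M : ℝ) ≠ 0 := by exact_mod_cast hM.ne'
  have hMk : (M : ℝ) * k = T := by
    rw [hk]
    push_cast
    field_simp
  have hk0 : 0 ≤ (k : ℝ) := k.coe_nonneg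
  set r : ℕ → ℝ := fun n => T - n * k with hr
  have hrT : ∀ n, r n ≤ T := fun n => by
    have : 0 ≤ (n : ℝ) * k := by positivity
    simp only [hr]; linarith
  have hrs : ∀ n : ℕ, r n - k = r (n + 1) := fun n => by simp only [hr]; push_cast; ring
  have hmono : ∀ i j : ℕ, i ≤ j → (i : ℝ≥0) * k ≤ j * k := fun i j hij => by gcongr
  set A : ℕ → Set Ω := fun n => {ω | ∀ j ≤ n, δ < Z j ω ∧ Z j ω < v * r j} with hA
  set H : ℕ → Set Ω := fun n => {ω | ∃ j ≤ n, Z j ω ≤ δ} with hH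
  have hAm : ∀ n : ℕ, MeasurableSet[ℱ (n * k)] (A n) := by
    intro n
    have : A n = ⋂ j ∈ Finset.range (n + 1), {ω | δ < Z j ω ∧ Z j ω < v * r j} := by
      ext ω
      simp [hA]
    rw [this]
    refine Finset.measurableSet_biInter _ fun j hj => ?_
    have hj' : j ≤ n := Nat.lt_succ_iff.1 (Finset.mem_range.1 hj)
    have h1 := (hZF j).mono (ℱ.mono (hmono j n hj')) le_rfl
    exact (measurableSet_lt measurable_const h1).inter (measurableSet_lt h1 measurable_const)
  have hAm' : ∀ n, MeasurableSet (A n) := fun n => ℱ.le _ _ (hAm n)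
  have hHm : ∀ n, MeasurableSet (H n) := by
    intro n
    have : H n = ⋃ j ∈ Finset.range (n + 1), {ω | Z j ω ≤ δ} := by
      ext ω
      simp [hH]
    rw [this]
    exact Finset.measurableSet_biUnion _ fun j _ => measurableSet_le (hZm j) measurable_const
  have hint : ∀ n, Integrable (fun ω => f (r n) (Z n ω)) Pr := fun n =>
    Integrable.of_bound ((hfm _).comp (hZm n)).aestronglyMeasurable D
      (Filter.Eventually.of_forall fun ω => hfD _ _ (hrT n))
  -- the chain is stopped on reaching `δ` or leaving the region where `f` is positive; `A n` is the
  -- event that this has not happened up to `n`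
  have key : ∀ n ≤ M, f T x₀ ≤ (∫ ω in A n, f (r n) (Z n ω) ∂Pr) + F * Pr.real (H n)
      + n * (C' * (k * Real.sqrt k)) := by
    intro n
    induction n with
    | zero =>
      intro _
      have hA0 : A 0 = univ := by
        ext ω
        have : Z 0 ω = x₀ := rfl
        simp [hA, this, hr, hδx, hxT]
      have h1 : ∀ ω, f (r 0) (Z 0 ω) = f T x₀ := fun ω => by
        have : Z 0 ω = x₀ := rfl
        simp [this, hr]
      rw [hA0]
      simp only [h1, Measure.restrict_univ, integral_const, probReal_univ, one_smul]
      have : 0 ≤ F * Pr.real (H 0) := by positivity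
      simpa using this
    | succ n ih =>
      intro hn
      refine (ih (by omega)).trans ?_
      have hkr : (k : ℝ) ≤ r n := by
        have h1 : ((n + 1 : ℕ) : ℝ) * k ≤ M * k := by gcongr
        rw [hMk] at h1
        push_cast at h1
        simp only [hr]
        linarith
      have hG : Measurable (Function.uncurry fun y Δ => f (r (n + 1)) (eulerStep m σ k y Δ)) :=
        (hfm _).comp hΨ
      have hle : (n : ℝ≥0) * k ≤ (n + 1 : ℕ) * k := hmono n (n + 1) (by omega)
      have h2 : ((n + 1 : ℕ) * k - n * k : ℝ≥0) = k := by
        push_cast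
        rw [add_mul, one_mul, add_tsub_cancel_left]
      have h1 := hW.integral_step hle (hAm n) (hZF n) hG (B := D) (fun x z => hfD _ _ (hrT _))
      rw [h2] at h1
      have h3 : ∫ ω in A n, f (r n) (Z n ω) ∂Pr
          ≤ (∫ ω in A n, f (r (n + 1)) (Z (n + 1) ω) ∂Pr) + C' * (k * Real.sqrt k) := by
        change _ ≤ (∫ ω in A n, f (r (n + 1))
          (eulerStep m σ k (Z n ω) (W ((n + 1 : ℕ) * k) ω - W (n * k) ω)) ∂Pr) + _
        rw [h1]
        have i1 : Integrable (fun ω => ∫ g, f (r (n + 1)) (eulerStep m σ k (Z n ω)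
            (Real.sqrt k * g)) ∂gaussianReal 0 1) (Pr.restrict (A n)) := by
          refine Integrable.of_bound ?_ D (Filter.Eventually.of_forall fun ω => ?_)
          · have h4 : Measurable fun p : ℝ × ℝ =>
                f (r (n + 1)) (eulerStep m σ k p.1 (Real.sqrt k * p.2)) :=
              hG.comp (measurable_fst.prodMk (measurable_snd.const_mul _))
            exact ((h4.stronglyMeasurable.integral_prod_right'
              (ν := gaussianReal 0 1)).comp_measurable (hZm n)).aestronglyMeasurable
          · refine (norm_integral_le_of_norm_le_const (C := D)
              (Filter.Eventually.of_forall fun g => hfD _ _ (hrT _))).trans ?_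
            simp
        have i2 : Integrable (fun _ : Ω => C' * (k * Real.sqrt k)) (Pr.restrict (A n)) :=
          integrable_const _
        calc ∫ ω in A n, f (r n) (Z n ω) ∂Pr
            ≤ ∫ ω in A n, ((∫ g, f (r (n + 1)) (eulerStep m σ k (Z n ω)
              (Real.sqrt k * g)) ∂gaussianReal 0 1) + C' * (k * Real.sqrt k)) ∂Pr := by
              refine setIntegral_mono_on (hint n).integrableOn (i1.add i2) (hAm' n) fun ω hω => ?_
              obtain ⟨h5, h6⟩ := hω n le_rfl
              have h7 := hstep (r n) (Z n ω) k hkr (hrT n) hk0 (by exact_mod_cast hk1) h5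
                (h6.trans_le ((mul_le_mul_of_nonneg_left (hrT n) hv.le).trans hvN)) h6
              rw [hrs] at h7
              simp only [eulerStep]
              linarith
          _ ≤ _ := by
              rw [integral_add i1 i2]
              gcongr
              rw [setIntegral_const, smul_eq_mul]
              exact mul_le_of_le_one_left (by positivity) measureReal_le_one
      have hsub : A (n + 1) ⊆ A n := fun ω hω j hj => hω j (by omega)
      have h4 : ∫ ω in A n, f (r (n + 1)) (Z (n + 1) ω) ∂Pr
          ≤ (∫ ω in A (n + 1), f (r (n + 1)) (Z (n + 1) ω) ∂Pr)
            + F * Pr.real (A n ∩ {ω | Z (n + 1) ω ≤ δ}) := by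
        have h5 : ∫ ω in A n \ A (n + 1), f (r (n + 1)) (Z (n + 1) ω) ∂Pr
            ≤ F * Pr.real (A n ∩ {ω | Z (n + 1) ω ≤ δ}) := by
          have hms : MeasurableSet {ω | Z (n + 1) ω ≤ δ} :=
            measurableSet_le (hZm _) measurable_const
          calc ∫ ω in A n \ A (n + 1), f (r (n + 1)) (Z (n + 1) ω) ∂Pr
              ≤ ∫ ω in A n \ A (n + 1), {ω | Z (n + 1) ω ≤ δ}.indicator (fun _ => F) ω ∂Pr := by
                refine setIntegral_mono_on (hint _).integrableOn
                  ((integrable_const F).indicator hms).integrableOn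
                  ((hAm' n).diff (hAm' (n + 1))) fun ω hω => ?_
                by_cases h6 : Z (n + 1) ω ≤ δ
                · rw [indicator_of_mem (show ω ∈ {ω | Z (n + 1) ω ≤ δ} from h6)]
                  exact hfδ _ _ (hrT _) h6
                · rw [indicator_of_notMem (show ω ∉ {ω | Z (n + 1) ω ≤ δ} from h6)]
                  refine hf0 _ _ ?_
                  by_contra h7
                  refine hω.2 fun j hj => ?_
                  rcases Nat.lt_or_ge n j with h8 | h8
                  · have : j = n + 1 := le_antisymm hj h8
                    rw [this]
                    exact ⟨not_le.1 h6, not_le.1 h7⟩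
                  · exact hω.1 j h8
            _ = F * Pr.real ({ω | Z (n + 1) ω ≤ δ} ∩ (A n \ A (n + 1))) := by
                rw [integral_indicator hms, setIntegral_const, smul_eq_mul, mul_comm,
                  measureReal_restrict_apply hms]
            _ ≤ _ := by
                refine mul_le_mul_of_nonneg_left (measureReal_mono ?_ (measure_ne_top _ _)) hF
                exact fun ω hω => ⟨hω.2.1, hω.1⟩
        have h6 := setIntegral_union (μ := Pr) (f := fun ω => f (r (n + 1)) (Z (n + 1) ω))
          (disjoint_sdiff_right (s := A (n + 1)) (t := A n)) ((hAm' n).diff (hAm' (n + 1)))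
          (hint _).integrableOn (hint _).integrableOn
        rw [union_sdiff_cancel hsub] at h6
        rw [h6]
        linarith
      have h5 : Pr.real (H n) + Pr.real (A n ∩ {ω | Z (n + 1) ω ≤ δ}) ≤ Pr.real (H (n + 1)) := by
        have hd : Disjoint (H n) (A n ∩ {ω | Z (n + 1) ω ≤ δ}) := by
          refine disjoint_left.2 fun ω ⟨j, hj, h6⟩ h7 => ?_
          exact absurd h6 (not_le.2 (h7.1 j hj).1)
        rw [← measureReal_union hd ((hAm' n).inter (measurableSet_le (hZm _) measurable_const))]
        refine measureReal_mono ?_ (measure_ne_top _ _)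
        rintro ω (⟨j, hj, h6⟩ | h6)
        · exact ⟨j, by omega, h6⟩
        · exact ⟨n + 1, le_rfl, h6.2⟩
      have h6 := mul_le_mul_of_nonneg_left h5 hF
      push_cast
      linarith
  -- at the final time the region is empty
  have hAM : A M = ∅ := by
    ext ω
    simp only [mem_empty_iff_false, iff_false]
    intro hω
    obtain ⟨h1, h2⟩ := hω M le_rfl
    have : r M = 0 := by simp only [hr]; rw [hMk, sub_self]
    rw [this, mul_zero] at h2
    linarith
  have := key M le_rfl
  rw [hAM] at this
  simpa using this

end Hitting

end PosScheme

/-! ### The probability that the exact solution comes close to the origin -/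

namespace PosScheme

open Filter Topology

/-- While the solution stays in `[δ, N]` its drift can be frozen outside of `[δ, N]`, and an Euler
chain for the frozen drift `m` follows the solution. -/
lemma SolPath.abs_sub_euler_le {μ m v x : ℝ → ℝ} {x₀ Lm T k ε δ N : ℝ} {M : ℕ} {Z : ℕ → ℝ}
    (hx : SolPath μ x₀ v x) (hμ : ContinuousOn μ (Ioi 0)) (hT : 0 < T) (hM : 0 < M)
    (hk : k = T / M) (hLm : 0 ≤ Lm) (hm : ∀ y z, |m y - m z| ≤ Lm * |y - z|)
    (hmμ : ∀ y, δ ≤ y → y ≤ N → m y = μ y) (hxδ : ∀ t, 0 ≤ t → t ≤ T → δ ≤ x t)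
    (hxN : ∀ t, 0 ≤ t → t ≤ T → x t ≤ N) (hv0 : v 0 = 0) (hε : 0 ≤ ε)
    (hosc : ∀ s t, 0 ≤ s → s ≤ t → t ≤ T → t ≤ s + k → |x t - x s| ≤ ε) (hZ0 : Z 0 = x₀)
    (hZ : ∀ n : ℕ, Z (n + 1) = Z n + (k * m (Z n) + (v ((n + 1 : ℕ) * k) - v ((n : ℝ) * k))))
    {n : ℕ} (hn : n ≤ M) :
    |x ((n : ℝ) * k) - Z n| ≤ Real.exp (Lm * T) * (T * Lm * ε) := by
  have hM' : (0 : ℝ) < M := by exact_mod_cast hM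
  have hk0 : 0 < k := by rw [hk]; positivity
  have hMk : (M : ℝ) * k = T := by rw [hk]; field_simp
  have hle : ∀ n : ℕ, n ≤ M → (n : ℝ) * k ≤ T := fun n hn => by
    rw [← hMk]; gcongr
  have hmc : Continuous m := by
    refine LipschitzWith.continuous (K := Real.toNNReal Lm) (LipschitzWith.of_dist_le_mul ?_)
    intro y z
    rw [Real.dist_eq, Real.dist_eq, Real.coe_toNNReal _ hLm]
    exact hm y z
  have hstep : ∀ n < M, |x (((n + 1 : ℕ) : ℝ) * k) - Z (n + 1)|
      ≤ (1 + k * Lm) * |x ((n : ℝ) * k) - Z n| + k * Lm * ε := by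
    intro n hn
    set s := (n : ℝ) * k with hs
    set t := ((n + 1 : ℕ) : ℝ) * k with ht
    have hts : t = s + k := by rw [ht, hs]; push_cast; ring
    have hs0 : 0 ≤ s := by positivity
    have hst : s ≤ t := by linarith
    have htT : t ≤ T := hle (n + 1) hn
    have h1 := hx.sub_eq hμ hs0 hst
    have h2 : ∫ u in s..t, μ (x u) = ∫ u in s..t, m (x u) := by
      refine intervalIntegral.integral_congr fun u hu => ?_
      rw [uIcc_of_le hst] at hu
      exact (hmμ _ (hxδ u (hs0.trans hu.1) (hu.2.trans htT))
        (hxN u (hs0.trans hu.1) (hu.2.trans htT))).symm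
    have h3 : ∫ _ in s..t, m (Z n) = k * m (Z n) := by
      rw [intervalIntegral.integral_const, hts, smul_eq_mul]
      ring
    have h4 : x t - Z (n + 1) = (x s - Z n) + ∫ u in s..t, (m (x u) - m (Z n)) := by
      have hi : IntervalIntegrable (fun u => m (x u)) volume s t :=
        (hmc.comp hx.cont).intervalIntegrable _ _
      rw [intervalIntegral.integral_sub hi intervalIntegrable_const, ← h2, h3, hZ n]
      linarith
    have h5 : |∫ u in s..t, (m (x u) - m (Z n))| ≤ Lm * (ε + |x s - Z n|) * k := by
      have := intervalIntegral.norm_integral_le_of_norm_le_const (a := s) (b := t)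
        (f := fun u => m (x u) - m (Z n)) (C := Lm * (ε + |x s - Z n|)) (fun u hu => by
          rw [uIoc_of_le hst] at hu
          rw [Real.norm_eq_abs]
          refine (hm _ _).trans (mul_le_mul_of_nonneg_left ?_ hLm)
          have h6 := hosc s u hs0 hu.1.le (hu.2.trans htT) (by linarith [hu.2])
          have h7 : x u - Z n = (x u - x s) + (x s - Z n) := by ring
          rw [h7]
          exact (abs_add_le _ _).trans (by linarith))
      rw [Real.norm_eq_abs, hts, add_sub_cancel_left, abs_of_pos hk0, ← hts] at this
      exact this
    rw [h4]
    refine (abs_add_le _ _).trans ?_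
    linarith
  have h0 : |x ((0 : ℕ) * k) - Z 0| = 0 := by
    have := hx.eqn 0 le_rfl
    simp only [intervalIntegral.integral_same, add_zero, hv0] at this
    simp [this, hZ0]
  have hg := discrete_gronwall (a := fun n => |x ((n : ℝ) * k) - Z n|) (u := k * Lm)
    (b := k * Lm * ε) (by positivity) (by positivity) (abs_nonneg _) hstep hn
  simp only [h0, zero_add] at hg
  refine hg.trans ?_
  have h1 := hle n hn
  gcongr ?_ * ?_
  · rw [Real.exp_le_exp]
    calc k * Lm * n = Lm * (n * k) := by ring
      _ ≤ Lm * T := by gcongr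
  · calc n * (k * Lm * ε) = n * k * Lm * ε := by ring
      _ ≤ T * Lm * ε := by gcongr

/-- A path that stays above `δ` is followed above `δ` by all Euler chains with small step size. -/
lemma SolPath.exists_forall_lt_euler {μ m v x : ℝ → ℝ} {x₀ Lm T δ N : ℝ}
    (hx : SolPath μ x₀ v x) (hμ : ContinuousOn μ (Ioi 0)) (hT : 0 < T)
    (hLm : 0 ≤ Lm) (hm : ∀ y z, |m y - m z| ≤ Lm * |y - z|)
    (hmμ : ∀ y, δ ≤ y → y ≤ N → m y = μ y) (hxδ : ∀ t, 0 ≤ t → t ≤ T → δ < x t)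
    (hxN : ∀ t, 0 ≤ t → t ≤ T → x t ≤ N) (hv0 : v 0 = 0) {Z : ℕ → ℕ → ℝ} (hZ0 : ∀ M, Z M 0 = x₀)
    (hZ : ∀ M n : ℕ, Z M (n + 1) = Z M n + (T / M * m (Z M n)
      + (v ((n + 1 : ℕ) * (T / M)) - v ((n : ℝ) * (T / M))))) :
    ∃ M₀ : ℕ, ∀ M ≥ M₀, ∀ n ≤ M, δ < Z M n := by
  obtain ⟨t₀, ht₀, hmin⟩ := isCompact_Icc.exists_isMinOn (nonempty_Icc.2 hT.le)
    (hx.cont.continuousOn (s := Icc 0 T))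
  set γ := x t₀ - δ with hγ
  have hγ0 : 0 < γ := by have := hxδ t₀ ht₀.1 ht₀.2; linarith
  have hxγ : ∀ t, 0 ≤ t → t ≤ T → δ + γ ≤ x t := fun t h1 h2 => by
    have : x t₀ ≤ x t := hmin ⟨h1, h2⟩
    linarith
  set E := Real.exp (Lm * T) * (T * Lm + 1) with hE
  have hE0 : 0 < E := by positivity
  set ε := γ / (2 * E) with hε
  have hε0 : 0 < ε := by positivity
  have huc := isCompact_Icc.uniformContinuousOn_of_continuous (hx.cont.continuousOn (s := Icc 0 T))
  obtain ⟨ρ, hρ, huc'⟩ := Metric.uniformContinuousOn_iff.1 huc ε hε0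
  obtain ⟨M₀, hM₀⟩ := exists_nat_gt (T / ρ)
  refine ⟨M₀ + 1, fun M hM n hn => ?_⟩
  have hM1 : 0 < M := by omega
  have hM' : (0 : ℝ) < M := by exact_mod_cast hM1
  have hkρ : T / M < ρ := by
    rw [div_lt_iff₀ hM', mul_comm, ← div_lt_iff₀ hρ]
    refine hM₀.trans_le ?_
    exact_mod_cast (by omega : M₀ ≤ M)
  have h1 := hx.abs_sub_euler_le hμ hT hM1 rfl hLm hm hmμ (fun t h1 h2 => (hxδ t h1 h2).le) hxN hv0
    hε0.le (fun s t hs hst ht htk => by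
      have := huc' t ⟨hs.trans hst, ht⟩ s ⟨hs, hst.trans ht⟩ (by
        rw [Real.dist_eq, abs_of_nonneg (by linarith)]
        linarith)
      rw [Real.dist_eq] at this
      exact this.le) (hZ0 M) (hZ M) hn
  have h2 : Real.exp (Lm * T) * (T * Lm * ε) ≤ γ / 2 := by
    calc Real.exp (Lm * T) * (T * Lm * ε) ≤ Real.exp (Lm * T) * ((T * Lm + 1) * ε) := by
          gcongr
          linarith
      _ = E * ε := by rw [hE]; ring
      _ = γ / 2 := by rw [hε]; field_simp
  have h3 := hxγ ((n : ℝ) * (T / M)) (by positivity) (by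
    calc (n : ℝ) * (T / M) ≤ M * (T / M) := by gcongr
      _ = T := by field_simp)
  have h4 := (abs_le.1 h1).2
  linarith

section Hitting

variable {Ω : Type*} [mΩ : MeasurableSpace Ω] {Pr : Measure Ω} [IsProbabilityMeasure Pr]
  {ℱ : Filtration ℝ≥0 mΩ} {W : ℝ≥0 → Ω → ℝ}

/-- If the hitting probabilities of the Euler chains for the drift frozen outside of `[δ, N]` are
asymptotically at least `a`, then the solution stays in `(δ, N]` with probability at most
`1 - a`. -/
lemma IsPositiveSolution.measureReal_stay_le (hW : IsBrownianOn Pr ℱ W) {q : FLP} {σ x₀ : ℝ}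
    {X : ℝ≥0 → Ω → ℝ} (hX : IsPositiveSolution Pr ℱ W q.eval σ x₀ X) {T : ℝ≥0} (hT : 0 < T)
    {δ N Lm a C : ℝ} {m : ℝ → ℝ} (hLm : 0 ≤ Lm) (hm : ∀ y z, |m y - m z| ≤ Lm * |y - z|)
    (hmμ : ∀ y, δ ≤ y → y ≤ N → m y = q.eval y)
    (hhit : ∀ M : ℕ, 0 < M → T / M ≤ 1 → a ≤
      Pr.real {ω | ∃ n ≤ M, brownianChain W (eulerStep m σ (T / M)) (T / M) x₀ n ω ≤ δ}
        + C * Real.sqrt (T / M)) :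
    Pr.real {ω | ∀ t ≤ T, δ < X t ω ∧ X t ω ≤ N} ≤ 1 - a := by
  have hT' : (0 : ℝ) < T := by exact_mod_cast hT
  have hmm : Measurable m := by
    refine (LipschitzWith.continuous (K := Real.toNNReal Lm)
      (LipschitzWith.of_dist_le_mul ?_)).measurable
    intro y z
    rw [Real.dist_eq, Real.dist_eq, Real.coe_toNNReal _ hLm]
    exact hm y z
  set Z : ℕ → ℕ → Ω → ℝ := fun M => brownianChain W (eulerStep m σ (T / M)) (T / M) x₀ with hZ
  have hZm : ∀ M n, Measurable (Z M n) := fun M n =>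
    (hW.measurable_chain (measurable_eulerStep hmm σ _) _ x₀ n).mono (ℱ.le _) le_rfl
  set H : ℕ → Set Ω := fun M => {ω | ∃ n ≤ M, Z M n ω ≤ δ} with hH
  have hHm : ∀ M, MeasurableSet (H M) := by
    intro M
    have : H M = ⋃ n ∈ Finset.range (M + 1), {ω | Z M n ω ≤ δ} := by
      ext ω
      simp [hH]
    rw [this]
    exact Finset.measurableSet_biUnion _ fun n _ => measurableSet_le (hZm M n) measurable_const
  set S : ℕ → Set Ω := fun i => ⋂ M ≥ i, (H M)ᶜ with hS
  have hSmono : Monotone S := by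
    intro i j hij ω hω
    simp only [hS, mem_iInter] at hω ⊢
    exact fun M hM => hω M (hij.trans hM)
  have hsub : ∀ᵐ ω ∂Pr, (∀ t ≤ T, δ < X t ω ∧ X t ω ≤ N) → ω ∈ ⋃ i, S i := by
    filter_upwards [hX.ae_solPath] with ω hω hb
    have hb' : ∀ t : ℝ, t ≤ T → δ < X t.toNNReal ω ∧ X t.toNNReal ω ≤ N := fun t ht =>
      hb _ (Real.toNNReal_le_iff_le_coe.2 ht)
    obtain ⟨M₀, hM₀⟩ := hω.exists_forall_lt_euler q.continuousOn_eval hT' hLm hm hmμ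
      (fun t _ ht => (hb' t ht).1) (fun t _ ht => (hb' t ht).2) (by simp)
      (Z := fun M n => Z M n ω) (fun M => rfl) (fun M n => by
        have h1 : ∀ n : ℕ, ((n : ℝ) * ((T : ℝ) / M)).toNNReal = n * (T / M) := fun n => by
          rw [← toNNReal_natCast_mul]
          push_cast
          rfl
        simp only [h1]
        change eulerStep m σ (T / M) (Z M n ω) _ = _
        simp only [eulerStep]
        push_cast
        ring)
    refine mem_iUnion.2 ⟨M₀, ?_⟩
    simp only [hS, mem_iInter, mem_compl_iff, hH, mem_ofPred_eq, not_exists, not_and, not_le]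
    exact hM₀
  have hSi : ∀ i, Pr.real (S i) ≤ 1 - a := by
    intro i
    have hlim : Tendsto (fun M : ℕ => 1 - a + C * Real.sqrt (T / M)) atTop (𝓝 (1 - a)) := by
      have h1 : Tendsto (fun M : ℕ => (T : ℝ) / M) atTop (𝓝 0) :=
        tendsto_const_div_atTop_nhds_zero_nat _
      have h2 := ((Real.continuous_sqrt.tendsto 0).comp h1).const_mul C |>.const_add (1 - a)
      simpa using h2
    refine ge_of_tendsto hlim ?_
    obtain ⟨M₁, hM₁⟩ := exists_nat_ge T
    filter_upwards [eventually_ge_atTop (i + M₁ + 1)] with M hM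
    have hM0 : (0 : ℝ≥0) < M := by exact_mod_cast (by omega : 0 < M)
    have h1 := hhit M (by omega) (by
      rw [div_le_one hM0]
      exact hM₁.trans (by exact_mod_cast (by omega : M₁ ≤ M)))
    have h2 : Pr.real (S i) ≤ Pr.real (H M)ᶜ := by
      refine measureReal_mono (fun ω hω => ?_) (measure_ne_top _ _)
      simp only [hS, mem_iInter] at hω
      exact hω M (by omega)
    rw [measureReal_compl (hHm M), probReal_univ] at h2
    linarith
  have h1 : Pr {ω | ∀ t ≤ T, δ < X t ω ∧ X t ω ≤ N} ≤ ENNReal.ofReal (1 - a) := by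
    calc Pr {ω | ∀ t ≤ T, δ < X t ω ∧ X t ω ≤ N} ≤ Pr (⋃ i, S i) := measure_mono_ae hsub
      _ = ⨆ i, Pr (S i) := hSmono.measure_iUnion
      _ ≤ _ := iSup_le fun i => by
          rw [← ENNReal.ofReal_toReal (measure_ne_top Pr (S i))]
          exact ENNReal.ofReal_le_ofReal (hSi i)
  have h2 : 0 ≤ 1 - a := measureReal_nonneg.trans (hSi 0)
  exact ENNReal.toReal_le_of_le_ofReal h2 h1

/-- The solution comes below `δ` with probability of order at least `δ ^ b`, if `b ≥ 1` and
`b ≥ 2 c / σ² - 1`. -/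
lemma IsPositiveSolution.exists_hitting_lower_bound (hW : IsBrownianOn Pr ℱ W) {q : FLP}
    {σ x₀ c b : ℝ} {X : ℝ≥0 → Ω → ℝ} (hX : IsPositiveSolution Pr ℱ W q.eval σ x₀ X) {T : ℝ≥0}
    (hT : 0 < T) (hσ : σ ≠ 0) (hx₀ : 0 < x₀) (hb : 1 ≤ b) (hbc : 2 * c / σ ^ 2 - 1 ≤ b)
    (hq : ∀ s ∈ (q - Finsupp.single (-1) c).support, -1 < s) :
    ∃ κ δ₀ : ℝ, 0 < κ ∧ 0 < δ₀ ∧ ∀ δ, 0 < δ → δ ≤ δ₀ →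
      ENNReal.ofReal (κ * δ ^ b) ≤ Pr {ω | ∃ t ≤ T, X t ω ≤ δ} := by
  have hT' : (0 : ℝ) < T := by exact_mod_cast hT
  have hσ2 : 0 < σ ^ 2 := by positivity
  obtain ⟨η, C, hη0, hη1, hC, hdrift⟩ := q.exists_drift_bound c hq (le_max_right (2 * x₀) 1)
  set C₁ : ℝ := C / σ ^ 2 with hC₁
  have hC₁0 : 0 ≤ C₁ := by positivity
  have hη1' : 0 < 1 - η := by linarith
  set κ : ℝ := 2 * C₁ * b / (η * (1 - η)) with hκ
  have hκ0 : 0 ≤ κ := by positivity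
  have hw : 2 * C₁ * b ≤ κ * η * (1 - η) := by
    rw [hκ]
    refine le_of_eq ?_
    field_simp
  have hwC : 2 * C₁ ≤ κ * η := by
    have h1 : 2 * C₁ * 1 ≤ 2 * C₁ * b := by gcongr
    have h2 : κ * η * (1 - η) ≤ κ * η * 1 := by gcongr; linarith
    linarith
  set v : ℝ := 2 * x₀ / T with hv
  have hv0 : 0 < v := by positivity
  have hvT : v * T = 2 * x₀ := by rw [hv]; field_simp
  set θ : ℝ := 2 * v / σ ^ 2 with hθ
  have hθ0 : 0 < θ := by positivity
  have hvθ : v ≤ σ ^ 2 * θ / 2 := by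
    rw [hθ]
    refine le_of_eq ?_
    field_simp
  set a₀ : ℝ := perturbedPower b κ η 0 x₀ * (Real.exp (θ * (v * T - x₀)) - 1) with ha₀
  have ha₀0 : 0 < a₀ := by
    refine mul_pos (perturbedPower_pos _ _ _ _ hx₀) ?_
    rw [sub_pos, Real.one_lt_exp_iff]
    exact mul_pos hθ0 (by linarith)
  refine ⟨a₀ / (2 ^ b * Real.exp (θ * v * T)), x₀ / 2, by positivity, by linarith, ?_⟩
  intro δ hδ hδx
  set F : ℝ := (δ / 2) ^ (-b) * Real.exp (θ * v * T) with hF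
  have hF0 : 0 < F := by positivity
  have haF : a₀ / (2 ^ b * Real.exp (θ * v * T)) * δ ^ b = a₀ / F := by
    rw [hF, Real.rpow_neg (by positivity), Real.div_rpow hδ.le (by norm_num)]
    field_simp
  rw [haF]
  obtain ⟨d, hd, hqd⟩ := q.exists_exponent_bound
  obtain ⟨Kq, Dq, hKq, hDq, hbound⟩ := q.exists_bound hd hqd
  have hstay : ∀ N : ℝ, 2 * x₀ ≤ N →
      Pr.real {ω | ∀ t ≤ T, δ < X t ω ∧ X t ω ≤ N} ≤ 1 - a₀ / F := by
    intro N hN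
    have hδN : δ ≤ N := by linarith
    obtain ⟨hb1, hb2⟩ := hbound (min δ 1) (max N 1) (by positivity) (min_le_right _ _)
      (le_max_right _ _)
    set A : ℝ := Kq * ((min δ 1) ^ (-d) * (max N 1) ^ Dq) with hA
    set Lm : ℝ := Kq * ((min δ 1) ^ (-(d + 1)) * (max N 1) ^ Dq) with hLm
    have hmin : 0 < min δ 1 := by positivity
    have hLm0 : 0 ≤ Lm := by positivity
    set m : ℝ → ℝ := fun x => q.eval (max δ (min x N)) with hm
    have hcl : ∀ x, min δ 1 ≤ max δ (min x N) ∧ max δ (min x N) ≤ max N 1 := fun x =>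
      ⟨(min_le_left _ _).trans (le_max_left _ _),
        (max_le hδN (min_le_right _ _)).trans (le_max_left _ _)⟩
    have hmA : ∀ z, |m z| ≤ A := fun z => hb1 _ (hcl z).1 (hcl z).2
    have hmL : ∀ y z, |m y - m z| ≤ Lm * |y - z| := by
      intro y z
      refine (hb2 _ _ (hcl y).1 (hcl y).2 (hcl z).1 (hcl z).2).trans ?_
      refine mul_le_mul_of_nonneg_left ?_ hLm0
      refine (abs_max_sub_max_le_max _ _ _ _).trans (max_le (by simp) ?_)
      refine (abs_min_sub_min_le_max _ _ _ _).trans (max_le le_rfl (by simp))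
    have hmμ : ∀ y, δ ≤ y → y ≤ N → m y = q.eval y := fun y h1 h2 => by
      simp only [hm]
      rw [min_eq_left h2, max_eq_right h1]
    have hmm : Measurable m := by
      refine (LipschitzWith.continuous (K := Real.toNNReal Lm)
        (LipschitzWith.of_dist_le_mul ?_)).measurable
      intro y z
      rw [Real.dist_eq, Real.dist_eq, Real.coe_toNNReal _ hLm0]
      exact hmL y z
    have hmb : ∀ z, δ < z → z < 2 * x₀ →
        m z ≤ σ ^ 2 * ((b + 1) / 2 * z⁻¹ + C₁ * z ^ (η - 1)) := by
      intro z h1 h2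
      have hz : 0 < z := hδ.trans h1
      rw [hmμ z h1.le (h2.le.trans hN)]
      refine (hdrift z hz (h2.le.trans (le_max_left _ _))).trans ?_
      have h3 : c ≤ σ ^ 2 * ((b + 1) / 2) := by
        have h4 : 2 * c / σ ^ 2 ≤ b + 1 := by linarith
        rw [div_le_iff₀ hσ2] at h4
        linarith
      have h4 : σ ^ 2 * C₁ = C := by rw [hC₁]; field_simp
      have h5 := mul_le_mul_of_nonneg_right h3 (inv_pos.2 hz).le
      calc c * z⁻¹ + C * z ^ (η - 1)
          ≤ σ ^ 2 * ((b + 1) / 2) * z⁻¹ + σ ^ 2 * C₁ * z ^ (η - 1) := by rw [h4]; gcongr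
        _ = _ := by ring
    obtain ⟨f, D, C', hfm, hfD, hfe, hfδ, hf0, hC', hstep⟩ :=
      exists_subsolution (T := T) hb hC₁0 hw hwC hκ0 hθ0 hv0 hvθ hδ (by linarith : δ < 2 * x₀)
        hmA hmb
    refine hX.measureReal_stay_le hW hT (C := T * C' / F) hLm0 hmL hmμ fun M hM hM1 => ?_
    have h1 := hW.le_hitting hmm σ hM rfl hM1 hδ hv0 hvT.le hF0.le hC'.le hfm hfD hfδ hf0 hstep
      (by linarith : δ < x₀) (by linarith)
    rw [hfe _ _ (by linarith) (by linarith)] at h1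
    change a₀ ≤ _ at h1
    have hM' : (0 : ℝ) < M := by exact_mod_cast hM
    have h2 : (M : ℝ) * (C' * (((T / M : ℝ≥0) : ℝ) * Real.sqrt ((T / M : ℝ≥0) : ℝ)))
        = T * C' * Real.sqrt (T / M) := by
      push_cast
      field_simp
    rw [h2] at h1
    rw [div_le_iff₀ hF0]
    refine h1.trans (le_of_eq ?_)
    field_simp
  have hall : Pr {ω | ∀ t ≤ T, δ < X t ω} ≤ ENNReal.ofReal (1 - a₀ / F) := by
    set G : ℕ → Set Ω := fun j => {ω | ∀ t ≤ T, δ < X t ω ∧ X t ω ≤ 2 * x₀ + j} with hG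
    have hGmono : Monotone G := by
      intro i j hij ω hω t ht
      have : (i : ℝ) ≤ j := by exact_mod_cast hij
      exact ⟨(hω t ht).1, (hω t ht).2.trans (by linarith)⟩
    have hsub : ∀ᵐ ω ∂Pr, (∀ t ≤ T, δ < X t ω) → ω ∈ ⋃ j, G j := by
      filter_upwards [hX.continuous] with ω hω hlow
      obtain ⟨B, hB⟩ := (isCompact_Icc (a := (0 : ℝ≥0)) (b := T)).exists_bound_of_continuousOn
        hω.continuousOn
      obtain ⟨j, hj⟩ := exists_nat_ge B
      refine mem_iUnion.2 ⟨j, fun t ht => ⟨hlow t ht, ?_⟩⟩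
      have := (le_abs_self _).trans (hB t ⟨zero_le, ht⟩)
      linarith
    calc Pr {ω | ∀ t ≤ T, δ < X t ω} ≤ Pr (⋃ j, G j) := measure_mono_ae hsub
      _ = ⨆ j, Pr (G j) := hGmono.measure_iUnion
      _ ≤ _ := iSup_le fun j => by
          rw [← ENNReal.ofReal_toReal (measure_ne_top Pr (G j))]
          exact ENNReal.ofReal_le_ofReal (hstay _ (by simp))
  have h1a : 0 ≤ 1 - a₀ / F := measureReal_nonneg.trans (hstay _ le_rfl)
  have hone : (1 : ℝ≥0∞) ≤ Pr {ω | ∃ t ≤ T, X t ω ≤ δ} + ENNReal.ofReal (1 - a₀ / F) := by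
    calc (1 : ℝ≥0∞) = Pr univ := measure_univ.symm
      _ ≤ Pr ({ω | ∃ t ≤ T, X t ω ≤ δ} ∪ {ω | ∀ t ≤ T, δ < X t ω}) := by
          refine measure_mono fun ω _ => ?_
          by_cases h : ∃ t ≤ T, X t ω ≤ δ
          · exact Or.inl h
          · push Not at h
            exact Or.inr h
      _ ≤ _ := (measure_union_le _ _).trans (add_le_add le_rfl hall)
  have hsum : ENNReal.ofReal (a₀ / F) + ENNReal.ofReal (1 - a₀ / F) = 1 := by
    rw [← ENNReal.ofReal_add (by positivity) h1a]
    simp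
  rw [← hsum] at hone
  exact (ENNReal.add_le_add_iff_right ENNReal.ofReal_ne_top).1 hone

end Hitting

end PosScheme

/-! ### Comparison of the inverse moments through their tails -/

namespace PosScheme

open Filter Topology

section Tails

variable {Ω : Type*} [mΩ : MeasurableSpace Ω] {Pr : Measure Ω} [IsProbabilityMeasure Pr]
  {ℱ : Filtration ℝ≥0 mΩ} {W : ℝ≥0 → Ω → ℝ}

/-- A measurable version of `sup 1 / X` over `[0, T]`. -/
lemma IsPositiveSolution.exists_sup_inv {μ : ℝ → ℝ} {σ x₀ : ℝ} {X : ℝ≥0 → Ω → ℝ}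
    (hX : IsPositiveSolution Pr ℱ W μ σ x₀ X) (T : ℝ≥0) :
    ∃ V : Ω → ℝ, Measurable V ∧ (∀ ω, 0 ≤ V ω) ∧ ∀ᵐ ω ∂Pr,
      (∀ δ, 0 < δ → (∃ t ≤ T, X t ω ≤ δ) → δ⁻¹ ≤ V ω) ∧
      ∀ r : ℝ, 0 ≤ r → ENNReal.ofReal (V ω ^ r)
        ≤ ⨆ t ∈ Icc (0 : ℝ≥0) T, ENNReal.ofReal (|X t ω| ^ (-r)) := by
  have : Nonempty (Icc (0 : ℝ≥0) T) := ⟨⟨0, le_rfl, zero_le⟩⟩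
  set d : ℕ → Icc (0 : ℝ≥0) T := TopologicalSpace.denseSeq _ with hd
  have hdd : DenseRange d := TopologicalSpace.denseRange_denseSeq _
  have hXm : ∀ t, Measurable (X t) := fun t => (hX.adapted t).mono (ℱ.le t) le_rfl
  set E : Ω → ℝ≥0∞ := fun ω => ⨆ i, ENNReal.ofReal (X (d i) ω)⁻¹ with hE
  have hEm : Measurable E := Measurable.iSup fun i => (hXm _).inv.ennreal_ofReal
  refine ⟨fun ω => (E ω).toReal, hEm.ennreal_toReal, fun ω => ENNReal.toReal_nonneg, ?_⟩
  filter_upwards [hX.continuous, hX.pos] with ω hc hp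
  obtain ⟨s, hs, hmin⟩ := (isCompact_Icc (a := (0 : ℝ≥0)) (b := T)).exists_isMinOn
    ⟨0, le_rfl, zero_le⟩ hc.continuousOn
  have hle : ∀ i, (X (d i) ω)⁻¹ ≤ (X s ω)⁻¹ := fun i => inv_anti₀ (hp s) (hmin (d i).2)
  have hEle : E ω ≤ ENNReal.ofReal (X s ω)⁻¹ := iSup_le fun i => ENNReal.ofReal_le_ofReal (hle i)
  have hEt : E ω ≠ ⊤ := (hEle.trans_lt ENNReal.ofReal_lt_top).ne
  constructor
  · rintro δ hδ ⟨t, ht, htδ⟩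
    have hi : ∀ i, 1 ≤ (E ω).toReal * X (d i) ω := by
      intro i
      have h1 : ENNReal.ofReal (X (d i) ω)⁻¹ ≤ E ω :=
        le_iSup (fun i => ENNReal.ofReal (X (d i) ω)⁻¹) i
      have h2 := (ENNReal.ofReal_le_iff_le_toReal hEt).1 h1
      calc (1 : ℝ) = (X (d i) ω)⁻¹ * X (d i) ω := (inv_mul_cancel₀ (hp _).ne').symm
        _ ≤ _ := mul_le_mul_of_nonneg_right h2 (hp _).le
    have hall : ∀ u : Icc (0 : ℝ≥0) T, 1 ≤ (E ω).toReal * X u ω := by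
      intro u
      refine hdd.induction_on (p := fun u : Icc (0 : ℝ≥0) T => 1 ≤ (E ω).toReal * X u ω) u
        (isClosed_le continuous_const (continuous_const.mul (hc.comp continuous_subtype_val))) hi
    have h1 := hall ⟨t, zero_le, ht⟩
    rw [inv_le_iff_one_le_mul₀ hδ]
    exact h1.trans (mul_le_mul_of_nonneg_left htδ ENNReal.toReal_nonneg)
  · intro r hr
    refine le_iSup₂_of_le s hs (ENNReal.ofReal_le_ofReal ?_)
    rw [abs_of_pos (hp s), Real.rpow_neg (hp s).le, ← Real.inv_rpow (hp s).le]
    refine Real.rpow_le_rpow ENNReal.toReal_nonneg ?_ hr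
    exact ENNReal.toReal_le_of_le_ofReal (inv_pos.2 (hp s)).le hEle

/-- A comparison of tails gives a comparison of moments, with constants that do not depend on the
order of the moment, even where the moments are infinite. -/
lemma lintegral_rpow_le_of_tail_le {V V' : Ω → ℝ} (hV : Measurable V) (hV0 : ∀ ω, 0 ≤ V ω)
    (hV' : Measurable V') (hV'0 : ∀ ω, 0 ≤ V' ω) {t₀ C : ℝ} (ht₀ : 0 ≤ t₀)
    (h : ∀ t, t₀ < t → Pr {ω | t ≤ V ω} ≤ ENNReal.ofReal C * Pr {ω | t ≤ V' ω}) {r : ℝ}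
    (hr : 0 < r) :
    ∫⁻ ω, ENNReal.ofReal (V ω ^ r) ∂Pr
      ≤ ENNReal.ofReal (t₀ ^ r) + ENNReal.ofReal C * ∫⁻ ω, ENNReal.ofReal (V' ω ^ r) ∂Pr := by
  have h0 := lintegral_rpow_eq_lintegral_meas_le_mul Pr (f := fun _ : Ω => t₀)
    (Eventually.of_forall fun _ => ht₀) aemeasurable_const hr
  rw [lintegral_const, measure_univ, mul_one] at h0
  rw [lintegral_rpow_eq_lintegral_meas_le_mul Pr (Eventually.of_forall hV0) hV.aemeasurable hr,
    lintegral_rpow_eq_lintegral_meas_le_mul Pr (Eventually.of_forall hV'0) hV'.aemeasurable hr, h0,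
    mul_left_comm (ENNReal.ofReal C), ← mul_add,
    ← lintegral_const_mul' _ _ (ENNReal.ofReal_ne_top (r := C))]
  refine mul_le_mul_right ?_ (ENNReal.ofReal r)
  have hm : Measurable fun t : ℝ => Pr {_ω : Ω | t ≤ t₀} * ENNReal.ofReal (t ^ (r - 1)) := by
    refine Measurable.mul (Antitone.measurable fun s t hst => measure_mono fun ω hω => ?_)
      (by fun_prop)
    exact le_trans hst hω
  rw [← lintegral_add_left hm]
  refine lintegral_mono fun t => ?_
  rw [← mul_assoc, ← add_mul]
  refine mul_le_mul_left ?_ _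
  rcases le_or_gt t t₀ with h1 | h1
  · have h2 : {_ω : Ω | t ≤ t₀} = univ := by
      ext ω
      simp [h1]
    rw [h2, measure_univ]
    exact prob_le_one.trans le_self_add
  · exact (h t h1).trans le_add_self

end Tails

section Moments

variable {Ω : Type*} [mΩ : MeasurableSpace Ω] {Pr : Measure Ω} [IsProbabilityMeasure Pr]
  {ℱ : Filtration ℝ≥0 mΩ} {W : ℝ≥0 → Ω → ℝ} {T : ℝ≥0} {P : ℝ≥0 → ℝ → ℝ} {q : FLP}
  {c K L m₁ m₂ x₀ σ : ℝ} {X : ℝ≥0 → Ω → ℝ}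

/-- If `2 c / σ² < 3` and no exponent of the explicit drift is `≤ -1`, then all inverse moments of
order at least `2` of the infimum of `X` are infinite. -/
lemma IsPositiveSolution.lintegral_iSup_eq_top (hW : IsBrownianOn Pr ℱ W)
    (hX : IsPositiveSolution Pr ℱ W q.eval σ x₀ X) (hT : 0 < T) (hσ : σ ≠ 0) (hx₀ : 0 < x₀)
    (hc : 2 * c / σ ^ 2 - 1 < 2)
    (hq : ∀ s ∈ (q - Finsupp.single (-1) c).support, -1 < s) {p : ℝ} (hp : 1 ≤ p) :
    ∫⁻ ω, (⨆ t ∈ Icc (0 : ℝ≥0) T, ENNReal.ofReal (|X t ω| ^ (-(2 * p)))) ∂Pr = ⊤ := by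
  set b : ℝ := max (2 * c / σ ^ 2 - 1) 1 with hb
  have hb2 : b < 2 * p := by
    have : b < 2 := max_lt hc (by norm_num)
    linarith
  obtain ⟨κ, δ₀, hκ, hδ₀, hlow⟩ := hX.exists_hitting_lower_bound hW hT hσ hx₀
    (le_max_right (2 * c / σ ^ 2 - 1) 1) (le_max_left _ _) hq
  rw [← hb] at hlow
  have hδ : ∀ δ, 0 < δ → δ ≤ δ₀ → ENNReal.ofReal (κ * δ ^ (b - 2 * p))
      ≤ ∫⁻ ω, (⨆ t ∈ Icc (0 : ℝ≥0) T, ENNReal.ofReal (|X t ω| ^ (-(2 * p)))) ∂Pr := by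
    intro δ hδ hδle
    obtain ⟨V, hVm, hV0, hV⟩ := hX.exists_sup_inv T
    have h1 : Pr {ω | ∃ t ≤ T, X t ω ≤ δ} ≤ Pr {ω | δ⁻¹ ≤ V ω} := by
      refine measure_mono_ae ?_
      filter_upwards [hV] with ω hω h2 using hω.1 δ hδ h2
    calc ENNReal.ofReal (κ * δ ^ (b - 2 * p))
        = ENNReal.ofReal (δ⁻¹ ^ (2 * p)) * ENNReal.ofReal (κ * δ ^ b) := by
          rw [← ENNReal.ofReal_mul (by positivity), Real.inv_rpow hδ.le, ← Real.rpow_neg hδ.le,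
            sub_eq_add_neg, Real.rpow_add hδ]
          congr 1
          ring
      _ ≤ ENNReal.ofReal (δ⁻¹ ^ (2 * p)) * Pr {ω | δ⁻¹ ≤ V ω} :=
          mul_le_mul_right ((hlow δ hδ hδle).trans h1) _
      _ ≤ ENNReal.ofReal (δ⁻¹ ^ (2 * p))
          * Pr {ω | ENNReal.ofReal (δ⁻¹ ^ (2 * p)) ≤ ENNReal.ofReal (V ω ^ (2 * p))} := by
          refine mul_le_mul_right (measure_mono fun ω hω => ?_) _
          refine ENNReal.ofReal_le_ofReal (Real.rpow_le_rpow (by positivity) hω (by linarith))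
      _ ≤ ∫⁻ ω, ENNReal.ofReal (V ω ^ (2 * p)) ∂Pr :=
          mul_meas_ge_le_lintegral (hVm.pow_const _).ennreal_ofReal _
      _ ≤ _ := by
          refine lintegral_mono_ae ?_
          filter_upwards [hV] with ω hω using hω.2 _ (by linarith)
  have hlim : Tendsto (fun δ : ℝ => ENNReal.ofReal (κ * δ ^ (b - 2 * p))) (𝓝[>] 0) (𝓝 ⊤) :=
    ENNReal.tendsto_ofReal_nhds_top.2
      ((tendsto_rpow_neg_nhdsGT_zero (by linarith)).const_mul_atTop hκ)
  refine top_le_iff.1 (le_of_tendsto hlim ?_)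
  filter_upwards [self_mem_nhdsWithin, nhdsWithin_le_nhds (gt_mem_nhds hδ₀)] with δ h1 h2
    using hδ δ h1 h2.le

/-- If no exponent of the explicit drift is `≤ -1`, the two sides are compared through the
probabilities of coming close to the origin. -/
lemma SchemeBounds.exists_moment_of_regular (hW : IsBrownianOn Pr ℱ W)
    (B : SchemeBounds T P (muHat q.eval c) c K L m₁ m₂)
    (hq : ∀ s ∈ (q - Finsupp.single (-1) c).support, -1 < s) (hx₀ : 0 < x₀) (hσ : σ ≠ 0)
    (hX : IsPositiveSolution Pr ℱ W q.eval σ x₀ X) (pmax : ℝ) :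
    ∃ C : ℝ, 0 < C ∧ ∀ p : ℝ, 1 ≤ p → p ≤ pmax → ∀ (M : ℕ) (h : ℝ≥0), 0 < M → h = T / M → h ≤ 1 →
      ∀ Y : ℕ → Ω → ℝ, IsSchemeSolution Pr W q.eval σ x₀ c P h M Y →
        ∫⁻ ω, (⨆ n ∈ Finset.range (M + 1), ENNReal.ofReal (|Y n ω| ^ (-(2 * p)))) ∂Pr
          ≤ ENNReal.ofReal C *
            ∫⁻ ω, (⨆ t ∈ Icc (0 : ℝ≥0) T, ENNReal.ofReal (|X t ω| ^ (-(2 * p)))) ∂Pr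
            + ENNReal.ofReal C := by
  rcases lt_or_ge (2 * c / σ ^ 2 - 1) 2 with hβ | hβ
  · refine ⟨1, one_pos, fun p hp _ M h _ _ _ Y _ => ?_⟩
    rw [hX.lintegral_iSup_eq_top hW B.T_pos hσ hx₀ hβ hq hp]
    simp
  set β : ℝ := 2 * c / σ ^ 2 - 1 with hβe
  obtain ⟨C₁, hC₁, hup⟩ := B.exists_tail hW hx₀ hσ hβe (by linarith)
  obtain ⟨κ, δ₀, hκ, hδ₀, hlow⟩ := hX.exists_hitting_lower_bound hW B.T_pos hσ hx₀
    (by linarith : 1 ≤ β) le_rfl hq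
  obtain ⟨V, hVm, hV0, hV⟩ := hX.exists_sup_inv T
  refine ⟨C₁ / κ + (1 + δ₀⁻¹) ^ (2 * pmax), by positivity, ?_⟩
  intro p hp hpm M h hM hhT hh1 Y hY
  have hh : IsStepSize T h := ⟨M, hM, hhT, hh1⟩
  set U := brownianChain W (schemeStep P (muHat q.eval c) c σ h) h x₀ with hU
  have hUpos : ∀ n ω, 0 < U n ω := B.chain_pos hh σ W hx₀
  have hUm : ∀ n, Measurable (U n) := fun n =>
    (hW.measurable_chain (B.measurable_schemeStep hh σ) h x₀ n).mono (ℱ.le _) le_rfl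
  have hne : (Finset.range (M + 1)).Nonempty := ⟨0, by simp⟩
  set VU : Ω → ℝ := fun ω => (Finset.range (M + 1)).sup' hne fun n => (U n ω)⁻¹ with hVU
  have hVUm : Measurable VU := by
    have h1 := Finset.measurable_sup' (s := Finset.range (M + 1)) hne
      (f := fun n ω => (U n ω)⁻¹) (fun n _ => (hUm n).inv)
    have h2 : VU = (Finset.range (M + 1)).sup' hne fun n ω => (U n ω)⁻¹ := by
      ext ω
      rw [Finset.sup'_apply]
    rwa [h2]
  have hleVU : ∀ n ≤ M, ∀ ω, (U n ω)⁻¹ ≤ VU ω := fun n hn ω =>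
    Finset.le_sup' (fun n => (U n ω)⁻¹) (Finset.mem_range.2 (Nat.lt_succ_of_le hn))
  have hVU0 : ∀ ω, 0 ≤ VU ω := fun ω =>
    (inv_pos.2 (hUpos 0 ω)).le.trans (hleVU 0 (Nat.zero_le _) ω)
  have htail : ∀ t, δ₀⁻¹ < t →
      Pr {ω | t ≤ VU ω} ≤ ENNReal.ofReal (C₁ / κ) * Pr {ω | t ≤ V ω} := by
    intro t ht
    have hi : 0 < δ₀⁻¹ := inv_pos.2 hδ₀
    have ht0 : 0 < t := hi.trans ht
    have htδ : t⁻¹ ≤ δ₀ := (inv_lt_of_inv_lt₀ hδ₀ ht).le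
    have h1 : Pr {ω | t ≤ VU ω} ≤ ENNReal.ofReal (C₁ * t⁻¹ ^ β) := by
      refine le_trans (measure_mono fun ω hω => ?_) (hup M h hM hhT hh1 t⁻¹ (inv_pos.2 ht0))
      have hω' : t ≤ (Finset.range (M + 1)).sup' hne fun n => (U n ω)⁻¹ := hω
      obtain ⟨n, hn, h2⟩ := (Finset.le_sup'_iff _).1 hω'
      exact ⟨n, Nat.lt_succ_iff.1 (Finset.mem_range.1 hn), le_inv_of_le_inv₀ ht0 h2⟩
    have h2 : ENNReal.ofReal (κ * t⁻¹ ^ β) ≤ Pr {ω | t ≤ V ω} := by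
      refine (hlow t⁻¹ (inv_pos.2 ht0) htδ).trans (measure_mono_ae ?_)
      filter_upwards [hV] with ω hω h3
      have := hω.1 t⁻¹ (inv_pos.2 ht0) h3
      rwa [inv_inv] at this
    calc Pr {ω | t ≤ VU ω} ≤ ENNReal.ofReal (C₁ * t⁻¹ ^ β) := h1
      _ = ENNReal.ofReal (C₁ / κ) * ENNReal.ofReal (κ * t⁻¹ ^ β) := by
          rw [← ENNReal.ofReal_mul (by positivity)]
          congr 1
          field_simp
      _ ≤ _ := mul_le_mul_right h2 _
  have hcmp := lintegral_rpow_le_of_tail_le hVUm hVU0 hVm hV0 (inv_pos.2 hδ₀).le htail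
    (by linarith : 0 < 2 * p)
  have hYV : ∫⁻ ω, (⨆ n ∈ Finset.range (M + 1), ENNReal.ofReal (|Y n ω| ^ (-(2 * p)))) ∂Pr
      ≤ ∫⁻ ω, ENNReal.ofReal (VU ω ^ (2 * p)) ∂Pr := by
    refine lintegral_mono_ae ?_
    filter_upwards [B.ae_eq_chain hh hx₀ hY] with ω hω
    refine iSup₂_le fun n hn => ENNReal.ofReal_le_ofReal ?_
    have hn' : n ≤ M := Nat.lt_succ_iff.1 (Finset.mem_range.1 hn)
    have h1 := hUpos n ω
    rw [hω n hn', ← hU, abs_of_pos h1, Real.rpow_neg h1.le, ← Real.inv_rpow h1.le]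
    exact Real.rpow_le_rpow (inv_pos.2 h1).le (hleVU n hn' ω) (by linarith)
  have hVX : ∫⁻ ω, ENNReal.ofReal (V ω ^ (2 * p)) ∂Pr
      ≤ ∫⁻ ω, (⨆ t ∈ Icc (0 : ℝ≥0) T, ENNReal.ofReal (|X t ω| ^ (-(2 * p)))) ∂Pr := by
    refine lintegral_mono_ae ?_
    filter_upwards [hV] with ω hω using hω.2 _ (by linarith)
  have hi : 0 < δ₀⁻¹ := inv_pos.2 hδ₀
  have hconst : δ₀⁻¹ ^ (2 * p) ≤ (1 + δ₀⁻¹) ^ (2 * pmax) :=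
    (Real.rpow_le_rpow hi.le (by linarith) (by linarith)).trans
      (Real.rpow_le_rpow_of_exponent_le (by linarith) (by linarith))
  have hpow : 0 < (1 + δ₀⁻¹) ^ (2 * pmax) := by positivity
  have hdiv : 0 < C₁ / κ := by positivity
  refine hYV.trans (hcmp.trans ?_)
  rw [add_comm]
  refine add_le_add (mul_le_mul' (ENNReal.ofReal_le_ofReal (by linarith)) hVX)
    (ENNReal.ofReal_le_ofReal (by linarith))

/-- The comparison of inverse moments up to an additive constant, in all cases. -/
lemma SchemeBounds.exists_moment (hW : IsBrownianOn Pr ℱ W)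
    (B : SchemeBounds T P (muHat q.eval c) c K L m₁ m₂) (hosl : OneSidedLipschitz q.eval)
    (hx₀ : 0 < x₀) (hσ : σ ≠ 0) (hX : IsPositiveSolution Pr ℱ W q.eval σ x₀ X) {pstar : ℝ≥0∞}
    (hinv : InverseMomentsBounded Pr X T pstar) (pmax : ℝ) :
    ∃ C : ℝ, 0 < C ∧ ∀ p : ℝ, 1 ≤ p → p ≤ pmax →
      ENNReal.ofReal p ≤ pstar / ENNReal.ofReal (2 * m₁) →
      ∀ (M : ℕ) (h : ℝ≥0), 0 < M → h = T / M → h ≤ 1 →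
      ∀ Y : ℕ → Ω → ℝ, IsSchemeSolution Pr W q.eval σ x₀ c P h M Y →
        ∫⁻ ω, (⨆ n ∈ Finset.range (M + 1), ENNReal.ofReal (|Y n ω| ^ (-(2 * p)))) ∂Pr
          ≤ ENNReal.ofReal C *
            ∫⁻ ω, (⨆ t ∈ Icc (0 : ℝ≥0) T, ENNReal.ofReal (|X t ω| ^ (-(2 * p)))) ∂Pr
            + ENNReal.ofReal C := by
  set q' : FLP := q - Finsupp.single (-1) c with hq'
  by_cases hreg : ∀ s ∈ q'.support, -1 < s
  · obtain ⟨C, hC, h⟩ := B.exists_moment_of_regular hW hreg hx₀ hσ hX pmax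
    exact ⟨C, hC, fun p hp hpm _ => h p hp hpm⟩
  push Not at hreg
  obtain ⟨s₀, hs₀, hs₀1⟩ := hreg
  obtain ⟨s, hs, hmin⟩ := q'.support.exists_min_image id ⟨s₀, hs₀⟩
  simp only [id] at hmin
  have hd : 1 ≤ -s := by linarith [hmin s₀ hs₀]
  have hmem : -(-s) ∈ q'.support := by rwa [neg_neg]
  have hlow : ∀ u ∈ q'.support, -(-s) ≤ u := fun u hu => by rw [neg_neg]; exact hmin u hu
  have hm₁ := B.four_mul_add_three_le hd hmem hlow
  have hm₁0 : 0 < 2 * m₁ := by linarith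
  obtain ⟨p₀, hp₀, hp₀s⟩ : ∃ p₀ : ℝ, (∀ p : ℝ, 1 ≤ p → p ≤ pmax →
      ENNReal.ofReal p ≤ pstar / ENNReal.ofReal (2 * m₁) → p ≤ p₀) ∧
      ENNReal.ofReal (2 * m₁ * p₀) ≤ pstar := by
    rcases eq_or_ne pstar ⊤ with htop | htop
    · exact ⟨pmax, fun p _ hp _ => hp, htop ▸ le_top⟩
    · refine ⟨pstar.toReal / (2 * m₁), fun p hp1 _ hp => ?_, ?_⟩
      · rw [ENNReal.le_div_iff_mul_le (Or.inl (by simpa using hm₁0)) (Or.inl ENNReal.ofReal_ne_top),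
          ← ENNReal.ofReal_mul (by linarith)] at hp
        rw [le_div_iff₀ hm₁0]
        exact (ENNReal.ofReal_le_iff_le_toReal htop).1 hp
      · rw [mul_div_cancel₀ _ hm₁0.ne', ENNReal.ofReal_toReal htop]
  by_cases h1 : 1 ≤ p₀
  · obtain ⟨C, hC, h⟩ := B.exists_moment_of_singular hW hosl hd hmem hlow hx₀ hσ hX hinv h1 hp₀s
    exact ⟨C, hC, fun p hp hpm hps => h p hp (hp₀ p hp hpm hps)⟩
  · exact ⟨1, one_pos, fun p hp hpm hps => absurd (hp.trans (hp₀ p hp hpm hps)) h1⟩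

end Moments

end PosScheme

theorem lemma4p3 {Ω : Type*} [mΩ : MeasurableSpace Ω] (Pr : Measure Ω) [IsProbabilityMeasure Pr]
    (ℱ : Filtration ℝ≥0 mΩ) (W : ℝ≥0 → Ω → ℝ) (hW : PosScheme.IsBrownianOn Pr ℱ W)
    (T : ℝ≥0) (hT : 0 < T)
    -- the drift `μ`, a fractional Laurent polynomial, and the exact solution `X`
    (μ : PosScheme.FLP) (σ x₀ : ℝ) (hσ : σ ≠ 0) (hx₀ : 0 < x₀)
    (X : ℝ≥0 → Ω → ℝ) (hX : PosScheme.IsPositiveSolution Pr ℱ W μ.eval σ x₀ X)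
    (hμ : PosScheme.OneSidedLipschitz μ.eval)
    (pstar : ℝ≥0∞) (hpstar : 2 < pstar)
    (hinv : PosScheme.InverseMomentsBounded Pr X T pstar)
    -- the ingredients of the scheme
    (c : ℝ) (hc : 0 < c) (hμhat : PosScheme.OneSidedLipschitz (PosScheme.muHat μ.eval c))
    (P : ℝ≥0 → ℝ → ℝ) (m₁ : ℝ) (hP : PosScheme.IsCorrection T P m₁)
    (hμP : PosScheme.CorrectedDriftBound T P μ.eval c)
    -- an arbitrary finite upper bound on `p`
    (pmax : ℝ) :
    ∃ C : ℝ, 0 < C ∧ ∀ p : ℝ, 1 ≤ p → p ≤ pmax →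
      ENNReal.ofReal p ≤ min (pstar / ENNReal.ofReal (-(2 * μ.degMinus)))
        (pstar / ENNReal.ofReal (2 * m₁)) →
      ∀ (M : ℕ) (h : ℝ≥0), 0 < M → h = T / M → h ≤ 1 →
      ∀ Y : ℕ → Ω → ℝ, PosScheme.IsSchemeSolution Pr W μ.eval σ x₀ c P h M Y →
      ∀ R₁ R₂ : ℕ → Ω → ℝ, PosScheme.IsRemainderSplit Pr ℱ X μ.eval c P h M R₁ R₂ →
        ∫⁻ ω, (⨆ n ∈ Finset.range (M + 1), ENNReal.ofReal (|Y n ω| ^ (-(2 * p)))) ∂Pr ≤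
          ENNReal.ofReal (C * (1 / (h : ℝ) ^ (2 * p - 1))) *
            ((⨆ n ∈ Finset.Icc 1 M, ∫⁻ ω, ENNReal.ofReal (|R₁ n ω| ^ (2 * p)) ∂Pr) +
              (⨆ n ∈ Finset.Icc 1 M, ∫⁻ ω, ENNReal.ofReal (|R₂ n ω| ^ (2 * p)) ∂Pr)) +
          ENNReal.ofReal C *
            ∫⁻ ω, (⨆ t ∈ Icc (0 : ℝ≥0) T, ENNReal.ofReal (|X t ω| ^ (-(2 * p)))) ∂Pr := by
  obtain ⟨K, L, m₂, B⟩ := PosScheme.exists_schemeBounds hT hc hμhat hP hμP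
  obtain ⟨C, hC, hmom⟩ := B.exists_moment hW hμ hx₀ hσ hX hinv pmax
  set a : ℝ := (1 + x₀) ^ (-(2 * pmax)) with ha
  have ha0 : 0 < a := by positivity
  refine ⟨C + C / a, by positivity, ?_⟩
  intro p hp hpm hps M h hM hhT hh1 Y hY R₁ R₂ _
  refine (hmom p hp hpm (hps.trans (min_le_right _ _)) M h hM hhT hh1 Y hY).trans
    (le_add_left ?_)
  have hlow := hX.ofReal_le_lintegral T hx₀ hp hpm
  set I := ∫⁻ ω, (⨆ t ∈ Icc (0 : ℝ≥0) T, ENNReal.ofReal (|X t ω| ^ (-(2 * p)))) ∂Pr with hI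
  -- the additive constant is absorbed since `X` starts at the fixed height `x₀`
  have h1 : ENNReal.ofReal C ≤ ENNReal.ofReal (C / a) * I := by
    calc ENNReal.ofReal C = ENNReal.ofReal (C / a) * ENNReal.ofReal a := by
          rw [← ENNReal.ofReal_mul (by positivity), div_mul_cancel₀ _ ha0.ne']
      _ ≤ _ := mul_le_mul_right hlow _
  rw [ENNReal.ofReal_add hC.le (by positivity), add_mul]
  exact add_le_add le_rfl h1
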